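/- **Setting.** Let $\mathbb T=\mathbb T_1^2\times\mathbb T_{2\pi}$ with variables $(x,\theta)$, $v_\theta=(\cos\theta,\sin\theta)$, $v_\theta^\perp=(-\sin\theta,\cos\theta)$. For $\gamma,\sigma_c,\sigma_x,\sigma_\theta,\lambda>0$, $\tau\ge 0$, and $f\in H^2(\mathbb T,\mathbb R)$, let $c=(\gamma-\sigma_c\Delta_x)^{-1}\int f\,d\theta$ on $\mathbb T_1^2$, $\mathrm B_\tau[f]=v_\theta^\perp\cdot\nabla_xc+\tau\,v_\theta^\perp\cdot(\nabla_x^2c)v_\theta$, and $$\mathrm F(f,\chi)=\sigma_x\Delta_xf+\sigma_\theta\partial_{\theta\theta}f-\lambda v_\theta\cdot\nabla_xf-\chi\,\partial_\theta\big(\mathrm B_\tau[f](\tfrac1{2\pi}+f)\big).$$ Let $X$ (resp. $Z$) be the space of $f\in H^2(\mathbb T,\mathbb R)$ (resp. $L^2(\mathbb T,\mathbb R)$) with zero average and $f(x,\theta)=f(-x,\theta+\pi)$; let $\mathrm L_\chi=D_f\mathrm F(0,\chi):X\to Z$, i.e. $\mathrm L_\chi f=\sigma_x\Delta_xf+\sigma_\theta\partial_{\theta\theta}f-\lambda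 v_\theta\cdot\nabla_xf-\tfrac{\chi}{2\pi}\partial_\theta\mathrm B_\tau[f]$. For $\ell\in\mathbb Z^2\setminus\{0\}$ let $\hat{\mathsf M}_\ell(\theta)=4\pi^2\sigma_x|\ell|^2+2\pi i\lambda\,v_\theta\cdot\ell$ and $\hat{\mathsf B}_\ell(\theta)=\big(2\pi i\,v_\theta^\perp\cdot\ell-4\pi^2\tau(v_\theta^\perp\cdot\ell)(v_\theta\cdot\ell)\big)/(\gamma+4\pi^2|\ell|^2\sigma_c)$, and let $\hat{\mathsf U}^\ell=(-\hat{\mathsf M}_\ell+\sigma_\theta\partial_{\theta\theta})^{-1}\partial_\theta\hat{\mathsf B}_\ell$ on $\mathbb T_{2\pi}$. For a positive integer $k$ put $\mathsf k_1=(k,0)$, $\mathsf k_2=(0,k)$, $\phi^{\mathsf k_j}(x,\theta)=\hat{\mathsf U}^{\mathsf k_j}(\theta)e^{2\pi i\mathsf k_j\cdot x}+\hat{\mathsf U}^{-\mathsf k_j}(\theta)e^{-2\pi i\mathsf k_j\cdot x}$ (real-valued), and $\chi^k=2\pi\big/\int_0^{2\pi}\hat{\mathsf U}^{\mathsf k_1}d\theta$.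 Write $X_0=X\cap\mathrm{Range}\,\mathrm L_{\chi^k}$. Call $k$ non-Pythagorean if $k^2\ne l^2+m^2$ for all positive integers $l,m$. **Theorem.** Let $\gamma,\sigma_c,\sigma_x,\lambda>0$, $\tau\ge0$ and let $k\ge1$ be non-Pythagorean. There is $\sigma_\theta^k>0$ such that for every $0<\sigma_\theta<\sigma_\theta^k$ one has $\chi^k>0$, and there exist open neighborhoods $U\subset\mathbb R$ of $0$, $V\subset\mathbb R$ of $\chi^k$, $O\subset X$ of $0$, and real-analytic functions $\Phi^k:U\times U\times V\to\mathbb R^2$ and $G:U\times U\times V\to X_0$ (with the $H^2$ norm on $X_0$) such that: 1. for all $\chi\in V$ and $f\in O$: $\mathrm F(f,\chi)=0$ in $Z$ if and only if there are $r_1,r_2\in U$ with $f=r_1\phi^{\mathsf k_1}+r_2\phi^{\mathsf k_2}+G(r_1,r_2,\chi)$ and $\Phi^k(r_1,r_2,\chi)=0$; 2. there are functions $\Xi^k,\Lambda^k:U\times V\to\mathbb R$ with $\Phi^k(r,r,\chi)=\Xi^k(r,\chi)(1,1)^{\mathsf T}$ and $\Phi^k(r,0,\chi)=\Lambda^k(r,\chi)(1,0)^{\mathsf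 T}$ for all $r\in U$, $\chi\in V$; 3. $\Phi^k(r_1,r_2,\chi)=\begin{pmatrix}0&1\\1&0\end{pmatrix}\Phi^k(r_2,r_1,\chi)$ for all $r_1,r_2\in U$, $\chi\in V$; 4. for all $\chi\in V$ and $n\ge0$: $D_rG(0,0,\chi)=0$ in $L(\mathbb R^2,X_0)$, $\partial_\chi^nG(0,0,\chi)=0$ in $X_0$, and $\partial_\chi^n\Phi^k(0,0,\chi)=0$. -/

import Mathlib

open MeasureTheory
open scoped ContDiff

set_option linter.unusedSectionVars false

/-- The angular circle `ℝ / 2πℤ` has positive length. -/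
instance antFactTwoPiPos : Fact ((0 : ℝ) < 2 * Real.pi) := ⟨Real.two_pi_pos⟩

namespace AntModel

noncomputable section

/-! ## Weak derivatives and `H²` on a torus

A torus `M` is presented by its covering homomorphism `e : ℝ^ι → M`. -/

section Sobolev

variable {ι M : Type} [Fintype ι] [DecidableEq ι]
  [AddCommGroup M] [TopologicalSpace M] [CompactSpace M]
  [MeasureSpace M] [BorelSpace M]

/-- The classical partial derivative in the `i`-th coordinate of a function on the torus. -/
def pderiv (e : (ι → ℝ) → M) (i : ι) (φ : M → ℝ) : M → ℝ :=
  fun z => deriv (fun s : ℝ => φ (z + e (Pi.single i s))) 0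

/-- Smooth real functions on the torus: the periodic pull-back to `ℝ^ι` is `C^∞`. (The continuity
of the function and of its first partial derivatives on the torus is then automatic; it is listed
for convenience.) -/
def IsTest (e : (ι → ℝ) → M) (φ : M → ℝ) : Prop :=
  ContDiff ℝ ∞ (fun y : ι → ℝ => φ (e y)) ∧ Continuous φ ∧ ∀ i, Continuous (pderiv e i φ)

/-- `g` is the weak `i`-th partial derivative of `u`. -/
def IsWeakDeriv (e : (ι → ℝ) → M) (i : ι) (u g : M → ℝ) : Prop :=
  Integrable u ∧ Integrable g ∧
    ∀ φ : M → ℝ, IsTest e φ → ∫ z, u z * pderiv e i φ z = - ∫ z, g z * φ z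

/-- The real Lebesgue space `L²(M)`. -/
abbrev L2 (M : Type) [MeasureSpace M] : Type := Lp ℝ 2 (volume : Measure M)

open Classical in
/-- The weak `i`-th partial derivative of `u` as an element of `L²` (it is unique;
the value is `0` if `u` has no weak derivative in `L²`). -/
def weakDeriv (e : (ι → ℝ) → M) (i : ι) (u : M → ℝ) : L2 M :=
  if h : ∃ g : L2 M, IsWeakDeriv e i u g then h.choose else 0

lemma isWeakDeriv_congr {e : (ι → ℝ) → M} {i : ι} {u u' g g' : M → ℝ}
    (hu : u =ᵐ[volume] u') (hg : g =ᵐ[volume] g') (h : IsWeakDeriv e i u g) :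
    IsWeakDeriv e i u' g' := by
  refine ⟨h.1.congr hu, h.2.1.congr hg, fun φ hφ => ?_⟩
  have h1 : ∫ z, u' z * pderiv e i φ z = ∫ z, u z * pderiv e i φ z :=
    integral_congr_ae (by filter_upwards [hu] with z hz; rw [hz])
  have h2 : ∫ z, g' z * φ z = ∫ z, g z * φ z :=
    integral_congr_ae (by filter_upwards [hg] with z hz; rw [hz])
  rw [h1, h2, h.2.2 φ hφ]

lemma integrable_mul_continuous {u ψ : M → ℝ} (hu : Integrable u) (hψ : Continuous ψ) :
    Integrable (fun z => u z * ψ z) := by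
  obtain ⟨C, hC⟩ := isCompact_univ.exists_bound_of_continuousOn hψ.continuousOn
  exact hu.mul_bdd hψ.aestronglyMeasurable
    (Filter.Eventually.of_forall fun z => hC z (Set.mem_univ z))

lemma isWeakDeriv_add {e : (ι → ℝ) → M} {i : ι} {u u' g g' : M → ℝ}
    (h : IsWeakDeriv e i u g) (h' : IsWeakDeriv e i u' g') :
    IsWeakDeriv e i (u + u') (g + g') := by
  refine ⟨h.1.add h'.1, h.2.1.add h'.2.1, fun φ hφ => ?_⟩
  simp only [Pi.add_apply, add_mul]
  rw [integral_add (integrable_mul_continuous h.1 (hφ.2.2 i))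
      (integrable_mul_continuous h'.1 (hφ.2.2 i)),
    integral_add (integrable_mul_continuous h.2.1 hφ.2.1)
      (integrable_mul_continuous h'.2.1 hφ.2.1), h.2.2 φ hφ, h'.2.2 φ hφ]
  ring

lemma isWeakDeriv_smul {e : (ι → ℝ) → M} {i : ι} {u g : M → ℝ} (c : ℝ)
    (h : IsWeakDeriv e i u g) : IsWeakDeriv e i (c • u) (c • g) := by
  refine ⟨h.1.smul c, h.2.1.smul c, fun φ hφ => ?_⟩
  simp only [Pi.smul_apply, smul_eq_mul, mul_assoc]
  rw [integral_const_mul, integral_const_mul, h.2.2 φ hφ]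
  ring

lemma isWeakDeriv_zero (e : (ι → ℝ) → M) (i : ι) : IsWeakDeriv e i 0 0 :=
  ⟨integrable_zero _ _ _, integrable_zero _ _ _, fun φ _ => by simp⟩

/-- Index set for a function, its first and its second order partial derivatives. -/
abbrev Jet2 (ι : Type) : Type := Unit ⊕ ι ⊕ (ι × ι)

/-- The Sobolev space `H²`: an element is an `L²` function together with its weak derivatives
`∂_i f` and `∂_j ∂_i f` in `L²` (which the function determines), with the norm
`‖f‖² + ∑ ‖∂_i f‖² + ∑ ‖∂_j ∂_i f‖²`. -/
def H2 (e : (ι → ℝ) → M) : Submodule ℝ (PiLp 2 (fun _ : Jet2 ι => L2 M)) where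
  carrier := {f | (∀ i, IsWeakDeriv e i (f (.inl ())) (f (.inr (.inl i)))) ∧
    ∀ i j, IsWeakDeriv e j (f (.inr (.inl i))) (f (.inr (.inr (i, j))))}
  add_mem' := by
    intro a b ha hb
    exact ⟨fun i => isWeakDeriv_congr (Lp.coeFn_add _ _).symm (Lp.coeFn_add _ _).symm
        (isWeakDeriv_add (ha.1 i) (hb.1 i)),
      fun i j => isWeakDeriv_congr (Lp.coeFn_add _ _).symm (Lp.coeFn_add _ _).symm
        (isWeakDeriv_add (ha.2 i j) (hb.2 i j))⟩
  zero_mem' :=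
    ⟨fun i => isWeakDeriv_congr (Lp.coeFn_zero _ _ _).symm (Lp.coeFn_zero _ _ _).symm
        (isWeakDeriv_zero e i),
      fun _ j => isWeakDeriv_congr (Lp.coeFn_zero _ _ _).symm (Lp.coeFn_zero _ _ _).symm
        (isWeakDeriv_zero e j)⟩
  smul_mem' := by
    intro c a ha
    exact ⟨fun i => isWeakDeriv_congr (Lp.coeFn_smul _ _).symm (Lp.coeFn_smul _ _).symm
        (isWeakDeriv_smul c (ha.1 i)),
      fun i j => isWeakDeriv_congr (Lp.coeFn_smul _ _).symm (Lp.coeFn_smul _ _).symm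
        (isWeakDeriv_smul c (ha.2 i j))⟩

/-- The underlying function of an element of `H²`. -/
def fn {e : (ι → ℝ) → M} (f : H2 e) : M → ℝ := f.1 (.inl ())

/-- The first partial derivative `∂_i f`. -/
def d1 {e : (ι → ℝ) → M} (f : H2 e) (i : ι) : M → ℝ := f.1 (.inr (.inl i))

/-- The second partial derivative `∂_j ∂_i f`. -/
def d2 {e : (ι → ℝ) → M} (f : H2 e) (i j : ι) : M → ℝ := f.1 (.inr (.inr (i, j)))

end Sobolev

/-! ## The domain -/

/-- The positional torus `𝕋₁²`. -/
abbrev Pos : Type := Fin 2 → UnitAddCircle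

/-- The angular circle `𝕋_{2π}`, of total mass `2π`. -/
abbrev Ang : Type := AddCircle (2 * Real.pi)

/-- The domain `𝕋₁² × 𝕋_{2π}` of the variables `(x, θ)`. -/
abbrev Phase : Type := Pos × Ang

/-- The covering map `ℝ² → 𝕋₁²`. -/
def posCover (y : Fin 2 → ℝ) : Pos := fun j => (y j : UnitAddCircle)

/-- The covering map `ℝ³ → 𝕋₁² × 𝕋_{2π}`; the coordinates `0, 1, 2` are `x₁, x₂, θ`. -/
def phaseCover (y : Fin 3 → ℝ) : Phase :=
  (![(y 0 : UnitAddCircle), (y 1 : UnitAddCircle)], (y 2 : Ang))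

/-- The cosine on `𝕋_{2π}`. -/
def cosA : Ang → ℝ := Real.cos_periodic.lift

/-- The sine on `𝕋_{2π}`. -/
def sinA : Ang → ℝ := Real.sin_periodic.lift

/-- `v_θ = (cos θ, sin θ)`. -/
def v (θ : Ang) : Fin 2 → ℝ := ![cosA θ, sinA θ]

/-- `v_θ^⊥ = (-sin θ, cos θ)`. -/
def vPerp (θ : Ang) : Fin 2 → ℝ := ![-sinA θ, cosA θ]

/-- The map `(x, θ) ↦ (-x, θ + π)`. -/
def antipode (z : Phase) : Phase := (-z.1, z.2 + ((Real.pi : ℝ) : Ang))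

lemma measurePreserving_antipode : MeasurePreserving antipode volume volume := by
  have h1 : MeasurePreserving (fun x : Pos => -x) volume volume :=
    volume_preserving_pi (α' := fun _ : Fin 2 => UnitAddCircle)
      (β' := fun _ : Fin 2 => UnitAddCircle) (f := fun _ x => -x)
      (fun _ => Measure.measurePreserving_neg (volume : Measure UnitAddCircle))
  have h2 : MeasurePreserving (fun θ : Ang => θ + ((Real.pi : ℝ) : Ang)) volume volume :=
    measurePreserving_add_right volume _
  exact h1.prod h2

/-- The space `X` of antipodal even functions in `H²(𝕋₁² × 𝕋_{2π}, ℝ)` with zero average: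
`f(-x, θ + π) = f(x, θ)` almost everywhere. -/
def X : Submodule ℝ (H2 phaseCover) where
  carrier := {f | ∫ z, fn f z = 0 ∧ (fun z => fn f (antipode z)) =ᵐ[volume] fn f}
  add_mem' := by
    intro a b ha hb
    have hab : fn (a + b) =ᵐ[volume] fun z => fn a z + fn b z := Lp.coeFn_add _ _
    refine ⟨?_, ?_⟩
    · have ia : Integrable (fn a) := (a.2.1 0).1
      have ib : Integrable (fn b) := (b.2.1 0).1
      rw [integral_congr_ae hab, integral_add ia ib]
      rw [show ∫ z, fn a z = 0 from ha.1, show ∫ z, fn b z = 0 from hb.1, add_zero]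
    · filter_upwards [hab, measurePreserving_antipode.quasiMeasurePreserving.ae_eq_comp hab,
        ha.2, hb.2] with z h1 h2 h3 h4
      simp only [Function.comp_apply] at h2
      rw [h1, h2, h3, h4]
  zero_mem' := by
    have h0 : fn (0 : H2 phaseCover) =ᵐ[volume] fun _ => 0 := Lp.coeFn_zero _ _ _
    refine ⟨?_, ?_⟩
    · rw [integral_congr_ae h0]; simp
    · filter_upwards [h0, measurePreserving_antipode.quasiMeasurePreserving.ae_eq_comp h0]
        with z h1 h2
      simp only [Function.comp_apply] at h2
      rw [h1, h2]
  smul_mem' := by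
    intro c a ha
    have hca : fn (c • a) =ᵐ[volume] fun z => c * fn a z := Lp.coeFn_smul _ _
    refine ⟨?_, ?_⟩
    · rw [integral_congr_ae hca, integral_const_mul]
      rw [show ∫ z, fn a z = 0 from ha.1, mul_zero]
    · filter_upwards [hca, measurePreserving_antipode.quasiMeasurePreserving.ae_eq_comp hca,
        ha.2] with z h1 h2 h3
      simp only [Function.comp_apply] at h2
      rw [h1, h2, h3]

/-! ## The equation -/

/-- The parameters `γ, σ_c, σ_x, σ_θ, λ, τ` of the model. -/
structure Params where
  gam : ℝ
  sigC : ℝ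
  sigX : ℝ
  sigTh : ℝ
  lam : ℝ
  tau : ℝ

/-- `c ∈ H²(𝕋₁²)` solves `γ c - σ_c Δ_x c = ∫ f dθ`. -/
def IsChem (p : Params) (f : H2 phaseCover) (c : H2 posCover) : Prop :=
  (fun x => p.gam * fn c x - p.sigC * (d2 c 0 0 x + d2 c 1 1 x))
    =ᵐ[volume] fun x => ∫ θ : Ang, fn f (x, θ)

open Classical in
/-- The chemical field `c = (γ - σ_c Δ_x)⁻¹ ∫ f dθ` (for `γ, σ_c > 0` the solution exists and is
unique). -/
def chem (p : Params) (f : H2 phaseCover) : H2 posCover :=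
  if h : ∃ c, IsChem p f c then h.choose else 0

/-- `B_τ[f] = v_θ^⊥ · ∇_x c + τ v_θ^⊥ · (∇_x² c) v_θ`. -/
def B (p : Params) (f : H2 phaseCover) : Phase → ℝ := fun z =>
  (∑ i, vPerp z.2 i * d1 (chem p f) i z.1) +
    p.tau * ∑ i, ∑ j, vPerp z.2 i * d2 (chem p f) i j z.1 * v z.2 j

/-- `σ_x Δ_x f + σ_θ ∂_θθ f - λ v_θ · ∇_x f`. -/
def diffusionTransport (p : Params) (f : H2 phaseCover) : Phase → ℝ := fun z =>
  p.sigX * (d2 f 0 0 z + d2 f 1 1 z) + p.sigTh * d2 f 2 2 z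
    - p.lam * (v z.2 0 * d1 f 0 z + v z.2 1 * d1 f 1 z)

/-- `F(f, χ) = σ_x Δ_x f + σ_θ ∂_θθ f - λ v_θ · ∇_x f - χ ∂_θ (B_τ[f] (1/(2π) + f))`, as a function
defined up to null sets. -/
def F (p : Params) (f : H2 phaseCover) (χ : ℝ) : Phase → ℝ := fun z =>
  diffusionTransport p f z
    - χ * weakDeriv phaseCover 2 (fun w => B p f w * (1 / (2 * Real.pi) + fn f w)) z

/-- The linearization of `F` at `f = 0`:
`L_χ f = σ_x Δ_x f + σ_θ ∂_θθ f - λ v_θ · ∇_x f - χ/(2π) ∂_θ B_τ[f]`. -/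
def L (p : Params) (χ : ℝ) (f : H2 phaseCover) : Phase → ℝ := fun z =>
  diffusionTransport p f z - χ / (2 * Real.pi) * weakDeriv phaseCover 2 (B p f) z

/-- `X ∩ Range L_χ`, where `L_χ` is restricted to `X`. -/
def rangeInX (p : Params) (χ : ℝ) : Set X :=
  {g | ∃ w : X, L p χ w.1 =ᵐ[volume] fn g.1}

/-! ## Fourier multipliers, the kernel functions and the bifurcation point -/

/-- The dot product of a real vector with an integer vector. -/
def dotZ (a : Fin 2 → ℝ) (ℓ : Fin 2 → ℤ) : ℝ := ∑ i, a i * (ℓ i : ℝ)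

/-- `|ℓ|²`. -/
def normSqZ (ℓ : Fin 2 → ℤ) : ℝ := ∑ i, (ℓ i : ℝ) ^ 2

/-- The Fourier multiplier of `B_τ` at the positional wave vector `ℓ`. -/
def Bhat (p : Params) (ℓ : Fin 2 → ℤ) (θ : Ang) : ℂ :=
  (2 * Real.pi * Complex.I * dotZ (vPerp θ) ℓ
    - 4 * Real.pi ^ 2 * p.tau * (dotZ (vPerp θ) ℓ * dotZ (v θ) ℓ : ℝ)) /
    (p.gam + 4 * Real.pi ^ 2 * normSqZ ℓ * p.sigC : ℝ)

/-- `∂_θ B̂_ℓ`. -/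
def dBhat (p : Params) (ℓ : Fin 2 → ℤ) (θ : Ang) : ℂ :=
  deriv (fun s : ℝ => Bhat p ℓ (θ + (s : Ang))) 0

/-- The Fourier multiplier of `-σ_x Δ_x + λ v_θ · ∇_x` at the positional wave vector `ℓ`. -/
def Mhat (p : Params) (ℓ : Fin 2 → ℤ) (θ : Ang) : ℂ :=
  4 * Real.pi ^ 2 * p.sigX * normSqZ ℓ + 2 * Real.pi * Complex.I * p.lam * dotZ (v θ) ℓ

/-- `u` is a `C²` solution on `𝕋_{2π}` of `-M̂_ℓ u + σ_θ u'' = g`. -/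
def IsResolvent (p : Params) (ℓ : Fin 2 → ℤ) (g u : Ang → ℂ) : Prop :=
  ContDiff ℝ 2 (fun s : ℝ => u (s : Ang)) ∧
    ∀ s : ℝ, - Mhat p ℓ (s : Ang) * u (s : Ang)
      + p.sigTh * iteratedDeriv 2 (fun t : ℝ => u (t : Ang)) s = g (s : Ang)

open Classical in
/-- `(-M̂_ℓ + σ_θ ∂_θθ)⁻¹ g` for continuous `g` (for `ℓ ≠ 0` and `σ_x, σ_θ > 0` the solution exists
and is unique). -/
def resolvent (p : Params) (ℓ : Fin 2 → ℤ) (g : Ang → ℂ) : Ang → ℂ :=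
  if h : ∃ u, IsResolvent p ℓ g u then h.choose else 0

/-- `Û^ℓ = (-M̂_ℓ + σ_θ ∂_θθ)⁻¹ ∂_θ B̂_ℓ`. -/
def Uhat (p : Params) (ℓ : Fin 2 → ℤ) : Ang → ℂ := resolvent p ℓ (dBhat p ℓ)

/-- The function `φ^ℓ` whose positional Fourier coefficients are `Û^ℓ` at `ℓ`, `Û^{-ℓ}` at `-ℓ` and
`0` otherwise (`Û^{-ℓ}` is the complex conjugate of `Û^ℓ`, so that the sum is real). -/
def phi (p : Params) (ℓ : Fin 2 → ℤ) : Phase → ℝ := fun z =>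
  (Uhat p ℓ z.2 * UnitAddTorus.mFourier ℓ z.1
    + Uhat p (-ℓ) z.2 * UnitAddTorus.mFourier (-ℓ) z.1).re

/-- The wave vector `(k, 0)`. -/
def k1 (k : ℕ) : Fin 2 → ℤ := ![(k : ℤ), 0]

/-- The wave vector `(0, k)`. -/
def k2 (k : ℕ) : Fin 2 → ℤ := ![0, (k : ℤ)]

/-- The bifurcation point `χ^k = 2π / ∫ Û^{(k,0)} dθ` (the integral is real). -/
def chiK (p : Params) (k : ℕ) : ℝ :=
  2 * Real.pi / (∫ θ : Ang, Uhat p (k1 k) θ).re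

/-- A natural number `k` is non-Pythagorean if `k² ≠ l² + m²` for all positive `l, m`. -/
def NonPythagorean (k : ℕ) : Prop :=
  ∀ l m : ℕ, 0 < l → 0 < m → k ^ 2 ≠ l ^ 2 + m ^ 2

end

end AntModel

/-! Write F(f, χ) = A f − χ (b f + q(f)), where A = σ_x Δ_x + σ_θ ∂_θθ − λ v_θ·∇_x, b f = ∂_θ B_τ[f]
/ 2π and q(f) = ∂_θ(B_τ[f] f) is quadratic. The theorem is a Lyapunov–Schmidt reduction at (0, χ^k).
Two things need work: kernel and range of L = A − χ^k b on X, and a form of the reduction from which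
the symmetries and the vanishing derivatives can be read off.

Linear theory. B_τ[f] sees f only through the density ∫ f dθ, so the wave vectors ℓ decouple, and on
each of them b has rank one. Let P^ℓ be the resolvent applied to the constant 1. Testing L_χ f
against e^{-2πi ℓ·x} P^ℓ gives (1 − (χ/2π) ∫Û^ℓ) ρ_ℓ, where ρ_ℓ is the density coefficient of f
(`BifData.pair_Lop`). So ℓ ≠ 0 is critical at χ^k exactly when ∫Û^ℓ = ∫Û^{k₁}, and then this
functional annihilates the range. The operator A : X → Z is an isomorphism (`AX_bijective`), by
Lax–Milgram with test functions D g − m g, D being the diffusion part of A. Hence solving L w = z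
amounts to dividing density coefficients by 1 − (χ^k/2π) ∫Û^ℓ (`BifData.exists_LX_eq`).

Small σ_θ. By rotation ∫Û^ℓ is real and depends on |ℓ| only, so everything reduces to a periodic
equation −M u + σ u'' = g with M of constant real part. For fixed |ℓ| one has ∫Û^ℓ = c₀ + c₁ σ +
O(σ²), with c₀ and c₁ explicit in r = a/√(1+a²), a = 2πσ_x|ℓ|/λ. Two different lengths never share
both coefficients (`coeff_ne`), so any two branches separate for small σ. A bound C/|ℓ|² that is
uniform in σ leaves only finitely many ℓ to compare with k₁, hence one threshold for σ_θ
(`exists_spectral`). Moreover c₀ > 0, so χ^k > 0, and the limit of ∫Û P is nonzero, so that φ^{k_j}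
is not in the range. The lattice vectors of length k are ±k₁, ±k₂ because k is non-Pythagorean.
Antipodal evenness makes ρ_ℓ = ρ_{-ℓ} real, so the kernel of L in X is spanned by the two functions
φ^{k_j}.

Reduction (`Reduction.exists_reduction`). Let ψ_j be the functionals dual to φ^{k_j} that vanish on
the range of L. The analytic map T(f, μ, χ) = (F(f, χ) − A(μ₁φ^{k₁} + μ₂φ^{k₂}), ψ(f), χ) has
invertible derivative at (0, 0, χ^k). The local preimage (f, μ, χ) of (0, (r₁, r₂), χ) defines Φ = μ
and G = f − r₁φ^{k₁} − r₂φ^{k₂}, and F(f, χ) = 0 means Φ = 0. The complement of the range is spanned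
by A φ^{k_j} rather than φ^{k_j}, because L_χ φ^{k_j} = (1 − χ/χ^k) A φ^{k_j} for every χ. Therefore
the preimage linearizes to r₁φ^{k₁} + r₂φ^{k₂} along the whole trivial branch, and D_r G = 0 there,
not only at χ^k.

Symmetry. F commutes with (x₁, x₂, θ) ↦ (x₂, x₁, π/2 − θ), which exchanges φ^{k₁} and φ^{k₂}. By
uniqueness of local preimages this swaps the components of Φ, and the diagonal field line follows.
The translation of x₂ by 1/(k+1) fixes φ^{k₁} but not φ^{k₂}. Solving inside the functions invariant
under it shows that Φ(r, 0, χ) is a multiple of (1, 0). -/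

namespace AntModel

/-! ### Characters of a torus and integration by parts. -/

noncomputable section

open scoped ComplexConjugate

/-- A covering homomorphism of a torus together with a total system of characters. -/
structure FourierSystem {ι M : Type} [Fintype ι] [AddCommGroup M] [TopologicalSpace M]
    (e : (ι → ℝ) → M) (κ : Type) [Neg κ] where
  cover_add : ∀ y y', e (y + y') = e y + e y'
  quot : Topology.IsQuotientMap e
  freq : κ → ι → ℝ
  freq_injective : Function.Injective freq
  freq_neg : ∀ n, freq (-n) = -freq n
  E : κ → C(M, ℂ)
  E_shift : ∀ n z y, E n (z + e y) = E n z * Complex.exp (Complex.I * (∑ i, freq n i * y i : ℝ))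
  E_neg : ∀ n z, E (-n) z = conj (E n z)
  E_norm : ∀ n z, ‖E n z‖ = 1
  dense : (Submodule.span ℂ (Set.range E)).topologicalClosure = ⊤

/-- The partial derivative of a complex-valued function on the torus. -/
def cpderiv {ι M : Type} [DecidableEq ι] [AddCommGroup M] (e : (ι → ℝ) → M) (i : ι)
    (φ : M → ℂ) : M → ℂ :=
  fun z => deriv (fun s : ℝ => φ (z + e (Pi.single i s))) 0

section Calculus

variable {ι M : Type} [Fintype ι] [DecidableEq ι]
  [AddCommGroup M] [TopologicalSpace M] [CompactSpace M]
  [MeasureSpace M] [BorelSpace M] {e : (ι → ℝ) → M} {κ : Type} [Neg κ]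

lemma FourierSystem.hasDerivAt_line {W : Type} [NormedAddCommGroup W] [NormedSpace ℝ W]
    (S : FourierSystem e κ) {φ : M → W} (hφ : ContDiff ℝ ∞ (fun y => φ (e y))) (y : ι → ℝ) (i : ι)
    (s : ℝ) : HasDerivAt (fun s : ℝ => φ (e y + e (Pi.single i s)))
      (fderiv ℝ (fun y => φ (e y)) (y + Pi.single i s) (Pi.single i 1)) s := by
  have h1 : HasDerivAt (fun s : ℝ => y + Pi.single i s) (Pi.single i (1 : ℝ) : ι → ℝ) s := by
    have : HasDerivAt (fun s : ℝ => (Pi.single i s : ι → ℝ)) (Pi.single i (1 : ℝ) : ι → ℝ) s := by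
      rw [hasDerivAt_pi]
      intro j
      by_cases h : j = i
      · subst h; simpa using hasDerivAt_id' s
      · simpa [Pi.single_apply, h] using hasDerivAt_const s (0 : ℝ)
    simpa using this.const_add y
  have h2 := ((hφ.differentiable (by simp)) (y + Pi.single i s)).hasFDerivAt
  have h3 := h2.comp_hasDerivAt s h1
  simpa [Function.comp_def, S.cover_add] using h3

lemma FourierSystem.pderiv_cover (S : FourierSystem e κ) {φ : M → ℝ}
    (hφ : ContDiff ℝ ∞ (fun y => φ (e y))) (y : ι → ℝ) (i : ι) :
    pderiv e i φ (e y) = fderiv ℝ (fun y => φ (e y)) y (Pi.single i 1) := by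
  have := (S.hasDerivAt_line hφ y i 0).deriv
  simpa [pderiv] using this

lemma FourierSystem.cpderiv_cover (S : FourierSystem e κ) {φ : M → ℂ}
    (hφ : ContDiff ℝ ∞ (fun y => φ (e y))) (y : ι → ℝ) (i : ι) :
    cpderiv e i φ (e y) = fderiv ℝ (fun y => φ (e y)) y (Pi.single i 1) := by
  have := (S.hasDerivAt_line hφ y i 0).deriv
  simpa [cpderiv] using this

lemma FourierSystem.hasDerivAt_pderiv (S : FourierSystem e κ) {φ : M → ℝ}
    (hφ : ContDiff ℝ ∞ (fun y => φ (e y))) (z : M) (i : ι) (s : ℝ) :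
    HasDerivAt (fun s : ℝ => φ (z + e (Pi.single i s))) (pderiv e i φ (z + e (Pi.single i s))) s := by
  obtain ⟨y, rfl⟩ := S.quot.surjective z
  rw [← S.cover_add, S.pderiv_cover hφ]
  exact S.hasDerivAt_line hφ y i s

lemma FourierSystem.hasDerivAt_cpderiv (S : FourierSystem e κ) {φ : M → ℂ}
    (hφ : ContDiff ℝ ∞ (fun y => φ (e y))) (z : M) (i : ι) (s : ℝ) :
    HasDerivAt (fun s : ℝ => φ (z + e (Pi.single i s)))
      (cpderiv e i φ (z + e (Pi.single i s))) s := by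
  obtain ⟨y, rfl⟩ := S.quot.surjective z
  rw [← S.cover_add, S.cpderiv_cover hφ]
  exact S.hasDerivAt_line hφ y i s

lemma FourierSystem.cover_zero (S : FourierSystem e κ) : e 0 = 0 := by
  have := S.cover_add 0 0
  simpa using this

lemma FourierSystem.hasDerivAt_pderiv_zero (S : FourierSystem e κ) {φ : M → ℝ}
    (hφ : ContDiff ℝ ∞ (fun y => φ (e y))) (z : M) (i : ι) :
    HasDerivAt (fun s : ℝ => φ (z + e (Pi.single i s))) (pderiv e i φ z) 0 := by
  simpa [S.cover_zero] using S.hasDerivAt_pderiv hφ z i 0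

lemma FourierSystem.hasDerivAt_cpderiv_zero (S : FourierSystem e κ) {φ : M → ℂ}
    (hφ : ContDiff ℝ ∞ (fun y => φ (e y))) (z : M) (i : ι) :
    HasDerivAt (fun s : ℝ => φ (z + e (Pi.single i s))) (cpderiv e i φ z) 0 := by
  simpa [S.cover_zero] using S.hasDerivAt_cpderiv hφ z i 0

lemma FourierSystem.contDiff_pderiv (S : FourierSystem e κ) {φ : M → ℝ}
    (hφ : ContDiff ℝ ∞ (fun y => φ (e y))) (i : ι) :
    ContDiff ℝ ∞ (fun y => pderiv e i φ (e y)) := by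
  simp only [S.pderiv_cover hφ]
  exact (hφ.fderiv_right (m := ∞) (by simp)).clm_apply contDiff_const

lemma FourierSystem.contDiff_cpderiv (S : FourierSystem e κ) {φ : M → ℂ}
    (hφ : ContDiff ℝ ∞ (fun y => φ (e y))) (i : ι) :
    ContDiff ℝ ∞ (fun y => cpderiv e i φ (e y)) := by
  simp only [S.cpderiv_cover hφ]
  exact (hφ.fderiv_right (m := ∞) (by simp)).clm_apply contDiff_const

lemma FourierSystem.continuous_of_contDiff {W : Type} [NormedAddCommGroup W] [NormedSpace ℝ W]
    (S : FourierSystem e κ) {φ : M → W}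
    (hφ : ContDiff ℝ ∞ (fun y => φ (e y))) : Continuous φ :=
  S.quot.continuous_iff.2 hφ.continuous

lemma FourierSystem.isTest (S : FourierSystem e κ) {φ : M → ℝ}
    (hφ : ContDiff ℝ ∞ (fun y => φ (e y))) : IsTest e φ :=
  ⟨hφ, S.continuous_of_contDiff hφ, fun i => S.continuous_of_contDiff (S.contDiff_pderiv hφ i)⟩

lemma FourierSystem.isTest_pderiv (S : FourierSystem e κ) {φ : M → ℝ}
    (hφ : IsTest e φ) (i : ι) : IsTest e (pderiv e i φ) :=
  S.isTest (S.contDiff_pderiv hφ.1 i)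

lemma FourierSystem.isTest_mul (S : FourierSystem e κ) {φ ψ : M → ℝ}
    (hφ : IsTest e φ) (hψ : IsTest e ψ) : IsTest e (fun z => φ z * ψ z) :=
  S.isTest (hφ.1.mul hψ.1)

lemma FourierSystem.pderiv_mul (S : FourierSystem e κ) {φ ψ : M → ℝ}
    (hφ : IsTest e φ) (hψ : IsTest e ψ) (i : ι) (z : M) :
    pderiv e i (fun z => φ z * ψ z) z = pderiv e i φ z * ψ z + φ z * pderiv e i ψ z := by
  have := (S.hasDerivAt_pderiv_zero hφ.1 z i).fun_mul (S.hasDerivAt_pderiv_zero hψ.1 z i)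
  have h := this.deriv
  simpa [pderiv, S.cover_zero] using h

lemma FourierSystem.pderiv_re (S : FourierSystem e κ) {φ : M → ℂ}
    (hφ : ContDiff ℝ ∞ (fun y => φ (e y))) (i : ι) (z : M) :
    pderiv e i (fun z => (φ z).re) z = (cpderiv e i φ z).re := by
  have h := (Complex.reCLM.hasFDerivAt.comp_hasDerivAt (0 : ℝ)
    (S.hasDerivAt_cpderiv_zero hφ z i)).deriv
  simpa [pderiv, Function.comp_def] using h

lemma FourierSystem.pderiv_im (S : FourierSystem e κ) {φ : M → ℂ}
    (hφ : ContDiff ℝ ∞ (fun y => φ (e y))) (i : ι) (z : M) :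
    pderiv e i (fun z => (φ z).im) z = (cpderiv e i φ z).im := by
  have h := (Complex.imCLM.hasFDerivAt.comp_hasDerivAt (0 : ℝ)
    (S.hasDerivAt_cpderiv_zero hφ z i)).deriv
  simpa [pderiv, Function.comp_def] using h

lemma FourierSystem.isTest_re (S : FourierSystem e κ) {φ : M → ℂ}
    (hφ : ContDiff ℝ ∞ (fun y => φ (e y))) : IsTest e (fun z => (φ z).re) :=
  S.isTest (Complex.reCLM.contDiff.comp hφ)

lemma FourierSystem.isTest_im (S : FourierSystem e κ) {φ : M → ℂ}
    (hφ : ContDiff ℝ ∞ (fun y => φ (e y))) : IsTest e (fun z => (φ z).im) :=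
  S.isTest (Complex.imCLM.contDiff.comp hφ)

/-- Integrable times continuous, with complex values. -/
lemma integrable_ofReal_mul_continuous {u : M → ℝ} {ψ : M → ℂ} (hu : Integrable u)
    (hψ : Continuous ψ) : Integrable (fun z => (u z : ℂ) * ψ z) := by
  obtain ⟨C, hC⟩ := isCompact_univ.exists_bound_of_continuousOn hψ.continuousOn
  exact hu.ofReal.mul_bdd hψ.aestronglyMeasurable
    (Filter.Eventually.of_forall fun z => hC z (Set.mem_univ z))

lemma integral_ofReal_mul_eq {u : M → ℝ} {ψ : M → ℂ} (hu : Integrable u)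
    (hψ : Continuous ψ) : ∫ z, (u z : ℂ) * ψ z
      = ((∫ z, u z * (ψ z).re : ℝ) : ℂ) + ((∫ z, u z * (ψ z).im : ℝ) : ℂ) * Complex.I := by
  have hi := integrable_ofReal_mul_continuous hu hψ
  rw [← integral_re_add_im hi]
  simp

/-- Integration of a weak derivative against a smooth complex-valued function. -/
lemma FourierSystem.weak_integral (S : FourierSystem e κ) {i : ι} {u g : M → ℝ}
    (h : IsWeakDeriv e i u g) {φ : M → ℂ} (hφ : ContDiff ℝ ∞ (fun y => φ (e y))) :
    ∫ z, (g z : ℂ) * φ z = -∫ z, (u z : ℂ) * cpderiv e i φ z := by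
  rw [integral_ofReal_mul_eq h.2.1 (S.continuous_of_contDiff hφ),
    integral_ofReal_mul_eq h.1 (S.continuous_of_contDiff (S.contDiff_cpderiv hφ i))]
  have h1 := h.2.2 _ (S.isTest_re hφ)
  have h2 := h.2.2 _ (S.isTest_im hφ)
  simp only [S.pderiv_re hφ, S.pderiv_im hφ] at h1 h2
  rw [h1, h2]
  push_cast
  ring

lemma FourierSystem.contDiff_E (S : FourierSystem e κ) (n : κ) :
    ContDiff ℝ ∞ (fun y => S.E n (e y)) := by
  have h : (fun y => S.E n (e y)) = fun y => S.E n 0 *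
      Complex.exp (Complex.I * (∑ i, S.freq n i * y i : ℝ)) := by
    funext y
    rw [← S.E_shift, zero_add]
  rw [h]
  refine contDiff_const.mul (Complex.contDiff_exp.comp (contDiff_const.mul ?_))
  exact Complex.ofRealCLM.contDiff.comp
    (ContDiff.sum fun i _ => contDiff_const.mul (contDiff_apply ℝ ℝ i))

lemma FourierSystem.cpderiv_E (S : FourierSystem e κ) (n : κ) (i : ι) (z : M) :
    cpderiv e i (S.E n) z = Complex.I * S.freq n i * S.E n z := by
  have h : (fun s : ℝ => S.E n (z + e (Pi.single i s))) = fun s : ℝ => S.E n z *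
      Complex.exp (Complex.I * (S.freq n i * s : ℝ)) := by
    funext s
    rw [S.E_shift]
    congr 4
    rw [Finset.sum_eq_single i]
    · simp
    · intro j _ hj; simp [hj]
    · simp
  rw [cpderiv, h]
  have h1 : HasDerivAt (fun s : ℝ => (S.freq n i * s : ℝ)) (S.freq n i) (0 : ℝ) := by
    simpa using (hasDerivAt_id (0 : ℝ)).const_mul (S.freq n i)
  have h2 := ((h1.ofReal_comp.const_mul Complex.I).cexp.const_mul (S.E n z)).deriv
  simp only [h2]
  simp
  ring

section Measure

variable [IsTopologicalAddGroup M] [SecondCountableTopology M] [T2Space M]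
  [Measure.IsAddLeftInvariant (volume : Measure M)] [IsFiniteMeasure (volume : Measure M)]

lemma integrable_of_continuous' {W : Type} [NormedAddCommGroup W] {φ : M → W}
    [SecondCountableTopology W] (h : Continuous φ) : Integrable φ (volume : Measure M) := by
  obtain ⟨C, hC⟩ := isCompact_univ.exists_bound_of_continuousOn h.continuousOn
  exact Integrable.of_bound h.aestronglyMeasurable C
    (Filter.Eventually.of_forall fun z => hC z (Set.mem_univ z))

/-- By translation invariance s ↦ ∫ φ(z + e(s eᵢ)) is constant; its derivative at 0, taken under the
integral, is the integral in question. -/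
lemma FourierSystem.integral_pderiv (S : FourierSystem e κ) {φ : M → ℝ} (hφ : IsTest e φ) (i : ι) :
    ∫ z, pderiv e i φ z = 0 := by
  obtain ⟨C, hC⟩ := isCompact_univ.exists_bound_of_continuousOn (hφ.2.2 i).continuousOn
  have h := hasDerivAt_integral_of_dominated_loc_of_deriv_le (μ := (volume : Measure M))
    (F := fun (s : ℝ) z => φ (z + e (Pi.single i s)))
    (F' := fun (s : ℝ) z => pderiv e i φ (z + e (Pi.single i s)))
    (x₀ := (0 : ℝ)) (s := Set.univ) (bound := fun _ => C) Filter.univ_mem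
    (Filter.Eventually.of_forall fun s =>
      (hφ.2.1.comp (continuous_add_const _)).aestronglyMeasurable)
    (integrable_of_continuous' (hφ.2.1.comp (continuous_add_const _)))
    ((hφ.2.2 i).comp (continuous_add_const _)).aestronglyMeasurable
    (Filter.Eventually.of_forall fun z s _ => hC _ (Set.mem_univ _))
    (integrable_const _)
    (Filter.Eventually.of_forall fun z s _ => S.hasDerivAt_pderiv hφ.1 z i s)
  have h1 : (fun s : ℝ => ∫ z, φ (z + e (Pi.single i s))) = fun _ => ∫ z, φ z := by
    funext s
    exact integral_add_right_eq_self φ (e (Pi.single i s))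
  have h2 := h.2
  rw [h1] at h2
  have h3 := h2.unique (hasDerivAt_const _ _)
  simpa [S.cover_zero] using h3

/-- The integral of ∂ᵢ(φψ) vanishes. -/
lemma FourierSystem.isWeakDeriv_of_isTest (S : FourierSystem e κ) {φ : M → ℝ} (hφ : IsTest e φ)
    (i : ι) : IsWeakDeriv e i φ (pderiv e i φ) := by
  refine ⟨integrable_of_continuous' hφ.2.1, integrable_of_continuous' (hφ.2.2 i), fun ψ hψ => ?_⟩
  have h := S.integral_pderiv (S.isTest_mul hφ hψ) i
  simp only [S.pderiv_mul hφ hψ] at h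
  have i1 : Integrable fun z => pderiv e i φ z * ψ z :=
    integrable_of_continuous' ((hφ.2.2 i).mul hψ.2.1)
  have i2 : Integrable fun z => φ z * pderiv e i ψ z :=
    integrable_of_continuous' (hφ.2.1.mul (hψ.2.2 i))
  rw [integral_add i1 i2] at h
  linarith

/-- Product rule for a smooth factor. -/
lemma FourierSystem.isWeakDeriv_mul (S : FourierSystem e κ) {i : ι} {u g b : M → ℝ}
    (h : IsWeakDeriv e i u g) (hb : IsTest e b) :
    IsWeakDeriv e i (fun z => u z * b z) (fun z => g z * b z + u z * pderiv e i b z) := by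
  refine ⟨integrable_mul_continuous h.1 hb.2.1, (integrable_mul_continuous h.2.1 hb.2.1).add
    (integrable_mul_continuous h.1 (hb.2.2 i)), fun ψ hψ => ?_⟩
  have h1 := h.2.2 _ (S.isTest_mul hb hψ)
  simp only [S.pderiv_mul hb hψ, mul_add, ← mul_assoc] at h1
  have i1 : Integrable fun z => u z * pderiv e i b z * ψ z :=
    integrable_mul_continuous (integrable_mul_continuous h.1 (hb.2.2 i)) hψ.2.1
  have i2 : Integrable fun z => u z * b z * pderiv e i ψ z :=
    integrable_mul_continuous (integrable_mul_continuous h.1 hb.2.1) (hψ.2.2 i)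
  have i3 : Integrable fun z => g z * b z * ψ z :=
    integrable_mul_continuous (integrable_mul_continuous h.2.1 hb.2.1) hψ.2.1
  rw [integral_add i1 i2] at h1
  simp only [add_mul]
  rw [integral_add i3 i1]
  linarith

end Measure

end Calculus

end

end AntModel

/-! ### Fourier series in real L², and weak derivatives as Fourier multipliers. -/

namespace AntModel

noncomputable section

open scoped ComplexConjugate

section FourierL2

variable {ι M : Type} [Fintype ι] [DecidableEq ι]
  [AddCommGroup M] [TopologicalSpace M] [CompactSpace M]
  [MeasureSpace M] [BorelSpace M] {e : (ι → ℝ) → M} {κ : Type} [Neg κ]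
  [IsTopologicalAddGroup M] [SecondCountableTopology M] [T2Space M]
  [Measure.IsAddLeftInvariant (volume : Measure M)] [IsFiniteMeasure (volume : Measure M)]
  [Measure.IsOpenPosMeasure (volume : Measure M)]

/-- The Fourier coefficients of a real-valued function. -/
def FourierSystem.coef (S : FourierSystem e κ) (u : M → ℝ) (n : κ) : ℂ :=
  ∫ z, (u z : ℂ) * conj (S.E n z)

variable (M) in
/-- The total mass of the torus. -/
def mass : ℝ := (volume : Measure M).real Set.univ

variable (M) in
lemma mass_pos : 0 < mass M := by
  rw [mass, measureReal_def, ENNReal.toReal_pos_iff]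
  exact ⟨isOpen_univ.measure_pos _ ⟨0, trivial⟩, measure_lt_top _ _⟩

/-- Translation by half a period of E_m · conj E_n, in a coordinate where the frequencies differ,
reverses the sign of the integrand but cannot change the integral. -/
lemma FourierSystem.integral_E_mul_conj (S : FourierSystem e κ) {m n : κ} (h : m ≠ n) :
    ∫ z, S.E m z * conj (S.E n z) = 0 := by
  obtain ⟨i, hi⟩ := Function.ne_iff.1 (fun hh => h (S.freq_injective hh))
  have hd : S.freq m i - S.freq n i ≠ 0 := sub_ne_zero.2 hi
  set s : ℝ := Real.pi / (S.freq m i - S.freq n i) with hs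
  have hE : ∀ k, ∀ z, S.E k (z + e (Pi.single i s)) = S.E k z *
      Complex.exp (Complex.I * (S.freq k i * s : ℝ)) := by
    intro k z
    rw [S.E_shift]
    congr 4
    rw [Finset.sum_eq_single i]
    · simp
    · intro j _ hj; simp [hj]
    · simp
  have h1 := integral_add_right_eq_self (μ := (volume : Measure M))
    (fun z => S.E m z * conj (S.E n z)) (e (Pi.single i s))
  have h2 : ∀ z, S.E m (z + e (Pi.single i s)) * conj (S.E n (z + e (Pi.single i s)))
      = -(S.E m z * conj (S.E n z)) := by
    intro z
    rw [hE, hE, map_mul, ← Complex.exp_conj]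
    have : Complex.exp (Complex.I * (S.freq m i * s : ℝ)) *
        Complex.exp (conj (Complex.I * (S.freq n i * s : ℝ))) = -1 := by
      rw [← Complex.exp_add, ← Complex.exp_pi_mul_I]
      congr 1
      simp only [map_mul, Complex.conj_I, Complex.conj_ofReal]
      have : (Real.pi : ℂ) = ((S.freq m i - S.freq n i) * s : ℝ) := by
        rw [hs]; congr 1; field_simp
      rw [this]; push_cast; ring
    linear_combination (S.E m z * conj (S.E n z)) * this
  simp only [h2, integral_neg] at h1
  exact self_eq_neg.1 h1.symm

lemma FourierSystem.E_mul_conj (S : FourierSystem e κ) (n : κ) (z : M) :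
    S.E n z * conj (S.E n z) = 1 := by
  rw [Complex.mul_conj, Complex.normSq_eq_norm_sq, S.E_norm]; simp

/-- The normalized characters in `L²`. -/
def FourierSystem.vec (S : FourierSystem e κ) (n : κ) : Lp ℂ 2 (volume : Measure M) :=
  ((Real.sqrt (mass M))⁻¹ : ℂ) • ContinuousMap.toLp 2 volume ℂ (S.E n)

lemma FourierSystem.orthonormal (S : FourierSystem e κ) :
    Orthonormal ℂ (S.vec : κ → Lp ℂ 2 (volume : Measure M)) := by
  classical
  rw [orthonormal_iff_ite]
  intro n m
  rw [FourierSystem.vec, FourierSystem.vec, inner_smul_left, inner_smul_right,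
    ContinuousMap.inner_toLp]
  split_ifs with h
  · subst h
    simp only [S.E_mul_conj, integral_const, map_inv₀, Complex.conj_ofReal]
    have h0 := mass_pos M
    have h1 : ((Real.sqrt (mass M) : ℝ) : ℂ) * (Real.sqrt (mass M) : ℝ) = (mass M : ℝ) := by
      rw [← Complex.ofReal_mul, Real.mul_self_sqrt h0.le]
    have h2 : ((Real.sqrt (mass M) : ℝ) : ℂ) ≠ 0 := by
      rw [Complex.ofReal_ne_zero]; exact (Real.sqrt_pos.2 h0).ne'
    change _ * (_ * (mass M • (1 : ℂ))) = 1
    rw [Complex.real_smul, ← h1]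
    field_simp
  · rw [S.integral_E_mul_conj (Ne.symm h)]; simp

/-- The characters span a dense subspace of C(M) in the sup norm, C(M) is dense in L², and
normalization does not change the span. -/
lemma FourierSystem.span_dense (S : FourierSystem e κ) :
    ⊤ ≤ (Submodule.span ℂ
      (Set.range (S.vec : κ → Lp ℂ 2 (volume : Measure M)))).topologicalClosure := by
  have h0 : ((Real.sqrt (mass M) : ℝ) : ℂ)⁻¹ ≠ 0 := by
    rw [Ne, inv_eq_zero, Complex.ofReal_eq_zero]; exact (Real.sqrt_pos.2 (mass_pos M)).ne'
  have h1 : Submodule.span ℂ (Set.range (S.vec : κ → Lp ℂ 2 (volume : Measure M)))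
      = Submodule.span ℂ (Set.range fun n => ContinuousMap.toLp 2 volume ℂ (S.E n)) := by
    apply le_antisymm
    · rw [Submodule.span_le]
      rintro _ ⟨n, rfl⟩
      exact Submodule.smul_mem _ _ (Submodule.subset_span ⟨n, rfl⟩)
    · rw [Submodule.span_le]
      rintro _ ⟨n, rfl⟩
      have : ContinuousMap.toLp 2 volume ℂ (S.E n)
          = (((Real.sqrt (mass M) : ℝ) : ℂ)⁻¹)⁻¹ • S.vec n := by
        rw [FourierSystem.vec, smul_smul, inv_mul_cancel₀ h0, one_smul]
      rw [SetLike.mem_coe]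
      simp only [this]
      exact Submodule.smul_mem _ _ (Submodule.subset_span ⟨n, rfl⟩)
  rw [h1]
  have h2 := (ContinuousMap.toLp_denseRange (p := 2) ℂ (volume : Measure M) ℂ
    (by simp)).topologicalClosure_map_submodule S.dense
  rw [Submodule.map_span, ← Set.range_comp] at h2
  exact h2.ge

/-- The Hilbert basis of normalized characters. -/
def FourierSystem.basis (S : FourierSystem e κ) :
    HilbertBasis κ ℂ (Lp ℂ 2 (volume : Measure M)) :=
  HilbertBasis.mk S.orthonormal S.span_dense

variable (M) in
/-- The embedding of real into complex `L²`. -/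
abbrev complexify : L2 M →L[ℝ] Lp ℂ 2 (volume : Measure M) :=
  Complex.ofRealCLM.compLpL 2 volume

lemma FourierSystem.basis_apply (S : FourierSystem e κ) (n : κ) :
    S.basis n = (S.vec n : Lp ℂ 2 (volume : Measure M)) := by
  rw [FourierSystem.basis, HilbertBasis.coe_mk]

lemma FourierSystem.inner_basis (S : FourierSystem e κ) (w : Lp ℂ 2 (volume : Measure M)) (n : κ) :
    inner ℂ (S.basis n) w = ((Real.sqrt (mass M))⁻¹ : ℂ) * ∫ z, w z * conj (S.E n z) := by
  rw [S.basis_apply, FourierSystem.vec, inner_smul_left, L2.inner_def]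
  congr 1
  · simp
  · apply integral_congr_ae
    filter_upwards [ContinuousMap.coeFn_toLp (p := 2) (𝕜 := ℂ) volume (S.E n)] with z hz
    rw [hz]; rfl

lemma FourierSystem.inner_basis_complexify (S : FourierSystem e κ) (u : L2 M) (n : κ) :
    inner ℂ (S.basis n) (complexify M u) = ((Real.sqrt (mass M))⁻¹ : ℂ) * S.coef u n := by
  rw [S.inner_basis, FourierSystem.coef]
  congr 1
  apply integral_congr_ae
  filter_upwards [ContinuousLinearMap.coeFn_compLpL (p := 2) (μ := volume) Complex.ofRealCLM u]
    with z hz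
  rw [hz]; rfl

lemma inner_complexify (u v : L2 M) :
    inner ℂ (complexify M u) (complexify M v) = ((∫ z, u z * v z : ℝ) : ℂ) := by
  rw [L2.inner_def, ← integral_complex_ofReal]
  apply integral_congr_ae
  filter_upwards [ContinuousLinearMap.coeFn_compLpL (p := 2) (μ := volume) Complex.ofRealCLM u,
    ContinuousLinearMap.coeFn_compLpL (p := 2) (μ := volume) Complex.ofRealCLM v] with z h1 h2
  rw [h1, h2]
  simp [mul_comm]

lemma L2_inner_eq (u v : L2 M) : inner ℝ u v = ∫ z, u z * v z := by
  rw [L2.inner_def]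
  simp [mul_comm]

lemma integrable_L2 (u : L2 M) : Integrable u :=
  (Lp.memLp u).integrable one_le_two

/-- Parseval's identity. -/
lemma FourierSystem.hasSum_coef (S : FourierSystem e κ) (u v : L2 M) :
    HasSum (fun n => conj (S.coef u n) * S.coef v n) ((mass M * inner ℝ u v : ℝ) : ℂ) := by
  have h := S.basis.hasSum_inner_mul_inner (complexify M u) (complexify M v)
  have h0 := mass_pos M
  have h1 : ((Real.sqrt (mass M) : ℝ) : ℂ) * (Real.sqrt (mass M) : ℝ) = (mass M : ℝ) := by
    rw [← Complex.ofReal_mul, Real.mul_self_sqrt h0.le]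
  have h2 : ((Real.sqrt (mass M) : ℝ) : ℂ) ≠ 0 := by
    rw [Complex.ofReal_ne_zero]; exact (Real.sqrt_pos.2 h0).ne'
  have h3 := h.mul_left ((mass M : ℝ) : ℂ)
  rw [inner_complexify, ← L2_inner_eq, ← Complex.ofReal_mul] at h3
  refine HasSum.congr_fun h3 fun n => ?_
  rw [← inner_conj_symm (complexify M u), S.inner_basis_complexify, S.inner_basis_complexify,
    ← h1]
  simp only [map_mul, map_inv₀, Complex.conj_ofReal]
  field_simp

lemma FourierSystem.hasSum_norm_coef (S : FourierSystem e κ) (u : L2 M) :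
    HasSum (fun n => ‖S.coef u n‖ ^ 2) (mass M * ‖u‖ ^ 2) := by
  have h := S.hasSum_coef u u
  rw [real_inner_self_eq_norm_sq] at h
  have h' := Complex.reCLM.hasSum h
  simp only [Complex.reCLM_apply, Complex.ofReal_re] at h'
  convert h' using 2 with n
  rw [mul_comm, Complex.mul_conj, Complex.normSq_eq_norm_sq, Complex.ofReal_re]

lemma FourierSystem.coef_ext (S : FourierSystem e κ) {u v : L2 M}
    (h : ∀ n, S.coef u n = S.coef v n) : u = v := by
  have hc : complexify M u = complexify M v := by
    rw [← sub_eq_zero, ← inner_self_eq_zero (𝕜 := ℂ)]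
    have h1 := S.basis.hasSum_inner_mul_inner (complexify M u - complexify M v)
      (complexify M u - complexify M v)
    refine h1.unique ?_
    simp only [inner_sub_right, S.inner_basis_complexify, h, sub_self, mul_zero]
    exact hasSum_zero
  ext1
  filter_upwards [ContinuousLinearMap.coeFn_compLpL (p := 2) (μ := volume) Complex.ofRealCLM u,
    ContinuousLinearMap.coeFn_compLpL (p := 2) (μ := volume) Complex.ofRealCLM v] with z h1 h2
  have : (complexify M u) z = (complexify M v) z := by rw [hc]
  rw [h1, h2] at this
  exact Complex.ofReal_injective this

lemma FourierSystem.coef_neg (S : FourierSystem e κ) (u : M → ℝ) (n : κ) :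
    S.coef u (-n) = conj (S.coef u n) := by
  rw [FourierSystem.coef, FourierSystem.coef, ← integral_conj]
  congr 1
  funext z
  simp [S.E_neg]

/-- Fourier multipliers. -/
lemma FourierSystem.exists_multiplier (S : FourierSystem e κ) (m : κ → ℂ) (C : ℝ)
    (hC : ∀ n, ‖m n‖ ≤ C) (hm : ∀ n, m (-n) = conj (m n)) (u : L2 M) :
    ∃ v : L2 M, ∀ n, S.coef v n = m n * S.coef u n := by
  have hs : Memℓp (fun n => m n * S.basis.repr (complexify M u) n) 2 := by
    have h1 := (lp.memℓp (S.basis.repr (complexify M u))).const_mul (C : ℂ)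
    refine h1.mono' fun n => ?_
    simp only [norm_mul]
    gcongr
    exact (hC n).trans (by simpa using le_abs_self C)
  set w : Lp ℂ 2 (volume : Measure M) := S.basis.repr.symm ⟨_, hs⟩ with hw
  have hwn : ∀ n, ∫ z, w z * conj (S.E n z) = m n * S.coef u n := by
    intro n
    have h1 : S.basis.repr w n = m n * S.basis.repr (complexify M u) n := by
      rw [hw, LinearIsometryEquiv.apply_symm_apply]
    rw [HilbertBasis.repr_apply_apply, HilbertBasis.repr_apply_apply, S.inner_basis,
      S.inner_basis_complexify] at h1
    have h2 : ((Real.sqrt (mass M) : ℝ) : ℂ)⁻¹ ≠ 0 := by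
      rw [Ne, inv_eq_zero, Complex.ofReal_eq_zero]; exact (Real.sqrt_pos.2 (mass_pos M)).ne'
    exact mul_left_cancel₀ h2 (by linear_combination h1)
  -- The multiplied series w is built in complex L². Its real part has the same coefficients,
  -- because m(-n) = conj m(n) and the coefficients of the real function u have the same symmetry.
  refine ⟨Complex.reCLM.compLpL 2 volume w, fun n => ?_⟩
  have hi : Integrable w := (Lp.memLp w).integrable one_le_two
  have hb : ∀ k, Integrable fun z => w z * conj (S.E k z) := fun k =>
    hi.mul_bdd (Complex.continuous_conj.comp (S.E k).continuous).aestronglyMeasurable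
      (Filter.Eventually.of_forall fun z => by simp [S.E_norm] : ∀ᵐ z, _ ≤ (1 : ℝ))
  have h1 : S.coef (Complex.reCLM.compLpL 2 volume w) n
      = ∫ z, (1 / 2 : ℂ) * (w z * conj (S.E n z) + conj (w z * conj (S.E (-n) z))) := by
    rw [FourierSystem.coef]
    apply integral_congr_ae
    filter_upwards [ContinuousLinearMap.coeFn_compLpL (p := 2) (μ := volume) Complex.reCLM w]
      with z hz
    rw [hz, Complex.reCLM_apply, Complex.re_eq_add_conj, S.E_neg]
    simp only [map_mul, Complex.conj_conj]
    ring
  rw [h1, integral_const_mul, integral_add (hb n) (by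
    simpa using (Complex.conjCLE.toContinuousLinearMap.integrable_comp (hb (-n)))),
    integral_conj, hwn, hwn, hm, S.coef_neg]
  simp only [map_mul, Complex.conj_conj]
  ring

lemma FourierSystem.coef_add (S : FourierSystem e κ) (u v : L2 M) (n : κ) :
    S.coef (u + v : L2 M) n = S.coef u n + S.coef v n := by
  have hc : Continuous fun z => conj (S.E n z) := Complex.continuous_conj.comp (S.E n).continuous
  rw [FourierSystem.coef, FourierSystem.coef, FourierSystem.coef,
    ← integral_add (integrable_ofReal_mul_continuous (integrable_L2 u) hc)
      (integrable_ofReal_mul_continuous (integrable_L2 v) hc)]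
  apply integral_congr_ae
  filter_upwards [Lp.coeFn_add u v] with z hz
  rw [hz, Pi.add_apply]; push_cast; ring

lemma FourierSystem.coef_smul (S : FourierSystem e κ) (c : ℝ) (u : L2 M) (n : κ) :
    S.coef (c • u : L2 M) n = c * S.coef u n := by
  rw [FourierSystem.coef, FourierSystem.coef, ← integral_const_mul]
  apply integral_congr_ae
  filter_upwards [Lp.coeFn_smul c u] with z hz
  rw [hz, Pi.smul_apply, smul_eq_mul]; push_cast; ring

lemma FourierSystem.coef_sub (S : FourierSystem e κ) (u v : L2 M) (n : κ) :
    S.coef (u - v : L2 M) n = S.coef u n - S.coef v n := by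
  have h := S.coef_add (u - v) v n
  rw [sub_add_cancel] at h
  rw [h]; ring

lemma FourierSystem.coef_congr (S : FourierSystem e κ) {u v : M → ℝ} (h : u =ᵐ[volume] v) (n : κ) :
    S.coef u n = S.coef v n := by
  refine integral_congr_ae ?_
  filter_upwards [h] with z hz
  rw [hz]

lemma FourierSystem.norm_coef_le (S : FourierSystem e κ) (u : L2 M) (n : κ) :
    ‖S.coef u n‖ ≤ Real.sqrt (mass M) * ‖u‖ := by
  have h := (S.hasSum_norm_coef u).summable.le_tsum n (fun _ _ => by positivity)
  rw [(S.hasSum_norm_coef u).tsum_eq] at h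
  refine abs_le_of_sq_le_sq' ?_ (by positivity) |>.2
  rw [mul_pow, Real.sq_sqrt (mass_pos M).le]
  exact h

/-- A Fourier coefficient as a continuous linear map. -/
def FourierSystem.coefL (S : FourierSystem e κ) (n : κ) : L2 M →L[ℝ] ℂ :=
  LinearMap.mkContinuous
    { toFun := fun u => S.coef u n
      map_add' := fun u v => S.coef_add u v n
      map_smul' := fun c u => by simp [S.coef_smul] }
    (Real.sqrt (mass M)) (fun u => S.norm_coef_le u n)

@[simp] lemma FourierSystem.coefL_apply (S : FourierSystem e κ) (n : κ) (u : L2 M) :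
    S.coefL n u = S.coef u n := rfl

/-- Comparison of norms through Fourier coefficients. -/
lemma FourierSystem.norm_sq_le_sum (S : FourierSystem e κ) {J : Type} [Fintype J] (u : L2 M)
    (v : J → L2 M) (h : ∀ n, ‖S.coef u n‖ ^ 2 ≤ ∑ j, ‖S.coef (v j) n‖ ^ 2) :
    ‖u‖ ^ 2 ≤ ∑ j, ‖v j‖ ^ 2 := by
  have h1 := S.hasSum_norm_coef u
  have h2 := hasSum_sum (s := Finset.univ) (fun j _ => S.hasSum_norm_coef (v j))
  have h3 := hasSum_le h h1 h2
  rw [← Finset.mul_sum] at h3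
  exact le_of_mul_le_mul_left h3 (mass_pos M)

lemma FourierSystem.norm_le_of_coef (S : FourierSystem e κ) {C : ℝ} (hC : 0 ≤ C) {u v : L2 M}
    (h : ∀ n, ‖S.coef u n‖ ≤ C * ‖S.coef v n‖) : ‖u‖ ≤ C * ‖v‖ := by
  have h1 := S.norm_sq_le_sum u (fun _ : Unit => C • v) (fun n => by
    simp only [Finset.univ_unique, Finset.sum_const, Finset.card_singleton, one_smul, S.coef_smul,
      norm_mul, Complex.norm_real, Real.norm_of_nonneg hC]
    gcongr
    exact h n)
  simp only [Finset.univ_unique, Finset.sum_const, Finset.card_singleton, one_smul, norm_smul,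
    Real.norm_of_nonneg hC] at h1
  exact abs_le_of_sq_le_sq' h1 (by positivity) |>.2

lemma IsWeakDeriv.coef (S : FourierSystem e κ) {i : ι} {u g : M → ℝ} (h : IsWeakDeriv e i u g)
    (n : κ) : S.coef g n = Complex.I * S.freq n i * S.coef u n := by
  have hE : ∀ z, conj (S.E n z) = S.E (-n) z := fun z => (S.E_neg n z).symm
  simp only [FourierSystem.coef, hE]
  rw [S.weak_integral h (S.contDiff_E (-n)), ← integral_const_mul, ← integral_neg]
  congr 1
  funext z
  rw [S.cpderiv_E, S.freq_neg]
  simp only [Pi.neg_apply]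
  push_cast
  ring

/-- Parseval turns both sides of the integration by parts formula into series. They agree term by
term, since the coefficients of a smooth test function obey the same differentiation rule. -/
lemma FourierSystem.isWeakDeriv_of_coef (S : FourierSystem e κ) {i : ι} {u g : L2 M}
    (h : ∀ n, S.coef g n = Complex.I * S.freq n i * S.coef u n) : IsWeakDeriv e i u g := by
  refine ⟨integrable_L2 u, integrable_L2 g, fun φ hφ => ?_⟩
  set a : L2 M := ContinuousMap.toLp 2 volume ℝ ⟨φ, hφ.2.1⟩ with ha
  set b : L2 M := ContinuousMap.toLp 2 volume ℝ ⟨pderiv e i φ, hφ.2.2 i⟩ with hb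
  have ha' : a =ᵐ[volume] φ := ContinuousMap.coeFn_toLp volume _
  have hb' : b =ᵐ[volume] pderiv e i φ := ContinuousMap.coeFn_toLp volume _
  have hab : ∀ n, S.coef b n = Complex.I * S.freq n i * S.coef a n := by
    intro n
    rw [S.coef_congr ha', S.coef_congr hb']
    exact (S.isWeakDeriv_of_isTest hφ i).coef S n
  have e1 : ∫ z, u z * pderiv e i φ z = inner ℝ u b := by
    rw [L2_inner_eq]; apply integral_congr_ae; filter_upwards [hb'] with z hz; rw [hz]
  have e2 : ∫ z, g z * φ z = inner ℝ g a := by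
    rw [L2_inner_eq]; apply integral_congr_ae; filter_upwards [ha'] with z hz; rw [hz]
  rw [e1, e2]
  have h1 := S.hasSum_coef u b
  have h2 := (S.hasSum_coef g a).neg
  have h3 : (fun n => conj (S.coef u n) * S.coef b n)
      = fun n => -(conj (S.coef g n) * S.coef a n) := by
    funext n
    rw [hab, h]
    simp only [map_mul, Complex.conj_I, Complex.conj_ofReal]
    ring
  rw [h3] at h1
  have h4 := h1.unique h2
  rw [← Complex.ofReal_neg, Complex.ofReal_inj, ← mul_neg] at h4
  exact mul_left_cancel₀ (mass_pos M).ne' h4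

lemma FourierSystem.isWeakDeriv_iff (S : FourierSystem e κ) {i : ι} {u g : L2 M} :
    IsWeakDeriv e i u g ↔ ∀ n, S.coef g n = Complex.I * S.freq n i * S.coef u n :=
  ⟨fun h n => h.coef S n, S.isWeakDeriv_of_coef⟩

/-- The coefficients of a weak derivative are determined by those of u, so the choice made in
`weakDeriv` is immaterial. -/
lemma FourierSystem.weakDeriv_eq (S : FourierSystem e κ) {i : ι} {u : M → ℝ} {g : L2 M}
    (h : IsWeakDeriv e i u g) : weakDeriv e i u = g := by
  have hex : ∃ g : L2 M, IsWeakDeriv e i u g := ⟨g, h⟩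
  rw [weakDeriv, dif_pos hex]
  exact S.coef_ext fun n => by rw [hex.choose_spec.coef S, h.coef S]

/-- Skew-symmetry of the weak derivative in `L²`. -/
lemma IsWeakDeriv.inner_eq (S : FourierSystem e κ) {i : ι} {u g u' g' : L2 M}
    (h : IsWeakDeriv e i u g) (h' : IsWeakDeriv e i u' g') : inner ℝ u g' = -inner ℝ g u' := by
  have h1 := S.hasSum_coef u g'
  have h2 := (S.hasSum_coef g u').neg
  have h3 : (fun n => conj (S.coef u n) * S.coef g' n)
      = fun n => -(conj (S.coef g n) * S.coef u' n) := by
    funext n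
    rw [h.coef S, h'.coef S]
    simp only [map_mul, Complex.conj_I, Complex.conj_ofReal]
    ring
  rw [h3] at h1
  have h4 := h1.unique h2
  rw [← Complex.ofReal_neg, Complex.ofReal_inj, ← mul_neg] at h4
  exact mul_left_cancel₀ (mass_pos M).ne' h4

end FourierL2

end

end AntModel

/-! ### The characters of the position torus and of the phase space. -/

namespace AntModel

noncomputable section

open scoped ComplexConjugate

instance phaseLeftInvariant : Measure.IsAddLeftInvariant (volume : Measure Phase) :=
  @Measure.prod.instIsAddLeftInvariant Pos _ _ _ _ inferInstance inferInstance _ _ _ _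
    inferInstance inferInstance inferInstance

lemma fourier_unit_shift (n : ℤ) (x : UnitAddCircle) (s : ℝ) :
    fourier n (x + (s : UnitAddCircle))
      = fourier n x * Complex.exp (Complex.I * ((2 * Real.pi * n * s : ℝ) : ℂ)) := by
  induction x using QuotientAddGroup.induction_on with
  | H t =>
    change fourier n (((t : ℝ) : UnitAddCircle) + (s : UnitAddCircle)) = fourier n ((t : ℝ) : UnitAddCircle) * _
    rw [← AddCircle.coe_add, fourier_coe_apply, fourier_coe_apply, ← Complex.exp_add]
    congr 1; push_cast; ring

lemma fourier_ang_shift (n : ℤ) (x : Ang) (s : ℝ) :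
    fourier n (x + (s : Ang))
      = fourier n x * Complex.exp (Complex.I * ((n * s : ℝ) : ℂ)) := by
  induction x using QuotientAddGroup.induction_on with
  | H t =>
    change fourier n (((t : ℝ) : Ang) + (s : Ang)) = fourier n ((t : ℝ) : Ang) * _
    rw [← AddCircle.coe_add, fourier_coe_apply, fourier_coe_apply, ← Complex.exp_add]
    congr 1; push_cast
    have : (Real.pi : ℂ) ≠ 0 := by exact_mod_cast Real.pi_ne_zero
    field_simp

lemma fourier_ang_apply (n : ℤ) (s : ℝ) :
    fourier n (s : Ang) = Complex.exp (Complex.I * ((n * s : ℝ) : ℂ)) := by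
  have := fourier_ang_shift n 0 s
  simpa using this

lemma posCover_isQuotientMap : Topology.IsQuotientMap posCover :=
  (IsOpenQuotientMap.piMap fun _ : Fin 2 =>
    (QuotientAddGroup.isOpenQuotientMap_mk (N := AddSubgroup.zmultiples (1 : ℝ)))).isQuotientMap

lemma mFourier_shift (ℓ : Fin 2 → ℤ) (x : Pos) (y : Fin 2 → ℝ) :
    UnitAddTorus.mFourier ℓ (x + posCover y) = UnitAddTorus.mFourier ℓ x *
      Complex.exp (Complex.I * ((∑ i, 2 * Real.pi * ℓ i * y i : ℝ) : ℂ)) := by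
  simp only [UnitAddTorus.mFourier, ContinuousMap.coe_mk, Fin.prod_univ_two, Fin.sum_univ_two,
    Pi.add_apply, posCover, fourier_unit_shift]
  push_cast
  rw [mul_add, Complex.exp_add]
  ring

/-- The characters of `𝕋₁²`. -/
def posFS : FourierSystem posCover (Fin 2 → ℤ) where
  cover_add y y' := by funext i; simp [posCover]
  quot := posCover_isQuotientMap
  freq n i := 2 * Real.pi * n i
  freq_injective a b h := by
    funext i
    have := congrFun h i
    have h2 : (2 * Real.pi) ≠ 0 := Real.two_pi_pos.ne'
    exact_mod_cast mul_left_cancel₀ h2 this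
  freq_neg n := by funext i; simp
  E := UnitAddTorus.mFourier
  E_shift n z y := mFourier_shift n z y
  E_neg n z := UnitAddTorus.mFourier_neg
  E_norm n z := by
    simp only [UnitAddTorus.mFourier, fourier_apply, ContinuousMap.coe_mk, norm_prod,
      Circle.norm_coe, Finset.prod_const_one]
  dense := UnitAddTorus.span_mFourier_closure_eq_top

/-- The characters of `𝕋₁² × 𝕋_{2π}`. -/
def phaseE (n : (Fin 2 → ℤ) × ℤ) : C(Phase, ℂ) where
  toFun z := UnitAddTorus.mFourier n.1 z.1 * fourier n.2 z.2
  continuous_toFun := by fun_prop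

lemma phaseE_apply (n : (Fin 2 → ℤ) × ℤ) (z : Phase) :
    phaseE n z = UnitAddTorus.mFourier n.1 z.1 * fourier n.2 z.2 := rfl

lemma phaseE_neg (n : (Fin 2 → ℤ) × ℤ) (z : Phase) : phaseE (-n) z = conj (phaseE n z) := by
  simp [phaseE_apply, UnitAddTorus.mFourier_neg]

lemma phaseE_add (m n : (Fin 2 → ℤ) × ℤ) : phaseE (m + n) = phaseE m * phaseE n := by
  ext z
  simp only [phaseE_apply, ContinuousMap.mul_apply, Prod.fst_add, Prod.snd_add,
    UnitAddTorus.mFourier_add, fourier_add]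
  ring

/-- The star subalgebra generated by the characters of the phase space. -/
def phaseSubalgebra : StarSubalgebra ℂ C(Phase, ℂ) where
  toSubalgebra := Algebra.adjoin ℂ (Set.range phaseE)
  star_mem' := by
    change Algebra.adjoin ℂ (Set.range phaseE) ≤ star (Algebra.adjoin ℂ (Set.range phaseE))
    refine Algebra.adjoin_le ?_
    rintro _ ⟨n, rfl⟩
    refine Algebra.subset_adjoin ⟨-n, ?_⟩
    ext1 x
    simp only [phaseE_neg, starRingEnd_apply, ContinuousMap.star_apply]

lemma phaseSubalgebra_coe :
    phaseSubalgebra.toSubalgebra.toSubmodule = Submodule.span ℂ (Set.range phaseE) := by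
  apply Algebra.adjoin_eq_span_of_subset
  refine .trans (fun x ↦ Submonoid.closure_induction (fun _ ↦ id) ⟨0, ?_⟩ ?_)
    Submodule.subset_span
  · ext z
    simp [phaseE_apply, UnitAddTorus.mFourier_zero]
  · rintro _ _ _ _ ⟨m, rfl⟩ ⟨n, rfl⟩
    exact ⟨m + n, phaseE_add m n⟩

lemma phaseSubalgebra_separatesPoints : phaseSubalgebra.SeparatesPoints := by
  intro x y hxy
  by_cases h2 : x.2 = y.2
  · have h1 : x.1 ≠ y.1 := fun h => hxy (Prod.ext h h2)
    obtain ⟨i, hi⟩ := Function.ne_iff.1 h1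
    refine ⟨_, ⟨phaseE (Pi.single i 1, 0), Algebra.subset_adjoin ⟨_, rfl⟩, rfl⟩, ?_⟩
    simp only [phaseE_apply, fourier_zero, mul_one]
    have := @UnitAddTorus.mFourier_single (Fin 2) _ _
    intro h
    erw [this, this] at h
    rw [fourier_one, fourier_one] at h
    exact hi (AddCircle.injective_toCircle one_ne_zero (Circle.coe_injective h))
  · refine ⟨_, ⟨phaseE (0, 1), Algebra.subset_adjoin ⟨_, rfl⟩, rfl⟩, ?_⟩
    simp only [phaseE_apply, UnitAddTorus.mFourier_zero, ContinuousMap.one_apply, one_mul,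
      fourier_one]
    exact fun h => h2 (AddCircle.injective_toCircle Real.two_pi_pos.ne' (Circle.coe_injective h))

/-- Stone–Weierstrass: products and conjugates of characters are characters, so their span is a star
algebra, and it separates points. -/
lemma phaseE_dense : (Submodule.span ℂ (Set.range phaseE)).topologicalClosure = ⊤ := by
  rw [← phaseSubalgebra_coe]
  exact congr_arg (Subalgebra.toSubmodule <| StarSubalgebra.toSubalgebra ·)
    (ContinuousMap.starSubalgebra_topologicalClosure_eq_top_of_separatesPoints _
      phaseSubalgebra_separatesPoints)

lemma phaseCover_fst (y : Fin 3 → ℝ) : (phaseCover y).1 = posCover ![y 0, y 1] := by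
  funext i
  fin_cases i <;> rfl

lemma phaseCover_isQuotientMap : Topology.IsQuotientMap phaseCover := by
  let h : (Fin 3 → ℝ) → (Fin 2 → ℝ) × ℝ := fun y => (![y 0, y 1], y 2)
  let h' : (Fin 2 → ℝ) × ℝ → (Fin 3 → ℝ) := fun p => ![p.1 0, p.1 1, p.2]
  have hh : Topology.IsQuotientMap h := by
    refine Topology.IsQuotientMap.of_inverse (f := h') ?_ ?_ ?_
    · refine continuous_pi fun i => ?_
      fin_cases i
      · exact ((continuous_apply 0).comp continuous_fst :
          Continuous fun a : (Fin 2 → ℝ) × ℝ => a.1 0)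
      · exact ((continuous_apply 1).comp continuous_fst :
          Continuous fun a : (Fin 2 → ℝ) × ℝ => a.1 1)
      · exact continuous_snd
    · refine Continuous.prodMk (continuous_pi fun i => ?_) (continuous_apply _)
      fin_cases i <;> exact continuous_apply _
    · intro p
      refine Prod.ext ?_ rfl
      funext i
      fin_cases i <;> rfl
  have h2 : IsOpenQuotientMap (Prod.map posCover (fun s : ℝ => (s : Ang))) :=
    (IsOpenQuotientMap.piMap fun _ : Fin 2 =>
      (QuotientAddGroup.isOpenQuotientMap_mk (N := AddSubgroup.zmultiples (1 : ℝ)))).prodMap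
      QuotientAddGroup.isOpenQuotientMap_mk
  have h3 := h2.isQuotientMap.comp hh
  convert h3 using 1
  funext y
  refine Prod.ext (phaseCover_fst y) rfl

lemma phaseCover_snd (y : Fin 3 → ℝ) : (phaseCover y).2 = (y 2 : Ang) := rfl

/-- The Fourier system of the phase space. -/
def phaseFS : FourierSystem phaseCover ((Fin 2 → ℤ) × ℤ) where
  cover_add y y' := by
    refine Prod.ext ?_ ?_
    · funext i; fin_cases i <;> simp [phaseCover]
    · simp [phaseCover]
  quot := phaseCover_isQuotientMap
  freq n := ![2 * Real.pi * n.1 0, 2 * Real.pi * n.1 1, n.2]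
  freq_injective a b h := by
    have h2 : (2 * Real.pi) ≠ 0 := Real.two_pi_pos.ne'
    have e0 := congrFun h 0
    have e1 := congrFun h 1
    have e2 := congrFun h 2
    simp only [Matrix.cons_val] at e0 e1 e2
    refine Prod.ext ?_ (by exact_mod_cast e2)
    funext i
    fin_cases i
    · exact_mod_cast mul_left_cancel₀ h2 e0
    · exact_mod_cast mul_left_cancel₀ h2 e1
  freq_neg n := by funext i; fin_cases i <;> simp
  E := phaseE
  E_shift n z y := by
    simp only [phaseE_apply, Prod.fst_add, Prod.snd_add, phaseCover_fst, phaseCover_snd,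
      mFourier_shift, fourier_ang_shift, Fin.sum_univ_two, Fin.sum_univ_three, Matrix.cons_val]
    push_cast
    simp only [mul_add, Complex.exp_add]
    ring
  E_neg n z := phaseE_neg n z
  E_norm n z := by
    simp only [phaseE_apply, UnitAddTorus.mFourier, fourier_apply, ContinuousMap.coe_mk, norm_prod,
      norm_mul, Circle.norm_coe, Finset.prod_const_one, mul_one]
  dense := phaseE_dense

@[simp] lemma phaseFS_E (n : (Fin 2 → ℤ) × ℤ) : phaseFS.E n = phaseE n := rfl
@[simp] lemma posFS_E (n : Fin 2 → ℤ) : posFS.E n = UnitAddTorus.mFourier n := rfl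
lemma posFS_freq (n : Fin 2 → ℤ) (i : Fin 2) : posFS.freq n i = 2 * Real.pi * n i := rfl
lemma phaseFS_freq (n : (Fin 2 → ℤ) × ℤ) (i : Fin 3) :
  phaseFS.freq n i = ![2 * Real.pi * n.1 0, 2 * Real.pi * n.1 1, n.2] i := rfl

end

end AntModel

/-! ### H² through Fourier coefficients, and the action of torus symmetries. -/

namespace AntModel

noncomputable section

open scoped ComplexConjugate

section SobolevSpace

variable {ι M : Type} [Fintype ι] [DecidableEq ι]
  [AddCommGroup M] [TopologicalSpace M] [CompactSpace M]
  [MeasureSpace M] [BorelSpace M] {e : (ι → ℝ) → M} {κ : Type} [Neg κ]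

/-- The components of the jet of a Sobolev function as continuous linear maps. -/
def jet (e : (ι → ℝ) → M) (j : Jet2 ι) : H2 e →L[ℝ] L2 M :=
  (PiLp.proj 2 (fun _ : Jet2 ι => L2 M) j).comp (H2 e).subtypeL

lemma jet_apply (j : Jet2 ι) (f : H2 e) : jet e j f = f.1 j := rfl

/-- The underlying `L²` function. -/
abbrev jet0 (e : (ι → ℝ) → M) : H2 e →L[ℝ] L2 M := jet e (.inl ())
/-- The first derivatives. -/
abbrev jet1 (e : (ι → ℝ) → M) (i : ι) : H2 e →L[ℝ] L2 M := jet e (.inr (.inl i))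
/-- The second derivatives. -/
abbrev jet2 (e : (ι → ℝ) → M) (i j : ι) : H2 e →L[ℝ] L2 M := jet e (.inr (.inr (i, j)))

lemma weak1 (f : H2 e) (i : ι) : IsWeakDeriv e i (jet0 e f) (jet1 e i f) := f.2.1 i
lemma weak2 (f : H2 e) (i j : ι) : IsWeakDeriv e j (jet1 e i f) (jet2 e i j f) := f.2.2 i j

lemma norm_jet_le (j : Jet2 ι) (f : H2 e) : ‖jet e j f‖ ≤ ‖f‖ := PiLp.norm_apply_le f.1 j

lemma H2_norm_sq (f : H2 e) : ‖f‖ ^ 2 = ∑ j, ‖jet e j f‖ ^ 2 :=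
  PiLp.norm_sq_eq_of_L2 (fun _ : Jet2 ι => L2 M) f.1

lemma H2_norm_le_sum (f : H2 e) : ‖f‖ ≤ ∑ j, ‖jet e j f‖ := by
  refine abs_le_of_sq_le_sq' ?_ (by positivity) |>.2
  rw [H2_norm_sq]
  exact Finset.sum_sq_le_sq_sum_of_nonneg fun _ _ => norm_nonneg _

/-- A Sobolev function from its jet. -/
def H2.mk' (w : Jet2 ι → L2 M) (h1 : ∀ i, IsWeakDeriv e i (w (.inl ())) (w (.inr (.inl i))))
    (h2 : ∀ i j, IsWeakDeriv e j (w (.inr (.inl i))) (w (.inr (.inr (i, j))))) : H2 e :=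
  ⟨WithLp.toLp 2 w, h1, h2⟩

@[simp] lemma jet_mk' (w : Jet2 ι → L2 M) (h1) (h2) (j : Jet2 ι) :
    jet e j (H2.mk' w h1 h2 : H2 e) = w j := rfl

lemma H2_ext_jet {f g : H2 e} (h : ∀ j, jet e j f = jet e j g) : f = g := by
  apply Subtype.ext
  ext1 j
  exact h j

section Measure

variable [IsTopologicalAddGroup M] [SecondCountableTopology M] [T2Space M]
  [Measure.IsAddLeftInvariant (volume : Measure M)] [IsFiniteMeasure (volume : Measure M)]
  [Measure.IsOpenPosMeasure (volume : Measure M)]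

lemma coef_jet1 (S : FourierSystem e κ) (f : H2 e) (i : ι) (n : κ) :
    S.coef (jet1 e i f) n = Complex.I * S.freq n i * S.coef (jet0 e f) n := (weak1 f i).coef S n

lemma coef_jet2 (S : FourierSystem e κ) (f : H2 e) (i j : ι) (n : κ) :
    S.coef (jet2 e i j f) n = -(S.freq n i * S.freq n j) * S.coef (jet0 e f) n := by
  rw [(weak2 f i j).coef S n, coef_jet1 S]
  linear_combination S.freq n i * S.freq n j * S.coef (jet0 e f) n * Complex.I_mul_I

lemma H2_ext (S : FourierSystem e κ) {f g : H2 e} (h : jet0 e f = jet0 e g) : f = g := by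
  apply H2_ext_jet
  rintro (⟨⟩ | i | ⟨i, j⟩)
  · exact h
  · exact S.coef_ext fun n => by rw [coef_jet1 S, coef_jet1 S, h]
  · exact S.coef_ext fun n => by rw [coef_jet2 S, coef_jet2 S, h]

/-- Each weak-derivative relation is a family of linear equations between Fourier coefficients,
which are continuous functionals on L². -/
lemma isClosed_H2 (S : FourierSystem e κ) :
    IsClosed (H2 e : Set (PiLp 2 (fun _ : Jet2 ι => L2 M))) := by
  have h : (H2 e : Set (PiLp 2 (fun _ : Jet2 ι => L2 M)))
      = (⋂ i, ⋂ n, {f | S.coefL n (f (.inr (.inl i)))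
          = Complex.I * S.freq n i * S.coefL n (f (.inl ()))}) ∩
        ⋂ i, ⋂ j, ⋂ n, {f | S.coefL n (f (.inr (.inr (i, j))))
          = Complex.I * S.freq n j * S.coefL n (f (.inr (.inl i)))} := by
    ext f
    simp only [Set.mem_inter_iff, Set.mem_iInter, Set.mem_ofPred_eq, FourierSystem.coefL_apply]
    change (∀ i, IsWeakDeriv e i _ _) ∧ (∀ i j, IsWeakDeriv e j _ _) ↔ _
    simp only [S.isWeakDeriv_iff]
  have hc : ∀ j : Jet2 ι, Continuous fun f : PiLp 2 (fun _ : Jet2 ι => L2 M) => f j := fun j =>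
    (PiLp.proj 2 (fun _ : Jet2 ι => L2 M) j : _ →L[ℝ] _).continuous
  rw [h]
  refine IsClosed.inter (isClosed_iInter fun i => isClosed_iInter fun n => ?_)
    (isClosed_iInter fun i => isClosed_iInter fun j => isClosed_iInter fun n => ?_)
  · exact isClosed_eq ((S.coefL n).continuous.comp (hc _))
      (continuous_const.mul ((S.coefL n).continuous.comp (hc _)))
  · exact isClosed_eq ((S.coefL n).continuous.comp (hc _))
      (continuous_const.mul ((S.coefL n).continuous.comp (hc _)))

lemma completeSpace_H2 (S : FourierSystem e κ) : CompleteSpace (H2 e) :=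
  (isClosed_H2 S).completeSpace_coe

/-- Fourier multipliers from `L²` to `H²`. -/
lemma exists_H2_multiplier (S : FourierSystem e κ) (m : κ → ℂ) (C : ℝ)
    (h0 : ∀ n, ‖m n‖ ≤ C) (h1 : ∀ n i, |S.freq n i| * ‖m n‖ ≤ C)
    (h2 : ∀ n i j, |S.freq n i| * |S.freq n j| * ‖m n‖ ≤ C)
    (hm : ∀ n, m (-n) = conj (m n)) (u : L2 M) :
    ∃ f : H2 e, ∀ n, S.coef (jet0 e f) n = m n * S.coef u n := by
  choose w0 hw0 using fun u => S.exists_multiplier m C h0 hm u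
  choose w1 hw1 using fun i => S.exists_multiplier (fun n => Complex.I * S.freq n i * m n) C
    (fun n => by simpa using h1 n i) (fun n => by simp [hm, S.freq_neg]) u
  choose w2 hw2 using fun i j => S.exists_multiplier
    (fun n => -(S.freq n i * S.freq n j) * m n) C
    (fun n => by simpa using h2 n i j) (fun n => by simp [hm, S.freq_neg]) u
  refine ⟨H2.mk' (fun j => match j with
    | .inl () => w0 u
    | .inr (.inl i) => w1 i
    | .inr (.inr (i, j)) => w2 i j) (fun i => S.isWeakDeriv_of_coef fun n => ?_)
    (fun i j => S.isWeakDeriv_of_coef fun n => ?_), fun n => hw0 u n⟩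
  · simp only [hw0, hw1]; ring
  · simp only [hw2, hw1]
    linear_combination (-(S.freq n i * S.freq n j) * m n * S.coef u n) * Complex.I_mul_I

/-- Bounded Fourier multipliers on `H²`. -/
lemma exists_H2_multiplier' (S : FourierSystem e κ) (m : κ → ℂ) (C : ℝ)
    (h0 : ∀ n, ‖m n‖ ≤ C) (hm : ∀ n, m (-n) = conj (m n)) (f : H2 e) :
    ∃ g : H2 e, ∀ n, S.coef (jet0 e g) n = m n * S.coef (jet0 e f) n := by
  choose w hw using fun u => S.exists_multiplier m C h0 hm u
  refine ⟨H2.mk' (fun j => w (jet e j f)) (fun i => S.isWeakDeriv_of_coef fun n => ?_)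
    (fun i j => S.isWeakDeriv_of_coef fun n => ?_), fun n => hw _ n⟩
  · simp only [hw]; rw [coef_jet1 S]; ring
  · simp only [hw]; rw [coef_jet1 S, coef_jet2 S]
    linear_combination (-(S.freq n i * S.freq n j) * m n * S.coef (jet0 e f) n) * Complex.I_mul_I

/-- A smooth function as an element of `H²`. -/
lemma exists_H2_of_isTest (S : FourierSystem e κ) {φ : M → ℝ} (hφ : IsTest e φ) :
    ∃ f : H2 e, jet0 e f =ᵐ[volume] φ := by
  let toL : ∀ ψ : M → ℝ, Continuous ψ → L2 M := fun ψ h => ContinuousMap.toLp 2 volume ℝ ⟨ψ, h⟩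
  have htoL : ∀ ψ h, toL ψ h =ᵐ[volume] ψ := fun ψ h => ContinuousMap.coeFn_toLp volume _
  have h1 := fun i => S.isTest_pderiv hφ i
  have h2 := fun i j => S.isTest_pderiv (h1 i) j
  exact ⟨H2.mk' (fun j => match j with
    | .inl () => toL φ hφ.2.1
    | .inr (.inl i) => toL (pderiv e i φ) (h1 i).2.1
    | .inr (.inr (i, j)) => toL (pderiv e j (pderiv e i φ)) (h2 i j).2.1)
    (fun i => isWeakDeriv_congr (htoL _ _).symm (htoL _ _).symm (S.isWeakDeriv_of_isTest hφ i))
    (fun i j => isWeakDeriv_congr (htoL _ _).symm (htoL _ _).symm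
      (S.isWeakDeriv_of_isTest (h1 i) j)), htoL _ _⟩

end Measure

end SobolevSpace

section Symmetry

variable {ι M : Type} [Fintype ι] [DecidableEq ι]
  [AddCommGroup M] [TopologicalSpace M] [CompactSpace M]
  [MeasureSpace M] [BorelSpace M]

/-- A measure preserving automorphism of a torus with a signed permutation matrix as its
derivative. -/
structure TorusSymm (e : (ι → ℝ) → M) where
  toFun : M → M
  inv : M → M
  left_inv : ∀ z, inv (toFun z) = z
  right_inv : ∀ z, toFun (inv z) = z
  cont : Continuous toFun
  mp : MeasurePreserving toFun volume volume
  lin : (ι → ℝ) →L[ℝ] (ι → ℝ)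
  inv_shift : ∀ w y, inv (w + e y) = inv w + e (lin y)
  perm : ι → ι
  sgn : ι → ℝ
  lin_single : ∀ i s, lin (Pi.single (perm i) s) = Pi.single i (sgn i * s)
  sgn_sq : ∀ i, sgn i * sgn i = 1

variable {e : (ι → ℝ) → M} {κ : Type} [Neg κ]

lemma TorusSymm.isTest_inv (T : TorusSymm e) (S : FourierSystem e κ) {φ : M → ℝ}
    (hφ : IsTest e φ) : IsTest e (fun w => φ (T.inv w)) := by
  apply S.isTest
  obtain ⟨y0, hy0⟩ := S.quot.surjective (T.inv 0)
  have : (fun y => φ (T.inv (e y))) = fun y => φ (e (y0 + T.lin y)) := by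
    funext y
    rw [← zero_add (e y), T.inv_shift, ← hy0, S.cover_add]
  rw [this]
  exact hφ.1.comp (contDiff_const.add T.lin.contDiff)

lemma TorusSymm.pderiv_inv (T : TorusSymm e) (S : FourierSystem e κ) {φ : M → ℝ}
    (hφ : IsTest e φ) (i : ι) (w : M) :
    pderiv e (T.perm i) (fun w => φ (T.inv w)) w = T.sgn i * pderiv e i φ (T.inv w) := by
  have h : (fun s : ℝ => φ (T.inv (w + e (Pi.single (T.perm i) s))))
      = fun s : ℝ => φ (T.inv w + e (Pi.single i (T.sgn i * s))) := by
    funext s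
    rw [T.inv_shift, T.lin_single]
  rw [pderiv, h]
  have h1 := S.hasDerivAt_pderiv_zero hφ.1 (T.inv w) i
  have h2 : HasDerivAt (fun s : ℝ => T.sgn i * s) (T.sgn i) 0 := by
    simpa using (hasDerivAt_id (0 : ℝ)).const_mul (T.sgn i)
  have h3 : HasDerivAt (fun s : ℝ => φ (T.inv w + e (Pi.single i s)))
      (pderiv e i φ (T.inv w)) (T.sgn i * 0) := by simpa using h1
  have h4 := (h3.comp (0 : ℝ) h2).deriv
  rw [Function.comp_def] at h4
  rw [h4, mul_comm]

lemma TorusSymm.integral_comp (T : TorusSymm e) {u : M → ℝ} (hu : AEStronglyMeasurable u volume) :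
    ∫ z, u (T.toFun z) = ∫ z, u z := by
  rw [← T.mp.map_eq] at hu
  have h := integral_map T.mp.measurable.aemeasurable hu
  rw [T.mp.map_eq] at h
  exact h.symm

/-- Change of variables: composing a test function with the inverse gives a test function whose
derivative in direction `perm i` is `sgn i` times the old i-th derivative; `sgn i` squares to 1 and
can be moved across. -/
lemma TorusSymm.isWeakDeriv (T : TorusSymm e) (S : FourierSystem e κ) {i : ι} {u g : M → ℝ}
    (h : IsWeakDeriv e (T.perm i) u g) :
    IsWeakDeriv e i (fun z => u (T.toFun z)) (fun z => T.sgn i * g (T.toFun z)) := by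
  have hu : Integrable fun z => u (T.toFun z) := T.mp.integrable_comp_of_integrable h.1
  have hg : Integrable fun z => g (T.toFun z) := T.mp.integrable_comp_of_integrable h.2.1
  refine ⟨hu, hg.const_mul _, fun φ hφ => ?_⟩
  have ht := T.isTest_inv S hφ
  have h1 := h.2.2 _ ht
  simp only [T.pderiv_inv S hφ] at h1
  have e1 : ∫ z, u (T.toFun z) * pderiv e i φ z
      = T.sgn i * ∫ z, u z * (T.sgn i * pderiv e i φ (T.inv z)) := by
    rw [← T.integral_comp (u := fun z => u z * (T.sgn i * pderiv e i φ (T.inv z))),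
      ← integral_const_mul]
    · congr 1; funext z; simp only [T.left_inv]
      linear_combination (-(u (T.toFun z) * pderiv e i φ z)) * T.sgn_sq i
    · have := (ht.2.2 (T.perm i))
      simp only [funext (T.pderiv_inv S hφ i)] at this
      exact (integrable_mul_continuous h.1 this).aestronglyMeasurable
  have e2 : ∫ z, T.sgn i * g (T.toFun z) * φ z = T.sgn i * ∫ z, g z * φ (T.inv z) := by
    rw [← T.integral_comp (u := fun z => g z * φ (T.inv z)), ← integral_const_mul]
    · congr 1; funext z; simp only [T.left_inv]; ring
    · exact (integrable_mul_continuous h.2.1 ht.2.1).aestronglyMeasurable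
  rw [e1, e2, h1]; ring

/-- Pull-back on `L²`. -/
def TorusSymm.pull (T : TorusSymm e) : L2 M →L[ℝ] L2 M :=
  (Lp.compMeasurePreservingₗᵢ ℝ T.toFun T.mp).toContinuousLinearMap

lemma TorusSymm.coeFn_pull (T : TorusSymm e) (u : L2 M) :
    T.pull u =ᵐ[volume] fun z => u (T.toFun z) := Lp.coeFn_compMeasurePreserving u T.mp

/-- The components of the pull-back of a jet. -/
def TorusSymm.jetPull (T : TorusSymm e) (f : H2 e) : Jet2 ι → L2 M
  | .inl () => T.pull (jet0 e f)
  | .inr (.inl i) => T.sgn i • T.pull (jet1 e (T.perm i) f)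
  | .inr (.inr (i, j)) => (T.sgn i * T.sgn j) • T.pull (jet2 e (T.perm i) (T.perm j) f)

lemma TorusSymm.coeFn_smul_pull (T : TorusSymm e) (c : ℝ) (u : L2 M) :
    (c • T.pull u : L2 M) =ᵐ[volume] fun z => c * u (T.toFun z) := by
  filter_upwards [Lp.coeFn_smul c (T.pull u), T.coeFn_pull u] with z h1 h2
  rw [h1, Pi.smul_apply, h2, smul_eq_mul]

/-- Pull-back on `H²`. -/
def TorusSymm.pullH2 (T : TorusSymm e) (S : FourierSystem e κ) : H2 e →L[ℝ] H2 e where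
  toFun f := H2.mk' (T.jetPull f)
    (fun i => isWeakDeriv_congr (T.coeFn_pull _).symm (T.coeFn_smul_pull _ _).symm
      (T.isWeakDeriv S (weak1 f (T.perm i))))
    (fun i j => isWeakDeriv_congr (T.coeFn_smul_pull _ _).symm (T.coeFn_smul_pull _ _).symm (by
      have := isWeakDeriv_smul (T.sgn i) (T.isWeakDeriv S (weak2 f (T.perm i) (T.perm j)))
      have h2 : (fun z => (T.sgn i * T.sgn j) * jet2 e (T.perm i) (T.perm j) f (T.toFun z))
          = T.sgn i • fun z => T.sgn j * jet2 e (T.perm i) (T.perm j) f (T.toFun z) := by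
        funext z
        rw [Pi.smul_apply, smul_eq_mul, mul_assoc]
      rw [h2]
      exact this))
  map_add' f g := by
    apply H2_ext_jet
    rintro (⟨⟩ | i | ⟨i, j⟩) <;> simp only [jet_mk', TorusSymm.jetPull, map_add, smul_add]
  map_smul' c f := by
    apply H2_ext_jet
    rintro (⟨⟩ | i | ⟨i, j⟩)
    · simp only [jet_mk', TorusSymm.jetPull, map_smul, RingHom.id_apply]
    · simp only [jet_mk', TorusSymm.jetPull, map_smul, RingHom.id_apply]
      exact smul_comm _ _ _
    · simp only [jet_mk', TorusSymm.jetPull, map_smul, RingHom.id_apply]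
      exact smul_comm _ _ _
  cont := by
    refine Continuous.subtype_mk ((PiLp.continuous_toLp 2 _).comp (continuous_pi ?_)) _
    rintro (⟨⟩ | i | ⟨i, j⟩)
    · exact T.pull.continuous.comp (jet0 e).continuous
    · exact (T.sgn i • T.pull.comp (jet1 e (T.perm i))).continuous
    · exact ((T.sgn i * T.sgn j) • T.pull.comp (jet2 e (T.perm i) (T.perm j))).continuous

@[simp] lemma TorusSymm.jet0_pullH2 (T : TorusSymm e) (S : FourierSystem e κ) (f : H2 e) :
    jet0 e (T.pullH2 S f) = T.pull (jet0 e f) := rfl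
@[simp] lemma TorusSymm.jet1_pullH2 (T : TorusSymm e) (S : FourierSystem e κ) (i : ι) (f : H2 e) :
    jet1 e i (T.pullH2 S f) = T.sgn i • T.pull (jet1 e (T.perm i) f) := rfl
@[simp] lemma TorusSymm.jet2_pullH2 (T : TorusSymm e) (S : FourierSystem e κ) (i j : ι)
    (f : H2 e) : jet2 e i j (T.pullH2 S f)
      = (T.sgn i * T.sgn j) • T.pull (jet2 e (T.perm i) (T.perm j) f) := rfl

end Symmetry

end

end AntModel

/-! ### Symmetries of the phase space; the spaces X and Z as closed subspaces. -/

namespace AntModel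

noncomputable section

/-- A symmetry of the angular circle. -/
structure AngSymm where
  toFun : Ang → Ang
  inv : Ang → Ang
  left_inv : ∀ z, inv (toFun z) = z
  right_inv : ∀ z, toFun (inv z) = z
  cont : Continuous toFun
  mp : MeasurePreserving toFun volume volume
  sgn : ℝ
  inv_shift : ∀ w (s : ℝ), inv (w + (s : Ang)) = inv w + ((sgn * s : ℝ) : Ang)
  sgn_sq : sgn * sgn = 1

/-- A symmetry of the phase space under which `v_θ` and `v_θ^⊥` are equivariant. -/
structure PhaseSymm where
  pos : TorusSymm posCover
  ang : AngSymm
  perm_bij : Function.Bijective pos.perm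
  v_ang : ∀ θ i, v (ang.toFun θ) (pos.perm i) = pos.sgn i * v θ i
  vPerp_ang : ∀ θ i, vPerp (ang.toFun θ) (pos.perm i) = ang.sgn * (pos.sgn i * vPerp θ i)

/-- The linear part of a symmetry of the phase space. -/
def PhaseSymm.lin (T : PhaseSymm) : (Fin 3 → ℝ) →L[ℝ] (Fin 3 → ℝ) :=
  LinearMap.toContinuousLinearMap
    { toFun := fun y => ![T.pos.lin ![y 0, y 1] 0, T.pos.lin ![y 0, y 1] 1, T.ang.sgn * y 2]
      map_add' := fun y y' => by
        have : (![(y + y') 0, (y + y') 1] : Fin 2 → ℝ) = ![y 0, y 1] + ![y' 0, y' 1] := by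
          funext i; fin_cases i <;> rfl
        rw [this, map_add]
        funext i
        fin_cases i <;> simp [mul_add]
      map_smul' := fun c y => by
        have : (![(c • y) 0, (c • y) 1] : Fin 2 → ℝ) = c • ![y 0, y 1] := by
          funext i; fin_cases i <;> rfl
        rw [this, map_smul]
        funext i
        fin_cases i <;> simp [mul_left_comm] }

lemma PhaseSymm.lin_apply (T : PhaseSymm) (y : Fin 3 → ℝ) :
    T.lin y = ![T.pos.lin ![y 0, y 1] 0, T.pos.lin ![y 0, y 1] 1, T.ang.sgn * y 2] := rfl

lemma PhaseSymm.lin_castSucc (T : PhaseSymm) (i j : Fin 2) (hi : T.pos.perm i = j) (s : ℝ) :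
    T.lin (Pi.single j.castSucc s) = Pi.single i.castSucc (T.pos.sgn i * s) := by
  have h1 : (![(Pi.single j.castSucc s : Fin 3 → ℝ) 0, (Pi.single j.castSucc s : Fin 3 → ℝ) 1] :
      Fin 2 → ℝ) = Pi.single j s := by
    funext k
    fin_cases j <;> fin_cases k <;> simp
  have h2 : (Pi.single j.castSucc s : Fin 3 → ℝ) 2 = 0 := by
    fin_cases j <;> simp
  rw [T.lin_apply, h1, h2, ← hi, T.pos.lin_single]
  funext k
  fin_cases i <;> fin_cases k <;> simp

/-- The symmetry as a symmetry of the torus. -/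
def PhaseSymm.torus (T : PhaseSymm) : TorusSymm phaseCover where
  toFun z := (T.pos.toFun z.1, T.ang.toFun z.2)
  inv z := (T.pos.inv z.1, T.ang.inv z.2)
  left_inv z := by simp [T.pos.left_inv, T.ang.left_inv]
  right_inv z := by simp [T.pos.right_inv, T.ang.right_inv]
  cont := T.pos.cont.prodMap T.ang.cont
  mp := T.pos.mp.prod T.ang.mp
  lin := T.lin
  inv_shift w y := by
    refine Prod.ext ?_ ?_
    · simp only [Prod.fst_add, phaseCover_fst, T.pos.inv_shift, T.lin_apply]
      congr 2
      funext i; fin_cases i <;> rfl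
    · simp only [Prod.snd_add, phaseCover_snd, T.ang.inv_shift, T.lin_apply]
      rfl
  perm := ![(T.pos.perm 0).castSucc, (T.pos.perm 1).castSucc, 2]
  sgn := ![T.pos.sgn 0, T.pos.sgn 1, T.ang.sgn]
  lin_single i s := by
    fin_cases i
    · exact T.lin_castSucc 0 _ rfl s
    · exact T.lin_castSucc 1 _ rfl s
    · change T.lin (Pi.single 2 s) = Pi.single 2 (T.ang.sgn * s)
      rw [T.lin_apply]
      have : (![(Pi.single 2 s : Fin 3 → ℝ) 0, (Pi.single 2 s : Fin 3 → ℝ) 1] :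
          Fin 2 → ℝ) = 0 := by funext k; fin_cases k <;> simp
      rw [this, map_zero]
      funext k; fin_cases k <;> simp
  sgn_sq i := by
    fin_cases i
    · exact T.pos.sgn_sq 0
    · exact T.pos.sgn_sq 1
    · exact T.ang.sgn_sq

lemma PhaseSymm.torus_apply (T : PhaseSymm) (z : Phase) :
    T.torus.toFun z = (T.pos.toFun z.1, T.ang.toFun z.2) := rfl

lemma cosA_coe (s : ℝ) : cosA (s : Ang) = Real.cos s := rfl
lemma sinA_coe (s : ℝ) : sinA (s : Ang) = Real.sin s := rfl

lemma continuous_cosA : Continuous cosA :=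
  continuous_quot_lift _ Real.continuous_cos
lemma continuous_sinA : Continuous sinA :=
  continuous_quot_lift _ Real.continuous_sin

lemma ang_induction {P : Ang → Prop} (h : ∀ s : ℝ, P (s : Ang)) (θ : Ang) : P θ :=
  QuotientAddGroup.induction_on θ h

lemma cosA_add_pi (θ : Ang) : cosA (θ + ((Real.pi : ℝ) : Ang)) = -cosA θ := by
  induction θ using ang_induction with
  | h s => rw [← AddCircle.coe_add, cosA_coe, cosA_coe, Real.cos_add_pi]

lemma sinA_add_pi (θ : Ang) : sinA (θ + ((Real.pi : ℝ) : Ang)) = -sinA θ := by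
  induction θ using ang_induction with
  | h s => rw [← AddCircle.coe_add, sinA_coe, sinA_coe, Real.sin_add_pi]

lemma cosA_pi_div_two_sub (θ : Ang) : cosA (((Real.pi / 2 : ℝ) : Ang) - θ) = sinA θ := by
  induction θ using ang_induction with
  | h s => rw [← AddCircle.coe_sub, cosA_coe, sinA_coe, Real.cos_pi_div_two_sub]

lemma sinA_pi_div_two_sub (θ : Ang) : sinA (((Real.pi / 2 : ℝ) : Ang) - θ) = cosA θ := by
  induction θ using ang_induction with
  | h s => rw [← AddCircle.coe_sub, cosA_coe, sinA_coe, Real.sin_pi_div_two_sub]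

/-- The point reflection of the position torus. -/
def posNeg : TorusSymm posCover where
  toFun x := -x
  inv x := -x
  left_inv := neg_neg
  right_inv := neg_neg
  cont := continuous_neg
  mp := volume_preserving_pi (α' := fun _ : Fin 2 => UnitAddCircle)
      (β' := fun _ : Fin 2 => UnitAddCircle) (f := fun _ x => -x)
      (fun _ => Measure.measurePreserving_neg (volume : Measure UnitAddCircle))
  lin := -ContinuousLinearMap.id ℝ _
  inv_shift w y := by
    funext i
    change -(w i + (y i : UnitAddCircle)) = -w i + ((-(y i) : ℝ) : UnitAddCircle)
    rw [AddCircle.coe_neg, neg_add]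
  perm := id
  sgn _ := -1
  lin_single i s := by simp [← Pi.single_neg]
  sgn_sq _ := by norm_num

/-- The coordinate swap of the position torus. -/
def posSwap : TorusSymm posCover where
  toFun x i := x (Equiv.swap 0 1 i)
  inv x i := x (Equiv.swap 0 1 i)
  left_inv x := by funext i; simp
  right_inv x := by funext i; simp
  cont := continuous_pi fun i => continuous_apply _
  mp := by
    have h := volume_measurePreserving_piCongrLeft (fun _ : Fin 2 => UnitAddCircle)
      (Equiv.swap (0 : Fin 2) 1)
    convert h using 1
    funext x i
    have := MeasurableEquiv.piCongrLeft_apply_apply (β := fun _ : Fin 2 => UnitAddCircle)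
      (Equiv.swap (0 : Fin 2) 1) x (Equiv.swap 0 1 i)
    rw [Equiv.swap_apply_self] at this
    exact this.symm
  lin := ContinuousLinearMap.pi fun i => ContinuousLinearMap.proj (Equiv.swap 0 1 i)
  inv_shift w y := by
    funext i
    simp [posCover]
  perm := Equiv.swap 0 1
  sgn _ := 1
  lin_single i s := by
    funext j
    fin_cases i <;> fin_cases j <;> simp
  sgn_sq _ := by norm_num

/-- The translations of the second position variable. -/
def posShift (t : ℝ) : TorusSymm posCover where
  toFun x := x + posCover ![0, t]
  inv x := x - posCover ![0, t]
  left_inv x := by simp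
  right_inv x := by simp
  cont := continuous_add_const _
  mp := measurePreserving_add_right volume _
  lin := ContinuousLinearMap.id ℝ _
  inv_shift w y := by simp [sub_add_eq_add_sub]
  perm := id
  sgn _ := 1
  lin_single i s := by simp
  sgn_sq _ := by norm_num

/-- The rotation of the angular circle by `π`. -/
def angHalf : AngSymm where
  toFun θ := θ + ((Real.pi : ℝ) : Ang)
  inv θ := θ - ((Real.pi : ℝ) : Ang)
  left_inv x := by simp
  right_inv x := by simp
  cont := continuous_add_const _
  mp := measurePreserving_add_right volume _
  sgn := 1
  inv_shift w s := by simp [sub_add_eq_add_sub]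
  sgn_sq := by norm_num

/-- The reflection `θ ↦ π/2 - θ`. -/
def angSwap : AngSymm where
  toFun θ := ((Real.pi / 2 : ℝ) : Ang) - θ
  inv θ := ((Real.pi / 2 : ℝ) : Ang) - θ
  left_inv x := by simp
  right_inv x := by simp
  cont := by fun_prop
  mp := Measure.measurePreserving_sub_left volume _
  sgn := -1
  inv_shift w s := by simp only [neg_one_mul, AddCircle.coe_neg]; abel
  sgn_sq := by norm_num

/-- The identity of the angular circle. -/
def angId : AngSymm where
  toFun θ := θ
  inv θ := θ
  left_inv _ := rfl
  right_inv _ := rfl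
  cont := continuous_id
  mp := MeasurePreserving.id _
  sgn := 1
  inv_shift w s := by simp
  sgn_sq := by norm_num

/-- The antipodal symmetry. -/
def symmAntipode : PhaseSymm where
  pos := posNeg
  ang := angHalf
  perm_bij := Function.bijective_id
  v_ang θ i := by
    fin_cases i <;> simp [v, posNeg, angHalf, cosA_add_pi, sinA_add_pi]
  vPerp_ang θ i := by
    fin_cases i <;> simp [vPerp, posNeg, angHalf, cosA_add_pi, sinA_add_pi]

/-- The symmetry exchanging the two position variables. -/
def symmSwap : PhaseSymm where
  pos := posSwap
  ang := angSwap
  perm_bij := (Equiv.swap 0 1).bijective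
  v_ang θ i := by
    fin_cases i <;> simp [v, posSwap, angSwap, cosA_pi_div_two_sub, sinA_pi_div_two_sub]
  vPerp_ang θ i := by
    fin_cases i <;> simp [vPerp, posSwap, angSwap, cosA_pi_div_two_sub, sinA_pi_div_two_sub]

/-- The translation of the second position variable. -/
def symmShift (t : ℝ) : PhaseSymm where
  pos := posShift t
  ang := angId
  perm_bij := Function.bijective_id
  v_ang θ i := by simp [posShift, angId]
  vPerp_ang θ i := by simp [posShift, angId]

lemma symmAntipode_toFun (z : Phase) : symmAntipode.torus.toFun z = antipode z := rfl

/-! ### The spaces `X` and `Z` -/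

/-- The pull-back by the antipodal map. -/
abbrev antiPull : L2 Phase →L[ℝ] L2 Phase := symmAntipode.torus.pull

/-- The space `Z` of antipodal even functions in `L²` with zero average. -/
def Zsp : Submodule ℝ (L2 Phase) :=
  LinearMap.ker (phaseFS.coefL 0 : L2 Phase →L[ℝ] ℂ).toLinearMap ⊓
    LinearMap.ker (antiPull - ContinuousLinearMap.id ℝ _).toLinearMap

lemma coef_zero_eq (u : Phase → ℝ) : phaseFS.coef u 0 = ((∫ z, u z : ℝ) : ℂ) := by
  rw [FourierSystem.coef, ← integral_complex_ofReal]
  congr 1; funext z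
  simp [phaseE_apply, UnitAddTorus.mFourier_zero]

lemma mem_Zsp {u : L2 Phase} : u ∈ Zsp ↔ phaseFS.coef u 0 = 0 ∧ antiPull u = u := by
  simp [Zsp, sub_eq_zero]

lemma antiPull_eq_iff {u : L2 Phase} :
    antiPull u = u ↔ (fun z => u (antipode z)) =ᵐ[volume] u := by
  have h := symmAntipode.torus.coeFn_pull u
  constructor
  · intro h2
    rw [show symmAntipode.torus.pull u = u from h2] at h
    exact h.symm
  · intro h2
    exact Lp.ext (h.trans h2)

lemma mem_X_iff {f : H2 phaseCover} : f ∈ X ↔ jet0 phaseCover f ∈ Zsp := by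
  rw [mem_Zsp, coef_zero_eq, antiPull_eq_iff, Complex.ofReal_eq_zero]
  rfl

lemma isClosed_Zsp : IsClosed (Zsp : Set (L2 Phase)) := by
  rw [Zsp, Submodule.coe_inf]
  exact (ContinuousLinearMap.isClosed_ker _).inter (ContinuousLinearMap.isClosed_ker _)

instance completeSpace_Zsp : CompleteSpace Zsp := isClosed_Zsp.completeSpace_coe

instance completeSpace_H2_phase : CompleteSpace (H2 phaseCover) := completeSpace_H2 phaseFS

lemma isClosed_X : IsClosed (X : Set (H2 phaseCover)) := by
  have : (X : Set (H2 phaseCover)) = jet0 phaseCover ⁻¹' Zsp := by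
    ext f; exact mem_X_iff
  rw [this]
  exact isClosed_Zsp.preimage (jet0 phaseCover).continuous

instance completeSpace_X : CompleteSpace X := isClosed_X.completeSpace_coe

end

end AntModel

/-! ### The density, the chemical field and its continuity up to second derivatives. -/

namespace AntModel

noncomputable section

open scoped ComplexConjugate

section Density

/-- Cauchy–Schwarz against the constant 1, from ∫ (m f − s)² ≥ 0 with m the total mass and s the
integral of f. -/
lemma integral_sq_le_of_memLp {α : Type} [MeasurableSpace α] {μ : Measure α} [IsFiniteMeasure μ]
    {f : α → ℝ} (hf : MemLp f 2 μ) : (∫ a, f a ∂μ) ^ 2 ≤ μ.real Set.univ * ∫ a, f a ^ 2 ∂μ := by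
  have h1 : Integrable f μ := hf.integrable one_le_two
  have h2 : Integrable (fun a => f a ^ 2) μ := hf.integrable_sq
  set m := μ.real Set.univ
  set s := ∫ a, f a ∂μ
  have h3 : 0 ≤ ∫ a, (m * f a - s) ^ 2 ∂μ := integral_nonneg fun a => sq_nonneg _
  have h4 : ∫ a, (m * f a - s) ^ 2 ∂μ = m ^ 2 * ∫ a, f a ^ 2 ∂μ - 2 * m * s * s + m * s ^ 2 := by
    have : (fun a => (m * f a - s) ^ 2)
        = fun a => (m ^ 2 * f a ^ 2 - 2 * m * s * f a) + s ^ 2 := by funext a; ring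
    have i1 : Integrable (fun a => m ^ 2 * f a ^ 2) μ := h2.const_mul _
    have i2 : Integrable (fun a => 2 * m * s * f a) μ := h1.const_mul _
    have i3 : Integrable (fun a => m ^ 2 * f a ^ 2 - 2 * m * s * f a) μ := i1.sub i2
    rw [this, integral_add i3 (integrable_const _), integral_sub i1 i2, integral_const_mul,
      integral_const_mul, integral_const, smul_eq_mul]
  have hm : 0 ≤ m := measureReal_nonneg
  rcases hm.eq_or_lt with h0 | h0
  · have : μ = 0 := by
      rw [← Measure.measure_univ_eq_zero]
      exact (measureReal_eq_zero_iff (measure_ne_top _ _)).1 h0.symm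
    simp [s, this]
  · rw [h4] at h3
    have : 0 ≤ m * (m * (∫ a, f a ^ 2 ∂μ) - s ^ 2) := by linarith
    have := nonneg_of_mul_nonneg_right this h0
    linarith

lemma memLp_density (u : L2 Phase) :
    MemLp (fun x : Pos => ∫ θ : Ang, u (x, θ)) 2 (volume : Measure Pos) := by
  have hu : Integrable (fun z : Pos × Ang => u z) ((volume : Measure Pos).prod volume) :=
    integrable_L2 u
  have hu2 : Integrable (fun z : Pos × Ang => u z ^ 2) ((volume : Measure Pos).prod volume) :=
    (Lp.memLp u).integrable_sq
  have hm := hu.integral_prod_left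
  rw [memLp_two_iff_integrable_sq hm.aestronglyMeasurable]
  refine (hu2.integral_prod_left.const_mul ((volume : Measure Ang).real Set.univ)).mono'
    (hm.aestronglyMeasurable.pow 2) ?_
  filter_upwards [hu.prod_right_ae, hu2.prod_right_ae] with x h1 h2
  rw [Real.norm_of_nonneg (sq_nonneg _)]
  exact integral_sq_le_of_memLp ((memLp_two_iff_integrable_sq h1.aestronglyMeasurable).2 h2)

/-- The density `∫ u dθ`. -/
def dens (u : L2 Phase) : L2 Pos := (memLp_density u).toLp _

lemma coeFn_dens (u : L2 Phase) : dens u =ᵐ[volume] fun x => ∫ θ : Ang, u (x, θ) :=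
  MemLp.coeFn_toLp _

/-- Fubini: the character with indices (ℓ, 0) does not depend on the angle. -/
lemma coef_dens (u : L2 Phase) (ℓ : Fin 2 → ℤ) :
    posFS.coef (dens u) ℓ = phaseFS.coef u (ℓ, 0) := by
  rw [posFS.coef_congr (coeFn_dens u), FourierSystem.coef, FourierSystem.coef]
  have hi : Integrable (fun z : Pos × Ang => (u z : ℂ) * conj (phaseFS.E (ℓ, 0) z))
      ((volume : Measure Pos).prod volume) :=
    integrable_ofReal_mul_continuous (integrable_L2 u)
      (Complex.continuous_conj.comp (phaseFS.E (ℓ, 0)).continuous)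
  have h := integral_prod _ hi
  refine Eq.trans ?_ h.symm
  congr 1
  funext x
  simp only [phaseFS_E, phaseE_apply, fourier_zero, mul_one, posFS_E]
  rw [integral_mul_const, integral_complex_ofReal]

end Density

section Chem

/-- The multiplier of `γ - σ_c Δ`. -/
def chemSymb (p : Params) (ℓ : Fin 2 → ℤ) : ℝ := p.gam + 4 * Real.pi ^ 2 * normSqZ ℓ * p.sigC

lemma normSqZ_nonneg (ℓ : Fin 2 → ℤ) : 0 ≤ normSqZ ℓ := by
  rw [normSqZ]; positivity

lemma chemSymb_pos {p : Params} (hg : 0 < p.gam) (hc : 0 < p.sigC) (ℓ : Fin 2 → ℤ) :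
    0 < chemSymb p ℓ := by
  have := normSqZ_nonneg ℓ
  rw [chemSymb]; positivity

lemma normSqZ_eq (ℓ : Fin 2 → ℤ) : normSqZ ℓ = (ℓ 0 : ℝ) ^ 2 + (ℓ 1 : ℝ) ^ 2 := by
  simp [normSqZ, Fin.sum_univ_two]

lemma normSqZ_neg (ℓ : Fin 2 → ℤ) : normSqZ (-ℓ) = normSqZ ℓ := by
  simp [normSqZ_eq]

lemma chemSymb_neg (p : Params) (ℓ : Fin 2 → ℤ) : chemSymb p (-ℓ) = chemSymb p ℓ := by
  simp [chemSymb, normSqZ_neg]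

lemma isChem_iff_dens {p : Params} {f : H2 phaseCover} {c : H2 posCover} :
    IsChem p f c ↔ p.gam • jet0 posCover c
      - p.sigC • (jet2 posCover 0 0 c + jet2 posCover 1 1 c) = dens (jet0 phaseCover f) := by
  have ha : (p.gam • jet0 posCover c - p.sigC • (jet2 posCover 0 0 c + jet2 posCover 1 1 c) :
      L2 Pos) =ᵐ[volume] fun x => p.gam * fn c x - p.sigC * (d2 c 0 0 x + d2 c 1 1 x) := by
    filter_upwards [Lp.coeFn_sub (p.gam • jet0 posCover c)
        (p.sigC • (jet2 posCover 0 0 c + jet2 posCover 1 1 c)),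
      Lp.coeFn_smul p.gam (jet0 posCover c),
      Lp.coeFn_smul p.sigC (jet2 posCover 0 0 c + jet2 posCover 1 1 c),
      Lp.coeFn_add (jet2 posCover 0 0 c) (jet2 posCover 1 1 c)] with x h1 h2 h3 h4
    rw [h1, Pi.sub_apply, h2, h3, Pi.smul_apply, Pi.smul_apply, h4]
    rfl
  constructor
  · intro h
    exact Lp.ext (ha.trans (h.trans (coeFn_dens _).symm))
  · intro h
    rw [h] at ha
    exact ha.symm.trans (coeFn_dens _)

lemma isChem_iff {p : Params} {f : H2 phaseCover} {c : H2 posCover} :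
    IsChem p f c ↔ ∀ ℓ, (chemSymb p ℓ : ℂ) * posFS.coef (jet0 posCover c) ℓ
      = phaseFS.coef (jet0 phaseCover f) (ℓ, 0) := by
  rw [isChem_iff_dens]
  have h2 : ∀ ℓ, posFS.coef (p.gam • jet0 posCover c
      - p.sigC • (jet2 posCover 0 0 c + jet2 posCover 1 1 c) : L2 Pos) ℓ
      = (chemSymb p ℓ : ℂ) * posFS.coef (jet0 posCover c) ℓ := by
    intro ℓ
    rw [posFS.coef_sub, posFS.coef_smul, posFS.coef_smul, posFS.coef_add, coef_jet2 posFS,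
      coef_jet2 posFS]
    simp only [posFS_freq, chemSymb, normSqZ_eq]
    push_cast
    ring
  constructor
  · intro h ℓ
    rw [← h2, h, coef_dens]
  · intro h
    exact posFS.coef_ext fun ℓ => by rw [h2, h, coef_dens]

/-- Since |w| ≤ 1 + w² and (g⁻¹ + c⁻¹)(g + sc) ≥ 1 + s. The same constant serves for symbols of
order 0, 1 and 2 and does not depend on ℓ, so that 1/(g + sc) is a multiplier from L² to H². -/
lemma abs_freq_mul_le {g c w s : ℝ} (hg : 0 < g) (hc : 0 < c) (h : w ^ 2 ≤ s) :
    |w| * (g + s * c)⁻¹ ≤ g⁻¹ + c⁻¹ := by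
  have hs : 0 ≤ s := (sq_nonneg _).trans h
  have h1 : |w| ≤ 1 + s := by
    have := sq_abs w
    nlinarith [sq_nonneg (|w| - 1)]
  rw [← div_eq_mul_inv, div_le_iff₀ (by positivity)]
  have : (g⁻¹ + c⁻¹) * (g + s * c) = 1 + s + (s * c * g⁻¹ + g * c⁻¹) := by field_simp; ring
  rw [this]
  have : 0 ≤ s * c * g⁻¹ + g * c⁻¹ := by positivity
  linarith

lemma inv_symb_le {g c s : ℝ} (hg : 0 < g) (hc : 0 < c) (hs : 0 ≤ s) :
    (g + s * c)⁻¹ ≤ g⁻¹ + c⁻¹ := by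
  have h1 : (g + s * c)⁻¹ ≤ g⁻¹ := by
    apply inv_anti₀ hg
    have : 0 ≤ s * c := by positivity
    linarith
  have : 0 < c⁻¹ := by positivity
  linarith

lemma abs_freq_mul_freq_le {g c w w' s : ℝ} (hg : 0 < g) (hc : 0 < c)
    (h : w ^ 2 ≤ s) (h' : w' ^ 2 ≤ s) : |w| * |w'| * (g + s * c)⁻¹ ≤ g⁻¹ + c⁻¹ := by
  have hs : 0 ≤ s := (sq_nonneg _).trans h
  have h1 : |w| * |w'| ≤ s := by
    have h1 := sq_abs w
    have h2 := sq_abs w'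
    nlinarith [sq_nonneg (|w| - |w'|)]
  rw [← div_eq_mul_inv, div_le_iff₀ (by positivity)]
  have : (g⁻¹ + c⁻¹) * (g + s * c) = 1 + s + (s * c * g⁻¹ + g * c⁻¹) := by field_simp; ring
  rw [this]
  have : 0 ≤ s * c * g⁻¹ + g * c⁻¹ := by positivity
  linarith

lemma posFS_freq_sq_le (ℓ : Fin 2 → ℤ) (i : Fin 2) :
    posFS.freq ℓ i ^ 2 ≤ 4 * Real.pi ^ 2 * normSqZ ℓ := by
  rw [posFS_freq, normSqZ_eq]
  have h0 := mul_nonneg (sq_nonneg (2 * Real.pi)) (sq_nonneg (ℓ 0 : ℝ))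
  have h1 := mul_nonneg (sq_nonneg (2 * Real.pi)) (sq_nonneg (ℓ 1 : ℝ))
  fin_cases i <;> simp only [Fin.zero_eta, Fin.mk_one] <;> nlinarith

lemma exists_isChem {p : Params} (hg : 0 < p.gam) (hc : 0 < p.sigC) (f : H2 phaseCover) :
    ∃ c, IsChem p f c := by
  have hs := fun ℓ => chemSymb_pos hg hc ℓ
  have hn : ∀ ℓ, ‖((chemSymb p ℓ : ℝ) : ℂ)⁻¹‖ = (chemSymb p ℓ)⁻¹ := fun ℓ => by
    rw [norm_inv, Complex.norm_real, Real.norm_of_nonneg (hs ℓ).le]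
  obtain ⟨c, hcc⟩ := exists_H2_multiplier posFS (fun ℓ => ((chemSymb p ℓ : ℝ) : ℂ)⁻¹)
    (p.gam⁻¹ + p.sigC⁻¹)
    (fun ℓ => by
      rw [hn]; exact inv_symb_le hg hc (by have := normSqZ_nonneg ℓ; positivity))
    (fun ℓ i => by rw [hn]; exact abs_freq_mul_le hg hc (posFS_freq_sq_le ℓ i))
    (fun ℓ i j => by
      rw [hn]
      exact abs_freq_mul_freq_le hg hc (posFS_freq_sq_le ℓ i) (posFS_freq_sq_le ℓ j))
    (fun ℓ => by rw [chemSymb_neg, map_inv₀, Complex.conj_ofReal]) (dens (jet0 phaseCover f))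
  refine ⟨c, isChem_iff.2 fun ℓ => ?_⟩
  have : ((chemSymb p ℓ : ℝ) : ℂ) ≠ 0 := by exact_mod_cast (hs ℓ).ne'
  rw [hcc, coef_dens]
  field_simp

lemma isChem_chem {p : Params} (hg : 0 < p.gam) (hc : 0 < p.sigC) (f : H2 phaseCover) :
    IsChem p f (chem p f) := by
  rw [chem, dif_pos (exists_isChem hg hc f)]
  exact (exists_isChem hg hc f).choose_spec

lemma coef_chem {p : Params} (hg : 0 < p.gam) (hc : 0 < p.sigC) (f : H2 phaseCover)
    (ℓ : Fin 2 → ℤ) : posFS.coef (jet0 posCover (chem p f)) ℓ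
      = phaseFS.coef (jet0 phaseCover f) (ℓ, 0) / (chemSymb p ℓ : ℂ) := by
  have : ((chemSymb p ℓ : ℝ) : ℂ) ≠ 0 := by exact_mod_cast (chemSymb_pos hg hc ℓ).ne'
  rw [eq_div_iff this, mul_comm]
  exact isChem_iff.1 (isChem_chem hg hc f) ℓ

lemma chem_unique {p : Params} (hg : 0 < p.gam) (hc : 0 < p.sigC) {f : H2 phaseCover}
    {c : H2 posCover} (h : IsChem p f c) : chem p f = c := by
  apply H2_ext posFS
  refine posFS.coef_ext fun ℓ => ?_
  have : ((chemSymb p ℓ : ℝ) : ℂ) ≠ 0 := by exact_mod_cast (chemSymb_pos hg hc ℓ).ne'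
  apply mul_left_cancel₀ this
  rw [isChem_iff.1 h, isChem_iff.1 (isChem_chem hg hc f)]

end Chem

section SupBound

variable {ι M : Type} [Fintype ι] [DecidableEq ι]
  [AddCommGroup M] [TopologicalSpace M] [CompactSpace M]
  [MeasureSpace M] [BorelSpace M] {e : (ι → ℝ) → M} {κ : Type} [Neg κ]
  [IsTopologicalAddGroup M] [SecondCountableTopology M] [T2Space M]
  [Measure.IsAddLeftInvariant (volume : Measure M)] [IsFiniteMeasure (volume : Measure M)]
  [Measure.IsOpenPosMeasure (volume : Measure M)]

/-- The symbol of a partial derivative of order at most two. -/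
def FourierSystem.jetSymb (S : FourierSystem e κ) : Jet2 ι → κ → ℂ
  | .inl () => fun _ => 1
  | .inr (.inl i) => fun n => Complex.I * S.freq n i
  | .inr (.inr (i, j)) => fun n => -(S.freq n i * S.freq n j)

lemma coef_jet (S : FourierSystem e κ) (j : Jet2 ι) (f : H2 e) (n : κ) :
    S.coef (jet e j f) n = S.jetSymb j n * S.coef (jet0 e f) n := by
  rcases j with ⟨⟩ | i | ⟨i, j⟩
  · simp [FourierSystem.jetSymb]
  · exact coef_jet1 S f i n
  · exact coef_jet2 S f i j n

/-- A function with an absolutely convergent Fourier series is continuous. -/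
lemma FourierSystem.exists_continuous (S : FourierSystem e κ) (u : L2 M)
    (hs : Summable fun n => ‖S.coef u n‖) :
    ∃ h : C(M, ℝ), h =ᵐ[volume] u ∧ ‖h‖ ≤ (mass M)⁻¹ * ∑' n, ‖S.coef u n‖ := by
  have hV := mass_pos M
  have hnE : ∀ n, ‖S.E n‖ ≤ 1 := fun n =>
    (ContinuousMap.norm_le _ zero_le_one).2 fun z => (S.E_norm n z).le
  have hterm : ∀ n, ‖(((mass M : ℝ) : ℂ)⁻¹ * S.coef u n) • S.E n‖ ≤ (mass M)⁻¹ * ‖S.coef u n‖ := by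
    intro n
    rw [norm_smul, norm_mul, norm_inv, Complex.norm_real, Real.norm_of_nonneg hV.le]
    exact mul_le_of_le_one_right (by positivity) (hnE n)
  have hsum : Summable fun n => (((mass M : ℝ) : ℂ)⁻¹ * S.coef u n) • S.E n :=
    Summable.of_norm_bounded (hs.mul_left _) hterm
  set hC : C(M, ℂ) := ∑' n, (((mass M : ℝ) : ℂ)⁻¹ * S.coef u n) • S.E n with hhC
  have hL : ContinuousMap.toLp 2 volume ℂ hC = complexify M u := by
    have h1 := (ContinuousMap.toLp (E := ℂ) 2 (volume : Measure M) ℂ).hasSum hsum.hasSum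
    have h2 := S.basis.hasSum_repr (complexify M u)
    refine h1.unique (h2.congr_fun fun n => ?_)
    rw [HilbertBasis.repr_apply_apply, S.inner_basis_complexify, S.basis_apply,
      FourierSystem.vec, smul_smul, map_smul]
    congr 1
    have h1 : ((mass M : ℝ) : ℂ) = ((Real.sqrt (mass M) : ℝ) : ℂ) * (Real.sqrt (mass M) : ℝ) := by
      rw [← Complex.ofReal_mul, Real.mul_self_sqrt hV.le]
    rw [h1, mul_inv]; ring
  refine ⟨⟨fun z => (hC z).re, by fun_prop⟩, ?_, ?_⟩
  · have h1 := ContinuousMap.coeFn_toLp (p := 2) (𝕜 := ℂ) (volume : Measure M) hC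
    filter_upwards [h1, ContinuousLinearMap.coeFn_compLpL (p := 2) (μ := volume)
      Complex.ofRealCLM u] with z h1 h2
    rw [ContinuousMap.coe_mk, ← h1, hL, h2]
    simp
  · rw [ContinuousMap.norm_le _ (mul_nonneg (by positivity) (tsum_nonneg fun _ => norm_nonneg _))]
    intro z
    calc ‖(hC z).re‖ ≤ ‖hC z‖ := Complex.abs_re_le_norm _
      _ ≤ ‖hC‖ := hC.norm_coe_le_norm z
      _ ≤ ∑' n, (mass M)⁻¹ * ‖S.coef u n‖ :=
        tsum_of_norm_bounded (hs.mul_left _).hasSum hterm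
      _ = _ := tsum_mul_left

end SupBound

section ChemSup

/-- In two dimensions (1 + |ℓ|²)² dominates (1 + ℓ₁²)(1 + ℓ₂²), whose inverse is a product of
convergent one-dimensional series. -/
lemma summable_weight :
    Summable fun ℓ : Fin 2 → ℤ => ((1 + 4 * Real.pi ^ 2 * normSqZ ℓ)⁻¹) ^ 2 := by
  have h1 : Summable fun n : ℤ => (1 + (n : ℝ) ^ 2)⁻¹ := by
    have h : Summable fun n : ℕ => (1 + (n : ℝ) ^ 2)⁻¹ := by
      refine Summable.of_nonneg_of_le (fun n => by positivity) (fun n => ?_)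
        ((Real.summable_one_div_nat_pow (p := 2)).2 one_lt_two |>.comp_injective Nat.succ_injective
          |>.mul_left 2)
      simp only [Function.comp_apply, Nat.succ_eq_add_one, Nat.cast_add, Nat.cast_one]
      rw [mul_one_div, inv_eq_one_div, div_le_div_iff₀ (by positivity) (by positivity)]
      nlinarith [sq_nonneg ((n : ℝ) - 1)]
    refine Summable.of_nat_of_neg (by simpa using h) (by simpa using h)
  have h2 := h1.mul_of_nonneg h1 (fun n => by positivity) (fun n => by positivity)
  have h3 := (finTwoArrowEquiv ℤ).summable_iff.2 h2
  refine Summable.of_nonneg_of_le (fun ℓ => by positivity) (fun ℓ => ?_) h3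
  simp only [Function.comp_apply, finTwoArrowEquiv_apply]
  rw [← mul_inv, inv_pow]
  apply inv_anti₀ (by positivity)
  rw [normSqZ_eq]
  have hpi : (1 : ℝ) ≤ 4 * Real.pi ^ 2 := by nlinarith [Real.pi_gt_three]
  have ha := sq_nonneg (ℓ 0 : ℝ)
  have hb := sq_nonneg (ℓ 1 : ℝ)
  have : 1 + ((ℓ 0 : ℝ) ^ 2 + (ℓ 1 : ℝ) ^ 2)
      ≤ 1 + 4 * Real.pi ^ 2 * ((ℓ 0 : ℝ) ^ 2 + (ℓ 1 : ℝ) ^ 2) := by nlinarith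
  calc (1 + (ℓ 0 : ℝ) ^ 2) * (1 + (ℓ 1 : ℝ) ^ 2)
      ≤ (1 + ((ℓ 0 : ℝ) ^ 2 + (ℓ 1 : ℝ) ^ 2)) ^ 2 := by nlinarith [mul_nonneg ha hb]
    _ ≤ _ := by gcongr

/-- The Fourier coefficients of the density of an `H²` function are summable. -/
lemma summable_coef_dens : ∃ K : ℝ, 0 ≤ K ∧ ∀ f : H2 phaseCover,
    Summable (fun ℓ => ‖phaseFS.coef (jet0 phaseCover f) (ℓ, 0)‖) ∧
      ∑' ℓ, ‖phaseFS.coef (jet0 phaseCover f) (ℓ, 0)‖ ≤ K * ‖f‖ := by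
  set W := ∑' ℓ : Fin 2 → ℤ, ((1 + 4 * Real.pi ^ 2 * normSqZ ℓ)⁻¹) ^ 2
  refine ⟨Real.sqrt W * (Real.sqrt (mass Phase) * 3), by positivity, fun f => ?_⟩
  -- u = f − Δ_x f has coefficients (1 + 4π²|ℓ|²) f̂ and norm at most 3‖f‖. Cauchy–Schwarz against
  -- the summable weight then bounds the sum of |f̂(ℓ, 0)|.
  set u : L2 Phase := jet0 phaseCover f - jet2 phaseCover 0 0 f - jet2 phaseCover 1 1 f with hu
  have hcu : ∀ ℓ, phaseFS.coef u (ℓ, 0) = ((1 + 4 * Real.pi ^ 2 * normSqZ ℓ : ℝ) : ℂ)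
      * phaseFS.coef (jet0 phaseCover f) (ℓ, 0) := by
    intro ℓ
    rw [hu, phaseFS.coef_sub, phaseFS.coef_sub, coef_jet2 phaseFS, coef_jet2 phaseFS]
    simp only [phaseFS_freq, normSqZ_eq, Matrix.cons_val]
    push_cast
    ring
  have hnu : ‖u‖ ≤ 3 * ‖f‖ := by
    have h1 := norm_jet_le (.inl ()) f
    have h2 := norm_jet_le (.inr (.inr (0, 0))) f
    have h3 := norm_jet_le (.inr (.inr (1, 1))) f
    calc ‖u‖ ≤ ‖jet0 phaseCover f - jet2 phaseCover 0 0 f‖ + ‖jet2 phaseCover 1 1 f‖ :=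
          norm_sub_le _ _
      _ ≤ ‖jet0 phaseCover f‖ + ‖jet2 phaseCover 0 0 f‖ + ‖jet2 phaseCover 1 1 f‖ := by
          gcongr; exact norm_sub_le _ _
      _ ≤ 3 * ‖f‖ := by linarith
  have hpos : ∀ ℓ : Fin 2 → ℤ, 0 < 1 + 4 * Real.pi ^ 2 * normSqZ ℓ := fun ℓ => by
    have := normSqZ_nonneg ℓ; positivity
  have heq : (fun ℓ => ‖phaseFS.coef (jet0 phaseCover f) (ℓ, 0)‖)
      = fun ℓ => (1 + 4 * Real.pi ^ 2 * normSqZ ℓ)⁻¹ * ‖phaseFS.coef u (ℓ, 0)‖ := by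
    funext ℓ
    rw [hcu, norm_mul, Complex.norm_real, Real.norm_of_nonneg (hpos ℓ).le,
      inv_mul_cancel_left₀ (hpos ℓ).ne']
  have hinj : Function.Injective fun ℓ : Fin 2 → ℤ => (ℓ, (0 : ℤ)) := fun a b h =>
    (Prod.ext_iff.1 h).1
  have hP := phaseFS.hasSum_norm_coef u
  have hsu : Summable fun ℓ => ‖phaseFS.coef u (ℓ, 0)‖ ^ 2 := hP.summable.comp_injective hinj
  have hle : ∑' ℓ, ‖phaseFS.coef u (ℓ, 0)‖ ^ 2 ≤ mass Phase * ‖u‖ ^ 2 := by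
    rw [← hP.tsum_eq]
    exact tsum_comp_le_tsum_of_inj hP.summable (fun _ => by positivity) hinj
  have key := Real.summable_and_inner_le_Lp_mul_Lq_tsum_of_nonneg Real.HolderConjugate.two_two
    (f := fun ℓ : Fin 2 → ℤ => (1 + 4 * Real.pi ^ 2 * normSqZ ℓ)⁻¹)
    (g := fun ℓ => ‖phaseFS.coef u (ℓ, 0)‖) (fun ℓ => (inv_pos.2 (hpos ℓ)).le)
    (fun ℓ => norm_nonneg _) (by simpa using summable_weight) (by simpa using hsu)
  rw [heq]
  refine ⟨key.1, key.2.trans ?_⟩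
  simp only [Real.rpow_two, ← Real.sqrt_eq_rpow]
  rw [mul_assoc]
  gcongr
  calc Real.sqrt (∑' ℓ, ‖phaseFS.coef u (ℓ, 0)‖ ^ 2) ≤ Real.sqrt (mass Phase * ‖u‖ ^ 2) :=
        Real.sqrt_le_sqrt hle
    _ = Real.sqrt (mass Phase) * ‖u‖ := by
        rw [Real.sqrt_mul (mass_pos _).le, Real.sqrt_sq (norm_nonneg _)]
    _ ≤ Real.sqrt (mass Phase) * (3 * ‖f‖) := by gcongr
    _ = _ := by ring

lemma norm_jetSymb_div_le {p : Params} (hg : 0 < p.gam) (hc : 0 < p.sigC) (j : Jet2 (Fin 2))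
    (ℓ : Fin 2 → ℤ) : ‖posFS.jetSymb j ℓ‖ / chemSymb p ℓ ≤ p.gam⁻¹ + p.sigC⁻¹ := by
  rw [div_eq_mul_inv]
  rcases j with ⟨⟩ | i | ⟨i, j⟩
  · simp only [FourierSystem.jetSymb, norm_one, one_mul]
    exact inv_symb_le hg hc (by have := normSqZ_nonneg ℓ; positivity)
  · simpa [FourierSystem.jetSymb, chemSymb] using abs_freq_mul_le hg hc (posFS_freq_sq_le ℓ i)
  · simpa [FourierSystem.jetSymb, chemSymb] using
      abs_freq_mul_freq_le hg hc (posFS_freq_sq_le ℓ i) (posFS_freq_sq_le ℓ j)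

/-- The chemical field and its derivatives up to order two are continuous functions. -/
lemma exists_chemC {p : Params} (hg : 0 < p.gam) (hc : 0 < p.sigC) (j : Jet2 (Fin 2)) :
    ∃ Λ : H2 phaseCover →L[ℝ] C(Pos, ℝ), ∀ f, Λ f =ᵐ[volume] jet posCover j (chem p f) := by
  obtain ⟨K, hK0, hK⟩ := summable_coef_dens
  have hcoef : ∀ f ℓ, posFS.coef (jet posCover j (chem p f)) ℓ
      = posFS.jetSymb j ℓ / (chemSymb p ℓ : ℂ) * phaseFS.coef (jet0 phaseCover f) (ℓ, 0) := by
    intro f ℓ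
    rw [coef_jet posFS, coef_chem hg hc]; ring
  have hle : ∀ f ℓ, ‖posFS.coef (jet posCover j (chem p f)) ℓ‖
      ≤ (p.gam⁻¹ + p.sigC⁻¹) * ‖phaseFS.coef (jet0 phaseCover f) (ℓ, 0)‖ := by
    intro f ℓ
    rw [hcoef, norm_mul, norm_div, Complex.norm_real,
      Real.norm_of_nonneg (chemSymb_pos hg hc ℓ).le]
    gcongr
    exact norm_jetSymb_div_le hg hc j ℓ
  have hsum : ∀ f, Summable fun ℓ => ‖posFS.coef (jet posCover j (chem p f)) ℓ‖ := fun f =>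
    Summable.of_nonneg_of_le (fun _ => norm_nonneg _) (hle f) ((hK f).1.mul_left _)
  choose h hh1 hh2 using fun f => posFS.exists_continuous (jet posCover j (chem p f)) (hsum f)
  -- Linearity is checked on L² classes through Fourier coefficients; it passes to the continuous
  -- representatives because these are unique.
  have huniq : ∀ a b : C(Pos, ℝ), a =ᵐ[volume] b → a = b := fun a b hab =>
    ContinuousMap.coe_injective (Continuous.ae_eq_iff_eq _ a.continuous b.continuous |>.1 hab)
  refine ⟨LinearMap.mkContinuous
    { toFun := h
      map_add' := fun f g => huniq _ _ ?_
      map_smul' := fun a f => huniq _ _ ?_ }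
    ((mass Pos)⁻¹ * ((p.gam⁻¹ + p.sigC⁻¹) * K)) fun f => ?_, hh1⟩
  · have : jet posCover j (chem p (f + g)) = jet posCover j (chem p f) + jet posCover j (chem p g) := by
      refine posFS.coef_ext fun ℓ => ?_
      rw [posFS.coef_add, hcoef, hcoef, hcoef, map_add, phaseFS.coef_add]; ring
    filter_upwards [hh1 (f + g), hh1 f, hh1 g,
      Lp.coeFn_add (jet posCover j (chem p f)) (jet posCover j (chem p g))] with x h1 h2 h3 h4
    rw [h1, this, h4, ContinuousMap.add_apply, h2, h3, Pi.add_apply]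
  · have : jet posCover j (chem p (a • f)) = a • jet posCover j (chem p f) := by
      refine posFS.coef_ext fun ℓ => ?_
      rw [posFS.coef_smul, hcoef, hcoef, map_smul, phaseFS.coef_smul]; ring
    filter_upwards [hh1 (a • f), hh1 f,
      Lp.coeFn_smul a (jet posCover j (chem p f))] with x h1 h2 h4
    rw [h1, this, h4, RingHom.id_apply, ContinuousMap.smul_apply, h2, Pi.smul_apply]
  · refine (hh2 f).trans ?_
    rw [mul_assoc]
    refine mul_le_mul_of_nonneg_left ?_ (inv_nonneg.2 (mass_pos _).le)
    calc ∑' ℓ, ‖posFS.coef (jet posCover j (chem p f)) ℓ‖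
        ≤ ∑' ℓ, (p.gam⁻¹ + p.sigC⁻¹) * ‖phaseFS.coef (jet0 phaseCover f) (ℓ, 0)‖ :=
          (hsum f).tsum_le_tsum (hle f) ((hK f).1.mul_left _)
      _ = (p.gam⁻¹ + p.sigC⁻¹) * ∑' ℓ, ‖phaseFS.coef (jet0 phaseCover f) (ℓ, 0)‖ := tsum_mul_left
      _ ≤ (p.gam⁻¹ + p.sigC⁻¹) * (K * ‖f‖) := by
          have : 0 < p.gam⁻¹ + p.sigC⁻¹ := by positivity
          exact mul_le_mul_of_nonneg_left (hK f).2 this.le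
      _ = _ := by ring

end ChemSup

end

end AntModel

/-! ### B_τ with values in continuous functions; F and L with values in L². -/

namespace AntModel

noncomputable section

open scoped ComplexConjugate

/-! ### Functions of the angle -/

lemma hasDerivAt_cosA (θ : Ang) (s : ℝ) :
    HasDerivAt (fun s : ℝ => cosA (θ + (s : Ang))) (-sinA (θ + (s : Ang))) s := by
  induction θ using ang_induction with
  | h t =>
    simp only [← AddCircle.coe_add, cosA_coe, sinA_coe]
    simpa using (Real.hasDerivAt_cos (t + s)).comp_const_add t s

lemma hasDerivAt_sinA (θ : Ang) (s : ℝ) :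
    HasDerivAt (fun s : ℝ => sinA (θ + (s : Ang))) (cosA (θ + (s : Ang))) s := by
  induction θ using ang_induction with
  | h t =>
    simp only [← AddCircle.coe_add, cosA_coe, sinA_coe]
    simpa using (Real.hasDerivAt_sin (t + s)).comp_const_add t s

lemma hasDerivAt_v (θ : Ang) (i : Fin 2) (s : ℝ) :
    HasDerivAt (fun s : ℝ => v (θ + (s : Ang)) i) (vPerp (θ + (s : Ang)) i) s := by
  fin_cases i
  · exact hasDerivAt_cosA θ s
  · exact hasDerivAt_sinA θ s

lemma hasDerivAt_vPerp (θ : Ang) (i : Fin 2) (s : ℝ) :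
    HasDerivAt (fun s : ℝ => vPerp (θ + (s : Ang)) i) (-v (θ + (s : Ang)) i) s := by
  fin_cases i
  · exact (hasDerivAt_sinA θ s).neg
  · exact hasDerivAt_cosA θ s

lemma continuous_v (i : Fin 2) : Continuous fun θ => v θ i := by
  fin_cases i
  · exact continuous_cosA
  · exact continuous_sinA

lemma continuous_vPerp (i : Fin 2) : Continuous fun θ => vPerp θ i := by
  fin_cases i
  · exact continuous_sinA.neg
  · exact continuous_cosA

lemma contDiff_v (i : Fin 2) : ContDiff ℝ ∞ fun s : ℝ => v (s : Ang) i := by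
  fin_cases i
  · exact Real.contDiff_cos
  · exact Real.contDiff_sin

lemma contDiff_vPerp (i : Fin 2) : ContDiff ℝ ∞ fun s : ℝ => vPerp (s : Ang) i := by
  fin_cases i
  · exact Real.contDiff_sin.neg
  · exact Real.contDiff_cos

lemma isTest_ang {g : Ang → ℝ} (hg : ContDiff ℝ ∞ fun s : ℝ => g (s : Ang)) :
    IsTest phaseCover fun z => g z.2 := by
  apply phaseFS.isTest
  exact hg.comp (contDiff_apply ℝ ℝ (2 : Fin 3))

lemma phaseCover_single_two (s : ℝ) : phaseCover (Pi.single 2 s) = (0, (s : Ang)) := by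
  refine Prod.ext ?_ ?_
  · rw [phaseCover_fst]
    funext i
    fin_cases i <;> simp [posCover]
  · simp [phaseCover_snd]

lemma pderiv_two_ang {g g' : Ang → ℝ} {z : Phase}
    (hg : HasDerivAt (fun s : ℝ => g (z.2 + (s : Ang))) (g' z.2) 0) :
    pderiv phaseCover 2 (fun z => g z.2) z = g' z.2 := by
  rw [pderiv]
  simp only [phaseCover_single_two, Prod.snd_add]
  exact hg.deriv

lemma phaseCover_single_castSucc (i : Fin 2) (s : ℝ) :
    phaseCover (Pi.single i.castSucc s) = (posCover (Pi.single i s), 0) := by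
  refine Prod.ext ?_ ?_
  · rw [phaseCover_fst]
    congr 1
    funext j
    fin_cases i <;> fin_cases j <;> simp
  · rw [phaseCover_snd]
    fin_cases i <;> simp

lemma pderiv_castSucc_ang (g : Ang → ℝ) (i : Fin 2) (z : Phase) :
    pderiv phaseCover i.castSucc (fun z => g z.2) z = 0 := by
  rw [pderiv]
  simp [phaseCover_single_castSucc]

/-- The trigonometric coefficients of `B_τ`. -/
def bA (p : Params) : Fin 2 ⊕ (Fin 2 × Fin 2) → Ang → ℝ
  | .inl i => fun θ => vPerp θ i
  | .inr (i, j) => fun θ => p.tau * (vPerp θ i * v θ j)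

/-- Their derivatives. -/
def dbA (p : Params) : Fin 2 ⊕ (Fin 2 × Fin 2) → Ang → ℝ
  | .inl i => fun θ => -v θ i
  | .inr (i, j) => fun θ => p.tau * (vPerp θ i * vPerp θ j - v θ i * v θ j)

lemma continuous_bA (p : Params) (a) : Continuous (bA p a) := by
  rcases a with i | ⟨i, j⟩
  · exact continuous_vPerp i
  · exact continuous_const.mul ((continuous_vPerp i).mul (continuous_v j))

lemma continuous_dbA (p : Params) (a) : Continuous (dbA p a) := by
  rcases a with i | ⟨i, j⟩
  · exact (continuous_v i).neg
  · exact continuous_const.mul (((continuous_vPerp i).mul (continuous_vPerp j)).sub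
      ((continuous_v i).mul (continuous_v j)))

lemma contDiff_bA (p : Params) (a) : ContDiff ℝ ∞ fun s : ℝ => bA p a (s : Ang) := by
  rcases a with i | ⟨i, j⟩
  · exact contDiff_vPerp i
  · exact contDiff_const.mul ((contDiff_vPerp i).mul (contDiff_v j))

lemma hasDerivAt_bA (p : Params) (a) (θ : Ang) (s : ℝ) :
    HasDerivAt (fun s : ℝ => bA p a (θ + (s : Ang))) (dbA p a (θ + (s : Ang))) s := by
  rcases a with i | ⟨i, j⟩
  · exact hasDerivAt_vPerp θ i s
  · refine (((hasDerivAt_vPerp θ i s).mul (hasDerivAt_v θ j s)).const_mul p.tau).congr_deriv ?_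
    simp only [dbA]; ring

/-! ### The operators -/

/-- Multiplication of an `L²` function by a continuous function. -/
def mulCL : C(Phase, ℝ) →L[ℝ] L2 Phase →L[ℝ] L2 Phase :=
  ((ContinuousLinearMap.mul ℝ ℝ).holderL volume ⊤ 2 2).comp (ContinuousMap.toLp ⊤ volume ℝ)

lemma coeFn_mulCL (c : C(Phase, ℝ)) (u : L2 Phase) :
    mulCL c u =ᵐ[volume] fun z => c z * u z := by
  have h1 := ContinuousLinearMap.coeFn_holder (r := 2) (ContinuousLinearMap.mul ℝ ℝ)
    (ContinuousMap.toLp ⊤ volume ℝ c) u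
  have h2 := ContinuousMap.coeFn_toLp (p := ⊤) (𝕜 := ℝ) (volume : Measure Phase) c
  filter_upwards [h1, h2] with z h1 h2
  rw [← h2]
  exact h1

/-- The class of a continuous function in `L²`. -/
abbrev toL2 : C(Phase, ℝ) →L[ℝ] L2 Phase := ContinuousMap.toLp 2 volume ℝ

lemma coeFn_toL2 (c : C(Phase, ℝ)) : toL2 c =ᵐ[volume] c := ContinuousMap.coeFn_toLp volume c

/-- Continuous functions of the position as continuous functions on the phase space. -/
def liftPos : C(Pos, ℝ) →L[ℝ] C(Phase, ℝ) :=
  LinearMap.mkContinuous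
    { toFun := fun c => c.comp ⟨Prod.fst, continuous_fst⟩
      map_add' := fun _ _ => rfl
      map_smul' := fun _ _ => rfl } 1 (fun c => by
      rw [one_mul, ContinuousMap.norm_le _ (norm_nonneg _)]
      exact fun z => c.norm_coe_le_norm z.1)

@[simp] lemma liftPos_apply (c : C(Pos, ℝ)) (z : Phase) : liftPos c z = c z.1 := rfl

/-- A continuous function of the angle on the phase space. -/
def liftAng (g : Ang → ℝ) (hg : Continuous g) : C(Phase, ℝ) := ⟨fun z => g z.2, hg.comp continuous_snd⟩

open Classical in
/-- The chemical field and its derivatives, as continuous functions. -/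
def chemC (p : Params) (j : Jet2 (Fin 2)) : H2 phaseCover →L[ℝ] C(Pos, ℝ) :=
  if h : 0 < p.gam ∧ 0 < p.sigC then (exists_chemC h.1 h.2 j).choose else 0

lemma coeFn_chemC {p : Params} (hg : 0 < p.gam) (hc : 0 < p.sigC) (j : Jet2 (Fin 2))
    (f : H2 phaseCover) : chemC p j f =ᵐ[volume] jet posCover j (chem p f) := by
  rw [chemC, dif_pos ⟨hg, hc⟩]
  exact (exists_chemC hg hc j).choose_spec f

/-- `B_τ` with values in continuous functions. -/
def Bop (p : Params) : H2 phaseCover →L[ℝ] C(Phase, ℝ) :=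
  ∑ a, (ContinuousLinearMap.mul ℝ C(Phase, ℝ) (liftAng (bA p a) (continuous_bA p a))).comp
    (liftPos.comp (chemC p (.inr a)))

/-- `∂_θ B_τ` with values in continuous functions. -/
def dBop (p : Params) : H2 phaseCover →L[ℝ] C(Phase, ℝ) :=
  ∑ a, (ContinuousLinearMap.mul ℝ C(Phase, ℝ) (liftAng (dbA p a) (continuous_dbA p a))).comp
    (liftPos.comp (chemC p (.inr a)))

lemma Bop_apply (p : Params) (f : H2 phaseCover) (z : Phase) :
    Bop p f z = ∑ a, bA p a z.2 * chemC p (.inr a) f z.1 := by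
  simp only [Bop, sum_apply, ContinuousMap.sum_apply]
  rfl

lemma dBop_apply (p : Params) (f : H2 phaseCover) (z : Phase) :
    dBop p f z = ∑ a, dbA p a z.2 * chemC p (.inr a) f z.1 := by
  simp only [dBop, sum_apply, ContinuousMap.sum_apply]
  rfl

lemma B_ae {p : Params} (hg : 0 < p.gam) (hc : 0 < p.sigC) (f : H2 phaseCover) :
    B p f =ᵐ[volume] Bop p f := by
  have hfst : Measure.QuasiMeasurePreserving (Prod.fst : Phase → Pos) volume volume :=
    Measure.quasiMeasurePreserving_fst
  have h : ∀ j, (fun z : Phase => chemC p j f z.1)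
      =ᵐ[volume] fun z => jet posCover j (chem p f) z.1 := fun j =>
    hfst.ae_eq_comp (coeFn_chemC hg hc j f)
  have h' := ae_all_iff.2 h
  filter_upwards [h'] with z hz
  rw [Bop_apply, B]
  simp only [Fintype.sum_sum_type, Fintype.sum_prod_type, hz, bA, Finset.mul_sum]
  refine congrArg₂ _ rfl (Finset.sum_congr rfl fun i _ => Finset.sum_congr rfl fun j _ => ?_)
  simp only [d2, jet_apply]
  ring

/-- A continuous function of the position may be moved through `∂_θ`. -/
lemma isWeakDeriv_two_mul_pos {u g : Phase → ℝ} (h : IsWeakDeriv phaseCover 2 u g) (c : C(Pos, ℝ)) :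
    IsWeakDeriv phaseCover 2 (fun z => c z.1 * u z) (fun z => c z.1 * g z) := by
  have hc1 : Continuous fun z : Phase => c z.1 := c.continuous.comp continuous_fst
  have i1 : Integrable fun z => c z.1 * u z := by
    simpa only [mul_comm] using integrable_mul_continuous h.1 hc1
  have i2 : Integrable fun z => c z.1 * g z := by
    simpa only [mul_comm] using integrable_mul_continuous h.2.1 hc1
  refine ⟨i1, i2, fun φ hφ => ?_⟩
  set w : Phase → ℝ := fun z => u z * pderiv phaseCover 2 φ z + g z * φ z with hw
  have iw : Integrable w := (integrable_mul_continuous h.1 (hφ.2.2 2)).add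
    (integrable_mul_continuous h.2.1 hφ.2.1)
  have hint : ∀ d : C(Pos, ℂ), Integrable fun z => (w z : ℂ) * d z.1 := fun d =>
    integrable_ofReal_mul_continuous iw (d.continuous.comp continuous_fst)
  -- Here c is only continuous, so c φ is not an admissible test function. But d ↦ ∫ w d(x) is a
  -- bounded functional on C(𝕋₁²), and it vanishes on characters, because E_ℓ φ is smooth and E_ℓ
  -- does not depend on θ. By density of the characters it vanishes at c.
  let Λ : C(Pos, ℂ) →L[ℂ] ℂ := LinearMap.mkContinuous
    { toFun := fun d => ∫ z, (w z : ℂ) * d z.1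
      map_add' := fun d d' => by
        simp only [ContinuousMap.add_apply, mul_add]
        exact integral_add (hint d) (hint d')
      map_smul' := fun a d => by
        simp only [ContinuousMap.smul_apply, smul_eq_mul, RingHom.id_apply]
        rw [← integral_const_mul]
        congr 1; funext z; ring } (∫ z, ‖w z‖) (fun d => by
      refine (norm_integral_le_integral_norm _).trans ?_
      rw [← integral_mul_const]
      refine integral_mono (hint d).norm (iw.norm.mul_const _) fun z => ?_
      simp only [norm_mul, Complex.norm_real]
      exact mul_le_mul_of_nonneg_left (d.norm_coe_le_norm _) (norm_nonneg _))
  have hΛ : ∀ d, Λ d = ∫ z, (w z : ℂ) * d z.1 := fun d => rfl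
  have hchar : ∀ ℓ, Λ (posFS.E ℓ) = 0 := by
    intro ℓ
    have hE : ContDiff ℝ ∞ fun y => phaseFS.E (ℓ, 0) (phaseCover y) := phaseFS.contDiff_E _
    have hφ' : ContDiff ℝ ∞ fun y => ((φ (phaseCover y) : ℝ) : ℂ) := Complex.ofRealCLM.contDiff.comp hφ.1
    have hprod : ContDiff ℝ ∞ fun y =>
        (fun z => phaseFS.E (ℓ, 0) z * (φ z : ℂ)) (phaseCover y) := hE.mul hφ'
    have h1 := phaseFS.weak_integral h (φ := fun z => phaseFS.E (ℓ, 0) z * (φ z : ℂ)) hprod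
    have hd : ∀ z, cpderiv phaseCover 2 (fun z => phaseFS.E (ℓ, 0) z * (φ z : ℂ)) z
        = phaseFS.E (ℓ, 0) z * (pderiv phaseCover 2 φ z : ℂ) := by
      intro z
      have a1 := phaseFS.hasDerivAt_cpderiv_zero hE z 2
      rw [phaseFS.cpderiv_E] at a1
      have a2 := (phaseFS.hasDerivAt_pderiv_zero hφ.1 z 2).ofReal_comp
      have a3 := (a1.fun_mul a2).deriv
      rw [cpderiv, a3]
      simp [phaseFS_freq, phaseFS.cover_zero]
    simp only [hd] at h1
    have e1 : ∀ z, phaseFS.E (ℓ, 0) z = posFS.E ℓ z.1 := fun z => by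
      simp [phaseE_apply]
    simp only [e1] at h1
    rw [hΛ]
    have e2 : (fun z => (w z : ℂ) * posFS.E ℓ z.1) = fun z : Phase =>
        (u z : ℂ) * (posFS.E ℓ z.1 * (pderiv phaseCover 2 φ z : ℂ))
          + (g z : ℂ) * (posFS.E ℓ z.1 * (φ z : ℂ)) := by
      funext z; rw [hw]; push_cast; ring
    have hEc : Continuous fun z : Phase => posFS.E ℓ z.1 :=
      (posFS.E ℓ).continuous.comp continuous_fst
    have j1 : Integrable fun z : Phase => (u z : ℂ) * (posFS.E ℓ z.1 * (pderiv phaseCover 2 φ z : ℂ)) :=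
      integrable_ofReal_mul_continuous h.1 (hEc.mul (Complex.continuous_ofReal.comp (hφ.2.2 2)))
    have j2 : Integrable fun z : Phase => (g z : ℂ) * (posFS.E ℓ z.1 * (φ z : ℂ)) :=
      integrable_ofReal_mul_continuous h.2.1 (hEc.mul (Complex.continuous_ofReal.comp hφ.2.1))
    rw [e2, integral_add j1 j2, h1]
    ring
  have hzero : ∀ d, Λ d = 0 := by
    have hle : Submodule.span ℂ (Set.range posFS.E) ≤ LinearMap.ker Λ.toLinearMap := by
      rw [Submodule.span_le]
      rintro _ ⟨ℓ, rfl⟩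
      exact hchar ℓ
    have h2 := Submodule.topologicalClosure_minimal _ hle (ContinuousLinearMap.isClosed_ker Λ)
    rw [posFS.dense] at h2
    exact fun d => h2 (Submodule.mem_top (x := d))
  have h3 := hzero ⟨fun x => (c x : ℂ), by fun_prop⟩
  rw [hΛ] at h3
  have e3 : (fun z : Phase => (w z : ℂ) * ((c z.1 : ℝ) : ℂ))
      = fun z => ((c z.1 * u z * pderiv phaseCover 2 φ z + c z.1 * g z * φ z : ℝ) : ℂ) := by
    funext z; rw [hw]; push_cast; ring
  rw [ContinuousMap.coe_mk] at h3
  rw [e3, integral_complex_ofReal, Complex.ofReal_eq_zero, integral_add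
    (integrable_mul_continuous i1 (hφ.2.2 2)) (integrable_mul_continuous i2 hφ.2.1)] at h3
  linarith

lemma isWeakDeriv_sum {ι M A : Type} [Fintype ι] [DecidableEq ι]
    [AddCommGroup M] [TopologicalSpace M] [CompactSpace M] [MeasureSpace M] [BorelSpace M]
    {e : (ι → ℝ) → M} {i : ι} {s : Finset A} {u g : A → M → ℝ}
    (h : ∀ a ∈ s, IsWeakDeriv e i (u a) (g a)) :
    IsWeakDeriv e i (fun z => ∑ a ∈ s, u a z) (fun z => ∑ a ∈ s, g a z) := by
  classical
  induction s using Finset.induction_on with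
  | empty => exact isWeakDeriv_zero e i
  | insert a s ha ih =>
    simp only [Finset.sum_insert ha]
    exact isWeakDeriv_add (h a (Finset.mem_insert_self a s))
      (ih fun b hb => h b (Finset.mem_insert_of_mem hb))

/-- Every summand of B_τ[f] is a smooth function of the angle, handled by the product rule, times a
continuous function of the position, which ∂_θ does not see. -/
lemma isWeakDeriv_Bop_mul (p : Params) (f : H2 phaseCover) {u g : Phase → ℝ}
    (h : IsWeakDeriv phaseCover 2 u g) :
    IsWeakDeriv phaseCover 2 (fun z => Bop p f z * u z)
      (fun z => dBop p f z * u z + Bop p f z * g z) := by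
  have h1 := isWeakDeriv_sum (s := Finset.univ) fun a _ =>
    isWeakDeriv_two_mul_pos (phaseFS.isWeakDeriv_mul h (isTest_ang (contDiff_bA p a)))
      (chemC p (.inr a) f)
  convert h1 using 1
  · funext z
    rw [Bop_apply, Finset.sum_mul]
    exact Finset.sum_congr rfl fun a _ => by ring
  · funext z
    rw [Bop_apply, dBop_apply, Finset.sum_mul, Finset.sum_mul, ← Finset.sum_add_distrib]
    refine Finset.sum_congr rfl fun a _ => ?_
    rw [pderiv_two_ang (g' := dbA p a) (by simpa using hasDerivAt_bA p a z.2 0)]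
    ring

/-- The diffusion-transport operator with values in `L²`. -/
def Aop (p : Params) : H2 phaseCover →L[ℝ] L2 Phase :=
  p.sigX • (jet2 phaseCover 0 0 + jet2 phaseCover 1 1) + p.sigTh • jet2 phaseCover 2 2
    - p.lam • ((mulCL (liftAng (fun θ => v θ 0) (continuous_v 0))).comp (jet1 phaseCover 0)
      + (mulCL (liftAng (fun θ => v θ 1) (continuous_v 1))).comp (jet1 phaseCover 1))

lemma Aop_ae (p : Params) (f : H2 phaseCover) : Aop p f =ᵐ[volume] diffusionTransport p f := by
  set a := jet2 phaseCover 0 0 f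
  set b := jet2 phaseCover 1 1 f
  set c := jet2 phaseCover 2 2 f
  set m0 := mulCL (liftAng (fun θ => v θ 0) (continuous_v 0)) (jet1 phaseCover 0 f)
  set m1 := mulCL (liftAng (fun θ => v θ 1) (continuous_v 1)) (jet1 phaseCover 1 f)
  have h : Aop p f = p.sigX • (a + b) + p.sigTh • c - p.lam • (m0 + m1) := rfl
  rw [h]
  filter_upwards [Lp.coeFn_sub (p.sigX • (a + b) + p.sigTh • c) (p.lam • (m0 + m1)),
    Lp.coeFn_add (p.sigX • (a + b)) (p.sigTh • c), Lp.coeFn_smul p.sigX (a + b),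
    Lp.coeFn_smul p.sigTh c, Lp.coeFn_smul p.lam (m0 + m1), Lp.coeFn_add a b,
    Lp.coeFn_add m0 m1, coeFn_mulCL (liftAng (fun θ => v θ 0) (continuous_v 0)) (jet1 phaseCover 0 f),
    coeFn_mulCL (liftAng (fun θ => v θ 1) (continuous_v 1)) (jet1 phaseCover 1 f)]
    with z h1 h2 h3 h4 h5 h6 h7 h8 h9
  rw [h1, Pi.sub_apply, h2, Pi.add_apply, h3, h4, h5, Pi.smul_apply, Pi.smul_apply, Pi.smul_apply,
    h6, h7, Pi.add_apply, Pi.add_apply, h8, h9]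
  rfl

/-- The quadratic part `∂_θ(B_τ[f] g)`. -/
def Qop (p : Params) (f g : H2 phaseCover) : L2 Phase :=
  mulCL (dBop p f) (jet0 phaseCover g) + mulCL (Bop p f) (jet1 phaseCover 2 g)

/-- `F` with values in `L²`. -/
def Fop (p : Params) (f : H2 phaseCover) (χ : ℝ) : L2 Phase :=
  Aop p f - χ • ((1 / (2 * Real.pi)) • toL2 (dBop p f) + Qop p f f)

/-- The linearization with values in `L²`. -/
def Lop (p : Params) (χ : ℝ) : H2 phaseCover →L[ℝ] L2 Phase :=
  Aop p - (χ / (2 * Real.pi)) • toL2.comp (dBop p)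

lemma isWeakDeriv_one : IsWeakDeriv phaseCover 2 (fun _ => 1) (fun _ => 0) := by
  have h := phaseFS.isWeakDeriv_of_isTest (isTest_ang (g := fun _ => 1) contDiff_const) 2
  convert h using 1
  funext z
  rw [pderiv_two_ang (g := fun _ => 1) (g' := fun _ => 0)]
  exact hasDerivAt_const _ _

lemma weakDeriv_B {p : Params} (hg : 0 < p.gam) (hc : 0 < p.sigC) (f : H2 phaseCover) :
    weakDeriv phaseCover 2 (B p f) = toL2 (dBop p f) := by
  apply phaseFS.weakDeriv_eq
  refine isWeakDeriv_congr (u := fun z => Bop p f z * 1) (g := fun z => dBop p f z * 1 + Bop p f z * 0)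
    ?_ ?_ (isWeakDeriv_Bop_mul p f isWeakDeriv_one)
  · simpa using (B_ae hg hc f).symm
  · simpa using (coeFn_toL2 (dBop p f)).symm

lemma weakDeriv_B_mul {p : Params} (hg : 0 < p.gam) (hc : 0 < p.sigC) (f : H2 phaseCover) :
    weakDeriv phaseCover 2 (fun w => B p f w * (1 / (2 * Real.pi) + fn f w))
      = (1 / (2 * Real.pi)) • toL2 (dBop p f) + Qop p f f := by
  apply phaseFS.weakDeriv_eq
  have h1 := isWeakDeriv_smul (1 / (2 * Real.pi)) (isWeakDeriv_Bop_mul p f isWeakDeriv_one)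
  have h2 := isWeakDeriv_Bop_mul p f (weak1 f 2)
  refine isWeakDeriv_congr ?_ ?_ (isWeakDeriv_add h1 h2)
  · filter_upwards [B_ae hg hc f] with z hz
    simp only [Pi.add_apply, Pi.smul_apply, smul_eq_mul, hz]
    change _ + Bop p f z * fn f z = _
    ring
  · filter_upwards [Lp.coeFn_add ((1 / (2 * Real.pi)) • toL2 (dBop p f)) (Qop p f f),
      Lp.coeFn_smul (1 / (2 * Real.pi)) (toL2 (dBop p f)), coeFn_toL2 (dBop p f),
      Lp.coeFn_add (mulCL (dBop p f) (jet0 phaseCover f)) (mulCL (Bop p f) (jet1 phaseCover 2 f)),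
      coeFn_mulCL (dBop p f) (jet0 phaseCover f), coeFn_mulCL (Bop p f) (jet1 phaseCover 2 f)]
      with z h1 h2 h3 h4 h5 h6
    rw [h1]
    simp only [Pi.add_apply, h2, Pi.smul_apply, h3, Qop, h4, h5, h6, smul_eq_mul, mul_one, mul_zero,
      add_zero]

lemma F_ae {p : Params} (hg : 0 < p.gam) (hc : 0 < p.sigC) (f : H2 phaseCover) (χ : ℝ) :
    Fop p f χ =ᵐ[volume] F p f χ := by
  set w : L2 Phase := (1 / (2 * Real.pi)) • toL2 (dBop p f) + Qop p f f with hw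
  have h : Fop p f χ = Aop p f - χ • w := rfl
  rw [h]
  filter_upwards [Lp.coeFn_sub (Aop p f) (χ • w), Lp.coeFn_smul χ w, Aop_ae p f] with z h1 h2 h3
  rw [h1, Pi.sub_apply, h2, h3, F, weakDeriv_B_mul hg hc]
  rfl

lemma L_ae {p : Params} (hg : 0 < p.gam) (hc : 0 < p.sigC) (f : H2 phaseCover) (χ : ℝ) :
    Lop p χ f =ᵐ[volume] L p χ f := by
  set w : L2 Phase := toL2 (dBop p f) with hw
  have h : Lop p χ f = Aop p f - (χ / (2 * Real.pi)) • w := rfl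
  rw [h]
  filter_upwards [Lp.coeFn_sub (Aop p f) ((χ / (2 * Real.pi)) • w),
    Lp.coeFn_smul (χ / (2 * Real.pi)) w, Aop_ae p f] with z h1 h2 h3
  rw [h1, Pi.sub_apply, h2, h3, L, weakDeriv_B hg hc]
  rfl

end

end AntModel

/-! ### Equivariance of the operators under phase space symmetries. -/

namespace AntModel

noncomputable section

open scoped ComplexConjugate

namespace PhaseSymm

/-- The action of a symmetry on `H²`. -/
abbrev act (T : PhaseSymm) : H2 phaseCover →L[ℝ] H2 phaseCover := T.torus.pullH2 phaseFS

/-- The action of a symmetry on `L²`. -/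
abbrev pull (T : PhaseSymm) : L2 Phase →L[ℝ] L2 Phase := T.torus.pull

lemma sum_perm {W : Type} [AddCommMonoid W] (T : PhaseSymm) (F : Fin 2 → W) :
    F (T.pos.perm 0) + F (T.pos.perm 1) = F 0 + F 1 := by
  have := T.perm_bij.sum_comp F
  simpa [Fin.sum_univ_two] using this

lemma dens_pull (T : PhaseSymm) (u : L2 Phase) : dens (T.pull u) = T.pos.pull (dens u) := by
  have hu : Integrable (fun z : Pos × Ang => u z) ((volume : Measure Pos).prod volume) :=
    integrable_L2 u
  have h1 : ∀ᵐ z : Pos × Ang ∂((volume : Measure Pos).prod volume),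
      T.pull u z = u (T.torus.toFun z) := T.torus.coeFn_pull u
  have h2 := Measure.ae_ae_of_ae_prod h1
  have h3 := T.pos.mp.quasiMeasurePreserving.ae hu.prod_right_ae
  apply Lp.ext
  filter_upwards [coeFn_dens (T.pull u), T.pos.coeFn_pull (dens u),
    T.pos.mp.quasiMeasurePreserving.ae_eq_comp (coeFn_dens u), h2, h3] with x e1 e2 e3 e4 e5
  rw [e1, e2]
  simp only [Function.comp_apply] at e3
  rw [e3, integral_congr_ae e4]
  have hm : AEStronglyMeasurable (fun θ => u (T.pos.toFun x, θ)) (volume.map T.ang.toFun) := by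
    rw [T.ang.mp.map_eq]; exact e5.aestronglyMeasurable
  have h := integral_map T.ang.mp.measurable.aemeasurable hm
  rw [T.ang.mp.map_eq] at h
  exact h.symm

/-- The pulled-back field solves the equation with pulled-back density: the Laplacian is insensitive
to signed permutations of the coordinates. Uniqueness does the rest. -/
lemma chem_act {p : Params} (hg : 0 < p.gam) (hc : 0 < p.sigC) (T : PhaseSymm)
    (f : H2 phaseCover) : chem p (T.act f) = T.pos.pullH2 posFS (chem p f) := by
  apply chem_unique hg hc
  rw [isChem_iff_dens]
  have h := isChem_iff_dens.1 (isChem_chem hg hc f)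
  rw [TorusSymm.jet0_pullH2, TorusSymm.jet0_pullH2, TorusSymm.jet2_pullH2, TorusSymm.jet2_pullH2,
    T.pos.sgn_sq, T.pos.sgn_sq, one_smul, one_smul, T.dens_pull, ← h, map_sub, map_smul, map_smul,
    map_add, T.sum_perm (fun i => T.pos.pull (jet2 posCover i i (chem p f)))]

/-- The factor by which a symmetry acts on the derivatives of the chemical field. -/
def jetSgn (T : PhaseSymm) : Fin 2 ⊕ (Fin 2 × Fin 2) → ℝ
  | .inl i => T.pos.sgn i
  | .inr (i, j) => T.pos.sgn i * T.pos.sgn j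

/-- The permutation by which a symmetry acts on the derivatives of the chemical field. -/
def jetPerm (T : PhaseSymm) : Fin 2 ⊕ (Fin 2 × Fin 2) → Fin 2 ⊕ (Fin 2 × Fin 2) :=
  Sum.map T.pos.perm (Prod.map T.pos.perm T.pos.perm)

lemma jetPerm_bij (T : PhaseSymm) : Function.Bijective T.jetPerm :=
  Function.Bijective.sumMap T.perm_bij (T.perm_bij.prodMap T.perm_bij)

lemma chemC_act {p : Params} (hg : 0 < p.gam) (hc : 0 < p.sigC) (T : PhaseSymm)
    (a : Fin 2 ⊕ (Fin 2 × Fin 2)) (f : H2 phaseCover) (x : Pos) :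
    chemC p (.inr a) (T.act f) x = T.jetSgn a * chemC p (.inr (T.jetPerm a)) f (T.pos.toFun x) := by
  have h : (fun x => chemC p (.inr a) (T.act f) x) = fun x =>
      T.jetSgn a * chemC p (.inr (T.jetPerm a)) f (T.pos.toFun x) := by
    refine Continuous.ae_eq_iff_eq (volume : Measure Pos) (ContinuousMap.continuous _)
      (continuous_const.mul ((ContinuousMap.continuous _).comp T.pos.cont)) |>.1 ?_
    have h1 := coeFn_chemC hg hc (.inr a) (T.act f)
    rw [T.chem_act hg hc] at h1
    have h2 := T.pos.mp.quasiMeasurePreserving.ae_eq_comp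
      (coeFn_chemC hg hc (.inr (T.jetPerm a)) f)
    have h3 : jet posCover (.inr a) (T.pos.pullH2 posFS (chem p f))
        = T.jetSgn a • T.pos.pull (jet posCover (.inr (T.jetPerm a)) (chem p f)) := by
      rcases a with i | ⟨i, j⟩
      · exact TorusSymm.jet1_pullH2 _ _ _ _
      · exact TorusSymm.jet2_pullH2 _ _ _ _ _
    rw [h3] at h1
    filter_upwards [h1, h2, T.pos.coeFn_smul_pull (T.jetSgn a)
      (jet posCover (.inr (T.jetPerm a)) (chem p f))] with x e1 e2 e3
    simp only [Function.comp_apply] at e2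
    rw [e1, e3, ← e2]
    rfl
  exact congrFun h x

lemma bA_perm (T : PhaseSymm) (p : Params) (a) (θ : Ang) :
    bA p (T.jetPerm a) (T.ang.toFun θ) = T.ang.sgn * (T.jetSgn a * bA p a θ) := by
  rcases a with i | ⟨i, j⟩
  · exact T.vPerp_ang θ i
  · simp only [jetPerm, Sum.map_inr, Prod.map_apply, bA, T.vPerp_ang, T.v_ang, jetSgn]
    ring

lemma dbA_perm (T : PhaseSymm) (p : Params) (a) (θ : Ang) :
    dbA p (T.jetPerm a) (T.ang.toFun θ) = T.jetSgn a * dbA p a θ := by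
  rcases a with i | ⟨i, j⟩
  · simp only [jetPerm, Sum.map_inl, dbA, T.v_ang, jetSgn]
    ring
  · simp only [jetPerm, Sum.map_inr, Prod.map_apply, dbA, T.vPerp_ang, T.v_ang, jetSgn]
    linear_combination (p.tau * T.pos.sgn i * T.pos.sgn j * vPerp θ i * vPerp θ j) * T.ang.sgn_sq

/-- An angular reflection reverses v^⊥, and this is where the sign comes from. The derivative in θ
contributes the same sign again, so ∂_θ B_τ and the whole equation are genuinely equivariant. -/
lemma Bop_act {p : Params} (hg : 0 < p.gam) (hc : 0 < p.sigC) (T : PhaseSymm) (f : H2 phaseCover)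
    (z : Phase) : Bop p (T.act f) z = T.ang.sgn * Bop p f (T.torus.toFun z) := by
  rw [Bop_apply, Bop_apply, Finset.mul_sum]
  conv_rhs => rw [← T.jetPerm_bij.sum_comp]
  refine Finset.sum_congr rfl fun a _ => ?_
  rw [T.chemC_act hg hc, T.torus_apply, T.bA_perm]
  linear_combination (-(T.jetSgn a * bA p a z.2 *
    chemC p (.inr (T.jetPerm a)) f (T.pos.toFun z.1))) * T.ang.sgn_sq

lemma dBop_act {p : Params} (hg : 0 < p.gam) (hc : 0 < p.sigC) (T : PhaseSymm) (f : H2 phaseCover)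
    (z : Phase) : dBop p (T.act f) z = dBop p f (T.torus.toFun z) := by
  rw [dBop_apply, dBop_apply]
  conv_rhs => rw [← T.jetPerm_bij.sum_comp]
  refine Finset.sum_congr rfl fun a _ => ?_
  rw [T.chemC_act hg hc, T.torus_apply, T.dbA_perm]
  ring

lemma mulCL_pull (T : PhaseSymm) {c c' : C(Phase, ℝ)} {s : ℝ}
    (h : ∀ z, c' z = s * c (T.torus.toFun z)) (u : L2 Phase) :
    mulCL c' (T.pull u) = s • T.pull (mulCL c u) := by
  apply Lp.ext
  filter_upwards [coeFn_mulCL c' (T.pull u), T.torus.coeFn_pull u,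
    T.torus.coeFn_smul_pull s (mulCL c u),
    T.torus.mp.quasiMeasurePreserving.ae_eq_comp (coeFn_mulCL c u)] with z e1 e2 e3 e4
  simp only [Function.comp_apply] at e4
  rw [e1, e2, e3, e4, h]; ring

lemma toL2_pull (T : PhaseSymm) {c c' : C(Phase, ℝ)} (h : ∀ z, c' z = c (T.torus.toFun z)) :
    toL2 c' = T.pull (toL2 c) := by
  apply Lp.ext
  filter_upwards [coeFn_toL2 c', T.torus.coeFn_pull (toL2 c),
    T.torus.mp.quasiMeasurePreserving.ae_eq_comp (coeFn_toL2 c)] with z e1 e2 e3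
  simp only [Function.comp_apply] at e3
  rw [e1, e2, e3, h]

lemma jet1_act_castSucc (T : PhaseSymm) (i : Fin 2) (f : H2 phaseCover) :
    jet1 phaseCover i.castSucc (T.act f)
      = T.pos.sgn i • T.pull (jet1 phaseCover (T.pos.perm i).castSucc f) := by
  fin_cases i <;> exact TorusSymm.jet1_pullH2 _ _ _ _

lemma jet2_act_castSucc (T : PhaseSymm) (i : Fin 2) (f : H2 phaseCover) :
    jet2 phaseCover i.castSucc i.castSucc (T.act f)
      = T.pull (jet2 phaseCover (T.pos.perm i).castSucc (T.pos.perm i).castSucc f) := by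
  have h : jet2 phaseCover i.castSucc i.castSucc (T.act f) = (T.pos.sgn i * T.pos.sgn i) •
      T.pull (jet2 phaseCover (T.pos.perm i).castSucc (T.pos.perm i).castSucc f) := by
    fin_cases i <;> exact TorusSymm.jet2_pullH2 _ _ _ _ _
  rw [h, T.pos.sgn_sq, one_smul]

lemma jet1_act_two (T : PhaseSymm) (f : H2 phaseCover) :
    jet1 phaseCover 2 (T.act f) = T.ang.sgn • T.pull (jet1 phaseCover 2 f) :=
  TorusSymm.jet1_pullH2 _ _ _ _

lemma jet2_act_two (T : PhaseSymm) (f : H2 phaseCover) :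
    jet2 phaseCover 2 2 (T.act f) = T.pull (jet2 phaseCover 2 2 f) := by
  have h : jet2 phaseCover 2 2 (T.act f) = (T.ang.sgn * T.ang.sgn) •
      T.pull (jet2 phaseCover 2 2 f) := TorusSymm.jet2_pullH2 _ _ _ _ _
  rw [h, T.ang.sgn_sq, one_smul]

end PhaseSymm

/-- Multiplication by a component of `v_θ`. -/
def mulV (i : Fin 2) : L2 Phase →L[ℝ] L2 Phase :=
  mulCL (liftAng (fun θ => v θ i) (continuous_v i))

lemma Aop_apply (p : Params) (f : H2 phaseCover) : Aop p f =
    p.sigX • (jet2 phaseCover (Fin.castSucc 0) (Fin.castSucc 0) f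
      + jet2 phaseCover (Fin.castSucc 1) (Fin.castSucc 1) f) + p.sigTh • jet2 phaseCover 2 2 f
    - p.lam • (mulV 0 (jet1 phaseCover (Fin.castSucc 0) f)
      + mulV 1 (jet1 phaseCover (Fin.castSucc 1) f)) := rfl

namespace PhaseSymm

lemma mulV_act (T : PhaseSymm) (i : Fin 2) (u : L2 Phase) :
    mulV i (T.pos.sgn i • T.pull u) = T.pull (mulV (T.pos.perm i) u) := by
  rw [map_smul, mulV, T.mulCL_pull (c := liftAng (fun θ => v θ (T.pos.perm i)) (continuous_v _))
    (s := T.pos.sgn i), smul_smul, T.pos.sgn_sq, one_smul]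
  · rfl
  · intro z
    change v z.2 i = T.pos.sgn i * v (T.ang.toFun z.2) (T.pos.perm i)
    rw [T.v_ang]
    linear_combination (-(v z.2 i)) * T.pos.sgn_sq i

lemma Aop_act (T : PhaseSymm) (p : Params) (f : H2 phaseCover) :
    Aop p (T.act f) = T.pull (Aop p f) := by
  rw [Aop_apply, Aop_apply, jet2_act_castSucc, jet2_act_castSucc, jet2_act_two, jet1_act_castSucc,
    jet1_act_castSucc, mulV_act, mulV_act, map_sub, map_add, map_smul, map_smul, map_smul, map_add,
    map_add, T.sum_perm (fun i => T.pull (jet2 phaseCover i.castSucc i.castSucc f)),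
    T.sum_perm (fun i => T.pull (mulV i (jet1 phaseCover i.castSucc f)))]

lemma Qop_act {p : Params} (hg : 0 < p.gam) (hc : 0 < p.sigC) (T : PhaseSymm)
    (f g : H2 phaseCover) : Qop p (T.act f) (T.act g) = T.pull (Qop p f g) := by
  rw [Qop, Qop, TorusSymm.jet0_pullH2, jet1_act_two, map_smul,
    T.mulCL_pull (c := dBop p f) (s := 1) (fun z => by rw [one_mul, T.dBop_act hg hc]),
    T.mulCL_pull (T.Bop_act hg hc f), smul_smul, T.ang.sgn_sq, one_smul, one_smul, map_add]

lemma toL2_dBop_act {p : Params} (hg : 0 < p.gam) (hc : 0 < p.sigC) (T : PhaseSymm)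
    (f : H2 phaseCover) : toL2 (dBop p (T.act f)) = T.pull (toL2 (dBop p f)) :=
  T.toL2_pull (T.dBop_act hg hc f)

lemma Fop_act {p : Params} (hg : 0 < p.gam) (hc : 0 < p.sigC) (T : PhaseSymm)
    (f : H2 phaseCover) (χ : ℝ) : Fop p (T.act f) χ = T.pull (Fop p f χ) := by
  simp only [Fop, T.Aop_act, T.Qop_act hg hc, T.toL2_dBop_act hg hc, map_sub, map_smul, map_add]

end PhaseSymm

end

end AntModel

namespace AntModel

noncomputable section

open scoped ComplexConjugate

/-! ## Periodic solutions of a second order linear equation -/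

/-- `∫_0^∞ e^{-κ t} h(s + t) dt`. -/
def expConv (κ : ℝ) (h : ℝ → ℂ) (s : ℝ) : ℂ := ∫ t in Set.Ioi (0 : ℝ), Real.exp (-κ * t) * h (s + t)

lemma integrableOn_exp_mul {κ C : ℝ} (hκ : 0 < κ) {h : ℝ → ℂ} (hh : Continuous h)
    (hC : ∀ s, ‖h s‖ ≤ C) (s : ℝ) :
    IntegrableOn (fun t : ℝ => (Real.exp (-κ * t) : ℂ) * h t) (Set.Ioi s) := by
  have h1 : IntegrableOn (fun t : ℝ => (Real.exp (-κ * t) : ℂ)) (Set.Ioi s) :=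
    (integrableOn_exp_mul_Ioi (neg_lt_zero.2 hκ) s).ofReal
  exact h1.mul_bdd hh.aestronglyMeasurable (Filter.Eventually.of_forall hC)

lemma expConv_eq {κ : ℝ} (h : ℝ → ℂ) (s : ℝ) :
    expConv κ h s = Real.exp (κ * s) * ∫ t in Set.Ioi s, Real.exp (-κ * t) * h t := by
  rw [expConv, ← integral_const_mul]
  have := (measurePreserving_add_left volume s).setIntegral_preimage_emb
    (MeasurableEquiv.addLeft s).measurableEmbedding
    (fun t => (Real.exp (κ * s) : ℂ) * (Real.exp (-κ * t) * h t)) (Set.Ioi s)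
  rw [Set.preimage_const_add_Ioi, sub_self] at this
  rw [← this]
  refine setIntegral_congr_fun measurableSet_Ioi fun t _ => ?_
  rw [← mul_assoc, ← Complex.ofReal_mul, ← Real.exp_add]
  congr 3
  ring

lemma hasDerivAt_expConv {κ C : ℝ} (hκ : 0 < κ) {h : ℝ → ℂ} (hh : Continuous h)
    (hC : ∀ s, ‖h s‖ ≤ C) (s : ℝ) :
    HasDerivAt (expConv κ h) (κ * expConv κ h s - h s) s := by
  have hc : Continuous fun t : ℝ => (Real.exp (-κ * t) : ℂ) * h t := by fun_prop
  have h1 : ∀ s : ℝ, ∫ t in Set.Ioi s, (Real.exp (-κ * t) : ℂ) * h t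
      = (∫ t in Set.Ioi 0, (Real.exp (-κ * t) : ℂ) * h t)
        - ∫ t in (0 : ℝ)..s, (Real.exp (-κ * t) : ℂ) * h t := fun s => by
    rw [← intervalIntegral.integral_Ioi_sub_Ioi' (integrableOn_exp_mul hκ hh hC 0)
      (integrableOn_exp_mul hκ hh hC s)]
    ring
  have h2 : HasDerivAt (fun s : ℝ => ∫ t in Set.Ioi s, (Real.exp (-κ * t) : ℂ) * h t)
      (-((Real.exp (-κ * s) : ℂ) * h s)) s := by
    have := (intervalIntegral.integral_hasDerivAt_right (hc.intervalIntegrable 0 s)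
      hc.aestronglyMeasurable.stronglyMeasurableAtFilter hc.continuousAt).const_sub
        (∫ t in Set.Ioi 0, (Real.exp (-κ * t) : ℂ) * h t)
    exact this.congr_of_eventuallyEq (Filter.Eventually.of_forall h1)
  have h3 : HasDerivAt (fun s : ℝ => (Real.exp (κ * s) : ℂ)) (κ * Real.exp (κ * s) : ℝ) s := by
    have := ((hasDerivAt_id' s).const_mul κ).exp
    exact (this.congr_deriv (by ring)).ofReal_comp
  refine ((h3.mul h2).congr_deriv ?_).congr_of_eventuallyEq
    (Filter.Eventually.of_forall (expConv_eq h))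
  rw [expConv_eq]
  have h4 : (Real.exp (κ * s) : ℂ) * (Real.exp (-κ * s) : ℂ) = 1 := by
    rw [← Complex.ofReal_mul, ← Real.exp_add]; simp
  push_cast at h4 ⊢
  linear_combination (-(h s)) * h4

lemma norm_expConv_le {κ C : ℝ} (hκ : 0 < κ) {h : ℝ → ℂ} (hC : ∀ s, ‖h s‖ ≤ C) (s : ℝ) :
    ‖expConv κ h s‖ ≤ C / κ := by
  have h1 : IntegrableOn (fun t : ℝ => Real.exp (-κ * t) * C) (Set.Ioi 0) :=
    (integrableOn_exp_mul_Ioi (neg_lt_zero.2 hκ) 0).mul_const C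
  refine (norm_integral_le_of_norm_le h1 (Filter.Eventually.of_forall fun t => ?_)).trans ?_
  · rw [norm_mul, Complex.norm_real, Real.norm_of_nonneg (Real.exp_nonneg _)]
    exact mul_le_mul_of_nonneg_left (hC _) (Real.exp_nonneg _)
  · rw [integral_mul_const, integral_exp_mul_Ioi (neg_lt_zero.2 hκ)]
    apply le_of_eq
    simp; field_simp

lemma expConv_sub {κ C C' : ℝ} (hκ : 0 < κ) {h h' : ℝ → ℂ} (hh : Continuous h)
    (hh' : Continuous h') (hC : ∀ s, ‖h s‖ ≤ C) (hC' : ∀ s, ‖h' s‖ ≤ C') (s : ℝ) :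
    expConv κ (fun t => h t - h' t) s = expConv κ h s - expConv κ h' s := by
  rw [expConv_eq, expConv_eq, expConv_eq, ← mul_sub,
    ← integral_sub (integrableOn_exp_mul hκ hh hC s) (integrableOn_exp_mul hκ hh' hC' s)]
  simp only [mul_sub]

/-- The bounded solution `v` of `c v - σ v'' = h` with `c = σ κ²`. -/
def helm (σ κ : ℝ) (h : ℝ → ℂ) (s : ℝ) : ℂ :=
  ((2 * κ * σ)⁻¹ : ℝ) * (expConv κ h s + expConv κ (fun t => h (-t)) (-s))

/-- Its derivative. -/
def helmD (σ κ : ℝ) (h : ℝ → ℂ) (s : ℝ) : ℂ :=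
  ((2 * σ)⁻¹ : ℝ) * (expConv κ h s - expConv κ (fun t => h (-t)) (-s))

section Helm

variable {σ κ C : ℝ} (hσ : 0 < σ) (hκ : 0 < κ) {h : ℝ → ℂ} (hh : Continuous h)
  (hC : ∀ s, ‖h s‖ ≤ C)

include hσ hκ hh hC

lemma hasDerivAt_helm (s : ℝ) : HasDerivAt (helm σ κ h) (helmD σ κ h s) s := by
  have h1 := hasDerivAt_expConv hκ hh hC s
  have h2 := (hasDerivAt_expConv hκ (hh.comp continuous_neg) (fun s => hC (-s)) (-s)).scomp s
    (hasDerivAt_neg s)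
  refine ((h1.fun_add h2).const_mul (((2 * κ * σ : ℝ)⁻¹ : ℝ) : ℂ)).congr_deriv ?_
  have h3 : (κ : ℂ) ≠ 0 := by exact_mod_cast hκ.ne'
  have h4 : (σ : ℂ) ≠ 0 := by exact_mod_cast hσ.ne'
  simp only [helmD, Function.comp_def, neg_neg, neg_smul, one_smul]
  push_cast
  field_simp
  ring

lemma hasDerivAt_helmD (s : ℝ) :
    HasDerivAt (helmD σ κ h) (((σ * κ ^ 2 : ℝ) * helm σ κ h s - h s) / σ) s := by
  have h1 := hasDerivAt_expConv hκ hh hC s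
  have h2 := (hasDerivAt_expConv hκ (hh.comp continuous_neg) (fun s => hC (-s)) (-s)).scomp s
    (hasDerivAt_neg s)
  refine ((h1.fun_sub h2).const_mul (((2 * σ : ℝ)⁻¹ : ℝ) : ℂ)).congr_deriv ?_
  have h3 : (κ : ℂ) ≠ 0 := by exact_mod_cast hκ.ne'
  have h4 : (σ : ℂ) ≠ 0 := by exact_mod_cast hσ.ne'
  simp only [helm, Function.comp_def, neg_neg, neg_smul, one_smul]
  push_cast
  field_simp
  ring

omit hh in
lemma norm_helm_le (s : ℝ) : ‖helm σ κ h s‖ ≤ C / (σ * κ ^ 2) := by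
  have h1 := norm_expConv_le hκ hC s
  have h2 := norm_expConv_le hκ (h := fun t => h (-t)) (fun s => hC (-s)) (-s)
  have h3 : ‖(((2 * κ * σ)⁻¹ : ℝ) : ℂ)‖ = (2 * κ * σ)⁻¹ := by
    rw [Complex.norm_real, Real.norm_of_nonneg (by positivity)]
  rw [helm, norm_mul, h3]
  calc _ ≤ (2 * κ * σ)⁻¹ * (C / κ + C / κ) :=
        mul_le_mul_of_nonneg_left ((norm_add_le _ _).trans (add_le_add h1 h2)) (by positivity)
    _ = _ := by field_simp; ring

lemma helm_sub {h' : ℝ → ℂ} {C' : ℝ} (hh' : Continuous h') (hC' : ∀ s, ‖h' s‖ ≤ C') (s : ℝ) :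
    helm σ κ (fun t => h t - h' t) s = helm σ κ h s - helm σ κ h' s := by
  rw [helm, expConv_sub hκ hh hh' hC hC', helm, helm,
    expConv_sub hκ (h := fun t => h (-t)) (h' := fun t => h' (-t)) (by fun_prop) (by fun_prop)
      (fun s => hC (-s)) (fun s => hC' (-s))]
  ring

end Helm

lemma helm_shift (σ κ : ℝ) (h : ℝ → ℂ) (a s : ℝ) :
    helm σ κ (fun t => h (t + a)) s = helm σ κ h (s + a) := by
  simp only [helm, expConv]
  congr 2
  · congr 1; funext t; congr 2; ring
  · congr 1; funext t; congr 2; ring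

/-- `u` is a `C²` solution of `-M u + σ u'' = g`. -/
def IsSol (σ : ℝ) (M g u : ℝ → ℂ) : Prop :=
  ContDiff ℝ 2 u ∧ ∀ s, -M s * u s + σ * iteratedDeriv 2 u s = g s

lemma isSol_of_hasDerivAt {σ : ℝ} (hσ : 0 < σ) {M g u u' : ℝ → ℂ} (hM : Continuous M)
    (hg : Continuous g) (h1 : ∀ s, HasDerivAt u (u' s) s)
    (h2 : ∀ s, HasDerivAt u' ((M s * u s + g s) / σ) s) : IsSol σ M g u := by
  have e1 : deriv u = u' := funext fun s => (h1 s).deriv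
  have e2 : deriv u' = fun s => (M s * u s + g s) / σ := funext fun s => (h2 s).deriv
  have hu : Continuous u := continuous_iff_continuousAt.2 fun s => (h1 s).continuousAt
  refine ⟨?_, fun s => ?_⟩
  · rw [show (2 : WithTop ℕ∞) = 1 + 1 by norm_num, contDiff_succ_iff_deriv]
    refine ⟨fun s => (h1 s).differentiableAt, by simp, ?_⟩
    rw [e1, contDiff_one_iff_deriv, e2]
    exact ⟨fun s => (h2 s).differentiableAt, by fun_prop⟩
  · rw [iteratedDeriv_succ, iteratedDeriv_one, e1, e2]
    have h4 : (σ : ℂ) ≠ 0 := by exact_mod_cast hσ.ne'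
    field_simp
    ring

lemma IsSol.deriv2 {σ : ℝ} (hσ : 0 < σ) {M g u : ℝ → ℂ} (h : IsSol σ M g u) (s : ℝ) :
    HasDerivAt (deriv u) ((M s * u s + g s) / σ) s := by
  have h4 : (σ : ℂ) ≠ 0 := by exact_mod_cast hσ.ne'
  have e : (M s * u s + g s) / σ = iteratedDeriv 2 u s := by
    rw [← h.2 s]; field_simp; ring
  rw [e, iteratedDeriv_succ, iteratedDeriv_one]
  have h1 : ContDiff ℝ 1 (deriv u) := by
    have := h.1
    rw [show (2 : WithTop ℕ∞) = 1 + 1 by norm_num, contDiff_succ_iff_deriv] at this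
    exact this.2.2
  exact (h1.differentiable (by norm_num) s).hasDerivAt

lemma IsSol.deriv1 {σ : ℝ} {M g u : ℝ → ℂ} (h : IsSol σ M g u) (s : ℝ) :
    HasDerivAt u (deriv u s) s := (h.1.differentiable (by norm_num) s).hasDerivAt

/-- Bootstrapping: the equation expresses u'' through u and smooth data, so u and u' gain one
derivative at each step. -/
lemma IsSol.contDiff {σ : ℝ} (hσ : 0 < σ) {M g u : ℝ → ℂ} (h : IsSol σ M g u)
    (hM : ContDiff ℝ ∞ M) (hg : ContDiff ℝ ∞ g) : ContDiff ℝ ∞ u := by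
  rw [contDiff_infty]
  have e2 : deriv (deriv u) = fun s => (M s * u s + g s) / σ :=
    funext fun s => (h.deriv2 hσ s).deriv
  have key : ∀ n : ℕ, ContDiff ℝ n u ∧ ContDiff ℝ n (deriv u) := fun n => by
    induction n with
    | zero =>
      have h1 : Continuous u := h.1.continuous
      have h2 : Continuous (deriv u) :=
        continuous_iff_continuousAt.2 fun s => (h.deriv2 hσ s).continuousAt
      exact ⟨contDiff_zero.2 h1, contDiff_zero.2 h2⟩
    | succ n ih =>
      refine ⟨?_, ?_⟩
      · push_cast
        rw [contDiff_succ_iff_deriv]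
        exact ⟨fun s => (h.deriv1 s).differentiableAt, by simp, ih.2⟩
      · push_cast
        rw [contDiff_succ_iff_deriv, e2]
        exact ⟨fun s => (h.deriv2 hσ s).differentiableAt, by simp,
          (((hM.of_le (by exact_mod_cast le_top)).mul ih.1).add
            (hg.of_le (by exact_mod_cast le_top))).div_const _⟩
  exact fun n => (key n).1

open scoped BoundedContinuousFunction in
/-- Existence of a periodic solution, by a contraction argument. -/
lemma exists_isSol {σ m β T Cg : ℝ} (hσ : 0 < σ) (hm : 0 < m) {M g : ℝ → ℂ} (hM : Continuous M)
    (hg : Continuous g) (hMre : ∀ s, (M s).re = m) (hMim : ∀ s, |(M s).im| ≤ β)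
    (hCg : ∀ s, ‖g s‖ ≤ Cg) (hMT : Function.Periodic M T) (hgT : Function.Periodic g T) :
    ∃ u, Function.Periodic u T ∧ IsSol σ M g u := by
  -- The equation is rewritten as c u − σ u'' = (c − M) u − g. The bounded inverse of c − σ ∂² has
  -- norm at most 1/c, so a contraction needs sup |c − M| < c. This choice gives c m = m² + β²,
  -- hence |c − M|² ≤ (c − m)² + β² = c² − (m² + β²).
  set c : ℝ := (m ^ 2 + β ^ 2) / m with hc
  have hβ : 0 ≤ β := (abs_nonneg _).trans (hMim 0)
  have hcm : c * m = m ^ 2 + β ^ 2 := by rw [hc]; field_simp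
  have hc0 : 0 < c := by positivity
  set ρ : ℝ := Real.sqrt (c ^ 2 - (m ^ 2 + β ^ 2)) with hρ
  have hcle : m ≤ c := by
    rw [hc, le_div_iff₀ hm]; nlinarith
  have hnn : 0 ≤ c ^ 2 - (m ^ 2 + β ^ 2) := by nlinarith
  have hρc : ρ < c := by
    rw [hρ, Real.sqrt_lt' hc0]; nlinarith
  have hρ0 : 0 ≤ ρ := Real.sqrt_nonneg _
  have hcM : ∀ s, ‖(c : ℂ) - M s‖ ≤ ρ := fun s => by
    rw [Complex.norm_def, hρ]
    apply Real.sqrt_le_sqrt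
    rw [Complex.normSq_apply]
    simp only [Complex.sub_re, Complex.sub_im, Complex.ofReal_re, Complex.ofReal_im, hMre]
    have := sq_abs (M s).im
    have := hMim s
    have := abs_nonneg (M s).im
    nlinarith
  set κ : ℝ := Real.sqrt (c / σ) with hκdef
  have hκ : 0 < κ := Real.sqrt_pos.2 (by positivity)
  have hκ2 : σ * κ ^ 2 = c := by rw [hκdef, Real.sq_sqrt (by positivity)]; field_simp
  let rhs : (ℝ →ᵇ ℂ) → ℝ → ℂ := fun u s => ((c : ℂ) - M s) * u s - g s
  have rhs_cont : ∀ u, Continuous (rhs u) := fun u =>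
    ((continuous_const.sub hM).mul u.continuous).sub hg
  have rhs_bdd : ∀ u s, ‖rhs u s‖ ≤ ρ * ‖u‖ + Cg := fun u s => by
    refine (norm_sub_le _ _).trans (add_le_add ?_ (hCg s))
    rw [norm_mul]
    exact mul_le_mul (hcM s) (u.norm_coe_le_norm s) (norm_nonneg _) hρ0
  let Tm : (ℝ →ᵇ ℂ) → (ℝ →ᵇ ℂ) := fun u =>
    BoundedContinuousFunction.ofNormedAddCommGroup (helm σ κ (rhs u))
      (continuous_iff_continuousAt.2 fun s =>
        (hasDerivAt_helm hσ hκ (rhs_cont u) (rhs_bdd u) s).continuousAt) _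
      (norm_helm_le hσ hκ (rhs_bdd u))
  have hTm : ∀ u s, Tm u s = helm σ κ (rhs u) s := fun u s => rfl
  have hcontr : ContractingWith (Real.toNNReal (ρ / c)) Tm := by
    refine ⟨?_, ?_⟩
    · rw [Real.toNNReal_lt_one]; exact (div_lt_one hc0).2 hρc
    · refine LipschitzWith.of_dist_le_mul fun u w => ?_
      rw [dist_eq_norm, dist_eq_norm]
      refine (BoundedContinuousFunction.norm_le (by positivity)).2 fun s => ?_
      rw [BoundedContinuousFunction.coe_sub, Pi.sub_apply, hTm, hTm,
        ← helm_sub hσ hκ (rhs_cont u) (rhs_bdd u) (rhs_cont w) (rhs_bdd w)]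
      refine (norm_helm_le (C := ρ * ‖u - w‖) hσ hκ (fun t => ?_) s).trans ?_
      · have : rhs u t - rhs w t = ((c : ℂ) - M t) * (u - w) t := by
          simp only [rhs, BoundedContinuousFunction.coe_sub, Pi.sub_apply]; ring
        rw [this, norm_mul]
        exact mul_le_mul (hcM t) ((u - w).norm_coe_le_norm t) (norm_nonneg _) hρ0
      · rw [hκ2]
        apply le_of_eq
        rw [Real.coe_toNNReal _ (by positivity)]
        ring
  obtain ⟨u, hu, huniq⟩ : ∃ u, Tm u = u ∧ ∀ w, Tm w = w → w = u :=
    ⟨hcontr.fixedPoint Tm, hcontr.fixedPoint_isFixedPt,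
      fun w hw => hcontr.fixedPoint_unique hw⟩
  -- Periodicity: the translate of u by T is also a fixed point, and fixed points are unique among
  -- bounded continuous functions.
  refine ⟨u, fun s => ?_, ?_⟩
  · let w : ℝ →ᵇ ℂ := u.compContinuous ⟨fun s => s + T, by fun_prop⟩
    have hw : Tm w = w := by
      ext s
      have e1 : rhs w = fun t => rhs u (t + T) := by
        funext t
        simp only [rhs, w, BoundedContinuousFunction.compContinuous_apply, ContinuousMap.coe_mk,
          hMT t, hgT t]
      rw [hTm, e1, helm_shift, ← hTm, hu]
      rfl
    exact congrArg (fun f : ℝ →ᵇ ℂ => f s) (huniq w hw)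
  · have hus : ∀ s, u s = helm σ κ (rhs u) s := fun s => by rw [← hTm, hu]
    have hue : (u : ℝ → ℂ) = helm σ κ (rhs u) := funext hus
    refine isSol_of_hasDerivAt (u' := helmD σ κ (rhs u)) hσ hM hg (fun s => ?_) (fun s => ?_)
    · have := hasDerivAt_helm hσ hκ (rhs_cont u) (rhs_bdd u) s
      rwa [← hue] at this
    · refine (hasDerivAt_helmD hσ hκ (rhs_cont u) (rhs_bdd u) s).congr_deriv ?_
      rw [hκ2, ← hus]
      simp only [rhs]
      congr 1
      ring

end

end AntModel

/-! ### Maximum principle, uniqueness and symmetries of periodic solutions. -/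

namespace AntModel

noncomputable section

open scoped ComplexConjugate

/-- If the second derivative were positive, the maximum would also be a local minimum. Then f would
be locally constant and its second derivative would be 0. -/
lemma deriv2_nonpos_of_max {f f' : ℝ → ℝ} {f2 s0 : ℝ} (h1 : ∀ s, HasDerivAt f (f' s) s)
    (h2 : HasDerivAt f' f2 s0) (hmax : ∀ s, f s ≤ f s0) : f2 ≤ 0 := by
  by_contra! hpos
  have e1 : deriv f = f' := funext fun s => (h1 s).deriv
  have hlm : IsLocalMax f s0 := Filter.Eventually.of_forall hmax
  have hmin : IsLocalMin f s0 := by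
    refine isLocalMin_of_deriv_deriv_pos ?_ hlm.deriv_eq_zero (h1 s0).continuousAt
    rw [e1, h2.deriv]; exact hpos
  have hconst : f =ᶠ[nhds s0] fun _ => f s0 := by
    filter_upwards [hmin] with s hs
    exact le_antisymm (hmax s) hs
  have h3 := hconst.deriv
  rw [e1] at h3
  have h4 := h3.deriv_eq
  rw [h2.deriv] at h4
  simp at h4
  exact hpos.ne' h4

lemma exists_max_of_periodic {f : ℝ → ℝ} (hf : Continuous f) {T : ℝ} (hT : 0 < T)
    (hp : Function.Periodic f T) : ∃ s0, ∀ s, f s ≤ f s0 := by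
  obtain ⟨s0, _, h0⟩ := isCompact_Icc.exists_isMaxOn (Set.nonempty_Icc.2 hT.le) hf.continuousOn
  refine ⟨s0, fun s => ?_⟩
  obtain ⟨y, hy, hys⟩ := hp.exists_mem_Ico₀ hT s
  rw [hys]
  exact h0 ⟨hy.1, hy.2.le⟩

lemma exists_norm_bound_of_periodic {f : ℝ → ℂ} (hf : Continuous f) {T : ℝ} (hT : 0 < T)
    (hp : Function.Periodic f T) : ∃ C, 0 ≤ C ∧ ∀ s, ‖f s‖ ≤ C := by
  obtain ⟨s0, h⟩ := exists_max_of_periodic hf.norm hT (fun s => by simp [hp s])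
  exact ⟨_, norm_nonneg _, h⟩

/-- The maximum principle. -/
lemma IsSol.norm_le {σ m C T : ℝ} (hσ : 0 < σ) (hm : 0 < m) (hT : 0 < T) {M g u : ℝ → ℂ}
    (h : IsSol σ M g u) (hMre : ∀ s, m ≤ (M s).re) (hC : ∀ s, ‖g s‖ ≤ C)
    (hu : Function.Periodic u T) (s : ℝ) : ‖u s‖ ≤ C / m := by
  have hre : ∀ s, HasDerivAt (fun s => (u s).re) (deriv u s).re s := fun s => by
    have := (Complex.reCLM.hasFDerivAt.comp_hasDerivAt s (h.deriv1 s)); exact this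
  have him : ∀ s, HasDerivAt (fun s => (u s).im) (deriv u s).im s := fun s => by
    have := (Complex.imCLM.hasFDerivAt.comp_hasDerivAt s (h.deriv1 s)); exact this
  have hre2 : ∀ s, HasDerivAt (fun s => (deriv u s).re) ((M s * u s + g s) / σ).re s := fun s => by
    have := (Complex.reCLM.hasFDerivAt.comp_hasDerivAt s (h.deriv2 hσ s)); exact this
  have him2 : ∀ s, HasDerivAt (fun s => (deriv u s).im) ((M s * u s + g s) / σ).im s := fun s => by
    have := (Complex.imCLM.hasFDerivAt.comp_hasDerivAt s (h.deriv2 hσ s)); exact this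
  have hn : ∀ s, Complex.normSq (u s) = (u s).re * (u s).re + (u s).im * (u s).im :=
    fun s => Complex.normSq_apply _
  have hcont : Continuous fun s => (u s).re * (u s).re + (u s).im * (u s).im := by
    have := h.1.continuous
    fun_prop
  obtain ⟨s0, hs0⟩ := exists_max_of_periodic hcont hT (fun s => by simp [hu s])
  -- At a maximum of |u|² the second derivative 2|u'|² + 2 Re(ū u'') is nonpositive. Inserting σ u''
  -- = M u + g gives Re M |u|² ≤ −Re(ū g) ≤ |u| |g|, with a bound independent of σ and of Im M.
  have hd := deriv2_nonpos_of_max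
    (fun s => ((hre s).fun_mul (hre s)).fun_add ((him s).fun_mul (him s)))
    ((((hre2 s0).fun_mul (hre s0)).fun_add ((hre s0).fun_mul (hre2 s0))).fun_add
      (((him2 s0).fun_mul (him s0)).fun_add ((him s0).fun_mul (him2 s0)))) hs0
  simp only [Complex.div_ofReal_re, Complex.div_ofReal_im, Complex.add_re, Complex.add_im,
    Complex.mul_re, Complex.mul_im] at hd
  set a := (u s0).re
  set b := (u s0).im
  set A := (M s0).re
  set B := (M s0).im
  have key : A * (a * a + b * b) + (a * (g s0).re + b * (g s0).im) ≤ 0 := by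
    have e : σ * ((a * ((A * a - B * b + (g s0).re) / σ)) + b * ((A * b + B * a + (g s0).im) / σ))
        = A * (a * a + b * b) + (a * (g s0).re + b * (g s0).im) := by
      field_simp
      ring
    rw [← e]
    apply mul_nonpos_of_nonneg_of_nonpos hσ.le
    nlinarith [mul_self_nonneg (deriv u s0).re, mul_self_nonneg (deriv u s0).im]
  have hcs : -(a * (g s0).re + b * (g s0).im) ≤ ‖u s0‖ * ‖g s0‖ := by
    have := Complex.abs_re_le_norm (conj (u s0) * g s0)
    rw [norm_mul, Complex.norm_conj, Complex.mul_re, Complex.conj_re, Complex.conj_im] at this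
    have := neg_abs_le (a * (g s0).re - -b * (g s0).im)
    linarith
  have hsq : a * a + b * b = ‖u s0‖ ^ 2 := by
    rw [Complex.sq_norm, Complex.normSq_apply]
  have hle : m * ‖u s0‖ ≤ C := by
    rcases (norm_nonneg (u s0)).eq_or_lt with h0 | h0
    · rw [← h0, mul_zero]; exact (norm_nonneg _).trans (hC s0)
    · have h5 : m * ‖u s0‖ ^ 2 ≤ ‖u s0‖ * C := by
        have := mul_le_mul_of_nonneg_right (hMre s0) (sq_nonneg ‖u s0‖)
        have := mul_le_mul_of_nonneg_left (hC s0) h0.le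
        rw [hsq] at key
        linarith
      have : ‖u s0‖ * (m * ‖u s0‖) ≤ ‖u s0‖ * C := by linarith [h5]
      exact le_of_mul_le_mul_left this h0
  have h6 : ‖u s‖ ≤ ‖u s0‖ := by
    have h7 := hs0 s
    rw [← Complex.normSq_apply, ← Complex.normSq_apply, ← Complex.sq_norm, ← Complex.sq_norm] at h7
    exact le_of_sq_le_sq (by simpa using h7) (norm_nonneg _)
  rw [le_div_iff₀ hm]
  nlinarith

lemma IsSol.sub {σ : ℝ} {M g g' u u' : ℝ → ℂ} (h : IsSol σ M g u) (h' : IsSol σ M g' u') :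
    IsSol σ M (fun s => g s - g' s) (fun s => u s - u' s) := by
  refine ⟨h.1.sub h'.1, fun s => ?_⟩
  have e : iteratedDeriv 2 (fun s => u s - u' s) s = iteratedDeriv 2 u s - iteratedDeriv 2 u' s :=
    iteratedDeriv_sub h.1.contDiffAt h'.1.contDiffAt
  rw [e]; beta_reduce; rw [← h.2 s, ← h'.2 s]; ring

lemma IsSol.const_mul {σ : ℝ} {M g u : ℝ → ℂ} (h : IsSol σ M g u) (c : ℂ) :
    IsSol σ M (fun s => c * g s) (fun s => c * u s) := by
  refine ⟨contDiff_const.mul h.1, fun s => ?_⟩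
  have e : iteratedDeriv 2 (fun s => c * u s) s = c * iteratedDeriv 2 u s :=
    iteratedDeriv_const_mul_field c u
  rw [e]; beta_reduce; rw [← h.2 s]; ring

lemma IsSol.unique {σ m T : ℝ} (hσ : 0 < σ) (hm : 0 < m) (hT : 0 < T) {M g u u' : ℝ → ℂ}
    (h : IsSol σ M g u) (h' : IsSol σ M g u') (hMre : ∀ s, m ≤ (M s).re)
    (hu : Function.Periodic u T) (hu' : Function.Periodic u' T) : u = u' := by
  funext s
  have := (h.sub h').norm_le hσ hm hT (C := 0) hMre (by simp)
    (fun s => by simp [hu s, hu' s]) s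
  rw [zero_div, norm_le_zero_iff, sub_eq_zero] at this
  exact this

lemma IsSol.comp_add {σ : ℝ} {M g u : ℝ → ℂ} (h : IsSol σ M g u) (a : ℝ) :
    IsSol σ (fun s => M (s + a)) (fun s => g (s + a)) (fun s => u (s + a)) := by
  refine ⟨h.1.comp (contDiff_id.add contDiff_const), fun s => ?_⟩
  have e := congrFun (iteratedDeriv_comp_add_const 2 u a) s
  rw [e]; exact h.2 _

lemma IsSol.comp_const_sub {σ : ℝ} {M g u : ℝ → ℂ} (h : IsSol σ M g u) (a : ℝ) :
    IsSol σ (fun s => M (a - s)) (fun s => g (a - s)) (fun s => u (a - s)) := by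
  refine ⟨h.1.comp (contDiff_const.sub contDiff_id), fun s => ?_⟩
  have e := congrFun (iteratedDeriv_comp_const_sub 2 u a) s
  rw [e]; simpa using h.2 (a - s)

lemma IsSol.conj {σ : ℝ} {M g u : ℝ → ℂ} (h : IsSol σ M g u) :
    IsSol σ (fun s => conj (M s)) (fun s => conj (g s)) (fun s => conj (u s)) := by
  have hc : ContDiff ℝ 2 fun s => conj (u s) := Complex.conjCLE.contDiff.comp h.1
  refine ⟨hc, fun s => ?_⟩
  have e : iteratedDeriv 2 (fun s => conj (u s)) s = conj (iteratedDeriv 2 u s) := by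
    have := Complex.conjCLE.toContinuousLinearMap.iteratedFDeriv_comp_left
      (h.1.contDiffAt (x := s)) (i := 2) le_rfl
    have h2 := congrArg (fun T => T (fun _ => (1 : ℝ))) this
    exact h2
  rw [e]; beta_reduce; rw [← h.2 s]; simp

/-- Self-adjointness (for the bilinear pairing) over a period. -/
lemma integral_pairing {T : ℝ} {u φ : ℝ → ℂ} (hu : ContDiff ℝ 2 u) (hφ : ContDiff ℝ 2 φ)
    (hup : Function.Periodic u T) (hφp : Function.Periodic φ T) :
    ∫ s in (0 : ℝ)..T, iteratedDeriv 2 u s * φ s = ∫ s in (0 : ℝ)..T, u s * iteratedDeriv 2 φ s := by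
  have d1 : ∀ {w : ℝ → ℂ}, ContDiff ℝ 2 w → ∀ s, HasDerivAt w (deriv w s) s := fun hw s =>
    (hw.differentiable (by norm_num) s).hasDerivAt
  have c1 : ∀ {w : ℝ → ℂ}, ContDiff ℝ 2 w → ContDiff ℝ 1 (deriv w) := fun hw => by
    rw [show (2 : WithTop ℕ∞) = 1 + 1 by norm_num, contDiff_succ_iff_deriv] at hw
    exact hw.2.2
  have d2 : ∀ {w : ℝ → ℂ}, ContDiff ℝ 2 w →
      ∀ s, HasDerivAt (deriv w) (iteratedDeriv 2 w s) s := fun hw s => by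
    rw [iteratedDeriv_succ, iteratedDeriv_one]
    exact ((c1 hw).differentiable (by norm_num) s).hasDerivAt
  have i2 : ∀ {w : ℝ → ℂ}, ContDiff ℝ 2 w →
      IntervalIntegrable (iteratedDeriv 2 w) volume 0 T := fun hw =>
    (hw.continuous_iteratedDeriv 2 le_rfl).intervalIntegrable _ _
  have i1 : ∀ {w : ℝ → ℂ}, ContDiff ℝ 2 w →
      IntervalIntegrable (deriv w) volume 0 T := fun hw => (c1 hw).continuous.intervalIntegrable _ _
  have per : ∀ {w : ℝ → ℂ}, Function.Periodic w T → deriv w T = deriv w 0 := fun {w} hw => by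
    have : deriv (fun s => w (s + T)) 0 = deriv w (0 + T) := deriv_comp_add_const _ _ _
    rw [zero_add] at this
    rw [← this]
    congr 1
    exact funext hw
  have e1 := intervalIntegral.integral_deriv_mul_eq_sub (a := 0) (b := T)
    (fun s _ => d2 hu s) (fun s _ => d1 hφ s) (i2 hu) (i1 hφ)
  have e2 := intervalIntegral.integral_deriv_mul_eq_sub (a := 0) (b := T)
    (fun s _ => d1 hu s) (fun s _ => d2 hφ s) (i1 hu) (i2 hφ)
  have hu0 : u T = u 0 := by simpa using hup 0
  have hφ0 : φ T = φ 0 := by simpa using hφp 0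
  rw [per hup, hφ0, sub_self] at e1
  rw [per hφp, hu0, sub_self] at e2
  have cu := hu.continuous
  have cφ := hφ.continuous
  have cu1 := (c1 hu).continuous
  have cφ1 := (c1 hφ).continuous
  have cu2 := hu.continuous_iteratedDeriv 2 le_rfl
  have cφ2 := hφ.continuous_iteratedDeriv 2 le_rfl
  rw [intervalIntegral.integral_add (f := fun s => iteratedDeriv 2 u s * φ s)
    (g := fun s => deriv u s * deriv φ s) ((cu2.mul cφ).intervalIntegrable _ _)
    ((cu1.mul cφ1).intervalIntegrable _ _)] at e1
  rw [intervalIntegral.integral_add (f := fun s => deriv u s * deriv φ s)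
    (g := fun s => u s * iteratedDeriv 2 φ s) ((cu1.mul cφ1).intervalIntegrable _ _)
    ((cu.mul cφ2).intervalIntegrable _ _)] at e2
  linear_combination e1 - e2

/-- The pairing is bilinear, without conjugation, so −M + σ ∂² is its own transpose even though M is
complex. -/
lemma IsSol.integral_mul {T σ : ℝ} {M g u φ : ℝ → ℂ} (h : IsSol σ M g u) (hM : Continuous M)
    (hφ : ContDiff ℝ 2 φ) (hup : Function.Periodic u T) (hφp : Function.Periodic φ T) :
    ∫ s in (0 : ℝ)..T, g s * φ s
      = ∫ s in (0 : ℝ)..T, u s * (-M s * φ s + σ * iteratedDeriv 2 φ s) := by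
  have cu := h.1.continuous
  have cφ := hφ.continuous
  have cu2 := h.1.continuous_iteratedDeriv 2 le_rfl
  have cφ2 := hφ.continuous_iteratedDeriv 2 le_rfl
  have e := integral_pairing h.1 hφ hup hφp
  have e1 : ∫ s in (0 : ℝ)..T, g s * φ s = (∫ s in (0 : ℝ)..T, -M s * u s * φ s)
      + σ * ∫ s in (0 : ℝ)..T, iteratedDeriv 2 u s * φ s := by
    rw [← intervalIntegral.integral_const_mul, ← intervalIntegral.integral_add
      (by apply Continuous.intervalIntegrable; fun_prop)
      (by apply Continuous.intervalIntegrable; fun_prop)]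
    congr 1; funext s; rw [← h.2 s]; ring
  have e2 : ∫ s in (0 : ℝ)..T, u s * (-M s * φ s + σ * iteratedDeriv 2 φ s)
      = (∫ s in (0 : ℝ)..T, -M s * u s * φ s)
      + σ * ∫ s in (0 : ℝ)..T, u s * iteratedDeriv 2 φ s := by
    rw [← intervalIntegral.integral_const_mul, ← intervalIntegral.integral_add
      (by apply Continuous.intervalIntegrable; fun_prop)
      (by apply Continuous.intervalIntegrable; fun_prop)]
    congr 1; funext s; ring
  rw [e1, e2, e]

end

end AntModel

namespace AntModel

noncomputable section

open scoped ComplexConjugate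

/-! ## Expansion of periodic solutions in the small parameter -/

lemma periodic_iteratedDeriv {f : ℝ → ℂ} {T : ℝ} (hp : Function.Periodic f T) (n : ℕ) :
    Function.Periodic (iteratedDeriv n f) T := fun s => by
  have := congrFun (iteratedDeriv_comp_add_const n f T) s
  rw [← this]
  congr 1
  exact funext hp

lemma norm_integral_le_of_bound {T C : ℝ} (hT : 0 < T) {f : ℝ → ℂ} (h : ∀ s, ‖f s‖ ≤ C) :
    ‖∫ s in (0 : ℝ)..T, f s‖ ≤ C * T := by
  have := intervalIntegral.norm_integral_le_of_norm_le_const (a := 0) (b := T) (f := f) (C := C)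
    fun s _ => h s
  rwa [sub_zero, abs_of_pos hT] at this

section Expansion

variable {a T : ℝ} {M g : ℝ → ℂ} (ha : 0 < a) (hT : 0 < T) (hM : ContDiff ℝ ∞ M)
  (hg : ContDiff ℝ ∞ g) (hMre : ∀ s, (M s).re = a) (hMT : Function.Periodic M T)
  (hgT : Function.Periodic g T)

include ha hT hM hg hMre hMT hgT

/-- With q = 1/M, the function φ = −q − σ q q'' satisfies −M φ + σ φ'' = 1 − σ² (q q'')''. Testing
the equation for u with φ gives ∫ u up to σ² ∫ u (q q'')'', and the maximum principle bounds u
uniformly in σ. No control of the derivatives of u is needed. -/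
lemma exists_expansion_integral : ∃ K : ℝ, ∀ σ > 0, ∀ u, Function.Periodic u T → IsSol σ M g u →
    ‖(∫ s in (0 : ℝ)..T, u s) + (∫ s in (0 : ℝ)..T, g s * (M s)⁻¹)
      + σ * ∫ s in (0 : ℝ)..T, g s * ((M s)⁻¹ * iteratedDeriv 2 (fun s => (M s)⁻¹) s)‖
      ≤ K * σ ^ 2 := by
  have hM0 : ∀ s, M s ≠ 0 := fun s h => by
    have := hMre s; rw [h, Complex.zero_re] at this; exact ha.ne this
  set q : ℝ → ℂ := fun s => (M s)⁻¹ with hq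
  have hqc : ContDiff ℝ ∞ q := hM.inv hM0
  have hqT : Function.Periodic q T := fun s => by simp [hq, hMT s]
  set q2 : ℝ → ℂ := iteratedDeriv 2 q with hq2
  have hq2c : ContDiff ℝ ∞ q2 := by
    rw [hq2, iteratedDeriv_eq_iterate]
    exact hqc.iterate_deriv 2
  have hq2T : Function.Periodic q2 T := periodic_iteratedDeriv hqT 2
  set r : ℝ → ℂ := fun s => q s * q2 s with hr
  have hrc : ContDiff ℝ ∞ r := hqc.mul hq2c
  have hrT : Function.Periodic r T := fun s => by simp [hr, hqT s, hq2T s]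
  have hr2c : Continuous (iteratedDeriv 2 r) :=
    hrc.continuous_iteratedDeriv 2 (ENat.LEInfty.out)
  obtain ⟨K, hK0, hK⟩ := exists_norm_bound_of_periodic hr2c hT (periodic_iteratedDeriv hrT 2)
  obtain ⟨Cg, hC0, hC⟩ := exists_norm_bound_of_periodic hg.continuous hT hgT
  refine ⟨Cg / a * K * T, fun σ hσ u hu hsol => ?_⟩
  have hub := hsol.norm_le hσ ha hT (fun s => (hMre s).ge) hC hu
  have h2 : (2 : WithTop ℕ∞) ≤ ∞ := ENat.LEInfty.out
  have hφ : ContDiff ℝ 2 fun s => -q s - σ * r s :=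
    (hqc.neg.sub (contDiff_const.mul hrc)).of_le h2
  have hφT : Function.Periodic (fun s => -q s - σ * r s) T := fun s => by simp [hqT s, hrT s]
  have e := hsol.integral_mul hM.continuous hφ hu hφT
  have e2 : ∀ s, iteratedDeriv 2 (fun s => -q s - σ * r s) s = -q2 s - σ * iteratedDeriv 2 r s := by
    intro s
    have := iteratedDeriv_sub (n := 2) (x := s) (f := fun s => -q s) (g := fun s => (σ : ℂ) * r s)
      (hqc.neg.of_le h2).contDiffAt ((contDiff_const.mul hrc).of_le h2).contDiffAt
    have h3 : iteratedDeriv 2 (fun s => -q s) s = -q2 s := iteratedDeriv_neg 2 q s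
    have h4 : iteratedDeriv 2 (fun s => (σ : ℂ) * r s) s = σ * iteratedDeriv 2 r s :=
      iteratedDeriv_const_mul_field _ _
    rw [← h3, ← h4]; exact this
  have e3 : ∀ s, u s * (-M s * (-q s - σ * r s) + σ * iteratedDeriv 2 (fun s => -q s - σ * r s) s)
      = u s - σ ^ 2 * (u s * iteratedDeriv 2 r s) := fun s => by
    rw [e2]
    have h5 : M s * q s = 1 := mul_inv_cancel₀ (hM0 s)
    simp only [hr]
    linear_combination (u s * (1 + σ * q2 s)) * h5
  simp only [e3] at e
  have cu := hsol.1.continuous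
  have cg := hg.continuous
  have cq := hqc.continuous
  have cr := hrc.continuous
  rw [intervalIntegral.integral_sub (cu.intervalIntegrable _ _)
    (by apply Continuous.intervalIntegrable; fun_prop), intervalIntegral.integral_const_mul] at e
  have e4 : ∫ s in (0 : ℝ)..T, g s * (-q s - σ * r s) = -(∫ s in (0 : ℝ)..T, g s * q s)
      - σ * ∫ s in (0 : ℝ)..T, g s * r s := by
    rw [← intervalIntegral.integral_const_mul, ← intervalIntegral.integral_neg,
      ← intervalIntegral.integral_sub
      (by apply Continuous.intervalIntegrable; fun_prop)
      (by apply Continuous.intervalIntegrable; fun_prop)]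
    congr 1; funext s; ring
  rw [e4] at e
  have e5 : (∫ s in (0 : ℝ)..T, u s) + (∫ s in (0 : ℝ)..T, g s * q s)
      + σ * ∫ s in (0 : ℝ)..T, g s * r s
      = σ ^ 2 * ∫ s in (0 : ℝ)..T, u s * iteratedDeriv 2 r s := by linear_combination -e
  rw [e5, norm_mul, norm_pow, Complex.norm_real, Real.norm_of_nonneg hσ.le, mul_comm]
  refine mul_le_mul_of_nonneg_right ?_ (by positivity)
  refine norm_integral_le_of_bound hT fun s => ?_
  rw [norm_mul]
  exact mul_le_mul (hub s) (hK s) (norm_nonneg _) (by positivity)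

/-- u + g/M solves the same equation with right-hand side σ (g/M)'', and the maximum principle
applies. -/
lemma exists_expansion_zero : ∃ K : ℝ, 0 ≤ K ∧ ∀ σ > 0, ∀ u, Function.Periodic u T →
    IsSol σ M g u → ∀ s, ‖u s + g s * (M s)⁻¹‖ ≤ K * σ := by
  have hM0 : ∀ s, M s ≠ 0 := fun s h => by
    have := hMre s; rw [h, Complex.zero_re] at this; exact ha.ne this
  set r : ℝ → ℂ := fun s => g s * (M s)⁻¹ with hr
  have hrc : ContDiff ℝ ∞ r := hg.mul (hM.inv hM0)
  have hrT : Function.Periodic r T := fun s => by simp [hr, hgT s, hMT s]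
  have hr2c : Continuous (iteratedDeriv 2 r) :=
    hrc.continuous_iteratedDeriv 2 (ENat.LEInfty.out)
  obtain ⟨K, hK0, hK⟩ := exists_norm_bound_of_periodic hr2c hT (periodic_iteratedDeriv hrT 2)
  refine ⟨K / a, by positivity, fun σ hσ u hu hsol s => ?_⟩
  have h2 : (2 : WithTop ℕ∞) ≤ ∞ := ENat.LEInfty.out
  have h3 : IsSol σ M (fun s => -g s + σ * iteratedDeriv 2 r s) r := by
    refine ⟨hrc.of_le h2, fun s => ?_⟩
    have h5 : M s * (M s)⁻¹ = 1 := mul_inv_cancel₀ (hM0 s)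
    simp only [hr]
    linear_combination (-(g s)) * h5
  have h4 := (hsol.sub (h3.const_mul (-1))).norm_le hσ ha hT (C := σ * K) (fun s => (hMre s).ge)
    (fun s => ?_) (fun s => by simp [hu s, hrT s]) s
  · calc _ = ‖u s - -1 * r s‖ := by congr 1; ring
      _ ≤ σ * K / a := h4
      _ = _ := by ring
  · have : g s - -1 * (-g s + σ * iteratedDeriv 2 r s) = σ * iteratedDeriv 2 r s := by ring
    rw [this, norm_mul, Complex.norm_real, Real.norm_of_nonneg hσ.le]
    exact mul_le_mul_of_nonneg_left (hK s) hσ.le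

/-- To leading order u is −g/M and P is −1/M, each uniformly up to O(σ); the condition σ ≤ 1 absorbs
the product of the two errors. -/
lemma exists_expansion_pairing : ∃ K : ℝ, ∀ σ > 0, σ ≤ 1 → ∀ u P, Function.Periodic u T →
    Function.Periodic P T → IsSol σ M g u → IsSol σ M (fun _ => 1) P →
    ‖(∫ s in (0 : ℝ)..T, u s * P s) - ∫ s in (0 : ℝ)..T, g s * (M s)⁻¹ ^ 2‖ ≤ K * σ := by
  have hM0 : ∀ s, M s ≠ 0 := fun s h => by
    have := hMre s; rw [h, Complex.zero_re] at this; exact ha.ne this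
  obtain ⟨K1, hK10, hK1⟩ := exists_expansion_zero ha hT hM hg hMre hMT hgT
  obtain ⟨K2, hK20, hK2⟩ := exists_expansion_zero (g := fun _ => 1) ha hT hM contDiff_const hMre hMT
    (fun _ => rfl)
  have hqc : Continuous fun s => (M s)⁻¹ := (hM.inv hM0).continuous
  obtain ⟨Cq, hq0, hq⟩ := exists_norm_bound_of_periodic hqc hT (fun s => by simp [hMT s])
  obtain ⟨Cg, hg0, hgb⟩ := exists_norm_bound_of_periodic hg.continuous hT hgT
  refine ⟨(K1 * Cq + Cg * Cq * K2 + K1 * K2) * T, fun σ hσ hσ1 u P hu hP hsu hsP => ?_⟩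
  have cu := hsu.1.continuous
  have cP := hsP.1.continuous
  have cg := hg.continuous
  rw [← intervalIntegral.integral_sub (by apply Continuous.intervalIntegrable; fun_prop)
    (by apply Continuous.intervalIntegrable; fun_prop)]
  refine (norm_integral_le_of_bound (C := (K1 * Cq + Cg * Cq * K2 + K1 * K2) * σ) hT
    fun s => ?_).trans (le_of_eq (by ring))
  have h1 := hK1 σ hσ u hu hsu s
  have h2 := hK2 σ hσ P hP hsP s
  set q := (M s)⁻¹
  set e := u s + g s * q
  set e' := P s + 1 * q
  have e1 : u s * P s - g s * q ^ 2 = -(q * e) - g s * q * e' + e * e' := by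
    simp only [e, e']; ring
  rw [e1]
  have n1 : ‖q * e‖ ≤ Cq * (K1 * σ) := by
    rw [norm_mul]; exact mul_le_mul (hq s) h1 (norm_nonneg _) hq0
  have n2 : ‖g s * q * e'‖ ≤ Cg * Cq * (K2 * σ) := by
    rw [norm_mul, norm_mul]
    exact mul_le_mul (mul_le_mul (hgb s) (hq s) (norm_nonneg _) hg0) h2 (norm_nonneg _)
      (by positivity)
  have n3 : ‖e * e'‖ ≤ K1 * K2 * σ := by
    rw [norm_mul]
    calc _ ≤ (K1 * σ) * (K2 * σ) := mul_le_mul h1 h2 (norm_nonneg _) (by positivity)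
      _ = K1 * K2 * σ * σ := by ring
      _ ≤ K1 * K2 * σ * 1 := mul_le_mul_of_nonneg_left hσ1 (by positivity)
      _ = _ := by ring
  calc _ ≤ ‖q * e‖ + ‖g s * q * e'‖ + ‖e * e'‖ := by
        refine (norm_add_le _ _).trans (add_le_add_left ?_ _)
        refine (norm_sub_le _ _).trans ?_
        rw [norm_neg]
    _ ≤ _ := by linarith

end Expansion

/-! ## Trigonometric integrals -/

/-- The normalized multiplier `a + i cos s`. -/
def mul1 (a s : ℝ) : ℂ := a + Complex.I * Real.cos s

lemma mul1_re (a s : ℝ) : (mul1 a s).re = a := by simp [mul1]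

lemma mul1_ne_zero {a : ℝ} (ha : 0 < a) (s : ℝ) : mul1 a s ≠ 0 := fun h => by
  have := mul1_re a s
  rw [h, Complex.zero_re] at this
  exact ha.ne this

lemma contDiff_ofReal_cos : ContDiff ℝ ∞ fun s : ℝ => (Real.cos s : ℂ) :=
  Complex.ofRealCLM.contDiff.comp Real.contDiff_cos

lemma contDiff_mul1 (a : ℝ) : ContDiff ℝ ∞ (mul1 a) :=
  contDiff_const.add (contDiff_const.mul contDiff_ofReal_cos)

lemma mul1_periodic (a : ℝ) : Function.Periodic (mul1 a) (2 * Real.pi) := fun s => by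
  simp [mul1]

lemma hasDerivAt_ofReal_cos (s : ℝ) :
    HasDerivAt (fun s : ℝ => (Real.cos s : ℂ)) (-(Real.sin s : ℂ)) s := by
  simpa using (Real.hasDerivAt_cos s).ofReal_comp

lemma hasDerivAt_ofReal_sin (s : ℝ) :
    HasDerivAt (fun s : ℝ => (Real.sin s : ℂ)) (Real.cos s : ℂ) s :=
  (Real.hasDerivAt_sin s).ofReal_comp

lemma hasDerivAt_mul1 (a s : ℝ) : HasDerivAt (mul1 a) (-(Complex.I * Real.sin s)) s := by
  refine (((hasDerivAt_ofReal_cos s).const_mul Complex.I).const_add (a : ℂ)).congr_deriv ?_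
  ring

/-- Together with `cos_eq` this makes the trigonometric integrands below Laurent polynomials in a +
i cos s. -/
lemma sin_sq_eq (a s : ℝ) : (Real.sin s : ℂ) ^ 2 = 1 + (mul1 a s - a) ^ 2 := by
  have h : (Real.sin s : ℂ) ^ 2 + (Real.cos s : ℂ) ^ 2 = 1 := by
    exact_mod_cast Real.sin_sq_add_cos_sq s
  simp only [mul1]
  linear_combination h - (Real.cos s : ℂ) ^ 2 * Complex.I_sq

lemma cos_eq (a s : ℝ) : (Real.cos s : ℂ) = -Complex.I * (mul1 a s - a) := by
  simp only [mul1]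
  linear_combination (Real.cos s : ℂ) * Complex.I_sq

/-- `∫ (a + i cos s)^{-n} ds`. -/
def W (a : ℝ) (n : ℕ) : ℂ := ∫ s in (0 : ℝ)..2 * Real.pi, (mul1 a s)⁻¹ ^ n

lemma W_zero (a : ℝ) : W a 0 = 2 * Real.pi := by simp [W]

lemma continuous_inv_mul1 {a : ℝ} (ha : 0 < a) : Continuous fun s => (mul1 a s)⁻¹ :=
  (contDiff_mul1 a).continuous.inv₀ (mul1_ne_zero ha)

lemma hasDerivAt_inv_mul1 {a : ℝ} (ha : 0 < a) (s : ℝ) :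
    HasDerivAt (fun s => (mul1 a s)⁻¹) (Complex.I * Real.sin s * (mul1 a s)⁻¹ ^ 2) s := by
  refine ((hasDerivAt_mul1 a s).fun_inv (mul1_ne_zero ha s)).congr_deriv ?_
  rw [inv_pow]; ring

lemma iteratedDeriv_inv_mul1 {a : ℝ} (ha : 0 < a) (s : ℝ) :
    iteratedDeriv 2 (fun s => (mul1 a s)⁻¹) s = -2 * (1 + a ^ 2) * (mul1 a s)⁻¹ ^ 3
      + 3 * a * (mul1 a s)⁻¹ ^ 2 - (mul1 a s)⁻¹ := by
  have e1 : deriv (fun s => (mul1 a s)⁻¹) = fun s : ℝ => Complex.I * Real.sin s * (mul1 a s)⁻¹ ^ 2 :=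
    funext fun s => (hasDerivAt_inv_mul1 ha s).deriv
  rw [iteratedDeriv_succ, iteratedDeriv_one, e1]
  have h := ((hasDerivAt_ofReal_sin s).const_mul Complex.I).fun_mul
    ((hasDerivAt_inv_mul1 ha s).fun_pow 2)
  rw [h.deriv]
  have hm : mul1 a s * (mul1 a s)⁻¹ = 1 := mul_inv_cancel₀ (mul1_ne_zero ha s)
  have h2 := sin_sq_eq a s
  have h3 := cos_eq a s
  rw [h3]
  set m := mul1 a s
  set w := m⁻¹
  have hI := Complex.I_sq
  simp only [Nat.cast_ofNat, Nat.reduceSub, pow_one]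
  linear_combination (2 * Complex.I ^ 2 * w ^ 3) * h2 + (-w ^ 2 * (m - a) + 2 * w ^ 3 * (1 + (m - a) ^ 2)) * hI
    + (-2 * w * (m * w + 1) + w + 4 * a * w ^ 2) * hm

/-- The derivative of sin s · (a + i cos s)^{-(n+1)} has zero integral over a period; expanded in
powers of (a + i cos s)^{-1} it is this recursion. -/
lemma W_rec {a : ℝ} (ha : 0 < a) (n : ℕ) :
    (n + 1) * (1 + a ^ 2) * W a (n + 2) = (2 * n + 1) * a * W a (n + 1) - n * W a n := by
  have c := continuous_inv_mul1 ha
  have hd : ∀ s ∈ Set.uIcc 0 (2 * Real.pi), HasDerivAt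
      (fun s : ℝ => (Real.sin s : ℂ) * (mul1 a s)⁻¹ ^ (n + 1))
      (-Complex.I * ((n : ℂ) * (mul1 a s)⁻¹ ^ n - (2 * n + 1) * a * (mul1 a s)⁻¹ ^ (n + 1)
        + (n + 1) * (1 + a ^ 2) * (mul1 a s)⁻¹ ^ (n + 2)) * (-1)) s := fun s _ => by
    refine ((hasDerivAt_ofReal_sin s).fun_mul
      ((hasDerivAt_inv_mul1 ha s).fun_pow (n + 1))).congr_deriv ?_
    have hm : mul1 a s * (mul1 a s)⁻¹ = 1 := mul_inv_cancel₀ (mul1_ne_zero ha s)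
    have h2 := sin_sq_eq a s
    have h3 := cos_eq a s
    rw [h3]
    set m := mul1 a s
    set w := m⁻¹
    simp only [Nat.cast_add, Nat.cast_one, Nat.add_sub_cancel]
    linear_combination ((n + 1) * Complex.I * w ^ n * w ^ 2) * h2
      + (Complex.I * w ^ n * (-1 + (n + 1) * (m * w + 1) - 2 * (n + 1) * a * w)) * hm
  have h := intervalIntegral.integral_eq_sub_of_hasDerivAt hd
    (by apply Continuous.intervalIntegrable; fun_prop)
  rw [Real.sin_two_pi, Real.sin_zero] at h
  simp only [Complex.ofReal_zero, zero_mul, sub_zero] at h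
  rw [intervalIntegral.integral_mul_const, intervalIntegral.integral_const_mul,
    intervalIntegral.integral_add (by apply Continuous.intervalIntegrable; fun_prop)
      (by apply Continuous.intervalIntegrable; fun_prop),
    intervalIntegral.integral_sub (by apply Continuous.intervalIntegrable; fun_prop)
      (by apply Continuous.intervalIntegrable; fun_prop),
    intervalIntegral.integral_const_mul, intervalIntegral.integral_const_mul,
    intervalIntegral.integral_const_mul] at h
  change -Complex.I * ((n : ℂ) * W a n - (2 * n + 1) * a * W a (n + 1)
    + (n + 1) * (1 + a ^ 2) * W a (n + 2)) * (-1) = 0 at h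
  have h' := (mul_eq_zero.1 ((mul_eq_zero.1 h).resolve_right (by norm_num))).resolve_left
    (neg_ne_zero.2 Complex.I_ne_zero)
  linear_combination h'

/-- The Cauchy integral of 1/(z − w) over the unit circle, with z = e^{is} factored out of the
denominator. -/
lemma integral_inv_one_sub {w : ℂ} (hw : ‖w‖ < 1) :
    ∫ s in (0 : ℝ)..2 * Real.pi, (1 - w * Complex.exp (-(s * Complex.I)))⁻¹ = 2 * Real.pi := by
  have h := circleIntegral.integral_sub_inv_of_mem_ball (c := 0) (R := 1) (w := w)
    (by simpa using hw)
  rw [circleIntegral] at h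
  have e : ∀ s : ℝ, deriv (circleMap 0 1) s • (circleMap 0 1 s - w)⁻¹
      = Complex.I * (1 - w * Complex.exp (-(s * Complex.I)))⁻¹ := fun s => by
    rw [deriv_circleMap, circleMap_zero]
    have h0 : Complex.exp (s * Complex.I) ≠ 0 := Complex.exp_ne_zero _
    rw [Complex.exp_neg, smul_eq_mul, Complex.ofReal_one, one_mul]
    have h1 : Complex.exp (s * Complex.I) - w
        = Complex.exp (s * Complex.I) * (1 - w * (Complex.exp (s * Complex.I))⁻¹) := by
      field_simp
    rw [h1, mul_inv]
    field_simp
  simp only [e] at h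
  rw [intervalIntegral.integral_const_mul] at h
  exact mul_left_cancel₀ Complex.I_ne_zero (by rw [h]; ring)

/-- With ρ = √(1+a²), η = ρ − a < 1, w = −iη and z = e^{is}, one has 2η (a + i cos s) = (1 − wz)(1 −
w/z). Partial fractions give 1/(a + i cos s) = ((1 − wz)⁻¹ + (1 − w/z)⁻¹ − 1)/ρ, and each of the two
inverses integrates to 2π. -/
lemma W_one {a : ℝ} (ha : 0 < a) : W a 1 = 2 * Real.pi / Real.sqrt (1 + a ^ 2) := by
  set r := Real.sqrt (1 + a ^ 2) with hr
  have hr2 : r ^ 2 = 1 + a ^ 2 := Real.sq_sqrt (by positivity)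
  have hra : a < r := Real.lt_sqrt_of_sq_lt (by linarith)
  have hr0 : 0 < r := ha.trans hra
  set η := r - a with hη
  have hη0 : 0 < η := by simp [hη, hra]
  have hη1 : η < 1 := by nlinarith
  set w : ℂ := -(Complex.I * η) with hw
  have hwn : ‖w‖ < 1 := by
    rw [hw, norm_neg, norm_mul, Complex.norm_I, one_mul, Complex.norm_real,
      Real.norm_of_nonneg hη0.le]
    exact hη1
  have h1 := integral_inv_one_sub hwn
  set f : ℝ → ℂ := fun s => (1 - w * Complex.exp (-(s * Complex.I)))⁻¹ with hf
  have hne : ∀ z : ℂ, ‖z‖ = 1 → 1 - w * z ≠ 0 := fun z hz h => by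
    have h3 : ‖w * z‖ = 1 := by rw [← sub_eq_zero.1 h, norm_one]
    rw [norm_mul, hz, mul_one] at h3
    exact hwn.ne h3
  have hn1 : ∀ s : ℝ, ‖Complex.exp (-(s * Complex.I))‖ = 1 := fun s => by
    have := Complex.norm_exp_ofReal_mul_I (-s)
    rwa [Complex.ofReal_neg, neg_mul] at this
  have hfc : Continuous f := by
    apply Continuous.inv₀ (by fun_prop)
    exact fun s => hne _ (hn1 s)
  have h2 : ∫ s in (0 : ℝ)..2 * Real.pi, f (2 * Real.pi - s) = 2 * Real.pi := by
    rw [intervalIntegral.integral_comp_sub_left]; simpa using h1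
  have e : ∀ s : ℝ, (mul1 a s)⁻¹ ^ 1 = (r : ℂ)⁻¹ * (f s + f (2 * Real.pi - s) - 1) := fun s => by
    set z := Complex.exp (s * Complex.I) with hz
    have hz0 : z ≠ 0 := Complex.exp_ne_zero _
    have hzn : ‖z‖ = 1 := Complex.norm_exp_ofReal_mul_I s
    have e1 : Complex.exp (-(s * Complex.I)) = z⁻¹ := Complex.exp_neg _
    have e2 : Complex.exp (-((2 * Real.pi - s : ℝ) * Complex.I)) = z := by
      push_cast
      rw [show -((2 * (Real.pi : ℂ) - s) * Complex.I) = s * Complex.I - 2 * Real.pi * Complex.I by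
        ring, Complex.exp_sub, Complex.exp_two_pi_mul_I, div_one]
    have e3 : (Real.cos s : ℂ) = (z + z⁻¹) / 2 := by
      rw [Complex.ofReal_cos, Complex.cos, hz, ← Complex.exp_neg, neg_mul]
    have n1 : 1 - w * z ≠ 0 := hne z hzn
    have n2 : 1 - w * z⁻¹ ≠ 0 := hne z⁻¹ (by rw [norm_inv, hzn, inv_one])
    simp only [hf, e1, e2, pow_one]
    have hm := mul1_ne_zero ha s
    have hrc : (r : ℂ) ≠ 0 := by exact_mod_cast hr0.ne'
    have hr2c : (r : ℂ) ^ 2 = 1 + (a : ℂ) ^ 2 := by exact_mod_cast hr2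
    have hzz : z * z⁻¹ = 1 := mul_inv_cancel₀ hz0
    have hηc : (η : ℂ) = r - a := by rw [hη]; push_cast; ring
    have p1 : (1 - w * z) * (1 - w * z⁻¹) = 2 * η * mul1 a s := by
      simp only [mul1, e3, hw, hηc]
      linear_combination (r - a) ^ 2 * Complex.I ^ 2 * hzz + (r - a) ^ 2 * Complex.I_sq - hr2c
    have p2 : (1 - w * z) + (1 - w * z⁻¹) - (1 - w * z) * (1 - w * z⁻¹) = 2 * η * r := by
      simp only [hw, hηc]
      linear_combination (-(r - a) ^ 2 * Complex.I ^ 2) * hzz - (r - a) ^ 2 * Complex.I_sq - hr2c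
    have hη0c : (η : ℂ) ≠ 0 := by exact_mod_cast hη0.ne'
    have p3 : (1 - w * z⁻¹)⁻¹ + (1 - w * z)⁻¹ - 1
        = ((1 - w * z) + (1 - w * z⁻¹) - (1 - w * z) * (1 - w * z⁻¹))
          / ((1 - w * z) * (1 - w * z⁻¹)) := by
      rw [eq_div_iff (mul_ne_zero n1 n2), sub_mul, add_mul]
      have q1 : (1 - w * z⁻¹)⁻¹ * (1 - w * z⁻¹) = 1 := inv_mul_cancel₀ n2
      have q2 : (1 - w * z)⁻¹ * (1 - w * z) = 1 := inv_mul_cancel₀ n1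
      linear_combination (1 - w * z) * q1 + (1 - w * z⁻¹) * q2
    rw [p3, p2, p1]
    field_simp
  rw [W]
  simp only [e]
  rw [intervalIntegral.integral_const_mul, intervalIntegral.integral_sub
    (by apply Continuous.intervalIntegrable; fun_prop) (by simp),
    intervalIntegral.integral_add (by apply Continuous.intervalIntegrable; fun_prop)
    (by apply Continuous.intervalIntegrable; fun_prop), h1, h2]
  simp
  field_simp

end

end AntModel

/-! ### The explicit integrals behind the expansion coefficients. -/

namespace AntModel

noncomputable section

open scoped ComplexConjugate

/-- The normalized right-hand side `-i cos s + T a cos 2s`. -/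
def rhs1 (a T s : ℝ) : ℂ := -(Complex.I * Real.cos s) + T * a * Real.cos (2 * s)

lemma rhs1_eq (a T s : ℝ) :
    rhs1 a T s = (a - mul1 a s) - T * a * (2 * (mul1 a s - a) ^ 2 + 1) := by
  have h : (Real.cos (2 * s) : ℂ) = 2 * (Real.cos s : ℂ) ^ 2 - 1 := by
    exact_mod_cast Real.cos_two_mul s
  rw [rhs1, h, cos_eq a s]
  linear_combination ((mul1 a s - a) + 2 * T * a * (mul1 a s - a) ^ 2) * Complex.I_sq

lemma contDiff_rhs1 (a T : ℝ) : ContDiff ℝ ∞ (rhs1 a T) :=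
  (contDiff_const.mul contDiff_ofReal_cos).neg.add
    (contDiff_const.mul (contDiff_ofReal_cos.comp (contDiff_const.mul contDiff_id)))

lemma rhs1_periodic (a T : ℝ) : Function.Periodic (rhs1 a T) (2 * Real.pi) := fun s => by
  have h : Real.cos (2 * (s + 2 * Real.pi)) = Real.cos (2 * s) := by
    rw [show 2 * (s + 2 * Real.pi) = 2 * s + (2 : ℕ) * (2 * Real.pi) by push_cast; ring,
      Real.cos_add_nat_mul_two_pi]
  simp only [rhs1, h, Real.cos_add_two_pi]

/-- The ratio `a / √(1 + a²)`. -/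
def ratio (a : ℝ) : ℝ := a / Real.sqrt (1 + a ^ 2)

section Integrals

variable {a : ℝ} (ha : 0 < a) (T : ℝ)

include ha

lemma W_two : W a 2 = 2 * Real.pi * a * ((Real.sqrt (1 + a ^ 2))⁻¹ : ℝ) ^ 3 := by
  have h := W_rec ha 0
  have h1 := W_one ha
  set s := Real.sqrt (1 + a ^ 2)
  have hs : s ^ 2 = 1 + a ^ 2 := Real.sq_sqrt (by positivity)
  have hs0 : (s : ℂ) ≠ 0 := by
    have : 0 < s := Real.sqrt_pos.2 (by positivity)
    exact_mod_cast this.ne'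
  have hsc : (1 : ℂ) + (a : ℂ) ^ 2 = (s : ℂ) ^ 2 := by exact_mod_cast hs.symm
  rw [hsc] at h
  simp only [Nat.cast_zero, zero_add, zero_mul, sub_zero, mul_zero, one_mul, h1] at h
  push_cast
  field_simp at h ⊢
  linear_combination h

lemma W_three : W a 3 = Real.pi * (2 * a ^ 2 - 1) * ((Real.sqrt (1 + a ^ 2))⁻¹ : ℝ) ^ 5 := by
  have h := W_rec ha 1
  have h1 := W_one ha
  have h2 := W_two ha
  set s := Real.sqrt (1 + a ^ 2)
  have hs : s ^ 2 = 1 + a ^ 2 := Real.sq_sqrt (by positivity)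
  have hs0 : (s : ℂ) ≠ 0 := by
    have : 0 < s := Real.sqrt_pos.2 (by positivity)
    exact_mod_cast this.ne'
  have hsc : (1 : ℂ) + (a : ℂ) ^ 2 = (s : ℂ) ^ 2 := by exact_mod_cast hs.symm
  rw [hsc] at h
  norm_num [h1, h2] at h
  push_cast
  field_simp at h ⊢
  linear_combination h + (Real.pi : ℂ) * hsc

lemma W_four : W a 4 = Real.pi * a * (2 * a ^ 2 - 3) * ((Real.sqrt (1 + a ^ 2))⁻¹ : ℝ) ^ 7 := by
  have h := W_rec ha 2
  have h2 := W_two ha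
  have h3 := W_three ha
  set s := Real.sqrt (1 + a ^ 2)
  have hs : s ^ 2 = 1 + a ^ 2 := Real.sq_sqrt (by positivity)
  have hs0 : (s : ℂ) ≠ 0 := by
    have : 0 < s := Real.sqrt_pos.2 (by positivity)
    exact_mod_cast this.ne'
  have hsc : (1 : ℂ) + (a : ℂ) ^ 2 = (s : ℂ) ^ 2 := by exact_mod_cast hs.symm
  rw [hsc] at h
  norm_num [h2, h3] at h
  push_cast
  field_simp at h ⊢
  linear_combination h / 3 + (4 / 3 * a * Real.pi : ℂ) * hsc

lemma ratio_facts : 0 < ratio a ∧ ratio a < 1 ∧ (ratio a = a * (Real.sqrt (1 + a ^ 2))⁻¹) ∧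
    ((Real.sqrt (1 + a ^ 2))⁻¹) ^ 2 * (1 + a ^ 2) = 1 := by
  have h0 : 0 < Real.sqrt (1 + a ^ 2) := Real.sqrt_pos.2 (by positivity)
  have hs : Real.sqrt (1 + a ^ 2) ^ 2 = 1 + a ^ 2 := Real.sq_sqrt (by positivity)
  refine ⟨div_pos ha h0, ?_, div_eq_mul_inv _ _, ?_⟩
  · rw [ratio, div_lt_one h0]; exact Real.lt_sqrt_of_sq_lt (by linarith)
  · rw [inv_pow, hs]; exact inv_mul_cancel₀ (by positivity)

/-- Naming c = (1+a²)^{-1/2} through c²(1+a²) = 1 turns the evaluations below into polynomial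
identities, with no square root left. -/
lemma W_eval : ∃ c : ℝ, c ^ 2 * (1 + a ^ 2) = 1 ∧ 0 < c ∧ ratio a = a * c ∧
    W a 1 = 2 * Real.pi * c ∧ W a 2 = 2 * Real.pi * a * c ^ 3 ∧
    W a 3 = Real.pi * (2 * a ^ 2 - 1) * c ^ 5 ∧ W a 4 = Real.pi * a * (2 * a ^ 2 - 3) * c ^ 7 :=
  ⟨(Real.sqrt (1 + a ^ 2))⁻¹, (ratio_facts ha).2.2.2,
    inv_pos.2 (Real.sqrt_pos.2 (by positivity)), (ratio_facts ha).2.2.1,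
    by rw [W_one ha, div_eq_mul_inv]; push_cast; ring, W_two ha, W_three ha, W_four ha⟩

lemma integral_pow_inv (n : ℕ) (c : ℂ) :
    ∫ s in (0 : ℝ)..2 * Real.pi, c * (mul1 a s)⁻¹ ^ n = c * W a n := by
  rw [intervalIntegral.integral_const_mul]; rfl

lemma integral_mul1 : ∫ s in (0 : ℝ)..2 * Real.pi, mul1 a s = 2 * Real.pi * a := by
  have h : ∫ s in (0 : ℝ)..2 * Real.pi, Complex.I * (Real.cos s : ℂ) = 0 := by
    rw [intervalIntegral.integral_const_mul, intervalIntegral.integral_ofReal, integral_cos]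
    simp
  have h2 : ∀ s, mul1 a s = (a : ℂ) + Complex.I * (Real.cos s : ℂ) := fun _ => rfl
  simp only [h2]
  rw [intervalIntegral.integral_add (by simp) (by apply Continuous.intervalIntegrable; fun_prop), h]
  simp

/-- Integration of a polynomial in `(a + i cos s)^{-1}`, plus a linear term in `a + i cos s`. -/
lemma integral_poly (b c0 c1 c2 c3 c4 : ℂ) :
    ∫ s in (0 : ℝ)..2 * Real.pi, (b * mul1 a s + c0 * (mul1 a s)⁻¹ ^ 0 + c1 * (mul1 a s)⁻¹ ^ 1
      + c2 * (mul1 a s)⁻¹ ^ 2 + c3 * (mul1 a s)⁻¹ ^ 3 + c4 * (mul1 a s)⁻¹ ^ 4)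
      = b * (2 * Real.pi * a) + c0 * (2 * Real.pi) + c1 * W a 1 + c2 * W a 2 + c3 * W a 3
        + c4 * W a 4 := by
  have c := continuous_inv_mul1 ha
  have cm := (contDiff_mul1 a).continuous
  have key : ∀ (n : ℕ) (d : ℂ), Continuous fun s => d * (mul1 a s)⁻¹ ^ n := fun n d =>
    continuous_const.mul (c.pow n)
  rw [intervalIntegral.integral_add (by apply Continuous.intervalIntegrable; fun_prop)
      (by apply Continuous.intervalIntegrable; fun_prop),
    intervalIntegral.integral_add (by apply Continuous.intervalIntegrable; fun_prop)
      (by apply Continuous.intervalIntegrable; fun_prop),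
    intervalIntegral.integral_add (by apply Continuous.intervalIntegrable; fun_prop)
      (by apply Continuous.intervalIntegrable; fun_prop),
    intervalIntegral.integral_add (by apply Continuous.intervalIntegrable; fun_prop)
      (by apply Continuous.intervalIntegrable; fun_prop),
    intervalIntegral.integral_add (by apply Continuous.intervalIntegrable; fun_prop)
      (by apply Continuous.intervalIntegrable; fun_prop),
    integral_pow_inv ha, integral_pow_inv ha, integral_pow_inv ha, integral_pow_inv ha,
    integral_pow_inv ha, intervalIntegral.integral_const_mul, integral_mul1 ha, W_zero]

/-- The zeroth-order coefficient of ∫Û, up to sign and scaling. Division by a + i cos s leaves one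
linear term, a constant and a first inverse power, so only `W a 1` enters. -/
lemma integral_rhs1_mul : ∫ s in (0 : ℝ)..2 * Real.pi, rhs1 a T s * (mul1 a s)⁻¹
    = -((2 * Real.pi * ((1 - ratio a) * (1 + T * ratio a / (1 + ratio a))) : ℝ) : ℂ) := by
  have e : ∀ s, rhs1 a T s * (mul1 a s)⁻¹ = (-2 * T * a) * mul1 a s
      + (-1 + 4 * T * a ^ 2) * (mul1 a s)⁻¹ ^ 0 + (a - T * a * (2 * a ^ 2 + 1)) * (mul1 a s)⁻¹ ^ 1
      + 0 * (mul1 a s)⁻¹ ^ 2 + 0 * (mul1 a s)⁻¹ ^ 3 + 0 * (mul1 a s)⁻¹ ^ 4 := fun s => by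
    have hm : mul1 a s * (mul1 a s)⁻¹ = 1 := mul_inv_cancel₀ (mul1_ne_zero ha s)
    rw [rhs1_eq]
    linear_combination (-1 - T * a * (2 * mul1 a s - 4 * a)) * hm
  simp only [e]
  rw [integral_poly ha]
  obtain ⟨c, hc, hc0, hr, h1, h2, h3, h4⟩ := W_eval ha
  have hr' : (1 - ratio a) * (1 + T * ratio a / (1 + ratio a))
      = 1 - a * c + T * (a * c * (1 + 2 * a ^ 2) - 2 * a ^ 2) := by
    have h0 : 1 + a * c ≠ 0 := by positivity
    rw [hr]
    field_simp
    linear_combination (-2 * T * a ^ 2) * hc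
  rw [hr', h1]
  push_cast
  ring

/-- The first-order coefficient of ∫Û, up to sign and scaling. The second derivative of the inverse
raises the powers to four, which is why `W a 2`, `W a 3` and `W a 4` are needed. -/
lemma integral_rhs1_mul_mul : ∫ s in (0 : ℝ)..2 * Real.pi, rhs1 a T s *
      ((mul1 a s)⁻¹ * iteratedDeriv 2 (fun s => (mul1 a s)⁻¹) s)
    = ((Real.pi * a * ((1 - ratio a) * (4 * T - (T - 1) * (ratio a * (1 + ratio a) *
      (1 + ratio a ^ 2)) - 2 * ratio a ^ 3 * (1 + ratio a))) : ℝ) : ℂ) := by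
  have e : ∀ s, rhs1 a T s * ((mul1 a s)⁻¹ * iteratedDeriv 2 (fun s => (mul1 a s)⁻¹) s)
      = 0 * mul1 a s + (2 * T * a) * (mul1 a s)⁻¹ ^ 0 + (1 - 10 * T * a ^ 2) * (mul1 a s)⁻¹ ^ 1
      + (-4 * a - T * a * (-4 * (1 + a ^ 2) - 12 * a ^ 2 - (2 * a ^ 2 + 1))) * (mul1 a s)⁻¹ ^ 2
      + (3 * a ^ 2 + 2 * (1 + a ^ 2) - T * a * (8 * a * (1 + a ^ 2) + 3 * a * (2 * a ^ 2 + 1)))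
        * (mul1 a s)⁻¹ ^ 3
      + (-2 * (1 + a ^ 2) * a + T * a * (2 * (1 + a ^ 2) * (2 * a ^ 2 + 1)))
        * (mul1 a s)⁻¹ ^ 4 := fun s => by
    have hm : mul1 a s * (mul1 a s)⁻¹ = 1 := mul_inv_cancel₀ (mul1_ne_zero ha s)
    rw [iteratedDeriv_inv_mul1 ha, rhs1_eq]
    set m := mul1 a s
    set w := m⁻¹
    have h5 : ((a - m) - T * a * (2 * (m - a) ^ 2 + 1)) * w
        = a * w - 1 - T * a * (2 * m - 4 * a + (2 * a ^ 2 + 1) * w) := by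
      linear_combination (-1 - T * a * (2 * m - 4 * a)) * hm
    rw [← mul_assoc, h5]
    linear_combination (- T * a * (2 * (-2 * (1 + a ^ 2) * w ^ 2 + 3 * a * w - 1))) * hm
  simp only [e]
  rw [integral_poly ha]
  obtain ⟨c, hc, hc0, hr, h1, h2, h3, h4⟩ := W_eval ha
  have hcc : (c : ℂ) ^ 2 * (1 + (a : ℂ) ^ 2) = 1 := by exact_mod_cast hc
  rw [hr, h1, h2, h3, h4]
  push_cast
  generalize (c : ℂ) = c at *
  generalize (a : ℂ) = a at *
  generalize (Real.pi : ℂ) = π at *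
  generalize (T : ℂ) = T at *
  clear e hr h1 h2 h3 h4
  grind

/-- The leading term of ∫Û P. The explicit value is minus a sum of a positive term and a multiple of
T by a positive factor, so T ≥ 0 excludes cancellation. -/
lemma integral_rhs1_mul_sq (hT : 0 ≤ T) : ∃ x : ℝ, x < 0 ∧
    ∫ s in (0 : ℝ)..2 * Real.pi, rhs1 a T s * (mul1 a s)⁻¹ ^ 2 = (x : ℂ) := by
  have e : ∀ s, rhs1 a T s * (mul1 a s)⁻¹ ^ 2
      = 0 * mul1 a s + (-2 * T * a) * (mul1 a s)⁻¹ ^ 0 + (-1 + 4 * T * a ^ 2) * (mul1 a s)⁻¹ ^ 1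
      + (a - T * a * (2 * a ^ 2 + 1)) * (mul1 a s)⁻¹ ^ 2 + 0 * (mul1 a s)⁻¹ ^ 3
      + 0 * (mul1 a s)⁻¹ ^ 4 := fun s => by
    have hm : mul1 a s * (mul1 a s)⁻¹ = 1 := mul_inv_cancel₀ (mul1_ne_zero ha s)
    rw [rhs1_eq]
    set m := mul1 a s
    set w := m⁻¹
    linear_combination (-w - T * a * (2 * (m * w + 1) - 4 * a * w)) * hm
  simp only [e]
  obtain ⟨c, hc, hc0, hr, h1, h2, h3, h4⟩ := W_eval ha
  have hr0 := (ratio_facts ha).1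
  refine ⟨-(2 * Real.pi * c ^ 3 + 2 * Real.pi * T * a * ((1 - ratio a) ^ 2 * (2 + ratio a))),
    neg_neg_of_pos (by positivity), ?_⟩
  rw [integral_poly ha]
  have hcc : (c : ℂ) ^ 2 * (1 + (a : ℂ) ^ 2) = 1 := by exact_mod_cast hc
  rw [hr, h1, h2, h3, h4]
  push_cast
  generalize (c : ℂ) = c at *
  generalize (a : ℂ) = a at *
  generalize (Real.pi : ℂ) = π at *
  generalize (T : ℂ) = T at *
  clear e hr h1 h2 h3 h4
  grind

end Integrals

end

end AntModel

namespace AntModel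

noncomputable section

open scoped ComplexConjugate

/-! ## Comparison of the eigenvalue branches -/

lemma ratio_strictMono {a b : ℝ} (ha : 0 < a) (hab : a < b) : ratio a < ratio b := by
  have hb := ha.trans hab
  obtain ⟨h1, h2, h3, h4⟩ := ratio_facts ha
  obtain ⟨k1, k2, k3, k4⟩ := ratio_facts hb
  have ea : ratio a ^ 2 * (1 + a ^ 2) = a ^ 2 := by
    rw [h3, mul_pow, mul_assoc, h4, mul_one]
  have eb : ratio b ^ 2 * (1 + b ^ 2) = b ^ 2 := by
    rw [k3, mul_pow, mul_assoc, k4, mul_one]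
  by_contra! hle
  have hsq : ratio b ^ 2 ≤ ratio a ^ 2 := by gcongr
  have ha2 : ratio a ^ 2 < 1 := by nlinarith
  have hlt : a ^ 2 < b ^ 2 := by gcongr
  nlinarith [mul_le_mul_of_nonneg_right hsq (by positivity : (0 : ℝ) ≤ 1 + b ^ 2)]

/-- The two leading coefficients determine the ratio. -/
lemma coeff_ne {T r r' D D' : ℝ} (hT : 0 ≤ T) (hr : 0 < r) (hrr : r < r') (hr' : r' < 1)
    (hD : 0 < D) (hDD : D < D') :
    (1 - r) * (1 + T * r / (1 + r)) / D ≠ (1 - r') * (1 + T * r' / (1 + r')) / D' ∨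
    (1 - r) * (4 * T - (T - 1) * (r * (1 + r) * (1 + r ^ 2)) - 2 * r ^ 3 * (1 + r)) / D ≠
    (1 - r') * (4 * T - (T - 1) * (r' * (1 + r') * (1 + r' ^ 2)) - 2 * r' ^ 3 * (1 + r')) / D' := by
  have hD' := hD.trans hDD
  have hr'0 := hr.trans hrr
  have hmono : r / (1 + r) < r' / (1 + r') := by
    rw [div_lt_div_iff₀ (by positivity) (by positivity)]; nlinarith
  -- For T < 1 the first quotient alone is strictly decreasing: (1 − r)(1 + Tr/(1+r)) decreases in r
  -- and its denominator D increases. For T > 1 this numerator increases near r = 0, so the second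
  -- coefficient must be used.
  by_cases hT1 : T < 1
  · left
    have e : ∀ x : ℝ, 0 < x → (1 - x) * (1 + T * x / (1 + x))
        = 1 - (1 - T) * x - 2 * T * (x * (x / (1 + x))) := fun x hx => by field_simp; ring
    have h1 : (1 - r') * (1 + T * r' / (1 + r')) < (1 - r) * (1 + T * r / (1 + r)) := by
      rw [e r hr, e r' hr'0]
      have : r * (r / (1 + r)) ≤ r' * (r' / (1 + r')) := by gcongr
      nlinarith
    have h2 : 0 < (1 - r') * (1 + T * r' / (1 + r')) :=
      mul_pos (by linarith) (by positivity)
    apply ne_of_gt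
    calc _ < (1 - r) * (1 + T * r / (1 + r)) / D' := by gcongr
      _ < _ := by gcongr; exact h2.trans h1
  -- Dividing one equality by the other eliminates 1 − r and D and leaves N/E = N'/E'. This is
  -- impossible, since N is positive and strictly decreasing in r while E is strictly increasing.
  · by_contra! hcon
    obtain ⟨e1, e2⟩ := hcon
    push Not at hT1
    set E := 1 + T * r / (1 + r)
    set E' := 1 + T * r' / (1 + r')
    set N := 4 * T - (T - 1) * (r * (1 + r) * (1 + r ^ 2)) - 2 * r ^ 3 * (1 + r) with hN
    set N' := 4 * T - (T - 1) * (r' * (1 + r') * (1 + r' ^ 2)) - 2 * r' ^ 3 * (1 + r') with hN'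
    have hE : 0 < E := by positivity
    have hEE : E < E' := by
      simp only [E, E', mul_div_assoc]; nlinarith
    have hq : r * (1 + r) * (1 + r ^ 2) < r' * (1 + r') * (1 + r' ^ 2) := by gcongr
    have hq3 : r ^ 3 * (1 + r) < r' ^ 3 * (1 + r') := by gcongr
    have hq4 : r' * (1 + r') * (1 + r' ^ 2) < 4 := by
      have a1 : r' * (1 + r') < 2 := by nlinarith
      have a2 : 1 + r' ^ 2 < 2 := by nlinarith
      have := mul_lt_mul'' a1 a2 (by positivity) (by positivity)
      linarith
    have hq5 : r' ^ 3 * (1 + r') < 2 := by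
      have a1 : r' ^ 3 < 1 := pow_lt_one₀ hr'0.le hr' (by norm_num)
      have := mul_lt_mul'' a1 (by linarith : 1 + r' < 2) (by positivity) (by positivity)
      linarith
    have hNN : N' < N := by simp only [N, N']; nlinarith
    have hN'0 : 0 < N' := by simp only [N']; nlinarith
    rw [div_eq_div_iff hD.ne' hD'.ne'] at e1 e2
    have h3 : (1 - r) * (1 - r') * D * D' * (N * E') = (1 - r) * (1 - r') * D * D' * (N' * E) := by
      linear_combination (1 - r') * E' * D * e2 - (1 - r') * N' * D * e1
    have h4 : N * E' = N' * E := by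
      refine mul_left_cancel₀ ?_ h3
      have : 0 < 1 - r := by linarith
      have : 0 < 1 - r' := by linarith
      positivity
    nlinarith [mul_pos hE (sub_pos.2 hNN), mul_pos (hN'0.trans hNN) (sub_pos.2 hEE)]

/-- If x = y, then c₀ − d₀ + σ(c₁ − d₁) = O(σ²). For small σ this contradicts c₀ ≠ d₀, and when c₀ =
d₀ it contradicts c₁ ≠ d₁ after division by σ. -/
lemma exists_separation {c0 c1 d0 d1 : ℂ} (h : c0 ≠ d0 ∨ c1 ≠ d1) (K K' : ℝ) :
    ∃ σ0 > 0, ∀ σ : ℝ, 0 < σ → σ < σ0 → ∀ x y : ℂ, ‖x - (c0 + σ * c1)‖ ≤ K * σ ^ 2 →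
      ‖y - (d0 + σ * d1)‖ ≤ K' * σ ^ 2 → x ≠ y := by
  have key : ∀ σ : ℝ, ∀ x y : ℂ, ‖x - (c0 + σ * c1)‖ ≤ K * σ ^ 2 →
      ‖y - (d0 + σ * d1)‖ ≤ K' * σ ^ 2 → x = y →
      ‖(c0 - d0) + σ * (c1 - d1)‖ ≤ (|K| + |K'|) * σ ^ 2 := by
    intro σ x y hx hy hxy
    subst hxy
    have e : (c0 - d0) + σ * (c1 - d1) = (x - (d0 + σ * d1)) - (x - (c0 + σ * c1)) := by ring
    rw [e]
    refine (norm_sub_le _ _).trans ((add_le_add hy hx).trans ?_)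
    have h1 := le_abs_self K
    have h2 := le_abs_self K'
    nlinarith [sq_nonneg σ, mul_le_mul_of_nonneg_right h1 (sq_nonneg σ),
      mul_le_mul_of_nonneg_right h2 (sq_nonneg σ)]
  set Q := |K| + |K'| with hQ
  have hQ0 : 0 ≤ Q := by positivity
  by_cases h0 : c0 = d0
  · have h1 : 0 < ‖c1 - d1‖ := norm_pos_iff.2 (sub_ne_zero.2 (h.resolve_left (not_not.2 h0)))
    refine ⟨‖c1 - d1‖ / (Q + 1), by positivity, fun σ hσ hσ0 x y hx hy hxy => ?_⟩
    have := key σ x y hx hy hxy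
    rw [h0, sub_self, zero_add, norm_mul, Complex.norm_real, Real.norm_of_nonneg hσ.le] at this
    rw [lt_div_iff₀ (by positivity)] at hσ0
    have h3 : σ * ‖c1 - d1‖ ≤ σ * (Q * σ) := by linarith [this]
    have := le_of_mul_le_mul_left h3 hσ
    nlinarith
  · have h1 : 0 < ‖c0 - d0‖ := norm_pos_iff.2 (sub_ne_zero.2 h0)
    refine ⟨min 1 (‖c0 - d0‖ / (Q + ‖c1 - d1‖ + 1)), by positivity,
      fun σ hσ hσ0 x y hx hy hxy => ?_⟩
    have h2 := key σ x y hx hy hxy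
    have h3 : ‖c0 - d0‖ ≤ ‖(c0 - d0) + σ * (c1 - d1)‖ + σ * ‖c1 - d1‖ := by
      have e : c0 - d0 = ((c0 - d0) + σ * (c1 - d1)) - σ * (c1 - d1) := by ring
      conv_lhs => rw [e]
      refine (norm_sub_le _ _).trans (le_of_eq ?_)
      rw [norm_mul, Complex.norm_real, Real.norm_of_nonneg hσ.le]
    have h4 : σ < 1 := hσ0.trans_le (min_le_left _ _)
    have h5 := hσ0.trans_le (min_le_right _ _)
    rw [lt_div_iff₀ (by positivity)] at h5
    have h6 : Q * σ ^ 2 ≤ Q * σ := by gcongr; nlinarith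
    linarith

/-! ## The radial problem -/

/-- The multiplier `M̂` for a wave vector of length `κ` along the first axis. -/
def radM (p : Params) (κ s : ℝ) : ℂ :=
  4 * Real.pi ^ 2 * p.sigX * κ ^ 2 + 2 * Real.pi * Complex.I * p.lam * (κ * Real.cos s : ℝ)

/-- The right-hand side `∂_θ B̂` for a wave vector of length `κ` along the first axis. -/
def radG (p : Params) (κ s : ℝ) : ℂ :=
  (-(2 * Real.pi * Complex.I * (κ * Real.cos s : ℝ))
    + 4 * Real.pi ^ 2 * p.tau * (κ ^ 2 * Real.cos (2 * s) : ℝ)) /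
    (p.gam + 4 * Real.pi ^ 2 * κ ^ 2 * p.sigC : ℝ)

/-- Scaling to the normalized problem: apart from prefactors, the wave length enters only through a
= 2πσ_xκ/λ, and τ only through T = τλ/σ_x (see `radG_eq`). -/
lemma radM_eq {p : Params} (hl : 0 < p.lam) (κ s : ℝ) : radM p κ s
    = (2 * Real.pi * p.lam * κ : ℝ) * mul1 (2 * Real.pi * p.sigX / p.lam * κ) s := by
  have : (p.lam : ℂ) ≠ 0 := by exact_mod_cast hl.ne'
  simp only [radM, mul1]
  push_cast
  field_simp
  ring

lemma radG_eq {p : Params} (hl : 0 < p.lam) (hx : 0 < p.sigX) (κ s : ℝ) : radG p κ s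
    = (2 * Real.pi * κ / (p.gam + 4 * Real.pi ^ 2 * κ ^ 2 * p.sigC) : ℝ) *
      rhs1 (2 * Real.pi * p.sigX / p.lam * κ) (p.tau * p.lam / p.sigX) s := by
  have : (p.lam : ℂ) ≠ 0 := by exact_mod_cast hl.ne'
  have : (p.sigX : ℂ) ≠ 0 := by exact_mod_cast hx.ne'
  simp only [radG, rhs1]
  push_cast
  field_simp
  ring

lemma contDiff_radM {p : Params} (hl : 0 < p.lam) (κ : ℝ) : ContDiff ℝ ∞ (radM p κ) := by
  rw [funext (radM_eq hl κ)]
  exact contDiff_const.mul (contDiff_mul1 _)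

lemma contDiff_radG {p : Params} (hl : 0 < p.lam) (hx : 0 < p.sigX) (κ : ℝ) :
    ContDiff ℝ ∞ (radG p κ) := by
  rw [funext (radG_eq hl hx κ)]
  exact contDiff_const.mul (contDiff_rhs1 _ _)

lemma radM_periodic {p : Params} (hl : 0 < p.lam) (κ : ℝ) :
    Function.Periodic (radM p κ) (2 * Real.pi) := fun s => by
  rw [radM_eq hl, radM_eq hl, mul1_periodic]

lemma radG_periodic {p : Params} (hl : 0 < p.lam) (hx : 0 < p.sigX) (κ : ℝ) :
    Function.Periodic (radG p κ) (2 * Real.pi) := fun s => by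
  rw [radG_eq hl hx, radG_eq hl hx, rhs1_periodic]

lemma radM_re (p : Params) (κ s : ℝ) : (radM p κ s).re = 4 * Real.pi ^ 2 * p.sigX * κ ^ 2 := by
  have h : radM p κ s = (4 * Real.pi ^ 2 * p.sigX * κ ^ 2 : ℝ)
      + Complex.I * (2 * Real.pi * p.lam * (κ * Real.cos s) : ℝ) := by
    simp only [radM]; push_cast; ring
  rw [h, Complex.add_re, Complex.ofReal_re, Complex.I_mul_re, Complex.ofReal_im, neg_zero, add_zero]

section Branch

variable {p : Params} (hg : 0 < p.gam) (hc : 0 < p.sigC) (hx : 0 < p.sigX) (hl : 0 < p.lam)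
  (ht : 0 ≤ p.tau) {κ : ℝ} (hκ : 0 < κ)

include hg hc hx hl ht hκ

/-- Second order expansion of the integral of the radial solution. -/
lemma exists_radial_expansion : ∃ K : ℝ, ∀ σ > 0, ∀ u, Function.Periodic u (2 * Real.pi) →
    IsSol σ (radM p κ) (radG p κ) u →
    let r := ratio (2 * Real.pi * p.sigX / p.lam * κ)
    let T := p.tau * p.lam / p.sigX
    let D := p.gam + 4 * Real.pi ^ 2 * κ ^ 2 * p.sigC
    ‖(∫ s in (0 : ℝ)..2 * Real.pi, u s)
      - (((2 * Real.pi / p.lam * ((1 - r) * (1 + T * r / (1 + r)) / D) : ℝ) : ℂ)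
      + σ * ((-(Real.pi * p.sigX / p.lam ^ 3) * ((1 - r) * (4 * T - (T - 1) * (r * (1 + r) *
        (1 + r ^ 2)) - 2 * r ^ 3 * (1 + r)) / D) : ℝ) : ℂ))‖ ≤ K * σ ^ 2 := by
  have h2π := Real.two_pi_pos
  have hD : 0 < p.gam + 4 * Real.pi ^ 2 * κ ^ 2 * p.sigC := by positivity
  have ha : 0 < 2 * Real.pi * p.sigX / p.lam * κ := by positivity
  have hM : 0 < 4 * Real.pi ^ 2 * p.sigX * κ ^ 2 := by positivity
  obtain ⟨K, hK⟩ := exists_expansion_integral hM h2π (contDiff_radM hl κ) (contDiff_radG hl hx κ)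
    (radM_re p κ) (radM_periodic hl κ) (radG_periodic hl hx κ)
  refine ⟨K, fun σ hσ u hu hsol => ?_⟩
  intro r T D
  have h := hK σ hσ u hu hsol
  refine le_trans (le_of_eq ?_) h
  have hlc : (p.lam : ℂ) ≠ 0 := by exact_mod_cast hl.ne'
  have hxc : (p.sigX : ℂ) ≠ 0 := by exact_mod_cast hx.ne'
  have hκc : (κ : ℂ) ≠ 0 := by exact_mod_cast hκ.ne'
  have hDc : (D : ℂ) ≠ 0 := by exact_mod_cast hD.ne'
  have hπc : (Real.pi : ℂ) ≠ 0 := by exact_mod_cast Real.pi_ne_zero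
  have e1 : ∀ s, (radM p κ s)⁻¹ = ((2 * Real.pi * p.lam * κ : ℝ) : ℂ)⁻¹ *
      (mul1 (2 * Real.pi * p.sigX / p.lam * κ) s)⁻¹ := fun s => by rw [radM_eq hl, mul_inv]
  have e2 : ∀ s, iteratedDeriv 2 (fun s => (radM p κ s)⁻¹) s
      = ((2 * Real.pi * p.lam * κ : ℝ) : ℂ)⁻¹ *
        iteratedDeriv 2 (fun s => (mul1 (2 * Real.pi * p.sigX / p.lam * κ) s)⁻¹) s := fun s => by
    simp only [e1]
    exact iteratedDeriv_const_mul_field _ _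
  have i1 : ∫ s in (0 : ℝ)..2 * Real.pi, radG p κ s * (radM p κ s)⁻¹
      = -((2 * Real.pi / p.lam * ((1 - r) * (1 + T * r / (1 + r)) / D) : ℝ) : ℂ) := by
    have e3 : ∀ s, radG p κ s * (radM p κ s)⁻¹ = ((p.lam * D : ℝ) : ℂ)⁻¹ *
        (rhs1 (2 * Real.pi * p.sigX / p.lam * κ) (p.tau * p.lam / p.sigX) s
          * (mul1 (2 * Real.pi * p.sigX / p.lam * κ) s)⁻¹) := fun s => by
      rw [e1, radG_eq hl hx]
      change ((2 * Real.pi * κ / D : ℝ) : ℂ) * _ * _ = _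
      push_cast
      field_simp
    simp only [e3]
    rw [intervalIntegral.integral_const_mul, integral_rhs1_mul ha]
    change _ * (-((2 * Real.pi * ((1 - r) * (1 + T * r / (1 + r))) : ℝ) : ℂ)) = _
    generalize (1 - r) * (1 + T * r / (1 + r)) = y
    push_cast
    field_simp
  have i2 : ∫ s in (0 : ℝ)..2 * Real.pi, radG p κ s *
      ((radM p κ s)⁻¹ * iteratedDeriv 2 (fun s => (radM p κ s)⁻¹) s)
      = -((-(Real.pi * p.sigX / p.lam ^ 3) * ((1 - r) * (4 * T - (T - 1) * (r * (1 + r) *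
        (1 + r ^ 2)) - 2 * r ^ 3 * (1 + r)) / D) : ℝ) : ℂ) := by
    have e3 : ∀ s, radG p κ s * ((radM p κ s)⁻¹ * iteratedDeriv 2 (fun s => (radM p κ s)⁻¹) s)
        = ((p.lam * D * (2 * Real.pi * p.lam * κ) : ℝ) : ℂ)⁻¹ *
        (rhs1 (2 * Real.pi * p.sigX / p.lam * κ) (p.tau * p.lam / p.sigX) s
          * ((mul1 (2 * Real.pi * p.sigX / p.lam * κ) s)⁻¹ *
          iteratedDeriv 2 (fun s => (mul1 (2 * Real.pi * p.sigX / p.lam * κ) s)⁻¹) s)) := fun s => by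
      rw [e2, e1, radG_eq hl hx]
      change ((2 * Real.pi * κ / D : ℝ) : ℂ) * _ * _ = _
      generalize iteratedDeriv 2 (fun s => (mul1 (2 * Real.pi * p.sigX / p.lam * κ) s)⁻¹) s = y
      push_cast
      field_simp
    simp only [e3]
    rw [intervalIntegral.integral_const_mul, integral_rhs1_mul_mul ha]
    change _ * (((Real.pi * (2 * Real.pi * p.sigX / p.lam * κ) * ((1 - r) * (4 * T - (T - 1) *
      (r * (1 + r) * (1 + r ^ 2)) - 2 * r ^ 3 * (1 + r))) : ℝ) : ℂ)) = _
    generalize (1 - r) * (4 * T - (T - 1) * (r * (1 + r) * (1 + r ^ 2)) - 2 * r ^ 3 * (1 + r)) = y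
    push_cast
    field_simp
  rw [i1, i2]
  congr 1
  ring

/-- The pairing `∫ U P` does not vanish for small angular diffusion. -/
lemma exists_radial_pairing_ne : ∃ σ0 > 0, ∀ σ : ℝ, 0 < σ → σ < σ0 → ∀ u P,
    Function.Periodic u (2 * Real.pi) → Function.Periodic P (2 * Real.pi) →
    IsSol σ (radM p κ) (radG p κ) u → IsSol σ (radM p κ) (fun _ => 1) P →
    ∫ s in (0 : ℝ)..2 * Real.pi, u s * P s ≠ 0 := by
  have h2π := Real.two_pi_pos
  have hD : 0 < p.gam + 4 * Real.pi ^ 2 * κ ^ 2 * p.sigC := by positivity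
  have ha : 0 < 2 * Real.pi * p.sigX / p.lam * κ := by positivity
  have hM : 0 < 4 * Real.pi ^ 2 * p.sigX * κ ^ 2 := by positivity
  obtain ⟨K, hK⟩ := exists_expansion_pairing hM h2π (contDiff_radM hl κ) (contDiff_radG hl hx κ)
    (radM_re p κ) (radM_periodic hl κ) (radG_periodic hl hx κ)
  obtain ⟨x, hx0, hxe⟩ := integral_rhs1_mul_sq ha (p.tau * p.lam / p.sigX) (by positivity)
  have e3 : ∀ s, radG p κ s * (radM p κ s)⁻¹ ^ 2
      = (2 * Real.pi * κ / (p.gam + 4 * Real.pi ^ 2 * κ ^ 2 * p.sigC) /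
        (2 * Real.pi * p.lam * κ) ^ 2 : ℝ) *
        (rhs1 (2 * Real.pi * p.sigX / p.lam * κ) (p.tau * p.lam / p.sigX) s
          * (mul1 (2 * Real.pi * p.sigX / p.lam * κ) s)⁻¹ ^ 2) := fun s => by
    rw [radG_eq hl hx, radM_eq hl, mul_inv]
    push_cast
    ring
  set y := ∫ s in (0 : ℝ)..2 * Real.pi, radG p κ s * (radM p κ s)⁻¹ ^ 2 with hy
  have hy0 : 0 < ‖y‖ := by
    rw [norm_pos_iff, hy]
    simp only [e3]
    rw [intervalIntegral.integral_const_mul, hxe]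
    refine mul_ne_zero ?_ ?_
    · rw [Ne, Complex.ofReal_eq_zero]; positivity
    · rw [Ne, Complex.ofReal_eq_zero]; exact hx0.ne
  refine ⟨min 1 (‖y‖ / (|K| + 1)), by positivity, fun σ hσ hσ0 u P hu hP hsu hsP h0 => ?_⟩
  have h := hK σ hσ (hσ0.le.trans (min_le_left _ _)) u P hu hP hsu hsP
  rw [h0, zero_sub, norm_neg] at h
  have h5 := hσ0.trans_le (min_le_right _ _)
  rw [lt_div_iff₀ (by positivity)] at h5
  have := mul_le_mul_of_nonneg_right (le_abs_self K) hσ.le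
  nlinarith

end Branch

/-- The branches for two different wave lengths are separated for small angular diffusion. -/
lemma exists_branch_ne {p : Params} (hg : 0 < p.gam) (hc : 0 < p.sigC) (hx : 0 < p.sigX)
    (hl : 0 < p.lam) (ht : 0 ≤ p.tau) {κ κ' : ℝ} (hκ : 0 < κ) (hκκ : κ < κ') :
    ∃ σ0 > 0, ∀ σ : ℝ, 0 < σ → σ < σ0 → ∀ u u', Function.Periodic u (2 * Real.pi) →
    Function.Periodic u' (2 * Real.pi) → IsSol σ (radM p κ) (radG p κ) u →
    IsSol σ (radM p κ') (radG p κ') u' →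
    ∫ s in (0 : ℝ)..2 * Real.pi, u s ≠ ∫ s in (0 : ℝ)..2 * Real.pi, u' s := by
  have hκ' := hκ.trans hκκ
  obtain ⟨K, hK⟩ := exists_radial_expansion hg hc hx hl ht hκ
  obtain ⟨K', hK'⟩ := exists_radial_expansion hg hc hx hl ht hκ'
  have hA : 0 < 2 * Real.pi * p.sigX / p.lam := by have := Real.pi_pos; positivity
  have h2π := Real.two_pi_pos
  have hne := coeff_ne (T := p.tau * p.lam / p.sigX) (D := p.gam + 4 * Real.pi ^ 2 * κ ^ 2 * p.sigC)
    (D' := p.gam + 4 * Real.pi ^ 2 * κ' ^ 2 * p.sigC) (by positivity)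
    (ratio_facts (mul_pos hA hκ)).1
    (ratio_strictMono (mul_pos hA hκ) (mul_lt_mul_of_pos_left hκκ hA))
    (ratio_facts (mul_pos hA hκ')).2.1 (by positivity) (by gcongr)
  refine (exists_separation (Or.imp (fun h e => h ?_) (fun h e => h ?_) hne) K K').imp
    fun σ0 h => ⟨h.1, fun σ hσ hσ0 u u' hu hu' hs hs' => h.2 σ hσ hσ0 _ _ (hK σ hσ u hu hs)
      (hK' σ hσ u' hu' hs')⟩
  · exact mul_left_cancel₀ (by positivity) (Complex.ofReal_injective e)
  · exact mul_left_cancel₀ (neg_ne_zero.2 (by positivity)) (Complex.ofReal_injective e)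

/-- The leading branch coefficient is positive. -/
lemma exists_branch_pos {p : Params} (hg : 0 < p.gam) (hc : 0 < p.sigC) (hx : 0 < p.sigX)
    (hl : 0 < p.lam) (ht : 0 ≤ p.tau) {κ : ℝ} (hκ : 0 < κ) :
    ∃ σ0 > 0, ∃ δ > 0, ∀ σ : ℝ, 0 < σ → σ < σ0 → ∀ u, Function.Periodic u (2 * Real.pi) →
    IsSol σ (radM p κ) (radG p κ) u → δ ≤ (∫ s in (0 : ℝ)..2 * Real.pi, u s).re := by
  obtain ⟨K, hK⟩ := exists_radial_expansion hg hc hx hl ht hκ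
  have hA : 0 < 2 * Real.pi * p.sigX / p.lam := by have := Real.pi_pos; positivity
  have h2π := Real.two_pi_pos
  obtain ⟨hr0, hr1, -⟩ := ratio_facts (mul_pos hA hκ)
  simp only at hK
  set r := ratio (2 * Real.pi * p.sigX / p.lam * κ)
  set c0 : ℝ := 2 * Real.pi / p.lam * ((1 - r) * (1 + p.tau * p.lam / p.sigX * r / (1 + r)) /
    (p.gam + 4 * Real.pi ^ 2 * κ ^ 2 * p.sigC)) with hc0
  have hc0p : 0 < c0 := by
    have : 0 < 1 - r := by linarith
    positivity
  generalize (-(Real.pi * p.sigX / p.lam ^ 3) * ((1 - r) * (4 * (p.tau * p.lam / p.sigX)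
    - (p.tau * p.lam / p.sigX - 1) * (r * (1 + r) * (1 + r ^ 2)) - 2 * r ^ 3 * (1 + r)) /
      (p.gam + 4 * Real.pi ^ 2 * κ ^ 2 * p.sigC))) = c1 at hK
  refine ⟨min 1 (c0 / 2 / (|c1| + |K| + 1)), by positivity, c0 / 2, by positivity,
    fun σ hσ hσ0 u hu hs => ?_⟩
  have h := (Complex.abs_re_le_norm _).trans (hK σ hσ u hu hs)
  have h4 : σ < 1 := hσ0.trans_le (min_le_left _ _)
  have h5 := hσ0.trans_le (min_le_right _ _)
  rw [lt_div_iff₀ (by positivity)] at h5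
  simp only [Complex.sub_re, Complex.add_re, Complex.re_ofReal_mul, Complex.ofReal_re] at h
  have h6 := (abs_le.1 h).1
  have h7 := neg_abs_le c1
  have h8 := le_abs_self K
  have h9 : K * σ ^ 2 ≤ |K| * σ := by
    calc K * σ ^ 2 ≤ |K| * σ ^ 2 := by gcongr
      _ ≤ |K| * σ := by gcongr; nlinarith
  nlinarith

/-- Uniform decay of the branches in the wave length. -/
lemma exists_branch_bound {p : Params} (hg : 0 < p.gam) (hc : 0 < p.sigC) (hx : 0 < p.sigX)
    (ht : 0 ≤ p.tau) :
    ∃ C : ℝ, 0 ≤ C ∧ ∀ κ : ℝ, 1 ≤ κ → ∀ σ > 0, ∀ u, Function.Periodic u (2 * Real.pi) →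
    IsSol σ (radM p κ) (radG p κ) u → ‖∫ s in (0 : ℝ)..2 * Real.pi, u s‖ ≤ C / κ ^ 2 := by
  have hπ := Real.pi_pos
  set Cg := (2 * Real.pi + 4 * Real.pi ^ 2 * p.tau) / (4 * Real.pi ^ 2 * p.sigC) with hCg
  refine ⟨Cg / (4 * Real.pi ^ 2 * p.sigX) * (2 * Real.pi), by positivity,
    fun κ hκ σ hσ u hu hs => ?_⟩
  have hκ0 : 0 < κ := by linarith
  -- Numerator and denominator of ∂_θB̂ both grow like κ², so the right-hand side is bounded
  -- uniformly in κ ≥ 1. The decay comes from Re M = 4π²σ_xκ² in the maximum principle.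
  have hb : ∀ s, ‖radG p κ s‖ ≤ Cg := fun s => by
    rw [radG, norm_div, hCg, Complex.norm_real, Real.norm_of_nonneg (by positivity)]
    have h1 : ‖-(2 * Real.pi * Complex.I * (κ * Real.cos s : ℝ))
        + 4 * Real.pi ^ 2 * p.tau * (κ ^ 2 * Real.cos (2 * s) : ℝ)‖
        ≤ (2 * Real.pi + 4 * Real.pi ^ 2 * p.tau) * κ ^ 2 := by
      refine (norm_add_le _ _).trans ?_
      rw [norm_neg]
      have n1 : ‖(2 * Real.pi * Complex.I * (κ * Real.cos s : ℝ) : ℂ)‖ ≤ 2 * Real.pi * κ := by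
        rw [norm_mul, norm_mul, norm_mul, Complex.norm_I, Complex.norm_real, Complex.norm_real,
          Real.norm_of_nonneg hπ.le, Complex.norm_ofNat, mul_one, norm_mul,
          Real.norm_of_nonneg hκ0.le]
        have := Real.abs_cos_le_one s
        gcongr
        calc κ * ‖Real.cos s‖ ≤ κ * 1 := by gcongr; exact this
          _ = κ := mul_one _
      have n2 : ‖(4 * Real.pi ^ 2 * p.tau * (κ ^ 2 * Real.cos (2 * s) : ℝ) : ℂ)‖
          ≤ 4 * Real.pi ^ 2 * p.tau * κ ^ 2 := by
        rw [norm_mul, norm_mul, norm_mul, norm_pow, Complex.norm_real, Complex.norm_real,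
          Complex.norm_real, Real.norm_of_nonneg hπ.le, Real.norm_of_nonneg ht, Complex.norm_ofNat,
          norm_mul, Real.norm_of_nonneg (by positivity : 0 ≤ κ ^ 2)]
        have := Real.abs_cos_le_one (2 * s)
        gcongr
        calc κ ^ 2 * ‖Real.cos (2 * s)‖ ≤ κ ^ 2 * 1 := by gcongr; exact this
          _ = κ ^ 2 := mul_one _
      have : κ ≤ κ ^ 2 := by nlinarith
      nlinarith [mul_le_mul_of_nonneg_left this hπ.le]
    rw [div_le_div_iff₀ (by positivity) (by positivity)]
    calc _ ≤ (2 * Real.pi + 4 * Real.pi ^ 2 * p.tau) * κ ^ 2 * (4 * Real.pi ^ 2 * p.sigC) := by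
          gcongr
      _ = (2 * Real.pi + 4 * Real.pi ^ 2 * p.tau) * (4 * Real.pi ^ 2 * κ ^ 2 * p.sigC) := by ring
      _ ≤ _ := by gcongr; linarith
  have h := hs.norm_le hσ (m := 4 * Real.pi ^ 2 * p.sigX * κ ^ 2) (by positivity)
    Real.two_pi_pos (fun s => (radM_re p κ s).ge) hb hu
  refine (norm_integral_le_of_bound Real.two_pi_pos h).trans (le_of_eq ?_)
  field_simp

end

end AntModel

namespace AntModel

noncomputable section

open scoped ComplexConjugate

/-! ## The resolvent on the angular circle -/

/-- Polar coordinates of a wave vector. -/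
def IsPolar (ℓ : Fin 2 → ℤ) (κ α : ℝ) : Prop := (ℓ 0 : ℝ) = κ * Real.cos α ∧ (ℓ 1 : ℝ) = κ * Real.sin α

lemma exists_isPolar (ℓ : Fin 2 → ℤ) : ∃ α, IsPolar ℓ (Real.sqrt (normSqZ ℓ)) α := by
  set z : ℂ := ⟨ℓ 0, ℓ 1⟩ with hz
  have hn : ‖z‖ = Real.sqrt (normSqZ ℓ) := by
    rw [Complex.norm_def, normSqZ_eq, Complex.normSq_mk]; congr 1; ring
  exact ⟨z.arg, by rw [← hn, Complex.norm_mul_cos_arg], by rw [← hn, Complex.norm_mul_sin_arg]⟩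

lemma IsPolar.neg {ℓ : Fin 2 → ℤ} {κ α : ℝ} (h : IsPolar ℓ κ α) : IsPolar (-ℓ) κ (α + Real.pi) := by
  constructor
  · simp [Real.cos_add_pi, h.1]
  · simp [Real.sin_add_pi, h.2]

lemma IsPolar.normSqZ {ℓ : Fin 2 → ℤ} {κ α : ℝ} (h : IsPolar ℓ κ α) : normSqZ ℓ = κ ^ 2 := by
  rw [normSqZ_eq, h.1, h.2]
  linear_combination κ ^ 2 * Real.sin_sq_add_cos_sq α

lemma isPolar_k1 (k : ℕ) : IsPolar (k1 k) k 0 := by constructor <;> simp [k1]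

lemma isPolar_k2 (k : ℕ) : IsPolar (k2 k) k (Real.pi / 2) := by constructor <;> simp [k2]

lemma normSqZ_pos {ℓ : Fin 2 → ℤ} (h : ℓ ≠ 0) : 0 < normSqZ ℓ := by
  refine lt_of_le_of_ne (normSqZ_nonneg ℓ) fun h0 => h ?_
  rw [normSqZ_eq] at h0
  have h1 : (ℓ 0 : ℝ) = 0 := by nlinarith [sq_nonneg (ℓ 0 : ℝ), sq_nonneg (ℓ 1 : ℝ)]
  have h2 : (ℓ 1 : ℝ) = 0 := by nlinarith [sq_nonneg (ℓ 0 : ℝ), sq_nonneg (ℓ 1 : ℝ)]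
  funext i
  fin_cases i
  · exact_mod_cast h1
  · exact_mod_cast h2

lemma IsPolar.dot_v {ℓ : Fin 2 → ℤ} {κ α : ℝ} (h : IsPolar ℓ κ α) (s : ℝ) :
    dotZ (v (s : Ang)) ℓ = κ * Real.cos (s - α) := by
  simp only [dotZ, Fin.sum_univ_two, h.1, h.2, v, cosA_coe, sinA_coe, Real.cos_sub,
    Matrix.cons_val_zero, Matrix.cons_val_one]
  ring

lemma IsPolar.dot_vPerp {ℓ : Fin 2 → ℤ} {κ α : ℝ} (h : IsPolar ℓ κ α) (s : ℝ) :
    dotZ (vPerp (s : Ang)) ℓ = -(κ * Real.sin (s - α)) := by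
  simp only [dotZ, Fin.sum_univ_two, h.1, h.2, vPerp, cosA_coe, sinA_coe, Real.sin_sub,
    Matrix.cons_val_zero, Matrix.cons_val_one]
  ring

/-- Rotational invariance: a wave vector of length κ and direction α gives the radial problem with
the angle shifted by α, so all ℓ of one length share the same profile. -/
lemma Mhat_polar {p : Params} {ℓ : Fin 2 → ℤ} {κ α : ℝ} (h : IsPolar ℓ κ α) (s : ℝ) :
    Mhat p ℓ (s : Ang) = radM p κ (s - α) := by
  rw [Mhat, radM, h.dot_v, h.normSqZ]; push_cast; ring

lemma hasDerivAt_dot_v (ℓ : Fin 2 → ℤ) (θ : Ang) (s : ℝ) :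
    HasDerivAt (fun s : ℝ => dotZ (v (θ + (s : Ang))) ℓ) (dotZ (vPerp (θ + (s : Ang))) ℓ) s :=
  HasDerivAt.fun_sum fun i _ => (hasDerivAt_v θ i s).mul_const _

lemma hasDerivAt_dot_vPerp (ℓ : Fin 2 → ℤ) (θ : Ang) (s : ℝ) :
    HasDerivAt (fun s : ℝ => dotZ (vPerp (θ + (s : Ang))) ℓ) (-dotZ (v (θ + (s : Ang))) ℓ) s := by
  refine (HasDerivAt.fun_sum fun i _ => (hasDerivAt_vPerp θ i s).mul_const _).congr_deriv ?_
  simp [dotZ]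

lemma dBhat_eq (p : Params) (ℓ : Fin 2 → ℤ) (θ : Ang) : dBhat p ℓ θ =
    (-(2 * Real.pi * Complex.I * dotZ (v θ) ℓ)
      - 4 * Real.pi ^ 2 * p.tau * (dotZ (vPerp θ) ℓ ^ 2 - dotZ (v θ) ℓ ^ 2 : ℝ)) / chemSymb p ℓ := by
  have h1 := ((hasDerivAt_dot_vPerp ℓ θ 0).ofReal_comp).const_mul (2 * Real.pi * Complex.I)
  have h2 := (((hasDerivAt_dot_vPerp ℓ θ 0).fun_mul (hasDerivAt_dot_v ℓ θ 0)).ofReal_comp).const_mul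
    (4 * (Real.pi : ℂ) ^ 2 * p.tau)
  have h := (h1.fun_sub h2).div_const (chemSymb p ℓ : ℂ)
  refine h.deriv.trans ?_
  simp only [AddCircle.coe_zero, add_zero]
  push_cast
  ring

lemma dBhat_polar {p : Params} {ℓ : Fin 2 → ℤ} {κ α : ℝ} (h : IsPolar ℓ κ α) (s : ℝ) :
    dBhat p ℓ (s : Ang) = radG p κ (s - α) := by
  rw [dBhat_eq, radG, h.dot_v, h.dot_vPerp, chemSymb, h.normSqZ]
  congr 1
  have : Real.cos (2 * (s - α)) = Real.cos (s - α) ^ 2 - Real.sin (s - α) ^ 2 := by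
    rw [Real.cos_two_mul]; linear_combination Real.sin_sq_add_cos_sq (s - α)
  rw [this]
  push_cast
  ring

lemma isResolvent_iff {p : Params} {ℓ : Fin 2 → ℤ} {g u : Ang → ℂ} : IsResolvent p ℓ g u ↔
    IsSol p.sigTh (fun s : ℝ => Mhat p ℓ s) (fun s : ℝ => g s) (fun s : ℝ => u s) := Iff.rfl

lemma coe_periodic {A : Type} (u : Ang → A) : Function.Periodic (fun s : ℝ => u s) (2 * Real.pi) :=
  fun s => by simp only [AddCircle.coe_add_period]

/-- A right-hand side with the symmetries of the radial problem. -/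
structure RadData (g : ℝ → ℂ) : Prop where
  smooth : ContDiff ℝ ∞ g
  periodic : Function.Periodic g (2 * Real.pi)
  even : ∀ s, g (-s) = g s
  antip : ∀ s, conj (g (s + Real.pi)) = g s

lemma radData_one : RadData fun _ => 1 :=
  ⟨contDiff_const, fun _ => rfl, fun _ => rfl, fun _ => map_one _⟩

lemma radM_data {p : Params} (hl : 0 < p.lam) (κ : ℝ) : RadData (radM p κ) where
  smooth := contDiff_radM hl κ
  periodic := radM_periodic hl κ
  even s := by simp [radM]
  antip s := by
    simp only [radM, Real.cos_add_pi, map_add, map_mul, map_pow, Complex.conj_ofReal, Complex.conj_I,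
      map_ofNat]
    push_cast
    ring

lemma radG_data {p : Params} (hl : 0 < p.lam) (hx : 0 < p.sigX) (κ : ℝ) : RadData (radG p κ) where
  smooth := contDiff_radG hl hx κ
  periodic := radG_periodic hl hx κ
  even s := by simp [radG]
  antip s := by
    have : Real.cos (2 * (s + Real.pi)) = Real.cos (2 * s) := by
      rw [mul_add, Real.cos_add_two_pi]
    simp only [radG, this, Real.cos_add_pi, map_add, map_mul, map_pow, map_div₀, map_neg,
      Complex.conj_ofReal, Complex.conj_I, map_ofNat]
    push_cast
    ring

section Resolvent

variable {p : Params} (hx : 0 < p.sigX) (hs : 0 < p.sigTh) (hl : 0 < p.lam)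

include hx hs hl

/-- The symmetries of the solution come from uniqueness: reflection, and the half-turn followed by
conjugation, preserve multiplier and right-hand side, so they fix the solution. -/
lemma exists_radSol {κ : ℝ} (hκ : 0 < κ) {g : ℝ → ℂ} (hg : RadData g) :
    ∃ u, RadData u ∧ IsSol p.sigTh (radM p κ) g u := by
  have hm : 0 < 4 * Real.pi ^ 2 * p.sigX * κ ^ 2 := by have := Real.pi_pos; positivity
  obtain ⟨C, hC0, hC⟩ := exists_norm_bound_of_periodic hg.smooth.continuous Real.two_pi_pos hg.periodic
  obtain ⟨β, hβ0, hβ⟩ := exists_norm_bound_of_periodic (contDiff_radM hl κ).continuous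
    Real.two_pi_pos (radM_periodic hl κ)
  obtain ⟨u, hup, hu⟩ := exists_isSol hs hm (contDiff_radM hl κ).continuous hg.smooth.continuous
    (radM_re p κ) (fun s => (Complex.abs_im_le_norm _).trans (hβ s)) hC (radM_periodic hl κ) hg.periodic
  have hM := radM_data hl κ
  have key : ∀ w, IsSol p.sigTh (radM p κ) g w → Function.Periodic w (2 * Real.pi) → w = u :=
    fun w hw hwp => hw.unique hs hm Real.two_pi_pos hu (fun s => (radM_re p κ s).ge) hwp hup
  refine ⟨u, ⟨hu.contDiff hs (contDiff_radM hl κ) hg.smooth, hup, ?_, ?_⟩, hu⟩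
  · have h := hu.comp_const_sub 0
    simp only [zero_sub, hM.even, hg.even] at h
    exact fun s => congrFun (key _ h fun s => by
      simp only [neg_add]; exact hup.sub_eq (-s)) s
  · have h := (hu.comp_add Real.pi).conj
    simp only [hM.antip, hg.antip] at h
    exact fun s => congrFun (key _ h fun s => by
      rw [add_right_comm, hup]) s

lemma isResolvent_unique {ℓ : Fin 2 → ℤ} (hℓ : ℓ ≠ 0) {G u w : Ang → ℂ}
    (hu : IsResolvent p ℓ G u) (hw : IsResolvent p ℓ G w) : u = w := by
  obtain ⟨α, hα⟩ := exists_isPolar ℓ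
  have hκ := Real.sqrt_pos.2 (normSqZ_pos hℓ)
  have hm : 0 < 4 * Real.pi ^ 2 * p.sigX * Real.sqrt (normSqZ ℓ) ^ 2 := by
    have := Real.pi_pos; positivity
  have h := (isResolvent_iff.1 hu).unique hs hm Real.two_pi_pos (isResolvent_iff.1 hw)
    (fun s => by rw [Mhat_polar hα, radM_re]) (coe_periodic u) (coe_periodic w)
  funext θ
  induction θ using QuotientAddGroup.induction_on with
  | H s => exact congrFun h s

/-- The resolvent in polar coordinates. -/
lemma IsPolar.exists_resolvent {ℓ : Fin 2 → ℤ} {κ α : ℝ} (hα : IsPolar ℓ κ α) (hκ : 0 < κ)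
    {g : ℝ → ℂ} {G : Ang → ℂ} (hG : ∀ s : ℝ, G s = g (s - α)) {u : ℝ → ℂ}
    (hu : RadData u) (hsol : IsSol p.sigTh (radM p κ) g u) :
    IsResolvent p ℓ G (resolvent p ℓ G) ∧ ∀ s : ℝ, resolvent p ℓ G s = u (s - α) := by
  have hℓ : ℓ ≠ 0 := fun h => by
    have := hα.normSqZ
    rw [h] at this
    simp [AntModel.normSqZ] at this
    exact hκ.ne' (pow_eq_zero_iff (by norm_num) |>.1 this.symm)
  have hup : Function.Periodic (fun s => u (s - α)) (2 * Real.pi) := fun s => by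
    simp only []; rw [add_sub_right_comm, hu.periodic]
  have hw : IsResolvent p ℓ G hup.lift := by
    rw [isResolvent_iff]
    simp only [Function.Periodic.lift_coe, hG, Mhat_polar hα, sub_eq_add_neg]
    exact hsol.comp_add (-α)
  have hex : ∃ w, IsResolvent p ℓ G w := ⟨_, hw⟩
  have hr : IsResolvent p ℓ G (resolvent p ℓ G) := by
    rw [resolvent, dif_pos hex]; exact hex.choose_spec
  refine ⟨hr, fun s => ?_⟩
  rw [isResolvent_unique hx hs hl hℓ hr hw, Function.Periodic.lift_coe]

end Resolvent

end

end AntModel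

/-! ### Properties of Û and P, and separation of the critical modes. -/

namespace AntModel

noncomputable section

open scoped ComplexConjugate

lemma integral_ang (f : Ang → ℂ) : ∫ θ, f θ = ∫ s in (0 : ℝ)..2 * Real.pi, f s := by
  have := AddCircle.intervalIntegral_preimage (2 * Real.pi) 0 f
  rw [zero_add] at this
  exact this.symm

lemma integral_ang_shift {f : Ang → ℂ} {g : ℝ → ℂ} (hg : Function.Periodic g (2 * Real.pi)) (α : ℝ)
    (h : ∀ s : ℝ, f s = g (s - α)) : ∫ θ, f θ = ∫ s in (0 : ℝ)..2 * Real.pi, g s := by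
  rw [integral_ang]
  simp only [h]
  rw [intervalIntegral.integral_comp_sub_right, zero_sub,
    show 2 * Real.pi - α = -α + 2 * Real.pi by ring, hg.intervalIntegral_add_eq (-α) 0, zero_add]

/-- The resolvent applied to the constant function `1`. -/
def Phat (p : Params) (ℓ : Fin 2 → ℤ) : Ang → ℂ := resolvent p ℓ fun _ => 1

/-- The integral of `Û^ℓ`. -/
def intU (p : Params) (ℓ : Fin 2 → ℤ) : ℂ := ∫ θ : Ang, Uhat p ℓ θ

/-- The pairing `∫ Û^ℓ P^ℓ`. -/
def intUP (p : Params) (ℓ : Fin 2 → ℤ) : ℂ := ∫ θ : Ang, Uhat p ℓ θ * Phat p ℓ θ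

lemma ang_ext {A : Type} {f g : Ang → A} (h : ∀ s : ℝ, f s = g s) (θ : Ang) : f θ = g θ := by
  induction θ using QuotientAddGroup.induction_on with
  | H s => exact h s

section Facts

variable {p : Params} (hx : 0 < p.sigX) (hs : 0 < p.sigTh) (hl : 0 < p.lam)

include hx hs hl

/-- The radial profiles of `Û^ℓ` and `P^ℓ`. -/
lemma exists_profiles {κ : ℝ} (hκ : 0 < κ) : ∃ u P : ℝ → ℂ, RadData u ∧ RadData P ∧
    IsSol p.sigTh (radM p κ) (radG p κ) u ∧ IsSol p.sigTh (radM p κ) (fun _ => 1) P ∧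
    ∀ ℓ α, IsPolar ℓ κ α → IsResolvent p ℓ (dBhat p ℓ) (Uhat p ℓ) ∧
      IsResolvent p ℓ (fun _ => 1) (Phat p ℓ) ∧ (∀ s : ℝ, Uhat p ℓ s = u (s - α)) ∧
      ∀ s : ℝ, Phat p ℓ s = P (s - α) := by
  obtain ⟨u, hu, hus⟩ := exists_radSol hx hs hl hκ (radG_data hl hx κ)
  obtain ⟨P, hP, hPs⟩ := exists_radSol hx hs hl hκ radData_one
  refine ⟨u, P, hu, hP, hus, hPs, fun ℓ α h => ?_⟩
  have h1 := h.exists_resolvent hx hs hl hκ (dBhat_polar h) hu hus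
  have h2 := h.exists_resolvent (g := fun _ => 1) (G := fun _ => 1) hx hs hl hκ (fun _ => rfl) hP hPs
  exact ⟨h1.1, h2.1, h1.2, h2.2⟩

variable {ℓ : Fin 2 → ℤ} (hℓ : ℓ ≠ 0)

include hℓ

lemma exists_profiles' : ∃ (κ α : ℝ) (u P : ℝ → ℂ), 0 < κ ∧ IsPolar ℓ κ α ∧ RadData u ∧ RadData P ∧
    IsSol p.sigTh (radM p κ) (radG p κ) u ∧ IsSol p.sigTh (radM p κ) (fun _ => 1) P ∧
    ∀ ℓ α, IsPolar ℓ κ α → IsResolvent p ℓ (dBhat p ℓ) (Uhat p ℓ) ∧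
      IsResolvent p ℓ (fun _ => 1) (Phat p ℓ) ∧ (∀ s : ℝ, Uhat p ℓ s = u (s - α)) ∧
      ∀ s : ℝ, Phat p ℓ s = P (s - α) := by
  obtain ⟨α, hα⟩ := exists_isPolar ℓ
  have hκ := Real.sqrt_pos.2 (normSqZ_pos hℓ)
  obtain ⟨u, P, h⟩ := exists_profiles hx hs hl hκ
  exact ⟨_, α, u, P, hκ, hα, h⟩

lemma isResolvent_Uhat : IsResolvent p ℓ (dBhat p ℓ) (Uhat p ℓ) := by
  obtain ⟨κ, α, u, P, hκ, hα, -, -, -, -, h⟩ := exists_profiles' hx hs hl hℓ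
  exact (h ℓ α hα).1

lemma isResolvent_Phat : IsResolvent p ℓ (fun _ => 1) (Phat p ℓ) := by
  obtain ⟨κ, α, u, P, hκ, hα, -, -, -, -, h⟩ := exists_profiles' hx hs hl hℓ
  exact (h ℓ α hα).2.1

lemma contDiff_Uhat : ContDiff ℝ ∞ fun s : ℝ => Uhat p ℓ s := by
  obtain ⟨κ, α, u, P, hκ, hα, hu, -, -, -, h⟩ := exists_profiles' hx hs hl hℓ
  simp only [(h ℓ α hα).2.2.1]
  exact hu.smooth.comp (contDiff_id.sub contDiff_const)

lemma contDiff_Phat : ContDiff ℝ ∞ fun s : ℝ => Phat p ℓ s := by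
  obtain ⟨κ, α, u, P, hκ, hα, -, hP, -, -, h⟩ := exists_profiles' hx hs hl hℓ
  simp only [(h ℓ α hα).2.2.2]
  exact hP.smooth.comp (contDiff_id.sub contDiff_const)

lemma Uhat_neg (θ : Ang) : Uhat p (-ℓ) θ = conj (Uhat p ℓ θ) := by
  obtain ⟨κ, α, u, P, hκ, hα, hu, hP, -, -, h⟩ := exists_profiles' hx hs hl hℓ
  refine ang_ext (f := Uhat p (-ℓ)) (g := fun θ => conj (Uhat p ℓ θ)) (fun s => ?_) θ
  rw [(h ℓ α hα).2.2.1, (h (-ℓ) _ hα.neg).2.2.1, ← hu.antip]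
  congr 2; ring

lemma Phat_neg (θ : Ang) : Phat p (-ℓ) θ = conj (Phat p ℓ θ) := by
  obtain ⟨κ, α, u, P, hκ, hα, hu, hP, -, -, h⟩ := exists_profiles' hx hs hl hℓ
  refine ang_ext (f := Phat p (-ℓ)) (g := fun θ => conj (Phat p ℓ θ)) (fun s => ?_) θ
  rw [(h ℓ α hα).2.2.2, (h (-ℓ) _ hα.neg).2.2.2, ← hP.antip]
  congr 2; ring

lemma Uhat_antip (θ : Ang) : Uhat p (-ℓ) (θ + ((Real.pi : ℝ) : Ang)) = Uhat p ℓ θ := by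
  obtain ⟨κ, α, u, P, hκ, hα, hu, hP, -, -, h⟩ := exists_profiles' hx hs hl hℓ
  refine ang_ext (f := fun θ => Uhat p (-ℓ) (θ + ((Real.pi : ℝ) : Ang))) (fun s => ?_) θ
  rw [← AddCircle.coe_add, (h ℓ α hα).2.2.1, (h (-ℓ) _ hα.neg).2.2.1]
  congr 1; ring

/-- Vectors of equal length have the same profile up to a shift of the angle, which the integral
over the circle ignores. -/
lemma intU_eq_of_normSqZ {ℓ' : Fin 2 → ℤ} (h' : normSqZ ℓ' = normSqZ ℓ) : intU p ℓ' = intU p ℓ := by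
  obtain ⟨α, hα⟩ := exists_isPolar ℓ
  obtain ⟨α', hα'⟩ := exists_isPolar ℓ'
  rw [h'] at hα'
  obtain ⟨u, P, hu, -, -, -, h⟩ := exists_profiles hx hs hl (Real.sqrt_pos.2 (normSqZ_pos hℓ))
  rw [intU, intU, integral_ang_shift hu.periodic α (h ℓ α hα).2.2.1,
    integral_ang_shift hu.periodic α' (h ℓ' α' hα').2.2.1]

lemma intUP_eq_of_normSqZ {ℓ' : Fin 2 → ℤ} (h' : normSqZ ℓ' = normSqZ ℓ) :
    intUP p ℓ' = intUP p ℓ := by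
  obtain ⟨α, hα⟩ := exists_isPolar ℓ
  obtain ⟨α', hα'⟩ := exists_isPolar ℓ'
  rw [h'] at hα'
  obtain ⟨u, P, hu, hP, -, -, h⟩ := exists_profiles hx hs hl (Real.sqrt_pos.2 (normSqZ_pos hℓ))
  have hup : Function.Periodic (fun s => u s * P s) (2 * Real.pi) := fun s => by
    simp only [hu.periodic s, hP.periodic s]
  rw [intUP, intUP, integral_ang_shift (f := fun θ => Uhat p ℓ θ * Phat p ℓ θ) hup α
      (fun s => by rw [(h ℓ α hα).2.2.1, (h ℓ α hα).2.2.2]),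
    integral_ang_shift (f := fun θ => Uhat p ℓ' θ * Phat p ℓ' θ) hup α'
      (fun s => by rw [(h ℓ' α' hα').2.2.1, (h ℓ' α' hα').2.2.2])]

lemma intU_neg : intU p (-ℓ) = intU p ℓ := intU_eq_of_normSqZ hx hs hl hℓ (normSqZ_neg ℓ)

/-- Reality: −ℓ has the same length as ℓ, and Û^{-ℓ} is the conjugate of Û^ℓ. -/
lemma conj_intU : conj (intU p ℓ) = intU p ℓ := by
  have h : intU p (-ℓ) = conj (intU p ℓ) := by
    rw [intU, intU, ← integral_conj]
    simp only [Uhat_neg hx hs hl hℓ]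
  rw [← h, intU_neg hx hs hl hℓ]

lemma conj_intUP : conj (intUP p ℓ) = intUP p ℓ := by
  have h : intUP p (-ℓ) = conj (intUP p ℓ) := by
    rw [intUP, intUP, ← integral_conj]
    simp only [Uhat_neg hx hs hl hℓ, Phat_neg hx hs hl hℓ, map_mul]
  rw [← h, intUP_eq_of_normSqZ hx hs hl hℓ (normSqZ_neg ℓ)]

/-- Transposing −M̂ + σ_θ ∂² from Û to P turns ∂_θB̂ · P into Û · 1. This is what brings ∫Û^ℓ into
the dispersion relation. -/
lemma integral_dBhat_mul_Phat : ∫ θ : Ang, dBhat p ℓ θ * Phat p ℓ θ = intU p ℓ := by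
  have h1 := isResolvent_iff.1 (isResolvent_Uhat hx hs hl hℓ)
  have h2 := isResolvent_iff.1 (isResolvent_Phat hx hs hl hℓ)
  obtain ⟨α, hα⟩ := exists_isPolar ℓ
  have hM : Continuous fun s : ℝ => Mhat p ℓ s := by
    simp only [Mhat_polar hα]
    exact (contDiff_radM hl _).continuous.comp (by fun_prop)
  rw [intU, integral_ang, integral_ang,
    h1.integral_mul hM h2.1 (coe_periodic _) (coe_periodic _)]
  simp only [h2.2, mul_one]

end Facts

section Swap

variable {p : Params} (hx : 0 < p.sigX) (hs : 0 < p.sigTh) (hl : 0 < p.lam) {k : ℕ} (hk : 0 < k)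

include hx hs hl hk

lemma Uhat_swap (θ : Ang) : Uhat p (k1 k) (((Real.pi / 2 : ℝ) : Ang) - θ) = Uhat p (k2 k) θ := by
  obtain ⟨u, P, hu, hP, -, -, h⟩ := exists_profiles hx hs hl (Nat.cast_pos.2 hk)
  refine ang_ext (f := fun θ => Uhat p (k1 k) (((Real.pi / 2 : ℝ) : Ang) - θ)) (fun s => ?_) θ
  rw [← AddCircle.coe_sub, (h _ _ (isPolar_k1 k)).2.2.1, (h _ _ (isPolar_k2 k)).2.2.1, sub_zero,
    ← hu.even, neg_sub]

end Swap

lemma finite_normSqZ_le (R : ℝ) : {ℓ : Fin 2 → ℤ | normSqZ ℓ ≤ R}.Finite := by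
  have hsub : {ℓ : Fin 2 → ℤ | normSqZ ℓ ≤ R} ⊆
      Set.Icc (fun _ => -⌈|R|⌉) (fun _ => ⌈|R|⌉) := fun ℓ h => by
    rw [Set.mem_ofPred_eq, normSqZ_eq] at h
    have hR : R ≤ ⌈|R|⌉ := (le_abs_self R).trans (Int.le_ceil _)
    have key : ∀ i, ℓ i ^ 2 ≤ ⌈|R|⌉ := fun i => by
      have : ((ℓ i : ℝ)) ^ 2 ≤ ⌈|R|⌉ := by
        fin_cases i
        · change (ℓ 0 : ℝ) ^ 2 ≤ _; nlinarith [sq_nonneg (ℓ 1 : ℝ)]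
        · change (ℓ 1 : ℝ) ^ 2 ≤ _; nlinarith [sq_nonneg (ℓ 0 : ℝ)]
      exact_mod_cast this
    constructor <;> intro i <;> have := key i <;> simp only <;> nlinarith [sq_nonneg (ℓ i - 1), sq_nonneg (ℓ i + 1)]
  exact (Set.finite_Icc _ _).subset hsub

lemma one_le_normSqZ {ℓ : Fin 2 → ℤ} (h : ℓ ≠ 0) : 1 ≤ normSqZ ℓ := by
  have h1 := normSqZ_pos h
  rw [normSqZ_eq] at h1 ⊢
  have h2 : 0 < ℓ 0 ^ 2 + ℓ 1 ^ 2 := by exact_mod_cast h1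
  have h3 : 1 ≤ ℓ 0 ^ 2 + ℓ 1 ^ 2 := h2
  exact_mod_cast h3

/-- The constant does not depend on σ. Hence the finite set of wave vectors that could compete with
the critical ones can be fixed before σ is made small. -/
lemma exists_intU_bound {p : Params} (hg : 0 < p.gam) (hc : 0 < p.sigC) (hx : 0 < p.sigX)
    (hl : 0 < p.lam) (ht : 0 ≤ p.tau) : ∃ C : ℝ, 0 ≤ C ∧ ∀ σ > 0, ∀ ℓ ≠ 0,
      ‖intU { p with sigTh := σ } ℓ‖ ≤ C / normSqZ ℓ := by
  obtain ⟨C, hC0, hC⟩ := exists_branch_bound hg hc hx ht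
  refine ⟨C, hC0, fun σ hσ ℓ hℓ => ?_⟩
  obtain ⟨κ, α, u, P, hκ, hα, hu, -, hus, -, h⟩ :=
    exists_profiles' (p := { p with sigTh := σ }) hx hσ hl hℓ
  have h1 := one_le_normSqZ hℓ
  rw [hα.normSqZ] at h1 ⊢
  rw [intU, integral_ang_shift hu.periodic α (h ℓ α hα).2.2.1]
  exact hC κ (by nlinarith) σ hσ u hu.periodic hus

/-- The spectral picture for small angular diffusion. -/
theorem exists_spectral {p : Params} (hg : 0 < p.gam) (hc : 0 < p.sigC) (hx : 0 < p.sigX)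
    (hl : 0 < p.lam) (ht : 0 ≤ p.tau) {k : ℕ} (hk : 0 < k) :
    ∃ σ0 > 0, ∀ σ, 0 < σ → σ < σ0 → 0 < (intU { p with sigTh := σ } (k1 k)).re ∧
      intUP { p with sigTh := σ } (k1 k) ≠ 0 ∧
      ∀ ℓ ≠ 0, normSqZ ℓ ≠ k ^ 2 →
        intU { p with sigTh := σ } ℓ ≠ intU { p with sigTh := σ } (k1 k) := by
  have hk' : (0 : ℝ) < k := Nat.cast_pos.2 hk
  obtain ⟨C, hC0, hC⟩ := exists_intU_bound hg hc hx hl ht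
  obtain ⟨σ1, h1, δ, hδ, hpos⟩ := exists_branch_pos hg hc hx hl ht hk'
  obtain ⟨σ2, h2, hne⟩ := exists_radial_pairing_ne hg hc hx hl ht hk'
  have hsep : ∀ ℓ : Fin 2 → ℤ, ℓ ≠ 0 → normSqZ ℓ ≠ k ^ 2 → ∃ σ0 > 0, ∀ σ, 0 < σ → σ < σ0 →
      intU { p with sigTh := σ } ℓ ≠ intU { p with sigTh := σ } (k1 k) := fun ℓ hℓ hne => by
    obtain ⟨α, hα⟩ := exists_isPolar ℓ
    have hκ := Real.sqrt_pos.2 (normSqZ_pos hℓ)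
    set κ := Real.sqrt (normSqZ ℓ) with hκd
    have hκk : κ ≠ k := fun h => hne (by rw [← h, hκd, Real.sq_sqrt (normSqZ_nonneg ℓ)])
    have key : ∀ σ > 0, ∃ u w, Function.Periodic u (2 * Real.pi) ∧
        Function.Periodic w (2 * Real.pi) ∧ IsSol σ (radM p κ) (radG p κ) u ∧
        IsSol σ (radM p k) (radG p k) w ∧
        intU { p with sigTh := σ } ℓ = ∫ s in (0 : ℝ)..2 * Real.pi, u s ∧
        intU { p with sigTh := σ } (k1 k) = ∫ s in (0 : ℝ)..2 * Real.pi, w s := fun σ hσ => by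
      obtain ⟨u, P, hu, -, hus, -, h⟩ := exists_profiles (p := { p with sigTh := σ }) hx hσ hl hκ
      obtain ⟨w, P', hw, -, hws, -, h'⟩ := exists_profiles (p := { p with sigTh := σ }) hx hσ hl hk'
      exact ⟨u, w, hu.periodic, hw.periodic, hus, hws,
        integral_ang_shift hu.periodic α (h ℓ α hα).2.2.1,
        integral_ang_shift hw.periodic 0 (h' _ _ (isPolar_k1 k)).2.2.1⟩
    rcases hκk.lt_or_gt with hlt | hlt
    · obtain ⟨σ0, h0, hb⟩ := exists_branch_ne hg hc hx hl ht hκ hlt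
      refine ⟨σ0, h0, fun σ hσ hσ0 => ?_⟩
      obtain ⟨u, w, hu, hw, hus, hws, e1, e2⟩ := key σ hσ
      rw [e1, e2]
      exact hb σ hσ hσ0 u w hu hw hus hws
    · obtain ⟨σ0, h0, hb⟩ := exists_branch_ne hg hc hx hl ht hk' hlt
      refine ⟨σ0, h0, fun σ hσ hσ0 => ?_⟩
      obtain ⟨u, w, hu, hw, hus, hws, e1, e2⟩ := key σ hσ
      rw [e1, e2]
      exact (hb σ hσ hσ0 w u hw hu hws hus).symm
  -- Outside S one has |∫Û^ℓ| ≤ C/|ℓ|² < δ ≤ Re ∫Û^{k₁}, for every admissible σ. Inside S only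
  -- finitely many thresholds have to be met.
  set S := {ℓ : Fin 2 → ℤ | normSqZ ℓ ≤ C / δ} with hS
  have hfin : S.Finite := finite_normSqZ_le _
  have hev : ∀ᶠ σ in nhdsWithin (0 : ℝ) (Set.Ioi 0), ∀ ℓ ∈ S, ℓ ≠ 0 → normSqZ ℓ ≠ k ^ 2 →
      intU { p with sigTh := σ } ℓ ≠ intU { p with sigTh := σ } (k1 k) := by
    rw [Filter.eventually_all_finite hfin]
    intro ℓ _
    by_cases hℓ : ℓ ≠ 0 ∧ normSqZ ℓ ≠ k ^ 2
    · obtain ⟨σ0, h0, h⟩ := hsep ℓ hℓ.1 hℓ.2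
      filter_upwards [Ioo_mem_nhdsGT h0] with σ hσ _ _ using h σ hσ.1 hσ.2
    · exact Filter.Eventually.of_forall fun σ a b => absurd ⟨a, b⟩ hℓ
  obtain ⟨σ3, h3, h3'⟩ := (mem_nhdsGT_iff_exists_Ioo_subset).1 hev
  refine ⟨min σ1 (min σ2 σ3), by positivity [Set.mem_Ioi.1 h3], fun σ hσ hσ0 => ?_⟩
  have l1 : σ < σ1 := hσ0.trans_le (min_le_left _ _)
  have l2 : σ < σ2 := hσ0.trans_le ((min_le_right _ _).trans (min_le_left _ _))
  have l3 : σ < σ3 := hσ0.trans_le ((min_le_right _ _).trans (min_le_right _ _))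
  obtain ⟨u, P, hu, hP, hus, hPs, h⟩ := exists_profiles (p := { p with sigTh := σ }) hx hσ hl hk'
  have hk1 := h _ _ (isPolar_k1 k)
  have hre : δ ≤ (intU { p with sigTh := σ } (k1 k)).re := by
    rw [intU, integral_ang_shift hu.periodic 0 hk1.2.2.1]
    exact hpos σ hσ l1 u hu.periodic hus
  refine ⟨hδ.trans_le hre, ?_, fun ℓ hℓ hne' => ?_⟩
  · have hup : Function.Periodic (fun s => u s * P s) (2 * Real.pi) := fun s => by
      simp only [hu.periodic s, hP.periodic s]
    rw [intUP, integral_ang_shift (f := fun θ => Uhat { p with sigTh := σ } (k1 k) θ *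
      Phat { p with sigTh := σ } (k1 k) θ) hup 0 (fun s => by rw [hk1.2.2.1, hk1.2.2.2])]
    exact hne σ hσ l2 u P hu.periodic hP.periodic hus hPs
  · by_cases hℓS : ℓ ∈ S
    · exact h3' ⟨hσ, l3⟩ ℓ hℓS hℓ hne'
    · intro he
      have hb := hC σ hσ ℓ hℓ
      rw [he] at hb
      have h4 := hre.trans ((Complex.re_le_norm _).trans hb)
      rw [hS, Set.mem_ofPred_eq, not_le, div_lt_iff₀ hδ] at hℓS
      rw [le_div_iff₀ (normSqZ_pos hℓ)] at h4
      linarith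

/-- A uniform gap away from the critical modes. -/
lemma exists_gap {p : Params} (hg : 0 < p.gam) (hc : 0 < p.sigC) (hx : 0 < p.sigX)
    (hs : 0 < p.sigTh) (hl : 0 < p.lam) (ht : 0 ≤ p.tau) (χ : ℝ) :
    ∃ K : ℝ, ∀ ℓ ≠ 0, ‖(1 - χ / (2 * Real.pi) * intU p ℓ)⁻¹‖ ≤ K := by
  obtain ⟨C, hC0, hC⟩ := exists_intU_bound hg hc hx hl ht
  have hπ := Real.pi_pos
  set q := |χ| / (2 * Real.pi)
  -- K covers the finitely many short wave vectors. Critical ones among them do no harm, since the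
  -- inverse of 0 is 0. For the others |χ/2π ∫Û^ℓ| ≤ 1/2, which makes the inverse at most 2.
  obtain ⟨K, hK⟩ := ((finite_normSqZ_le (2 * (q * C))).image
    fun ℓ => ‖(1 - χ / (2 * Real.pi) * intU p ℓ)⁻¹‖).bddAbove
  refine ⟨max K 2, fun ℓ hℓ => ?_⟩
  rcases le_or_gt (normSqZ ℓ) (2 * (q * C)) with hle | hlt
  · exact (hK ⟨ℓ, hle, rfl⟩).trans (le_max_left _ _)
  · refine le_trans ?_ (le_max_right _ _)
    have h1 := hC p.sigTh hs ℓ hℓ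
    rw [le_div_iff₀ (normSqZ_pos hℓ)] at h1
    have h2 : ‖(χ / (2 * Real.pi) * intU p ℓ : ℂ)‖ ≤ 1 / 2 := by
      have h3 : ‖(χ / (2 * Real.pi) : ℂ)‖ = q := by
        rw [norm_div, norm_mul, Complex.norm_real, Complex.norm_real, Complex.norm_ofNat,
          Real.norm_of_nonneg hπ.le, Real.norm_eq_abs]
      rw [norm_mul, h3]
      have hn := normSqZ_pos hℓ
      have h4 : q * (‖intU p ℓ‖ * normSqZ ℓ) ≤ q * C := by gcongr
      by_contra! hcon
      have := mul_lt_mul_of_pos_right hcon hn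
      linarith
    have h5 : 1 / 2 ≤ ‖1 - (χ / (2 * Real.pi) * intU p ℓ : ℂ)‖ := by
      have := norm_sub_norm_le (1 : ℂ) (χ / (2 * Real.pi) * intU p ℓ)
      rw [norm_one] at this
      linarith
    rw [norm_inv]
    calc _ ≤ (1 / 2 : ℝ)⁻¹ := inv_anti₀ (by norm_num) h5
      _ = 2 := by norm_num

end

end AntModel

namespace AntModel

noncomputable section

open scoped ComplexConjugate

/-! ## Pairing with single wave vectors -/

/-- The test function `e^{-2πi ℓ·x} Θ(θ)`. -/
def wave (ℓ : Fin 2 → ℤ) (Θ : Ang → ℂ) (z : Phase) : ℂ := UnitAddTorus.mFourier (-ℓ) z.1 * Θ z.2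

/-- The pairing `∫ u e^{-2πi ℓ·x} Θ(θ)`. -/
def pair (ℓ : Fin 2 → ℤ) (Θ : Ang → ℂ) (u : Phase → ℝ) : ℂ := ∫ z, (u z : ℂ) * wave ℓ Θ z

lemma wave_eq (ℓ : Fin 2 → ℤ) (Θ : Ang → ℂ) (z : Phase) :
    wave ℓ Θ z = phaseFS.E (-ℓ, 0) z * Θ z.2 := by
  rw [phaseFS_E, phaseE_apply, wave]; simp

lemma continuous_ang {Θ : Ang → ℂ} (h : Continuous fun s : ℝ => Θ s) : Continuous Θ :=
  (QuotientAddGroup.isQuotientMap_mk (N := AddSubgroup.zmultiples (2 * Real.pi))).continuous_iff.2 h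

lemma continuous_wave (ℓ : Fin 2 → ℤ) {Θ : Ang → ℂ} (h : Continuous Θ) : Continuous (wave ℓ Θ) :=
  ((UnitAddTorus.mFourier (-ℓ)).continuous.comp continuous_fst).mul (h.comp continuous_snd)

lemma contDiff_wave (ℓ : Fin 2 → ℤ) {Θ : Ang → ℂ} (h : ContDiff ℝ ∞ fun s : ℝ => Θ s) :
    ContDiff ℝ ∞ fun y => wave ℓ Θ (phaseCover y) := by
  simp only [wave_eq]
  refine (phaseFS.contDiff_E _).mul ?_
  exact h.comp (contDiff_apply ℝ ℝ (2 : Fin 3))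

/-- The derivative of a function of the angle. -/
def derivAng (Θ : Ang → ℂ) (θ : Ang) : ℂ := deriv (fun s : ℝ => Θ (θ + (s : Ang))) 0

lemma derivAng_coe (Θ : Ang → ℂ) (t : ℝ) : derivAng Θ t = deriv (fun s : ℝ => Θ s) t := by
  rw [derivAng]
  simp only [← AddCircle.coe_add]
  rw [deriv_comp_const_add (fun s : ℝ => Θ s) t 0, add_zero]

lemma derivAng_derivAng_coe (Θ : Ang → ℂ) (t : ℝ) :
    derivAng (derivAng Θ) t = iteratedDeriv 2 (fun s : ℝ => Θ s) t := by
  rw [derivAng_coe, iteratedDeriv_succ, iteratedDeriv_one]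
  simp only [derivAng_coe]

lemma contDiff_derivAng {Θ : Ang → ℂ} (h : ContDiff ℝ ∞ fun s : ℝ => Θ s) :
    ContDiff ℝ ∞ fun s : ℝ => derivAng Θ s := by
  simp only [derivAng_coe]
  exact (contDiff_infty_iff_deriv.1 h).2

lemma hasDerivAt_wave_ang {Θ : Ang → ℂ} (h : ContDiff ℝ ∞ fun s : ℝ => Θ s) (θ : Ang) :
    HasDerivAt (fun s : ℝ => Θ (θ + (s : Ang))) (derivAng Θ θ) 0 := by
  apply DifferentiableAt.hasDerivAt
  induction θ using ang_induction with
  | h t =>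
    simp only [← AddCircle.coe_add]
    exact ((h.differentiable (by simp)).comp (by fun_prop : Differentiable ℝ fun s : ℝ => t + s)) 0

lemma cpderiv_two_wave (ℓ : Fin 2 → ℤ) {Θ : Ang → ℂ} (h : ContDiff ℝ ∞ fun s : ℝ => Θ s)
    (z : Phase) : cpderiv phaseCover 2 (wave ℓ Θ) z = wave ℓ (derivAng Θ) z := by
  rw [cpderiv]
  simp only [wave, phaseCover_single_two, Prod.fst_add, Prod.snd_add, add_zero]
  exact ((hasDerivAt_wave_ang h z.2).const_mul _).deriv

lemma cpderiv_castSucc_wave (ℓ : Fin 2 → ℤ) (Θ : Ang → ℂ) (i : Fin 2) (z : Phase) :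
    cpderiv phaseCover i.castSucc (wave ℓ Θ) z = -(2 * Real.pi * Complex.I * ℓ i) * wave ℓ Θ z := by
  have h1 := phaseFS.hasDerivAt_cpderiv_zero (phaseFS.contDiff_E (-ℓ, 0)) z i.castSucc
  rw [phaseFS.cpderiv_E] at h1
  have h2 : cpderiv phaseCover i.castSucc (wave ℓ Θ) z
      = Complex.I * phaseFS.freq (-ℓ, 0) i.castSucc * phaseFS.E (-ℓ, 0) z * Θ z.2 := by
    rw [cpderiv]
    refine HasDerivAt.deriv ((h1.mul_const (Θ z.2)).congr_of_eventuallyEq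
      (Filter.Eventually.of_forall fun s => ?_))
    simp only [wave_eq]
    congr 2
    simp [phaseCover_single_castSucc]
  rw [h2, wave_eq, phaseFS_freq]
  fin_cases i <;> simp <;> ring

lemma pair_congr {u w : Phase → ℝ} (h : u =ᵐ[volume] w) (ℓ : Fin 2 → ℤ) (Θ : Ang → ℂ) :
    pair ℓ Θ u = pair ℓ Θ w :=
  integral_congr_ae (by filter_upwards [h] with z hz; rw [hz])

lemma integrable_pair (u : L2 Phase) (ℓ : Fin 2 → ℤ) {Θ : Ang → ℂ} (h : Continuous Θ) :
    Integrable fun z => (u z : ℂ) * wave ℓ Θ z :=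
  integrable_ofReal_mul_continuous (integrable_L2 u) (continuous_wave ℓ h)

lemma pair_add (ℓ : Fin 2 → ℤ) {Θ : Ang → ℂ} (h : Continuous Θ) (u w : L2 Phase) :
    pair ℓ Θ (u + w : L2 Phase) = pair ℓ Θ u + pair ℓ Θ w := by
  rw [pair_congr (Lp.coeFn_add u w), pair, pair, pair,
    ← integral_add (integrable_pair u ℓ h) (integrable_pair w ℓ h)]
  congr 1; funext z; simp; ring

lemma pair_smul (ℓ : Fin 2 → ℤ) (Θ : Ang → ℂ) (c : ℝ) (u : L2 Phase) :
    pair ℓ Θ (c • u : L2 Phase) = c * pair ℓ Θ u := by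
  rw [pair_congr (Lp.coeFn_smul c u), pair, pair, ← integral_const_mul]
  congr 1; funext z; simp; ring

lemma pair_sub (ℓ : Fin 2 → ℤ) {Θ : Ang → ℂ} (h : Continuous Θ) (u w : L2 Phase) :
    pair ℓ Θ (u - w : L2 Phase) = pair ℓ Θ u - pair ℓ Θ w := by
  have := pair_add ℓ h (u - w) w
  rw [sub_add_cancel] at this
  rw [this]; ring

lemma pair_add_fun (ℓ : Fin 2 → ℤ) {Θ Θ' : Ang → ℂ} (h : Continuous Θ) (h' : Continuous Θ')
    (u : L2 Phase) : pair ℓ (fun θ => Θ θ + Θ' θ) u = pair ℓ Θ u + pair ℓ Θ' u := by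
  rw [pair, pair, pair, ← integral_add (integrable_pair u ℓ h) (integrable_pair u ℓ h')]
  congr 1; funext z; simp only [wave]; ring

lemma pair_const_mul_fun (ℓ : Fin 2 → ℤ) (c : ℂ) (Θ : Ang → ℂ) (u : Phase → ℝ) :
    pair ℓ (fun θ => c * Θ θ) u = c * pair ℓ Θ u := by
  rw [pair, pair, ← integral_const_mul]
  congr 1; funext z; simp only [wave]; ring

lemma pair_one (ℓ : Fin 2 → ℤ) (u : Phase → ℝ) : pair ℓ (fun _ => 1) u = phaseFS.coef u (ℓ, 0) := by
  rw [pair, FourierSystem.coef]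
  congr 1; funext z
  rw [wave_eq, mul_one, ← phaseFS.E_neg]; rfl

section Pairing

variable {Θ : Ang → ℂ} (hΘ : ContDiff ℝ ∞ fun s : ℝ => Θ s) (ℓ : Fin 2 → ℤ)

include hΘ

lemma pair_jet2_castSucc (f : H2 phaseCover) (i : Fin 2) :
    pair ℓ Θ (jet2 phaseCover i.castSucc i.castSucc f)
      = -(4 * Real.pi ^ 2 * ℓ i ^ 2) * pair ℓ Θ (jet0 phaseCover f) := by
  have hw := contDiff_wave ℓ hΘ
  rw [pair, phaseFS.weak_integral (weak2 f _ _) hw]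
  simp only [cpderiv_castSucc_wave]
  have e : ∀ z, (jet1 phaseCover i.castSucc f z : ℂ) * (-(2 * Real.pi * Complex.I * ℓ i) * wave ℓ Θ z)
      = -(2 * Real.pi * Complex.I * ℓ i) * (jet1 phaseCover i.castSucc f z * wave ℓ Θ z) :=
    fun z => by ring
  simp only [e]
  rw [integral_const_mul, phaseFS.weak_integral (weak1 f _) hw]
  simp only [cpderiv_castSucc_wave]
  have e : ∀ z, (jet0 phaseCover f z : ℂ) * (-(2 * Real.pi * Complex.I * ℓ i) * wave ℓ Θ z)
      = -(2 * Real.pi * Complex.I * ℓ i) * (jet0 phaseCover f z * wave ℓ Θ z) :=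
    fun z => by ring
  simp only [e]
  rw [integral_const_mul, pair]
  linear_combination (4 * Real.pi ^ 2 * ℓ i ^ 2 * ∫ z, (jet0 phaseCover f z : ℂ) * wave ℓ Θ z) *
    Complex.I_sq

lemma pair_jet2_two (f : H2 phaseCover) : pair ℓ Θ (jet2 phaseCover 2 2 f)
    = pair ℓ (derivAng (derivAng Θ)) (jet0 phaseCover f) := by
  rw [pair, phaseFS.weak_integral (weak2 f _ _) (contDiff_wave ℓ hΘ)]
  simp only [cpderiv_two_wave ℓ hΘ]
  rw [phaseFS.weak_integral (weak1 f _) (contDiff_wave ℓ (contDiff_derivAng hΘ)), neg_neg]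
  simp only [cpderiv_two_wave ℓ (contDiff_derivAng hΘ)]
  rfl

lemma pair_mulV (f : H2 phaseCover) (i : Fin 2) :
    pair ℓ Θ (mulV i (jet1 phaseCover i.castSucc f))
      = pair ℓ (fun θ => 2 * Real.pi * Complex.I * ℓ i * (v θ i * Θ θ)) (jet0 phaseCover f) := by
  have hv : ContDiff ℝ ∞ fun s : ℝ => ((v (s : Ang) i : ℝ) : ℂ) * Θ s :=
    (Complex.ofRealCLM.contDiff.comp (contDiff_v i)).mul hΘ
  rw [pair_const_mul_fun, mulV, pair_congr (coeFn_mulCL _ _), pair]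
  have e : ∀ z, ((liftAng (fun θ => v θ i) (continuous_v i) z *
      jet1 phaseCover i.castSucc f z : ℝ) : ℂ) * wave ℓ Θ z
      = (jet1 phaseCover i.castSucc f z : ℂ) * wave ℓ (fun θ => v θ i * Θ θ) z := fun z => by
    simp only [wave, liftAng, ContinuousMap.coe_mk]; push_cast; ring
  simp only [e]
  rw [phaseFS.weak_integral (weak1 f _) (contDiff_wave ℓ hv)]
  simp only [cpderiv_castSucc_wave]
  have e : ∀ z, (jet0 phaseCover f z : ℂ) *
      (-(2 * Real.pi * Complex.I * ℓ i) * wave ℓ (fun θ => v θ i * Θ θ) z)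
      = -(2 * Real.pi * Complex.I * ℓ i) *
        (jet0 phaseCover f z * wave ℓ (fun θ => v θ i * Θ θ) z) := fun z => by ring
  simp only [e]
  rw [integral_const_mul, pair]
  ring

/-- The transposed operator acts on wave vectors through `-M̂_ℓ + σ_θ ∂_θθ`. -/
lemma pair_Aop (p : Params) (f : H2 phaseCover) : pair ℓ Θ (Aop p f)
    = pair ℓ (fun θ => -Mhat p ℓ θ * Θ θ + p.sigTh * derivAng (derivAng Θ) θ)
      (jet0 phaseCover f) := by
  have c := continuous_ang hΘ.continuous
  have c2 := continuous_ang (contDiff_derivAng (contDiff_derivAng hΘ)).continuous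
  have cv : ∀ (i) (d : ℂ), Continuous fun θ => d * (v θ i * Θ θ) := fun i d =>
    continuous_const.mul ((Complex.continuous_ofReal.comp (continuous_v i)).mul c)
  have c0 : ∀ d : ℂ, Continuous fun θ => d * Θ θ := fun d => continuous_const.mul c
  have c3 : ∀ d : ℂ, Continuous fun θ => d * derivAng (derivAng Θ) θ := fun d =>
    continuous_const.mul c2
  have c4 : ∀ d d' : ℂ, Continuous fun θ => d * Θ θ + d' * derivAng (derivAng Θ) θ :=
    fun d d' => (c0 d).add (c3 d')
  have c5 : ∀ d d' : ℂ, Continuous fun θ => d * (v θ 0 * Θ θ) + d' * (v θ 1 * Θ θ) :=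
    fun d d' => (cv 0 d).add (cv 1 d')
  have e : (fun θ => -Mhat p ℓ θ * Θ θ + p.sigTh * derivAng (derivAng Θ) θ) = fun θ =>
      (-(4 * Real.pi ^ 2 * p.sigX * normSqZ ℓ) * Θ θ + p.sigTh * derivAng (derivAng Θ) θ)
      + (-(p.lam * (2 * Real.pi * Complex.I * ℓ 0)) * (v θ 0 * Θ θ)
        + -(p.lam * (2 * Real.pi * Complex.I * ℓ 1)) * (v θ 1 * Θ θ)) := by
    funext θ
    simp only [Mhat, dotZ, Fin.sum_univ_two]
    push_cast
    ring
  rw [Aop_apply, pair_sub ℓ c, pair_add ℓ c, pair_smul, pair_smul, pair_smul, pair_add ℓ c,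
    pair_add ℓ c, pair_jet2_castSucc hΘ, pair_jet2_castSucc hΘ, pair_jet2_two hΘ,
    pair_mulV hΘ, pair_mulV hΘ, pair_const_mul_fun, pair_const_mul_fun, e,
    pair_add_fun ℓ (c4 _ _) (c5 _ _), pair_add_fun ℓ (c0 _) (c3 _),
    pair_add_fun ℓ (cv 0 _) (cv 1 _), pair_const_mul_fun, pair_const_mul_fun, pair_const_mul_fun,
    pair_const_mul_fun, normSqZ_eq]
  push_cast
  ring

/-- For G = 1 and Θ = P^ℓ, pairing with A f returns the density coefficient of f at ℓ. -/
lemma pair_Aop_of_isResolvent {p : Params} {G : Ang → ℂ} (h : IsResolvent p ℓ G Θ)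
    (f : H2 phaseCover) : pair ℓ Θ (Aop p f) = pair ℓ G (jet0 phaseCover f) := by
  rw [pair_Aop hΘ]
  congr 1
  funext θ
  refine ang_ext (f := fun θ => -Mhat p ℓ θ * Θ θ + p.sigTh * derivAng (derivAng Θ) θ)
    (fun s => ?_) θ
  simp only [derivAng_derivAng_coe]
  exact h.2 s

end Pairing

lemma dBhat_eq_sum (p : Params) (ℓ : Fin 2 → ℤ) (θ : Ang) : dBhat p ℓ θ
    = (∑ a, posFS.jetSymb (.inr a) ℓ * (dbA p a θ : ℂ)) / chemSymb p ℓ := by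
  rw [dBhat_eq]
  congr 1
  simp only [Fintype.sum_sum_type, Fintype.sum_prod_type, Fin.sum_univ_two,
    FourierSystem.jetSymb, dbA, posFS_freq, dotZ]
  push_cast
  ring

/-- Fubini, since every term of ∂_θB_τ[f] is a function of x times a function of θ. At each wave
vector the chemotactic term is thus of rank one: the density coefficient times ∂_θB̂_ℓ. -/
lemma pair_dBop {p : Params} (hg : 0 < p.gam) (hc : 0 < p.sigC) (f : H2 phaseCover)
    (ℓ : Fin 2 → ℤ) {Θ : Ang → ℂ} (hΘ : Continuous Θ) : pair ℓ Θ (toL2 (dBop p f))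
    = phaseFS.coef (jet0 phaseCover f) (ℓ, 0) * ∫ θ, dBhat p ℓ θ * Θ θ := by
  rw [pair_congr (coeFn_toL2 _), pair]
  have hc1 : ∀ a, Continuous fun θ => (dbA p a θ : ℂ) * Θ θ := fun a =>
    (Complex.continuous_ofReal.comp (continuous_dbA p a)).mul hΘ
  have hc2 : ∀ a, Continuous fun x : Pos =>
      (chemC p (.inr a) f x : ℂ) * UnitAddTorus.mFourier (-ℓ) x := fun a =>
    (Complex.continuous_ofReal.comp (ContinuousMap.continuous _)).mul (ContinuousMap.continuous _)
  have e : ∀ z : Phase, (dBop p f z : ℂ) * wave ℓ Θ z = ∑ a,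
      ((chemC p (.inr a) f z.1 : ℂ) * UnitAddTorus.mFourier (-ℓ) z.1) * (dbA p a z.2 * Θ z.2) :=
    fun z => by
      rw [dBop_apply, wave, Complex.ofReal_sum, Finset.sum_mul]
      exact Finset.sum_congr rfl fun a _ => by push_cast; ring
  simp only [e]
  have hint : ∀ a, Integrable fun z : Phase =>
      ((chemC p (.inr a) f z.1 : ℂ) * UnitAddTorus.mFourier (-ℓ) z.1) * (dbA p a z.2 * Θ z.2) :=
    fun a => integrable_of_continuous'
      (((hc2 a).comp continuous_fst).mul ((hc1 a).comp continuous_snd))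
  rw [integral_finsetSum _ fun a _ => hint a]
  have e2 : ∀ a, ∫ z : Phase, ((chemC p (.inr a) f z.1 : ℂ) * UnitAddTorus.mFourier (-ℓ) z.1) *
      (dbA p a z.2 * Θ z.2) = (posFS.jetSymb (.inr a) ℓ *
        (phaseFS.coef (jet0 phaseCover f) (ℓ, 0) / chemSymb p ℓ)) * ∫ θ, dbA p a θ * Θ θ := by
    intro a
    have h1 : ∫ x : Pos, (chemC p (.inr a) f x : ℂ) * UnitAddTorus.mFourier (-ℓ) x
        = posFS.jetSymb (.inr a) ℓ * (phaseFS.coef (jet0 phaseCover f) (ℓ, 0) / chemSymb p ℓ) := by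
      rw [← coef_chem hg hc, ← coef_jet, ← posFS.coef_congr (coeFn_chemC hg hc (.inr a) f),
        FourierSystem.coef]
      congr 1; funext x
      rw [← posFS.E_neg, posFS_E]
    rw [← h1]
    exact integral_prod_mul (μ := (volume : Measure Pos)) (ν := (volume : Measure Ang))
      (fun x => (chemC p (.inr a) f x : ℂ) * UnitAddTorus.mFourier (-ℓ) x)
      (fun θ => (dbA p a θ : ℂ) * Θ θ)
  simp only [e2, dBhat_eq_sum]
  have e3 : ∀ θ, (∑ a, posFS.jetSymb (.inr a) ℓ * (dbA p a θ : ℂ)) / chemSymb p ℓ * Θ θ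
      = ∑ a, (posFS.jetSymb (.inr a) ℓ / chemSymb p ℓ) * (dbA p a θ * Θ θ) := fun θ => by
    rw [Finset.sum_div, Finset.sum_mul]
    exact Finset.sum_congr rfl fun a _ => by ring
  simp only [e3]
  have hc3 : ∀ a, Integrable fun θ => posFS.jetSymb (.inr a) ℓ / chemSymb p ℓ * (dbA p a θ * Θ θ) :=
    fun a => integrable_of_continuous' (continuous_const.mul (hc1 a))
  rw [integral_finsetSum _ fun a _ => hc3 a, Finset.mul_sum]
  refine Finset.sum_congr rfl fun a _ => ?_
  rw [integral_const_mul]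
  ring

end

end AntModel

namespace AntModel

noncomputable section

open scoped ComplexConjugate

/-! ## The diffusion-transport operator is an isomorphism -/

lemma mem_X_iff_act {f : H2 phaseCover} :
    f ∈ X ↔ phaseFS.coef (jet0 phaseCover f) 0 = 0 ∧ symmAntipode.act f = f := by
  rw [mem_X_iff, mem_Zsp]
  refine and_congr_right fun _ => ⟨fun h => H2_ext phaseFS ?_, fun h => ?_⟩
  · rw [TorusSymm.jet0_pullH2]; exact h
  · conv_rhs => rw [← h]
    exact (TorusSymm.jet0_pullH2 ..).symm

lemma derivAng_const (c : ℂ) : derivAng (fun _ => c) = fun _ => 0 := by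
  funext θ; simp [derivAng]

/-- Conservation of mass: the transposed operator annihilates constants. -/
lemma coef_zero_Aop (p : Params) (f : H2 phaseCover) : phaseFS.coef (Aop p f) 0 = 0 := by
  have h := pair_Aop (Θ := fun _ => 1) contDiff_const 0 p f
  rw [pair_one] at h
  rw [← Prod.mk_zero_zero, h]
  simp [derivAng_const, Mhat, normSqZ, dotZ, pair, wave]

lemma coef_zero_of_isWeakDeriv {u g : Phase → ℝ} (h : IsWeakDeriv phaseCover 2 u g) :
    phaseFS.coef g 0 = 0 := by
  rw [h.coef phaseFS, phaseFS_freq]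
  simp

lemma isWeakDeriv_Qop (p : Params) (f g : H2 phaseCover) :
    IsWeakDeriv phaseCover 2 (fun z => Bop p f z * jet0 phaseCover g z) (Qop p f g) := by
  refine isWeakDeriv_congr Filter.EventuallyEq.rfl ?_ (isWeakDeriv_Bop_mul p f (weak1 g 2))
  filter_upwards [Lp.coeFn_add (mulCL (dBop p f) (jet0 phaseCover g))
    (mulCL (Bop p f) (jet1 phaseCover 2 g)),
      coeFn_mulCL (dBop p f) (jet0 phaseCover g), coeFn_mulCL (Bop p f) (jet1 phaseCover 2 g)]
      with z h4 h5 h6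
  rw [Qop, h4, Pi.add_apply, h5, h6]

lemma isWeakDeriv_dBop (p : Params) (f : H2 phaseCover) :
    IsWeakDeriv phaseCover 2 (fun z => Bop p f z * 1) (toL2 (dBop p f)) := by
  refine isWeakDeriv_congr Filter.EventuallyEq.rfl ?_ (isWeakDeriv_Bop_mul p f isWeakDeriv_one)
  simpa using (coeFn_toL2 (dBop p f)).symm

lemma Aop_mem (p : Params) (f : X) : Aop p f.1 ∈ Zsp := by
  have h := symmAntipode.Aop_act p f.1
  rw [(mem_X_iff_act.1 f.2).2] at h
  exact mem_Zsp.2 ⟨coef_zero_Aop p f.1, h.symm⟩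

section Chemotaxis
variable {p : Params} (hg : 0 < p.gam) (hc : 0 < p.sigC)
include hg hc

lemma dBop_mem {f : H2 phaseCover} (hf : symmAntipode.act f = f) : toL2 (dBop p f) ∈ Zsp := by
  have h := symmAntipode.toL2_dBop_act hg hc f
  rw [hf] at h
  exact mem_Zsp.2 ⟨coef_zero_of_isWeakDeriv (isWeakDeriv_dBop p f), h.symm⟩

lemma Qop_mem (f g : X) : Qop p f.1 g.1 ∈ Zsp := by
  have h := symmAntipode.Qop_act hg hc f.1 g.1
  rw [(mem_X_iff_act.1 f.2).2, (mem_X_iff_act.1 g.2).2] at h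
  exact mem_Zsp.2 ⟨coef_zero_of_isWeakDeriv (isWeakDeriv_Qop p f.1 g.1), h.symm⟩

end Chemotaxis

/-- The Fourier symbol of `-σ_x Δ_x - σ_θ ∂_θθ`. -/
def diffSymb (p : Params) (n : (Fin 2 → ℤ) × ℤ) : ℝ :=
  p.sigX * (4 * Real.pi ^ 2 * normSqZ n.1) + p.sigTh * (n.2 : ℝ) ^ 2

lemma diffSymb_neg (p : Params) (n : (Fin 2 → ℤ) × ℤ) : diffSymb p (-n) = diffSymb p n := by
  simp [diffSymb, normSqZ_neg]

/-- The diffusion operator. -/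
abbrev Dop (p : Params) : H2 phaseCover →L[ℝ] L2 Phase := Aop { p with lam := 0 }

/-- The transport operator. -/
def Top (f : H2 phaseCover) : L2 Phase :=
  mulV 0 (jet1 phaseCover (Fin.castSucc 0) f) + mulV 1 (jet1 phaseCover (Fin.castSucc 1) f)

lemma Dop_apply (p : Params) (f : H2 phaseCover) : Dop p f =
    p.sigX • (jet2 phaseCover (Fin.castSucc 0) (Fin.castSucc 0) f
      + jet2 phaseCover (Fin.castSucc 1) (Fin.castSucc 1) f)
      + p.sigTh • jet2 phaseCover 2 2 f := by
  rw [Dop, Aop_apply]; simp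

lemma Aop_eq (p : Params) (f : H2 phaseCover) : Aop p f = Dop p f - p.lam • Top f := by
  rw [Dop_apply, Aop_apply]; rfl

lemma coef_Dop (p : Params) (f : H2 phaseCover) (n : (Fin 2 → ℤ) × ℤ) :
    phaseFS.coef (Dop p f) n = -(diffSymb p n : ℂ) * phaseFS.coef (jet0 phaseCover f) n := by
  rw [Dop_apply, phaseFS.coef_add, phaseFS.coef_smul, phaseFS.coef_smul, phaseFS.coef_add,
    coef_jet2, coef_jet2, coef_jet2]
  simp only [phaseFS_freq, diffSymb, normSqZ_eq, Fin.castSucc_zero, Matrix.cons_val,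
    Fin.castSucc_one]
  push_cast
  ring

lemma inner_mulV_comm (i : Fin 2) (u w : L2 Phase) : inner ℝ (mulV i u) w = inner ℝ u (mulV i w) := by
  rw [L2_inner_eq, L2_inner_eq]
  refine integral_congr_ae ?_
  filter_upwards [coeFn_mulCL (liftAng (fun θ => v θ i) (continuous_v i)) u,
    coeFn_mulCL (liftAng (fun θ => v θ i) (continuous_v i)) w] with z h1 h2
  rw [mulV, h1, h2]; ring

/-- v_i depends on θ only and commutes with ∂_{x_i}, so v_i ∂_{x_i} is skew-symmetric. -/
lemma inner_mulV_jet1 (i : Fin 2) (f : H2 phaseCover) :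
    inner ℝ (mulV i (jet1 phaseCover i.castSucc f)) (jet0 phaseCover f) = 0 := by
  have h : IsWeakDeriv phaseCover i.castSucc (mulV i (jet0 phaseCover f))
      (mulV i (jet1 phaseCover i.castSucc f)) := by
    refine isWeakDeriv_congr ?_ ?_ (phaseFS.isWeakDeriv_mul (weak1 f i.castSucc)
      (isTest_ang (g := fun θ => v θ i) (contDiff_v i)))
    · filter_upwards [coeFn_mulCL (liftAng (fun θ => v θ i) (continuous_v i)) (jet0 phaseCover f)]
        with z h1
      rw [mulV, h1]; exact mul_comm _ _
    · filter_upwards [coeFn_mulCL (liftAng (fun θ => v θ i) (continuous_v i))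
        (jet1 phaseCover i.castSucc f)] with z h1
      rw [mulV, h1, pderiv_castSucc_ang (fun θ => v θ i), mul_zero, add_zero]; exact mul_comm _ _
  have h1 := (weak1 f i.castSucc).inner_eq phaseFS h
  rw [real_inner_comm, ← inner_mulV_comm] at h1
  linarith

lemma inner_Top (f : H2 phaseCover) : inner ℝ (Top f) (jet0 phaseCover f) = 0 := by
  rw [Top, inner_add_left, inner_mulV_jet1, inner_mulV_jet1, add_zero]

lemma inner_jet2 (i : Fin 3) (f : H2 phaseCover) :
    inner ℝ (jet2 phaseCover i i f) (jet0 phaseCover f) = -‖jet1 phaseCover i f‖ ^ 2 := by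
  have h := (weak1 f i).inner_eq phaseFS (weak2 f i i)
  rw [real_inner_comm, h, real_inner_self_eq_norm_sq]

lemma inner_Dop (p : Params) (f : H2 phaseCover) : inner ℝ (Dop p f) (jet0 phaseCover f)
    = -(p.sigX * (‖jet1 phaseCover (Fin.castSucc 0) f‖ ^ 2
      + ‖jet1 phaseCover (Fin.castSucc 1) f‖ ^ 2) + p.sigTh * ‖jet1 phaseCover 2 f‖ ^ 2) := by
  rw [Dop_apply, inner_add_left, inner_smul_left, inner_smul_left, inner_add_left, inner_jet2,
    inner_jet2, inner_jet2]
  simp only [conj_trivial]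
  ring

lemma norm_mulV_le (i : Fin 2) (u : L2 Phase) : ‖mulV i u‖ ≤ ‖u‖ := by
  refine Lp.norm_le_norm_of_ae_le ?_
  filter_upwards [coeFn_mulCL (liftAng (fun θ => v θ i) (continuous_v i)) u] with z h
  rw [mulV, h, norm_mul]
  refine mul_le_of_le_one_left (norm_nonneg _) ?_
  change |v z.2 i| ≤ 1
  refine ang_induction (P := fun θ => |v θ i| ≤ 1) (fun s => ?_) z.2
  fin_cases i
  · exact Real.abs_cos_le_one s
  · exact Real.abs_sin_le_one s

lemma norm_Top_sq_le (f : H2 phaseCover) : ‖Top f‖ ^ 2 ≤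
    2 * (‖jet1 phaseCover (Fin.castSucc 0) f‖ ^ 2 + ‖jet1 phaseCover (Fin.castSucc 1) f‖ ^ 2) := by
  have h0 := norm_mulV_le 0 (jet1 phaseCover (Fin.castSucc 0) f)
  have h1 := norm_mulV_le 1 (jet1 phaseCover (Fin.castSucc 1) f)
  have h : ‖Top f‖ ≤ ‖jet1 phaseCover (Fin.castSucc 0) f‖ + ‖jet1 phaseCover (Fin.castSucc 1) f‖ :=
    (norm_add_le _ _).trans (add_le_add h0 h1)
  have := norm_nonneg (Top f)
  nlinarith [sq_nonneg (‖jet1 phaseCover (Fin.castSucc 0) f‖ - ‖jet1 phaseCover (Fin.castSucc 1) f‖)]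

/-- Lax–Milgram for the form (f, g) ↦ ⟨a f, b g⟩, where trial and test functions enter through
different operators. -/
lemma exists_inner_eq_of_coercive {V W : Type*} [NormedAddCommGroup V] [InnerProductSpace ℝ V]
    [CompleteSpace V] [NormedAddCommGroup W] [InnerProductSpace ℝ W] (a b : V →L[ℝ] W) {C : ℝ}
    (hC : 0 < C) (h : ∀ f, C * ‖f‖ * ‖f‖ ≤ inner ℝ (a f) (b f)) (z : W) :
    ∃ f, ∀ g, inner ℝ (a f) (b g) = inner ℝ z (b g) := by
  let form : V →L[ℝ] V →L[ℝ] ℝ := (innerSL ℝ).bilinearComp a b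
  have hform : IsCoercive form := ⟨C, hC, h⟩
  let φ : V →L[ℝ] ℝ := (innerSL ℝ z).comp b
  refine ⟨hform.continuousLinearEquivOfBilin.symm ((InnerProductSpace.toDual ℝ V).symm φ),
    fun g => ?_⟩
  have h1 := hform.continuousLinearEquivOfBilin_apply
    (hform.continuousLinearEquivOfBilin.symm ((InnerProductSpace.toDual ℝ V).symm φ)) g
  rw [ContinuousLinearEquiv.apply_symm_apply, InnerProductSpace.toDual_symm_apply] at h1
  exact h1.symm

/-- The shift in the test operator of the coercivity estimate. -/
def testShift (p : Params) : ℝ := p.lam ^ 2 / p.sigX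

/-- The operator `σ_x Δ_x + σ_θ ∂_θθ - m`. -/
def testOp (p : Params) : H2 phaseCover →L[ℝ] L2 Phase := Dop p - testShift p • jet0 phaseCover

lemma testOp_apply (p : Params) (f : H2 phaseCover) :
    testOp p f = Dop p f - testShift p • jet0 phaseCover f := rfl

section Isomorphism
variable {p : Params} (hx : 0 < p.sigX) (hs : 0 < p.sigTh)
include hx hs

/-- Tested with D f − m f: transport is orthogonal to f, so −m⟨A f, f⟩ = m(σ_x |∇_x f|² + σ_θ |∂_θ
f|²). Young's inequality bounds the cross term λ⟨v·∇_x f, D f⟩ by ½‖D f‖² + λ²|∇_x f|², and m =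
λ²/σ_x is chosen to absorb the last term. -/
lemma norm_Dop_sq_le (f : H2 phaseCover) :
    ‖Dop p f‖ ^ 2 / 2 ≤ inner ℝ (Aop p f) (testOp p f) := by
  have h1 : inner ℝ (Aop p f) (testOp p f) = ‖Dop p f‖ ^ 2
      - testShift p * inner ℝ (Dop p f) (jet0 phaseCover f) - p.lam * inner ℝ (Top f) (Dop p f) := by
    rw [testOp_apply, Aop_eq, inner_sub_left, inner_sub_right, inner_sub_right, inner_smul_left,
      inner_smul_left, inner_smul_right, inner_smul_right, inner_Top, real_inner_self_eq_norm_sq]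
    simp only [conj_trivial]
    ring
  rw [h1, inner_Dop]
  have h2 : p.lam * inner ℝ (Top f) (Dop p f) ≤ ‖Dop p f‖ ^ 2 / 2 + p.lam ^ 2 * ‖Top f‖ ^ 2 / 2 := by
    have h := real_inner_le_norm (p.lam • Top f) (Dop p f)
    rw [inner_smul_left, conj_trivial, norm_smul, Real.norm_eq_abs] at h
    have e : (|p.lam| * ‖Top f‖) ^ 2 = p.lam ^ 2 * ‖Top f‖ ^ 2 := by rw [mul_pow, sq_abs]
    nlinarith [sq_nonneg (|p.lam| * ‖Top f‖ - ‖Dop p f‖)]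
  have h3 := mul_le_mul_of_nonneg_left (norm_Top_sq_le f) (sq_nonneg p.lam)
  have h4 : testShift p * p.sigX = p.lam ^ 2 := div_mul_cancel₀ _ hx.ne'
  have h5 : 0 ≤ testShift p * (p.sigTh * ‖jet1 phaseCover 2 f‖ ^ 2) :=
    mul_nonneg (div_nonneg (sq_nonneg _) hx.le) (by positivity)
  have h6 : testShift p * (p.sigX * (‖jet1 phaseCover (Fin.castSucc 0) f‖ ^ 2
      + ‖jet1 phaseCover (Fin.castSucc 1) f‖ ^ 2))
      = p.lam ^ 2 * (‖jet1 phaseCover (Fin.castSucc 0) f‖ ^ 2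
      + ‖jet1 phaseCover (Fin.castSucc 1) f‖ ^ 2) := by rw [← mul_assoc, h4]
  linarith

lemma diffSymb_pos {n : (Fin 2 → ℤ) × ℤ} (hn : n ≠ 0) : min p.sigX p.sigTh ≤ diffSymb p n := by
  have hpi : (1 : ℝ) ≤ 4 * Real.pi ^ 2 := by nlinarith [Real.pi_gt_three]
  by_cases h : n.1 = 0
  · have h2 : n.2 ≠ 0 := fun h2 => hn (Prod.ext h h2)
    have h3 : (1 : ℝ) ≤ (n.2 : ℝ) ^ 2 := by
      have : (1 : ℤ) ≤ n.2 ^ 2 := Int.add_one_le_iff.2 ((sq_nonneg _).lt_of_ne' (pow_ne_zero 2 h2))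
      exact_mod_cast this
    have : 0 ≤ p.sigX * (4 * Real.pi ^ 2 * normSqZ n.1) :=
      mul_nonneg hx.le (mul_nonneg (by positivity) (normSqZ_nonneg _))
    rw [diffSymb]
    nlinarith [min_le_right p.sigX p.sigTh]
  · have h3 := one_le_normSqZ h
    have h4 : 1 ≤ 4 * Real.pi ^ 2 * normSqZ n.1 := by nlinarith
    have : 0 ≤ p.sigTh * (n.2 : ℝ) ^ 2 := by positivity
    rw [diffSymb]
    nlinarith [min_le_left p.sigX p.sigTh]

lemma freq_mul_freq_le (n : (Fin 2 → ℤ) × ℤ) (i j : Fin 3) :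
    |phaseFS.freq n i| * |phaseFS.freq n j| ≤ (min p.sigX p.sigTh)⁻¹ * diffSymb p n := by
  have hm : 0 < min p.sigX p.sigTh := lt_min hx hs
  have h : ∀ i, phaseFS.freq n i ^ 2 ≤ (min p.sigX p.sigTh)⁻¹ * diffSymb p n := by
    intro i
    rw [inv_mul_eq_div, le_div_iff₀ hm, diffSymb, normSqZ_eq]
    have h1 : 0 ≤ (min p.sigX p.sigTh) := hm.le
    have hX := min_le_left p.sigX p.sigTh
    have hT := min_le_right p.sigX p.sigTh
    have a0 : 0 ≤ 4 * Real.pi ^ 2 * (n.1 0 : ℝ) ^ 2 := by positivity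
    have a1 : 0 ≤ 4 * Real.pi ^ 2 * (n.1 1 : ℝ) ^ 2 := by positivity
    have a2 : 0 ≤ (n.2 : ℝ) ^ 2 := by positivity
    rw [phaseFS_freq]
    fin_cases i
    · change (2 * Real.pi * (n.1 0 : ℝ)) ^ 2 * _ ≤ _
      nlinarith [mul_le_mul_of_nonneg_right hX a0, mul_nonneg hx.le a1, mul_nonneg hs.le a2]
    · change (2 * Real.pi * (n.1 1 : ℝ)) ^ 2 * _ ≤ _
      nlinarith [mul_le_mul_of_nonneg_right hX a1, mul_nonneg hx.le a0, mul_nonneg hs.le a2]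
    · change (n.2 : ℝ) ^ 2 * _ ≤ _
      nlinarith [mul_le_mul_of_nonneg_right hT a2, mul_nonneg hx.le a0, mul_nonneg hx.le a1]
  have hi := h i
  have hj := h j
  rw [← sq_abs] at hi hj
  nlinarith [sq_nonneg (|phaseFS.freq n i| - |phaseFS.freq n j|)]

lemma norm_jetSymb_le (j : Jet2 (Fin 3)) {n : (Fin 2 → ℤ) × ℤ} (hn : n ≠ 0) :
    ‖phaseFS.jetSymb j n‖ ≤ 2 * (min p.sigX p.sigTh)⁻¹ * diffSymb p n := by
  have hm : 0 < min p.sigX p.sigTh := lt_min hx hs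
  have h1 : 1 ≤ (min p.sigX p.sigTh)⁻¹ * diffSymb p n := by
    rw [inv_mul_eq_div, le_div_iff₀ hm, one_mul]; exact diffSymb_pos hx hs hn
  rcases j with ⟨⟩ | i | ⟨i, j⟩
  · simp only [FourierSystem.jetSymb, norm_one]; linarith
  · have h := freq_mul_freq_le hx hs n i i
    simp only [FourierSystem.jetSymb, norm_mul, Complex.norm_I, one_mul, Complex.norm_real,
      Real.norm_eq_abs]
    nlinarith [sq_nonneg (|phaseFS.freq n i| - 1)]
  · have h := freq_mul_freq_le hx hs n i j
    simp only [FourierSystem.jetSymb, norm_mul, norm_neg, Complex.norm_real, Real.norm_eq_abs]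
    linarith

/-- Elliptic regularity for functions of zero average. -/
lemma exists_norm_le_Dop : ∃ C > 0, ∀ f : X, ‖f‖ ≤ C * ‖Dop p f.1‖ := by
  have hm : 0 < min p.sigX p.sigTh := lt_min hx hs
  refine ⟨∑ _j : Jet2 (Fin 3), 2 * (min p.sigX p.sigTh)⁻¹, ?_, fun f => ?_⟩
  · exact Finset.sum_pos (fun _ _ => by positivity) Finset.univ_nonempty
  · refine (H2_norm_le_sum f.1).trans ?_
    rw [Finset.sum_mul]
    refine Finset.sum_le_sum fun j _ => phaseFS.norm_le_of_coef (by positivity) fun n => ?_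
    rw [coef_jet, coef_Dop]
    by_cases hn : n = 0
    · rw [hn, (mem_X_iff_act.1 f.2).1]; simp
    · rw [norm_mul, norm_mul, norm_neg, Complex.norm_real, Real.norm_eq_abs,
        abs_of_pos (hm.trans_le (diffSymb_pos hx hs hn)), ← mul_assoc]
      exact mul_le_mul_of_nonneg_right (norm_jetSymb_le hx hs j hn) (norm_nonneg _)

lemma exists_coercive : ∃ C > 0, ∀ f : X, C * ‖f‖ * ‖f‖ ≤ inner ℝ (Aop p f.1) (testOp p f.1) := by
  obtain ⟨C, hC, h⟩ := exists_norm_le_Dop hx hs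
  refine ⟨(2 * C ^ 2)⁻¹, by positivity, fun f => ?_⟩
  refine le_trans ?_ (norm_Dop_sq_le hx hs f.1)
  have h1 : ‖f‖ ^ 2 ≤ C ^ 2 * ‖Dop p f.1‖ ^ 2 := by
    rw [← mul_pow]; exact pow_le_pow_left₀ (norm_nonneg _) (h f) 2
  rw [mul_assoc, ← sq, inv_mul_le_iff₀ (by positivity)]
  linarith

/-- Lax–Milgram gives equality only against the functions D g − m g, so these must exhaust Z. The
operator D − m is the multiplier −(d_n + m) with m > 0 and d_n ≥ 0; its inverse maps L² to H²,
preserves the mean-zero condition and commutes with the antipodal map. -/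
lemma exists_testOp_eq (hl : 0 < p.lam) (z : Zsp) : ∃ g : X, testOp p g.1 = z := by
  have hm : 0 < min p.sigX p.sigTh := lt_min hx hs
  have hsh : 0 < testShift p := div_pos (pow_pos hl 2) hx
  have hd : ∀ n, 0 ≤ diffSymb p n := fun n => add_nonneg
    (mul_nonneg hx.le (mul_nonneg (by positivity) (normSqZ_nonneg _))) (by positivity)
  have hc : ∀ f n, phaseFS.coef (testOp p f) n
      = -((diffSymb p n + testShift p : ℝ) : ℂ) * phaseFS.coef (jet0 phaseCover f) n := fun f n => by
    rw [testOp_apply, phaseFS.coef_sub, phaseFS.coef_smul, coef_Dop]; push_cast; ring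
  have hne : ∀ n, ((diffSymb p n + testShift p : ℝ) : ℂ) ≠ 0 := fun n => by
    exact_mod_cast (add_pos_of_nonneg_of_pos (hd n) hsh).ne'
  have hinj : ∀ f g, testOp p f = testOp p g → f = g := fun f g h =>
    H2_ext phaseFS (phaseFS.coef_ext fun n => by
      have h1 := hc f n
      rw [h, hc g n] at h1
      exact (mul_left_cancel₀ (neg_ne_zero.2 (hne n)) h1).symm)
  have hnorm : ∀ n, ‖(-((diffSymb p n + testShift p : ℝ) : ℂ)⁻¹)‖
      = (diffSymb p n + testShift p)⁻¹ := fun n => by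
    rw [norm_neg, norm_inv, Complex.norm_real, Real.norm_eq_abs,
      abs_of_pos (add_pos_of_nonneg_of_pos (hd n) hsh)]
  have e0 : ∀ n, (diffSymb p n + testShift p)⁻¹ ≤ (testShift p)⁻¹ := fun n =>
    inv_anti₀ hsh (le_add_of_nonneg_left (hd n))
  have e2 : ∀ n i j, |phaseFS.freq n i| * |phaseFS.freq n j| * (diffSymb p n + testShift p)⁻¹
      ≤ (min p.sigX p.sigTh)⁻¹ := fun n i j => by
    rw [← div_eq_mul_inv, div_le_iff₀ (add_pos_of_nonneg_of_pos (hd n) hsh), mul_add]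
    have := freq_mul_freq_le hx hs n i j
    have : 0 ≤ (min p.sigX p.sigTh)⁻¹ * testShift p := by positivity
    linarith
  obtain ⟨g, hgc⟩ := exists_H2_multiplier phaseFS
    (fun n => -((diffSymb p n + testShift p : ℝ) : ℂ)⁻¹)
    ((testShift p)⁻¹ + (min p.sigX p.sigTh)⁻¹)
    (fun n => by rw [hnorm]; exact (e0 n).trans (le_add_of_nonneg_right (by positivity)))
    (fun n i => by
      rw [hnorm]
      have h1 := e2 n i i
      have h0 := e0 n
      have h3 : 0 ≤ (diffSymb p n + testShift p)⁻¹ :=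
        inv_nonneg.2 (add_pos_of_nonneg_of_pos (hd n) hsh).le
      have h4 : |phaseFS.freq n i| ≤ |phaseFS.freq n i| * |phaseFS.freq n i| + 1 := by
        nlinarith [sq_nonneg (|phaseFS.freq n i| - 1), abs_nonneg (phaseFS.freq n i)]
      have := mul_le_mul_of_nonneg_right h4 h3
      linarith)
    (fun n i j => by rw [hnorm]; exact (e2 n i j).trans (le_add_of_nonneg_left (by positivity)))
    (fun n => by rw [diffSymb_neg, map_neg, map_inv₀, Complex.conj_ofReal]) z.1
  have hz : testOp p g = z := phaseFS.coef_ext fun n => by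
    rw [hc, hgc, ← mul_assoc, neg_mul_neg, mul_inv_cancel₀ (hne n), one_mul]
  refine ⟨⟨g, mem_X_iff_act.2 ⟨?_, hinj _ _ ?_⟩⟩, hz⟩
  · rw [hgc, (mem_Zsp.1 z.2).1, mul_zero]
  · have h2 : testOp p (symmAntipode.act g) = symmAntipode.pull (testOp p g) := by
      rw [testOp_apply, testOp_apply, Dop, symmAntipode.Aop_act, TorusSymm.jet0_pullH2, map_sub,
        map_smul]
    rw [h2, hz]
    exact (mem_Zsp.1 z.2).2

omit hx hs in
/-- The diffusion-transport operator from `X` to `Z`. -/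
def AX (p : Params) : X →L[ℝ] Zsp := ((Aop p).comp X.subtypeL).codRestrict Zsp (Aop_mem p)

omit hx hs in
lemma AX_coe (p : Params) (f : X) : (AX p f : L2 Phase) = Aop p f.1 := rfl

lemma AX_bijective (hl : 0 < p.lam) : Function.Bijective (AX p) := by
  obtain ⟨C, hC, hco⟩ := exists_coercive hx hs
  constructor
  · rw [injective_iff_map_eq_zero]
    intro f hf
    have h1 : Aop p f.1 = 0 := congrArg Subtype.val hf
    have h2 := hco f
    rw [h1, inner_zero_left] at h2
    have h3 : ‖f‖ * ‖f‖ ≤ 0 := by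
      by_contra! h
      have := mul_pos hC h
      linarith
    exact norm_eq_zero.1 (mul_self_eq_zero.1 (le_antisymm h3 (mul_self_nonneg _)))
  · intro z
    let a : X →L[ℝ] L2 Phase := (Aop p).comp X.subtypeL
    let b : X →L[ℝ] L2 Phase := (testOp p).comp X.subtypeL
    obtain ⟨f, hf⟩ := @exists_inner_eq_of_coercive X (L2 Phase) _ _ _ _ _ a b C hC hco z
    refine ⟨f, ?_⟩
    -- The residual A f − z is itself an admissible test function, so it is orthogonal to itself.
    obtain ⟨g, hg⟩ := exists_testOp_eq hx hs hl (AX p f - z)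
    have h1 : inner ℝ (Aop p f.1) (testOp p g.1) = inner ℝ (z : L2 Phase) (testOp p g.1) := hf g
    rw [hg, ← sub_eq_zero, ← inner_sub_left] at h1
    exact sub_eq_zero.1 (inner_self_eq_zero.1 h1)

end Isomorphism

end

end AntModel

namespace AntModel

noncomputable section

open scoped ComplexConjugate

/-! ## Symmetries of Fourier coefficients and of the kernel functions -/

lemma mFourier_comp_neg (ℓ : Fin 2 → ℤ) (x : Pos) :
    UnitAddTorus.mFourier ℓ (-x) = UnitAddTorus.mFourier (-ℓ) x := by
  simp [UnitAddTorus.mFourier]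

lemma coef_antiPull (u : L2 Phase) (n : (Fin 2 → ℤ) × ℤ) :
    phaseFS.coef u n = conj (Complex.exp (Complex.I * ((n.2 * Real.pi : ℝ) : ℂ))) *
      phaseFS.coef (antiPull u) (-n.1, n.2) := by
  have hE : ∀ z, phaseFS.E n (antipode z)
      = Complex.exp (Complex.I * ((n.2 * Real.pi : ℝ) : ℂ)) * phaseFS.E (-n.1, n.2) z := fun z => by
    change UnitAddTorus.mFourier n.1 (-z.1) * fourier n.2 (z.2 + _) = _ *
      (UnitAddTorus.mFourier (-n.1) z.1 * fourier n.2 z.2)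
    rw [mFourier_comp_neg, fourier_ang_shift]; ring
  have hm : AEStronglyMeasurable (fun z => (u z : ℂ) * conj (phaseFS.E n z))
      (volume.map antipode) := by
    rw [measurePreserving_antipode.map_eq]
    exact (Complex.measurable_ofReal.comp_aemeasurable
      (Lp.aestronglyMeasurable u).aemeasurable).aestronglyMeasurable.mul
      ((ContinuousMap.continuous _).star.aestronglyMeasurable)
  have h := integral_map measurePreserving_antipode.measurable.aemeasurable hm
  rw [measurePreserving_antipode.map_eq] at h
  rw [FourierSystem.coef, h, ← phaseFS.coef_congr (symmAntipode.torus.coeFn_pull u).symm,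
    FourierSystem.coef, ← integral_const_mul]
  congr 1; funext z
  rw [hE, map_mul, symmAntipode_toFun]; ring

lemma coef_antip {u : L2 Phase} (h : antiPull u = u) (ℓ : Fin 2 → ℤ) :
    phaseFS.coef u (-ℓ, 0) = phaseFS.coef u (ℓ, 0) := by
  have h1 := coef_antiPull u (ℓ, 0)
  rw [h] at h1
  simpa using h1.symm

/-- For real f evenness gives ρ_{-ℓ} = ρ_ℓ as well as ρ_{-ℓ} = conj ρ_ℓ. A critical pair ±ℓ
therefore contributes one real dimension to the kernel, not two. -/
lemma conj_coef_antip {u : L2 Phase} (h : antiPull u = u) (ℓ : Fin 2 → ℤ) :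
    conj (phaseFS.coef u (ℓ, 0)) = phaseFS.coef u (ℓ, 0) := by
  rw [← phaseFS.coef_neg, ← coef_antip h ℓ]
  simp

/-- Multiplication of the positional modes by real numbers. -/
lemma exists_positional_multiplier (ν : (Fin 2 → ℤ) → ℂ) {K : ℝ} (hK : ∀ ℓ, ‖ν ℓ‖ ≤ K)
    (hν : ∀ ℓ, ν (-ℓ) = ν ℓ) (hr : ∀ ℓ, conj (ν ℓ) = ν ℓ) {f : H2 phaseCover}
    (hf : symmAntipode.act f = f) : ∃ g : H2 phaseCover, symmAntipode.act g = g ∧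
      ∀ n, phaseFS.coef (jet0 phaseCover g) n = ν n.1 * phaseFS.coef (jet0 phaseCover f) n := by
  obtain ⟨g, hg⟩ := exists_H2_multiplier' phaseFS (fun n => ν n.1) K (fun n => hK _)
    (fun n => by rw [hr]; exact hν n.1) f
  refine ⟨g, H2_ext phaseFS (phaseFS.coef_ext fun n => ?_), hg⟩
  rw [TorusSymm.jet0_pullH2]
  have hf' : antiPull (jet0 phaseCover f) = jet0 phaseCover f := by
    conv_rhs => rw [← hf]
    exact (TorusSymm.jet0_pullH2 ..).symm
  have h1 := coef_antiPull (jet0 phaseCover g) (-n.1, n.2)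
  have h2 := coef_antiPull (jet0 phaseCover f) (-n.1, n.2)
  have hexp : conj (Complex.exp (Complex.I * (((-n.1, n.2) : (Fin 2 → ℤ) × ℤ).2 * Real.pi : ℝ))) ≠ 0 :=
    (map_ne_zero _).2 (Complex.exp_ne_zero _)
  rw [hf'] at h2
  rw [hg, h2] at h1
  simp only [neg_neg, hν] at h1 h2 hexp
  rw [hg]
  refine mul_left_cancel₀ hexp ?_
  rw [← h1]; ring

lemma L2_ext_pair {u w : L2 Phase} (h : ∀ (ℓ : Fin 2 → ℤ) (Θ : Ang → ℂ),
    (ContDiff ℝ ∞ fun s : ℝ => Θ s) → pair ℓ Θ u = pair ℓ Θ w) : u = w := by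
  refine phaseFS.coef_ext fun n => ?_
  have e : ∀ u : L2 Phase, phaseFS.coef u n = pair n.1 (fun θ => fourier (-n.2) θ) u := fun u => by
    rw [FourierSystem.coef, pair]
    congr 1; funext z
    rw [← phaseFS.E_neg]; rfl
  rw [e, e]
  refine h _ _ ?_
  simp only [fourier_ang_apply]
  exact (contDiff_const.mul (Complex.ofRealCLM.contDiff.comp
    (contDiff_const.mul contDiff_id))).cexp

lemma integral_mFourier_mul (a b : Fin 2 → ℤ) : ∫ x : Pos, UnitAddTorus.mFourier a x *
    UnitAddTorus.mFourier (-b) x = if b = a then 1 else 0 := by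
  have e : ∀ x : Pos, UnitAddTorus.mFourier a x * UnitAddTorus.mFourier (-b) x
      = posFS.E a x * conj (posFS.E b x) := fun x => by rw [← posFS.E_neg]; rfl
  simp only [e]
  split_ifs with h
  · subst h
    simp only [posFS.E_mul_conj, integral_const, measureReal_def, volume_pi, Measure.pi_univ]
    simp
  · exact posFS.integral_E_mul_conj (Ne.symm h)

lemma pair_wave (ℓ ℓ' : Fin 2 → ℤ) (Θ Θ' : Ang → ℂ) :
    ∫ z, wave (-ℓ) Θ z * wave ℓ' Θ' z = if ℓ' = ℓ then ∫ θ, Θ θ * Θ' θ else 0 := by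
  have h := integral_prod_mul (μ := (volume : Measure Pos)) (ν := (volume : Measure Ang))
      (fun x => UnitAddTorus.mFourier ℓ x * UnitAddTorus.mFourier (-ℓ') x) (fun θ => Θ θ * Θ' θ)
  rw [integral_mFourier_mul, ite_mul, one_mul, zero_mul] at h
  rw [← h]
  refine integral_congr_ae (Filter.Eventually.of_forall fun z => ?_)
  simp only [wave, neg_neg]; ring

section Kernel
variable {p : Params} (hx : 0 < p.sigX) (hs : 0 < p.sigTh) (hl : 0 < p.lam) {ℓ : Fin 2 → ℤ}
  (hℓ : ℓ ≠ 0)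
include hx hs hl hℓ

lemma phi_eq (z : Phase) :
    (phi p ℓ z : ℂ) = wave (-ℓ) (Uhat p ℓ) z + wave ℓ (Uhat p (-ℓ)) z := by
  have e : Uhat p (-ℓ) z.2 * UnitAddTorus.mFourier (-ℓ) z.1
      = conj (Uhat p ℓ z.2 * UnitAddTorus.mFourier ℓ z.1) := by
    rw [map_mul, Uhat_neg hx hs hl hℓ, UnitAddTorus.mFourier_neg]
  rw [phi, e, Complex.add_conj, Complex.ofReal_re]
  have e2 := Complex.add_conj (Uhat p ℓ z.2 * UnitAddTorus.mFourier ℓ z.1)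
  rw [← e2, ← e]
  simp only [wave, neg_neg]; ring

lemma contDiff_phi : ContDiff ℝ ∞ fun y => ((phi p ℓ (phaseCover y) : ℝ) : ℂ) := by
  simp only [phi_eq hx hs hl hℓ]
  exact (contDiff_wave _ (contDiff_Uhat hx hs hl hℓ)).add
    (contDiff_wave _ (contDiff_Uhat hx hs hl (neg_ne_zero.2 hℓ)))

lemma exists_phiH : ∃ f : H2 phaseCover, jet0 phaseCover f =ᵐ[volume] phi p ℓ := by
  have h := phaseFS.isTest_re (φ := fun z => ((phi p ℓ z : ℝ) : ℂ)) (contDiff_phi hx hs hl hℓ)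
  simp only [Complex.ofReal_re] at h
  exact exists_H2_of_isTest phaseFS h

omit hx hs hl hℓ in
open Classical in
/-- The kernel function `φ^ℓ` as an element of `H²`. -/
def phiH (p : Params) (ℓ : Fin 2 → ℤ) : H2 phaseCover :=
  if h : ∃ f : H2 phaseCover, jet0 phaseCover f =ᵐ[volume] phi p ℓ then h.choose else 0

lemma coeFn_phiH : jet0 phaseCover (phiH p ℓ) =ᵐ[volume] phi p ℓ := by
  have h := exists_phiH hx hs hl hℓ
  rw [phiH, dif_pos h]; exact h.choose_spec

lemma pair_phiH (ℓ' : Fin 2 → ℤ) {Θ : Ang → ℂ} (hΘ : Continuous Θ) :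
    pair ℓ' Θ (jet0 phaseCover (phiH p ℓ)) = (if ℓ' = ℓ then ∫ θ, Uhat p ℓ θ * Θ θ else 0)
      + if ℓ' = -ℓ then ∫ θ, Uhat p (-ℓ) θ * Θ θ else 0 := by
  rw [pair_congr (coeFn_phiH hx hs hl hℓ), pair, ← pair_wave, ← pair_wave, neg_neg]
  have c1 := continuous_wave (-ℓ) (continuous_ang (contDiff_Uhat hx hs hl hℓ).continuous)
  have c2 := continuous_wave ℓ (continuous_ang
    (contDiff_Uhat hx hs hl (neg_ne_zero.2 hℓ)).continuous)
  have i1 : Integrable fun z => wave (-ℓ) (Uhat p ℓ) z * wave ℓ' Θ z :=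
    integrable_of_continuous' (c1.mul (continuous_wave ℓ' hΘ))
  have i2 : Integrable fun z => wave ℓ (Uhat p (-ℓ)) z * wave ℓ' Θ z :=
    integrable_of_continuous' (c2.mul (continuous_wave ℓ' hΘ))
  rw [← integral_add i1 i2]
  congr 1; funext z
  rw [phi_eq hx hs hl hℓ]; ring

lemma coef_phiH (ℓ' : Fin 2 → ℤ) : phaseFS.coef (jet0 phaseCover (phiH p ℓ)) (ℓ', 0)
    = if ℓ' = ℓ ∨ ℓ' = -ℓ then intU p ℓ else 0 := by
  have hne : ℓ ≠ -ℓ := fun h => hℓ (self_eq_neg.1 h)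
  rw [← pair_one, pair_phiH hx hs hl hℓ ℓ' continuous_const]
  simp only [mul_one]
  change (if ℓ' = ℓ then intU p ℓ else 0) + (if ℓ' = -ℓ then intU p (-ℓ) else 0) = _
  rw [intU_neg hx hs hl hℓ]
  by_cases h1 : ℓ' = ℓ
  · subst h1; simp [hne]
  · simp [h1]

lemma integral_Uhat_mul {Θ : Ang → ℂ} (hΘ : ContDiff ℝ ∞ fun s : ℝ => Θ s) :
    ∫ θ, Uhat p ℓ θ * (-Mhat p ℓ θ * Θ θ + p.sigTh * derivAng (derivAng Θ) θ)
      = ∫ θ, dBhat p ℓ θ * Θ θ := by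
  have h1 := isResolvent_iff.1 (isResolvent_Uhat hx hs hl hℓ)
  obtain ⟨α, hα⟩ := exists_isPolar ℓ
  have hM : Continuous fun s : ℝ => Mhat p ℓ s := by
    simp only [Mhat_polar hα]
    exact (contDiff_radM hl _).continuous.comp (by fun_prop)
  rw [integral_ang, integral_ang, h1.integral_mul hM (hΘ.of_le ENat.LEInfty.out)
    (coe_periodic _) (coe_periodic _)]
  simp only [derivAng_derivAng_coe]

lemma continuous_adjoint {Θ : Ang → ℂ} (hΘ : ContDiff ℝ ∞ fun s : ℝ => Θ s) (ℓ' : Fin 2 → ℤ) :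
    Continuous fun θ => -Mhat p ℓ' θ * Θ θ + p.sigTh * derivAng (derivAng Θ) θ := by
  have c := continuous_ang hΘ.continuous
  have c2 := continuous_ang (contDiff_derivAng (contDiff_derivAng hΘ)).continuous
  have cM : Continuous fun θ => Mhat p ℓ' θ := by
    simp only [Mhat, dotZ, Fin.sum_univ_two]
    have c0 := continuous_v 0
    have c1 := continuous_v 1
    fun_prop
  fun_prop

/-- `φ^ℓ` lies in the kernel of the linearization at `χ = 2π/∫Û^ℓ`. -/
lemma Aop_phiH (hg : 0 < p.gam) (hc : 0 < p.sigC) {r : ℝ} (hr : (r : ℂ) * intU p ℓ = 1) :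
    Aop p (phiH p ℓ) = r • toL2 (dBop p (phiH p ℓ)) := by
  refine L2_ext_pair fun ℓ' Θ hΘ => ?_
  have h1 := integral_Uhat_mul hx hs hl hℓ hΘ
  have h2 := integral_Uhat_mul hx hs hl (neg_ne_zero.2 hℓ) hΘ
  rw [pair_Aop hΘ, pair_phiH hx hs hl hℓ _ (continuous_adjoint hx hs hl hℓ hΘ ℓ'), pair_smul,
    pair_dBop hg hc _ _ (continuous_ang hΘ.continuous), coef_phiH hx hs hl hℓ, ← mul_assoc]
  have hne : ℓ ≠ -ℓ := fun h => hℓ (self_eq_neg.1 h)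
  by_cases e1 : ℓ' = ℓ
  · subst e1
    rw [if_pos rfl, if_neg hne, if_pos (Or.inl rfl), hr, one_mul, add_zero, h1]
  · by_cases e2 : ℓ' = -ℓ
    · subst e2
      rw [if_neg e1, if_pos rfl, if_pos (Or.inr rfl), hr, one_mul, zero_add, h2]
    · simp [e1, e2]

lemma phi_antipode (z : Phase) : phi p ℓ (antipode z) = phi p ℓ z := by
  have h1 := Uhat_antip hx hs hl hℓ z.2
  have h2 := Uhat_antip hx hs hl (neg_ne_zero.2 hℓ) z.2
  rw [neg_neg] at h2
  simp only [phi, antipode, mFourier_comp_neg, neg_neg, h1, h2]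
  rw [add_comm]

lemma act_phiH {ℓ' : Fin 2 → ℤ} (hℓ' : ℓ' ≠ 0) (T : PhaseSymm)
    (h : ∀ z, phi p ℓ (T.torus.toFun z) = phi p ℓ' z) : T.act (phiH p ℓ) = phiH p ℓ' := by
  refine H2_ext phaseFS (Lp.ext ?_)
  rw [TorusSymm.jet0_pullH2]
  filter_upwards [T.torus.coeFn_pull (jet0 phaseCover (phiH p ℓ)), coeFn_phiH hx hs hl hℓ',
    T.torus.mp.quasiMeasurePreserving.ae_eq_comp (coeFn_phiH hx hs hl hℓ)] with z h1 h2 h3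
  simp only [Function.comp_apply] at h3
  rw [h1, h3, h2, h]

lemma phiH_mem : phiH p ℓ ∈ X := by
  refine mem_X_iff_act.2 ⟨?_, act_phiH hx hs hl hℓ hℓ _ (phi_antipode hx hs hl hℓ)⟩
  have := coef_phiH hx hs hl hℓ 0
  rw [if_neg (by simp [hℓ, Ne.symm hℓ])] at this
  exact this

end Kernel

end

end AntModel

namespace AntModel

noncomputable section

open scoped ComplexConjugate

/-! ## The bordered linearization -/

/-- The standing assumptions at the bifurcation point. -/
structure BifData (p : Params) (k : ℕ) : Prop where
  gam : 0 < p.gam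
  sigC : 0 < p.sigC
  sigX : 0 < p.sigX
  sigTh : 0 < p.sigTh
  lam : 0 < p.lam
  tau : 0 ≤ p.tau
  pos : 0 < k
  nonpyth : NonPythagorean k
  intU_pos : 0 < (intU p (k1 k)).re
  intUP_ne : intUP p (k1 k) ≠ 0
  sep : ∀ ℓ : Fin 2 → ℤ, ℓ ≠ 0 → normSqZ ℓ ≠ (k : ℝ) ^ 2 → intU p ℓ ≠ intU p (k1 k)

/-- The two critical wave vectors. -/
def kvec (k : ℕ) : Fin 2 → Fin 2 → ℤ := ![k1 k, k2 k]

lemma normSqZ_kvec (k : ℕ) (j : Fin 2) : normSqZ (kvec k j) = (k : ℝ) ^ 2 := by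
  fin_cases j <;> simp [normSqZ_eq, kvec, k1, k2]

lemma kvec_ne_zero {k : ℕ} (hk : 0 < k) (j : Fin 2) : kvec k j ≠ 0 := fun h => by
  have h1 := normSqZ_kvec k j
  rw [h] at h1
  have : (0 : ℝ) < (k : ℝ) ^ 2 := by positivity
  simp only [normSqZ, Pi.zero_apply, Int.cast_zero, Fin.sum_univ_two] at h1
  nlinarith

lemma kvec_eq_iff {k : ℕ} (hk : 0 < k) {i j : Fin 2} : kvec k j = kvec k i ↔ j = i := by
  refine ⟨fun h => ?_, fun h => by rw [h]⟩
  have h0 := congrFun h 0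
  have h1 := congrFun h 1
  fin_cases i <;> fin_cases j <;> simp [kvec, k1, k2] at h0 h1 ⊢ <;> omega

lemma kvec_ne_neg {k : ℕ} (hk : 0 < k) (i j : Fin 2) : kvec k j ≠ -kvec k i := fun h => by
  have h0 := congrFun h 0
  have h1 := congrFun h 1
  fin_cases i <;> fin_cases j <;> simp [kvec, k1, k2] at h0 h1 <;> omega

/-- If both components of ℓ were nonzero, their absolute values would write k² as a sum of two
positive squares. -/
lemma exists_kvec {k : ℕ} (hnp : NonPythagorean k) {ℓ : Fin 2 → ℤ}
    (h : normSqZ ℓ = (k : ℝ) ^ 2) : ∃ j, ℓ = kvec k j ∨ ℓ = -kvec k j := by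
  rw [normSqZ_eq] at h
  have h1 : (ℓ 0) ^ 2 + (ℓ 1) ^ 2 = (k : ℤ) ^ 2 := by exact_mod_cast h
  have h2 : k ^ 2 = (ℓ 0).natAbs ^ 2 + (ℓ 1).natAbs ^ 2 := by
    zify; rw [sq_abs, sq_abs, h1]
  by_cases e0 : ℓ 0 = 0
  · have e1 : (ℓ 1) ^ 2 = (k : ℤ) ^ 2 := by rw [← h1, e0]; ring
    refine ⟨1, (sq_eq_sq_iff_eq_or_eq_neg.1 e1).imp (fun e => ?_) fun e => ?_⟩ <;>
    · funext i; fin_cases i <;> simp [kvec, k2, e0, e]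
  · by_cases e1 : ℓ 1 = 0
    · have e2 : (ℓ 0) ^ 2 = (k : ℤ) ^ 2 := by rw [← h1, e1]; ring
      refine ⟨0, (sq_eq_sq_iff_eq_or_eq_neg.1 e2).imp (fun e => ?_) fun e => ?_⟩ <;>
      · funext i; fin_cases i <;> simp [kvec, k1, e1, e]
    · exact absurd h2 (hnp _ _ (Int.natAbs_pos.2 e0) (Int.natAbs_pos.2 e1))

lemma continuous_re_wave (ℓ : Fin 2 → ℤ) {Θ : Ang → ℂ} (h : Continuous Θ) :
    Continuous fun z => (wave ℓ Θ z).re := Complex.continuous_re.comp (continuous_wave ℓ h)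

/-- The real part of the pairing with a wave. -/
def pairRe (ℓ : Fin 2 → ℤ) {Θ : Ang → ℂ} (h : Continuous Θ) : L2 Phase →L[ℝ] ℝ :=
  innerSL ℝ (toL2 ⟨fun z => (wave ℓ Θ z).re, continuous_re_wave ℓ h⟩)

lemma pairRe_apply (ℓ : Fin 2 → ℤ) {Θ : Ang → ℂ} (h : Continuous Θ) (u : L2 Phase) :
    pairRe ℓ h u = (pair ℓ Θ u).re := by
  rw [pair, integral_ofReal_mul_eq (integrable_L2 u) (continuous_wave ℓ h)]
  simp only [Complex.add_re, Complex.ofReal_re, Complex.mul_re, Complex.I_re, mul_zero,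
    Complex.ofReal_im, zero_mul, sub_zero, add_zero]
  rw [pairRe, innerSL_apply_apply, L2_inner_eq]
  refine integral_congr_ae ?_
  filter_upwards [coeFn_toL2 ⟨fun z => (wave ℓ Θ z).re, continuous_re_wave ℓ h⟩] with z hz
  rw [hz]
  exact mul_comm _ _

lemma toL2_dBop_eq_zero {p : Params} (hg : 0 < p.gam) (hc : 0 < p.sigC) {f : H2 phaseCover}
    (hf : ∀ ℓ, phaseFS.coef (jet0 phaseCover f) (ℓ, 0) = 0) : toL2 (dBop p f) = 0 :=
  L2_ext_pair fun ℓ Θ hΘ => by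
    rw [pair_dBop hg hc _ _ (continuous_ang hΘ.continuous), hf, zero_mul, ← zero_smul ℝ (0 : L2 Phase),
      pair_smul]
    simp

lemma coef_zero_mode {f : H2 phaseCover} (hf : f ∈ X) :
    phaseFS.coef (jet0 phaseCover f) (0, 0) = 0 := (mem_X_iff_act.1 hf).1

lemma antiPull_of_mem {f : H2 phaseCover} (hf : f ∈ X) :
    antiPull (jet0 phaseCover f) = jet0 phaseCover f := (mem_Zsp.1 (mem_X_iff.1 hf)).2

lemma Lop_apply (p : Params) (χ : ℝ) (f : H2 phaseCover) :
    Lop p χ f = Aop p f - (χ / (2 * Real.pi)) • toL2 (dBop p f) := rfl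

lemma Lop_mem {p : Params} (hg : 0 < p.gam) (hc : 0 < p.sigC) (χ : ℝ) (f : X) :
    Lop p χ f.1 ∈ Zsp :=
  Zsp.sub_mem (Aop_mem p f) (Zsp.smul_mem _ (dBop_mem hg hc (mem_X_iff_act.1 f.2).2))

namespace BifData

variable {p : Params} {k : ℕ} (D : BifData p k)
include D

lemma continuous_Phat (j : Fin 2) : Continuous (Phat p (kvec k j)) :=
  continuous_ang (contDiff_Phat D.sigX D.sigTh D.lam (kvec_ne_zero D.pos j)).continuous

lemma pair_Aop {ℓ : Fin 2 → ℤ} (hℓ : ℓ ≠ 0) (f : H2 phaseCover) :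
    pair ℓ (Phat p ℓ) (Aop p f) = phaseFS.coef (jet0 phaseCover f) (ℓ, 0) := by
  rw [pair_Aop_of_isResolvent (contDiff_Phat D.sigX D.sigTh D.lam hℓ) ℓ
    (isResolvent_Phat D.sigX D.sigTh D.lam hℓ), pair_one]

lemma pair_dB {ℓ : Fin 2 → ℤ} (hℓ : ℓ ≠ 0) (f : H2 phaseCover) :
    pair ℓ (Phat p ℓ) (toL2 (dBop p f))
      = intU p ℓ * phaseFS.coef (jet0 phaseCover f) (ℓ, 0) := by
  rw [pair_dBop D.gam D.sigC _ _
    (continuous_ang (contDiff_Phat D.sigX D.sigTh D.lam hℓ).continuous),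
    integral_dBhat_mul_Phat D.sigX D.sigTh D.lam hℓ, mul_comm]

/-- The dispersion relation. For noncritical ℓ it forces the density coefficient of a kernel element
to vanish; for critical ℓ it gives a functional that annihilates the range. -/
lemma pair_Lop {ℓ : Fin 2 → ℤ} (hℓ : ℓ ≠ 0) (χ : ℝ) (f : H2 phaseCover) :
    pair ℓ (Phat p ℓ) (Lop p χ f)
      = (1 - χ / (2 * Real.pi) * intU p ℓ) * phaseFS.coef (jet0 phaseCover f) (ℓ, 0) := by
  rw [Lop_apply, pair_sub ℓ (continuous_ang (contDiff_Phat D.sigX D.sigTh D.lam hℓ).continuous),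
    pair_smul, D.pair_Aop hℓ, D.pair_dB hℓ]
  push_cast; ring

lemma intU_kvec (j : Fin 2) : intU p (kvec k j) = ((intU p (k1 k)).re : ℂ) := by
  rw [intU_eq_of_normSqZ D.sigX D.sigTh D.lam (kvec_ne_zero D.pos 0)
    ((normSqZ_kvec k j).trans (normSqZ_kvec k 0).symm)]
  exact (Complex.conj_eq_iff_re.1 (conj_intU D.sigX D.sigTh D.lam (kvec_ne_zero D.pos 0))).symm

lemma intUP_kvec (j : Fin 2) : intUP p (kvec k j) = ((intUP p (k1 k)).re : ℂ) := by
  rw [intUP_eq_of_normSqZ D.sigX D.sigTh D.lam (kvec_ne_zero D.pos 0)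
    ((normSqZ_kvec k j).trans (normSqZ_kvec k 0).symm)]
  exact (Complex.conj_eq_iff_re.1 (conj_intUP D.sigX D.sigTh D.lam (kvec_ne_zero D.pos 0))).symm

lemma intUP_re_ne : (intUP p (k1 k)).re ≠ 0 := fun h => D.intUP_ne (by
  have := D.intUP_kvec 0
  rw [h] at this
  simpa [kvec] using this)

lemma chiK_eq : chiK p k = 2 * Real.pi / (intU p (k1 k)).re := rfl

lemma chiK_pos : 0 < chiK p k := div_pos Real.two_pi_pos D.intU_pos

lemma chiK_mul : chiK p k / (2 * Real.pi) * (intU p (k1 k)).re = 1 := by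
  rw [D.chiK_eq]
  have := D.intU_pos.ne'
  have := Real.pi_pos.ne'
  field_simp

lemma chiK_mul_kvec (j : Fin 2) :
    ((chiK p k / (2 * Real.pi) : ℝ) : ℂ) * intU p (kvec k j) = 1 := by
  rw [D.intU_kvec, ← Complex.ofReal_mul, D.chiK_mul, Complex.ofReal_one]

lemma noncritical {ℓ : Fin 2 → ℤ} (hℓ : ℓ ≠ 0) (h : ∀ j, ℓ ≠ kvec k j ∧ ℓ ≠ -kvec k j) :
    1 - (chiK p k : ℂ) / (2 * Real.pi) * intU p ℓ ≠ 0 := by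
  intro h0
  have hn : normSqZ ℓ ≠ (k : ℝ) ^ 2 := fun hn => by
    obtain ⟨j, hj⟩ := exists_kvec D.nonpyth hn
    exact hj.elim (h j).1 (h j).2
  refine D.sep ℓ hℓ hn ?_
  have h1 := D.chiK_mul_kvec 0
  have h2 : ((chiK p k / (2 * Real.pi) : ℝ) : ℂ) * intU p ℓ = 1 := by
    push_cast; exact (sub_eq_zero.1 h0).symm
  have hne : ((chiK p k / (2 * Real.pi) : ℝ) : ℂ) ≠ 0 := fun h => by simp [h] at h1
  exact mul_left_cancel₀ hne (h2.trans h1.symm)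

/-- The kernel functions in `X`. -/
def phi (j : Fin 2) : X := ⟨phiH p (kvec k j), phiH_mem D.sigX D.sigTh D.lam (kvec_ne_zero D.pos j)⟩

/-- The functionals dual to the kernel functions. -/
def dual (j : Fin 2) : L2 Phase →L[ℝ] ℝ :=
  ((intUP p (k1 k)).re)⁻¹ • pairRe (kvec k j) (D.continuous_Phat j)

lemma dual_apply (j : Fin 2) (u : L2 Phase) : D.dual j u
    = ((intUP p (k1 k)).re)⁻¹ * (pair (kvec k j) (Phat p (kvec k j)) u).re := by
  rw [dual, smul_apply, pairRe_apply, smul_eq_mul]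

lemma dual_Lop (j : Fin 2) (f : H2 phaseCover) : D.dual j (Lop p (chiK p k) f) = 0 := by
  rw [dual_apply, D.pair_Lop (kvec_ne_zero D.pos j)]
  have := D.chiK_mul_kvec j
  push_cast at this
  rw [this]; simp

lemma coef_phi (i : Fin 2) (ℓ : Fin 2 → ℤ) : phaseFS.coef (jet0 phaseCover (D.phi i).1) (ℓ, 0)
    = if ℓ = kvec k i ∨ ℓ = -kvec k i then intU p (kvec k i) else 0 :=
  coef_phiH D.sigX D.sigTh D.lam (kvec_ne_zero D.pos i) ℓ

lemma coef_phi_kvec (i j : Fin 2) : phaseFS.coef (jet0 phaseCover (D.phi i).1) (kvec k j, 0)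
    = if j = i then ((intU p (k1 k)).re : ℂ) else 0 := by
  rw [coef_phi]
  simp only [kvec_eq_iff D.pos, kvec_ne_neg D.pos, or_false, D.intU_kvec]

lemma dual_phi (i j : Fin 2) : D.dual j (jet0 phaseCover (D.phi i).1) = if j = i then 1 else 0 := by
  rw [dual_apply, phi, pair_phiH D.sigX D.sigTh D.lam (kvec_ne_zero D.pos i) _
    (D.continuous_Phat j)]
  simp only [kvec_eq_iff D.pos, kvec_ne_neg D.pos, if_false, add_zero]
  split_ifs with h
  · subst h
    change _ * (intUP p (kvec k j)).re = 1
    rw [D.intUP_kvec, Complex.ofReal_re, inv_mul_cancel₀ D.intUP_re_ne]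
  · simp

/-- The nonzero number by which the dual functionals act on `Aφ_j`. -/
def weight (_ : BifData p k) : ℝ := (intUP p (k1 k)).re⁻¹ * (intU p (k1 k)).re

lemma weight_ne : D.weight ≠ 0 := mul_ne_zero (inv_ne_zero D.intUP_re_ne) D.intU_pos.ne'

lemma dual_Aop (i j : Fin 2) : D.dual j (Aop p (D.phi i).1) = if j = i then D.weight else 0 := by
  rw [dual_apply, D.pair_Aop (kvec_ne_zero D.pos j), coef_phi_kvec]
  split_ifs
  · rw [Complex.ofReal_re]; rfl
  · simp

/-- Linear combinations of the kernel functions. -/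
def comb : (Fin 2 → ℝ) →L[ℝ] X :=
  ∑ j, (ContinuousLinearMap.proj (R := ℝ) (φ := fun _ : Fin 2 => ℝ) j).smulRight (D.phi j)

lemma comb_apply (μ : Fin 2 → ℝ) : D.comb μ = μ 0 • D.phi 0 + μ 1 • D.phi 1 := by
  simp [comb, Fin.sum_univ_two]

/-- The projection onto the kernel. -/
def psi : X →L[ℝ] (Fin 2 → ℝ) :=
  ContinuousLinearMap.pi fun j => (D.dual j).comp ((jet0 phaseCover).comp X.subtypeL)

lemma psi_apply (f : X) (j : Fin 2) : D.psi f j = D.dual j (jet0 phaseCover f.1) := rfl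

lemma psi_comb (μ : Fin 2 → ℝ) : D.psi (D.comb μ) = μ := by
  rw [comb_apply, map_add, map_smul, map_smul]
  funext j
  simp only [Pi.add_apply, Pi.smul_apply, psi_apply, dual_phi, smul_eq_mul]
  fin_cases j <;> simp

lemma dual_AX_comb (μ : Fin 2 → ℝ) (j : Fin 2) :
    D.dual j (AX p (D.comb μ) : L2 Phase) = D.weight * μ j := by
  rw [comb_apply, map_add, map_smul, map_smul]
  simp only [Submodule.coe_add, Submodule.coe_smul, map_add, map_smul, AX_coe, dual_Aop,
    smul_eq_mul]
  fin_cases j <;> simp [mul_comm]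

/-- The linearization on `X`. -/
def LX (χ : ℝ) : X →L[ℝ] Zsp :=
  ((Lop p χ).comp X.subtypeL).codRestrict Zsp (Lop_mem D.gam D.sigC χ)

lemma LX_coe (χ : ℝ) (f : X) : (D.LX χ f : L2 Phase) = Lop p χ f.1 := rfl

lemma dBop_phi (i : Fin 2) :
    (chiK p k / (2 * Real.pi)) • toL2 (dBop p (D.phi i).1) = Aop p (D.phi i).1 :=
  (Aop_phiH D.sigX D.sigTh D.lam (kvec_ne_zero D.pos i) D.gam D.sigC (D.chiK_mul_kvec i)).symm

/-- A φ_i and ∂_θB_τ[φ_i] are proportional by the kernel equation at χ^k, so L_χ φ_i stays on the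
line through A φ_i for every χ. This is why the bordered problem uses A φ_i as a complement of the
range. -/
lemma Lop_phi (χ : ℝ) (i : Fin 2) :
    Lop p χ (D.phi i).1 = (1 - χ / chiK p k) • Aop p (D.phi i).1 := by
  rw [Lop_apply, ← D.dBop_phi i, smul_smul, ← sub_smul]
  congr 1
  have := D.chiK_pos.ne'
  have := Real.pi_pos.ne'
  field_simp

lemma LX_comb (χ : ℝ) (μ : Fin 2 → ℝ) :
    D.LX χ (D.comb μ) = (1 - χ / chiK p k) • AX p (D.comb μ) := by
  have h : ∀ i, D.LX χ (D.phi i) = (1 - χ / chiK p k) • AX p (D.phi i) := fun i =>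
    Subtype.ext (D.Lop_phi χ i)
  rw [comb_apply, map_add, map_add, map_smul, map_smul, map_smul, map_smul, h, h, smul_add,
    smul_comm (μ 0), smul_comm (μ 1)]

lemma LX_comb_crit (μ : Fin 2 → ℝ) : D.LX (chiK p k) (D.comb μ) = 0 := by
  rw [LX_comb, div_self D.chiK_pos.ne', sub_self, zero_smul]

/-- Let g = A⁻¹z and c = χ^k/2π. The equation reads w = g + c A⁻¹∂_θB[w], whose right-hand side
involves only the density of w, and its density coefficients must be ρ_ℓ(g)/(1 − c∫Û^ℓ). A
multiplier applied to g yields some f with these coefficients. Then w = g + c A⁻¹∂_θB[f] has the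
density of f, so ∂_θB[w] = ∂_θB[f]. At critical ℓ the hypothesis on z says ρ_ℓ(g) = 0. -/
lemma exists_LX_eq {z : Zsp} (hz : ∀ j, D.dual j z = 0) : ∃ w, D.LX (chiK p k) w = z := by
  obtain ⟨g, hg⟩ := (AX_bijective D.sigX D.sigTh D.lam).2 z
  have hg' : Aop p g.1 = z := congrArg Subtype.val hg
  have hanti := antiPull_of_mem g.2
  have hcrit : ∀ j, phaseFS.coef (jet0 phaseCover g.1) (kvec k j, 0) = 0 := fun j => by
    have h1 := hz j
    rw [dual_apply, ← hg', D.pair_Aop (kvec_ne_zero D.pos j)] at h1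
    have h2 := (mul_eq_zero.1 h1).resolve_left (inv_ne_zero D.intUP_re_ne)
    rw [← Complex.conj_eq_iff_re.1 (conj_coef_antip hanti (kvec k j)), h2, Complex.ofReal_zero]
  obtain ⟨K, hK⟩ := exists_gap D.gam D.sigC D.sigX D.sigTh D.lam D.tau (chiK p k)
  -- The value at ℓ = 0 is irrelevant, as elements of X have zero mean. At critical ℓ the inverse
  -- takes the default value 0, which matches ρ_ℓ(g) = 0.
  let ν : (Fin 2 → ℤ) → ℂ := fun ℓ =>
    if ℓ = 0 then 0 else (1 - (chiK p k : ℂ) / (2 * Real.pi) * intU p ℓ)⁻¹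
  obtain ⟨f, hf, hfc⟩ := exists_positional_multiplier ν (K := max K 0)
    (fun ℓ => by
      by_cases h : ℓ = 0
      · simp [ν, h]
      · simp only [ν, if_neg h]; exact (hK ℓ h).trans (le_max_left _ _))
    (fun ℓ => by
      by_cases h : ℓ = 0
      · simp [ν, h]
      · simp only [ν, neg_eq_zero, intU_neg D.sigX D.sigTh D.lam h])
    (fun ℓ => by
      by_cases h : ℓ = 0
      · simp [ν, h]
      · simp only [ν, if_neg h, map_inv₀, map_sub, map_one, map_mul, map_div₀, Complex.conj_ofReal,
          conj_intU D.sigX D.sigTh D.lam h, map_ofNat]) (mem_X_iff_act.1 g.2).2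
  obtain ⟨q, hq⟩ := (AX_bijective D.sigX D.sigTh D.lam).2 ⟨_, dBop_mem D.gam D.sigC hf⟩
  have hq' : Aop p q.1 = toL2 (dBop p f) := congrArg Subtype.val hq
  set c : ℝ := chiK p k / (2 * Real.pi) with hcdef
  refine ⟨g + c • q, Subtype.ext ?_⟩
  have h0 : toL2 (dBop p (f - (g + c • q).1)) = 0 := by
    refine toL2_dBop_eq_zero D.gam D.sigC fun ℓ => ?_
    have e : phaseFS.coef (jet0 phaseCover (f - (g + c • q).1)) (ℓ, 0)
        = ν ℓ * phaseFS.coef (jet0 phaseCover g.1) (ℓ, 0)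
          - (phaseFS.coef (jet0 phaseCover g.1) (ℓ, 0)
            + c * phaseFS.coef (jet0 phaseCover q.1) (ℓ, 0)) := by
      rw [map_sub, Submodule.coe_add, Submodule.coe_smul, map_add, map_smul, phaseFS.coef_sub,
        phaseFS.coef_add, phaseFS.coef_smul, hfc]
    rw [e]
    by_cases hℓ : ℓ = 0
    · subst hℓ
      rw [coef_zero_mode g.2, coef_zero_mode q.2]; simp
    · have hqc : phaseFS.coef (jet0 phaseCover q.1) (ℓ, 0)
          = intU p ℓ * (ν ℓ * phaseFS.coef (jet0 phaseCover g.1) (ℓ, 0)) := by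
        rw [← D.pair_Aop hℓ, hq', D.pair_dB hℓ, hfc]
      rw [hqc]
      by_cases hk : ∃ j, ℓ = kvec k j ∨ ℓ = -kvec k j
      · have hzero : phaseFS.coef (jet0 phaseCover g.1) (ℓ, 0) = 0 := by
          obtain ⟨j, rfl | rfl⟩ := hk
          · exact hcrit j
          · rw [coef_antip hanti]; exact hcrit j
        rw [hzero]; simp
      · push Not at hk
        have hne := D.noncritical hℓ hk
        have hν : ν ℓ * (1 - (chiK p k : ℂ) / (2 * Real.pi) * intU p ℓ) = 1 := by
          simp only [ν, if_neg hℓ]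
          exact inv_mul_cancel₀ hne
        have hcc : (c : ℂ) = (chiK p k : ℂ) / (2 * Real.pi) := by rw [hcdef]; push_cast; rfl
        rw [hcc]
        linear_combination phaseFS.coef (jet0 phaseCover g.1) (ℓ, 0) * hν
  have h1 : toL2 (dBop p f) = toL2 (dBop p (g + c • q).1) := by
    rw [map_sub, map_sub, sub_eq_zero] at h0; exact h0
  rw [LX_coe, Lop_apply, ← h1, ← hq', ← hg', Submodule.coe_add, Submodule.coe_smul, map_add,
    map_smul, add_sub_cancel_right]

lemma dual_LX (f : X) (j : Fin 2) : D.dual j (D.LX (chiK p k) f : L2 Phase) = 0 := D.dual_Lop j f.1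

/-- Noncritical density coefficients of f vanish by the dispersion relation, and the critical ones
are matched by a combination of φ_1 and φ_2. The difference has zero density, so L acts on it as A,
which is injective. Thus the kernel is spanned by the φ_j, and ψ detects it. -/
lemma eq_zero_of_LX_eq_zero {f : X} (h : D.LX (chiK p k) f = 0) (hf : D.psi f = 0) : f = 0 := by
  have h' : Lop p (chiK p k) f.1 = 0 := congrArg Subtype.val h
  have hnc : ∀ ℓ, (∀ j, ℓ ≠ kvec k j ∧ ℓ ≠ -kvec k j) →
      phaseFS.coef (jet0 phaseCover f.1) (ℓ, 0) = 0 := fun ℓ hk => by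
    by_cases hℓ : ℓ = 0
    · subst hℓ; exact coef_zero_mode f.2
    · have h1 := D.pair_Lop hℓ (chiK p k) f.1
      rw [h', ← zero_smul ℝ (0 : L2 Phase), pair_smul, Complex.ofReal_zero, zero_mul] at h1
      exact (mul_eq_zero.1 h1.symm).resolve_left (D.noncritical hℓ hk)
  set I := (intU p (k1 k)).re with hI
  let μ : Fin 2 → ℝ := fun j => (phaseFS.coef (jet0 phaseCover f.1) (kvec k j, 0)).re / I
  have hμ : ∀ j, phaseFS.coef (jet0 phaseCover f.1) (kvec k j, 0) = (μ j : ℂ) * I := fun j => by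
    have h1 := Complex.conj_eq_iff_re.1 (conj_coef_antip (antiPull_of_mem f.2) (kvec k j))
    have hne : I ≠ 0 := D.intU_pos.ne'
    rw [← h1, ← Complex.ofReal_mul]
    congr 1
    exact (div_mul_cancel₀ _ hne).symm
  have hcomb : ∀ ℓ, phaseFS.coef (jet0 phaseCover (D.comb μ).1) (ℓ, 0)
      = μ 0 * phaseFS.coef (jet0 phaseCover (D.phi 0).1) (ℓ, 0)
        + μ 1 * phaseFS.coef (jet0 phaseCover (D.phi 1).1) (ℓ, 0) := fun ℓ => by
    rw [comb_apply, Submodule.coe_add, Submodule.coe_smul, Submodule.coe_smul, map_add, map_smul,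
      map_smul, phaseFS.coef_add, phaseFS.coef_smul, phaseFS.coef_smul]
  have hk0 : ∀ j, phaseFS.coef (jet0 phaseCover (f - D.comb μ).1) (kvec k j, 0) = 0 := fun j => by
    rw [Submodule.coe_sub, map_sub, phaseFS.coef_sub, hμ, hcomb, coef_phi_kvec, coef_phi_kvec]
    fin_cases j <;> simp [hI]
  have hd : ∀ ℓ, phaseFS.coef (jet0 phaseCover (f - D.comb μ).1) (ℓ, 0) = 0 := fun ℓ => by
    by_cases hk : ∃ j, ℓ = kvec k j ∨ ℓ = -kvec k j
    · obtain ⟨j, rfl | rfl⟩ := hk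
      · exact hk0 j
      · rw [coef_antip (antiPull_of_mem (f - D.comb μ).2)]; exact hk0 j
    · push Not at hk
      have e : ∀ i, ¬ (ℓ = kvec k i ∨ ℓ = -kvec k i) := fun i hi => hi.elim (hk i).1 (hk i).2
      rw [Submodule.coe_sub, map_sub, phaseFS.coef_sub, hnc ℓ hk, hcomb, coef_phi, coef_phi,
        if_neg (e 0), if_neg (e 1)]
      simp
  have hdB := toL2_dBop_eq_zero D.gam D.sigC hd
  have hL : D.LX (chiK p k) (f - D.comb μ) = 0 := by rw [map_sub, h, LX_comb_crit, sub_zero]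
  have hA : AX p (f - D.comb μ) = 0 := by
    refine Subtype.ext ?_
    have h1 : Lop p (chiK p k) (f - D.comb μ).1 = 0 := congrArg Subtype.val hL
    rw [Lop_apply, hdB, smul_zero, sub_zero] at h1
    exact h1
  have hfeq : f = D.comb μ := sub_eq_zero.1
    ((injective_iff_map_eq_zero _).1 (AX_bijective D.sigX D.sigTh D.lam).1 _ hA)
  rw [hfeq, psi_comb] at hf
  rw [hfeq, hf, map_zero]

/-- The bordered linearization. -/
def bord : (X × (Fin 2 → ℝ)) →L[ℝ] (Zsp × (Fin 2 → ℝ)) :=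
  ((D.LX (chiK p k)).comp (ContinuousLinearMap.fst ℝ X (Fin 2 → ℝ))
    - ((AX p).comp D.comb).comp (ContinuousLinearMap.snd ℝ X (Fin 2 → ℝ))).prod
    (D.psi.comp (ContinuousLinearMap.fst ℝ X (Fin 2 → ℝ)))

lemma bord_apply (f : X) (μ : Fin 2 → ℝ) :
    D.bord (f, μ) = (D.LX (chiK p k) f - AX p (D.comb μ), D.psi f) := rfl

/-- The dual functionals vanish on the range of L and send A(comb μ) to a nonzero multiple of μ, so
the first component determines μ. What remains is L up to its kernel, and ψ fixes the kernel part.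
-/
lemma bord_bijective : Function.Bijective D.bord := by
  constructor
  · rw [injective_iff_map_eq_zero]
    rintro ⟨f, μ⟩ h
    rw [bord_apply, Prod.mk_eq_zero] at h
    have h1 := sub_eq_zero.1 h.1
    have hμ : μ = 0 := by
      funext j
      have h2 := D.dual_LX f j
      rw [h1, dual_AX_comb] at h2
      exact (mul_eq_zero.1 h2).resolve_left D.weight_ne
    subst hμ
    rw [map_zero, map_zero] at h1
    rw [D.eq_zero_of_LX_eq_zero h1 h.2]; rfl
  · rintro ⟨z, s⟩
    let μ : Fin 2 → ℝ := fun j => -(D.weight⁻¹ * D.dual j z)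
    obtain ⟨w, hw⟩ := D.exists_LX_eq (z := z + AX p (D.comb μ)) fun j => by
      rw [Submodule.coe_add, map_add, dual_AX_comb]
      simp only [μ]
      rw [mul_neg, mul_inv_cancel_left₀ D.weight_ne, add_neg_cancel]
    refine ⟨(w + D.comb (s - D.psi w), μ), ?_⟩
    rw [bord_apply, map_add, LX_comb_crit, hw, map_add, psi_comb]
    simp

/-- Functions of `X` annihilated by the dual functionals lie in the range of the linearization. -/
lemma mem_rangeInX {g : X} (h : D.psi g = 0) : g ∈ rangeInX p (chiK p k) := by
  obtain ⟨w, hw⟩ := D.exists_LX_eq (z := ⟨jet0 phaseCover g.1, mem_X_iff.1 g.2⟩)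
    fun j => congrFun h j
  have hw' : Lop p (chiK p k) w.1 = jet0 phaseCover g.1 := congrArg Subtype.val hw
  refine ⟨w, (L_ae D.gam D.sigC w.1 (chiK p k)).symm.trans ?_⟩
  rw [hw']; rfl

end BifData

end

end AntModel

namespace AntModel

noncomputable section

open Filter Topology

/-! ## Lyapunov–Schmidt reduction with a two-dimensional kernel -/

section Abstract

variable {E Z : Type*} [NormedAddCommGroup E] [NormedSpace ℝ E] [NormedAddCommGroup Z]
  [NormedSpace ℝ Z]

variable (E Z) in
/-- A bordered bifurcation problem `A f - χ (b f + q f) = 0` with a quadratic term `q`. -/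
structure Reduction where
  A : E →L[ℝ] Z
  b : E →L[ℝ] Z
  q : E → Z
  analytic_q : ∀ f, AnalyticAt ℝ q f
  q_zero : q 0 = 0
  deriv_q : HasFDerivAt q (0 : E →L[ℝ] Z) 0
  comb : (Fin 2 → ℝ) →L[ℝ] E
  psi : E →L[ℝ] (Fin 2 → ℝ)
  χ₀ : ℝ
  χ₀_ne : χ₀ ≠ 0
  b_comb : ∀ μ, χ₀ • b (comb μ) = A (comb μ)
  psi_comb : ∀ μ, psi (comb μ) = μ
  bij : Function.Bijective fun a : E × (Fin 2 → ℝ) =>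
    (A a.1 - χ₀ • b a.1 - A (comb a.2), psi a.1)

/-- The pair of the first two coordinates. -/
def pairVec : ℝ × ℝ × ℝ →L[ℝ] (Fin 2 → ℝ) :=
  ContinuousLinearMap.pi ![ContinuousLinearMap.fst ℝ ℝ (ℝ × ℝ),
    (ContinuousLinearMap.fst ℝ ℝ ℝ).comp (ContinuousLinearMap.snd ℝ ℝ (ℝ × ℝ))]

lemma pairVec_apply (q : ℝ × ℝ × ℝ) : pairVec q = ![q.1, q.2.1] := by
  funext i; fin_cases i <;> rfl

namespace Reduction

variable (R : Reduction E Z)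

/-- The nonlinear operator. -/
def F (f : E) (χ : ℝ) : Z := R.A f - χ • (R.b f + R.q f)

/-- The bordered nonlinear operator. -/
def T (a : E × (Fin 2 → ℝ) × ℝ) : Z × (Fin 2 → ℝ) × ℝ :=
  (R.F a.1 a.2.2 - R.A (R.comb a.2.1), R.psi a.1, a.2.2)

/-- The derivative of the bordered operator on the trivial branch. -/
def dT (χ : ℝ) : E × (Fin 2 → ℝ) × ℝ →L[ℝ] Z × (Fin 2 → ℝ) × ℝ :=
  ((R.A - χ • R.b).comp (ContinuousLinearMap.fst ℝ E ((Fin 2 → ℝ) × ℝ))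
    - ((R.A).comp R.comb).comp ((ContinuousLinearMap.fst ℝ (Fin 2 → ℝ) ℝ).comp
      (ContinuousLinearMap.snd ℝ E ((Fin 2 → ℝ) × ℝ)))).prod
    ((R.psi.comp (ContinuousLinearMap.fst ℝ E ((Fin 2 → ℝ) × ℝ))).prod
      ((ContinuousLinearMap.snd ℝ (Fin 2 → ℝ) ℝ).comp
        (ContinuousLinearMap.snd ℝ E ((Fin 2 → ℝ) × ℝ))))

lemma dT_apply (χ : ℝ) (a : E × (Fin 2 → ℝ) × ℝ) :
    R.dT χ a = (R.A a.1 - χ • R.b a.1 - R.A (R.comb a.2.1), R.psi a.1, a.2.2) := rfl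

lemma T_zero (χ : ℝ) : R.T (0, 0, χ) = (0, 0, χ) := by
  simp [T, F, R.q_zero]

lemma analyticAt_T (a : E × (Fin 2 → ℝ) × ℝ) : AnalyticAt ℝ R.T a := by
  have h1 : AnalyticAt ℝ (fun a : E × (Fin 2 → ℝ) × ℝ => a.1) a := analyticAt_fst
  have h2 : AnalyticAt ℝ (fun a : E × (Fin 2 → ℝ) × ℝ => a.2.1) a :=
    analyticAt_fst.comp analyticAt_snd
  have h3 : AnalyticAt ℝ (fun a : E × (Fin 2 → ℝ) × ℝ => a.2.2) a :=
    analyticAt_snd.comp analyticAt_snd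
  have hA := (R.A.analyticAt a.1).fun_comp h1
  have hb := (R.b.analyticAt a.1).fun_comp h1
  have hq := (R.analytic_q a.1).fun_comp h1
  have hc := (R.A.analyticAt _).fun_comp ((R.comb.analyticAt _).fun_comp h2)
  exact ((hA.sub (h3.smul (hb.add hq))).sub hc).prod (((R.psi.analyticAt a.1).fun_comp h1).prod h3)

lemma hasFDerivAt_T (χ : ℝ) : HasFDerivAt R.T (R.dT χ) (0, 0, χ) := by
  have h1 : HasFDerivAt (fun a : E × (Fin 2 → ℝ) × ℝ => a.1)
    (ContinuousLinearMap.fst ℝ E ((Fin 2 → ℝ) × ℝ)) (0, 0, χ) := hasFDerivAt_fst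
  have h3 : HasFDerivAt (fun a : E × (Fin 2 → ℝ) × ℝ => a.2.2)
    ((ContinuousLinearMap.snd ℝ (Fin 2 → ℝ) ℝ).comp
      (ContinuousLinearMap.snd ℝ E ((Fin 2 → ℝ) × ℝ))) (0, 0, χ) := hasFDerivAt_snd.snd
  have hq : HasFDerivAt (fun a : E × (Fin 2 → ℝ) × ℝ => R.q a.1)
      ((0 : E →L[ℝ] Z).comp (ContinuousLinearMap.fst ℝ E ((Fin 2 → ℝ) × ℝ))) (0, 0, χ) :=
    HasFDerivAt.comp (g := R.q) (0, 0, χ) R.deriv_q h1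
  have hb : HasFDerivAt (fun a : E × (Fin 2 → ℝ) × ℝ => R.b a.1)
      (R.b.comp (ContinuousLinearMap.fst ℝ E ((Fin 2 → ℝ) × ℝ))) (0, 0, χ) :=
    HasFDerivAt.comp (g := R.b) (0, 0, χ) R.b.hasFDerivAt h1
  have hA : HasFDerivAt (fun a : E × (Fin 2 → ℝ) × ℝ => R.A a.1)
      (R.A.comp (ContinuousLinearMap.fst ℝ E ((Fin 2 → ℝ) × ℝ))) (0, 0, χ) :=
    HasFDerivAt.comp (g := R.A) (0, 0, χ) R.A.hasFDerivAt h1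
  have hc : HasFDerivAt (fun a : E × (Fin 2 → ℝ) × ℝ => R.A (R.comb a.2.1))
      (((R.A).comp R.comb).comp ((ContinuousLinearMap.fst ℝ (Fin 2 → ℝ) ℝ).comp
      (ContinuousLinearMap.snd ℝ E ((Fin 2 → ℝ) × ℝ)))) (0, 0, χ) :=
    HasFDerivAt.comp (g := R.A.comp R.comb) (0, 0, χ) (R.A.comp R.comb).hasFDerivAt
      hasFDerivAt_snd.fst
  have hψ : HasFDerivAt (fun a : E × (Fin 2 → ℝ) × ℝ => R.psi a.1)
      (R.psi.comp (ContinuousLinearMap.fst ℝ E ((Fin 2 → ℝ) × ℝ))) (0, 0, χ) :=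
    HasFDerivAt.comp (g := R.psi) (0, 0, χ) R.psi.hasFDerivAt h1
  have h := ((hA.fun_sub (h3.fun_smul (hb.fun_add hq))).fun_sub hc).prodMk (hψ.prodMk h3)
  refine h.congr_fderiv ?_
  ext a <;> simp [dT, R.q_zero]

lemma dT_bijective : Function.Bijective (R.dT R.χ₀) := by
  constructor
  · rintro ⟨f, μ, c⟩ ⟨f', μ', c'⟩ h
    simp only [dT_apply, Prod.mk.injEq] at h
    have h1 := R.bij.1 (a₁ := (f, μ)) (a₂ := (f', μ')) (Prod.ext h.1 h.2.1)
    simp only [Prod.mk.injEq] at h1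
    rw [h1.1, h1.2, h.2.2]
  · rintro ⟨z, s, c⟩
    obtain ⟨⟨f, μ⟩, h⟩ := R.bij.2 (z, s)
    simp only [Prod.mk.injEq] at h
    exact ⟨(f, μ, c), by rw [dT_apply]; simp only [h.1, h.2]⟩

variable [CompleteSpace E] [CompleteSpace Z]

lemma hasStrictFDerivAt_T (χ : ℝ) : HasStrictFDerivAt R.T (R.dT χ) (0, 0, χ) := by
  have h := (R.analyticAt_T (0, 0, χ)).hasStrictFDerivAt
  rwa [(R.hasFDerivAt_T χ).fderiv] at h

/-- Keeping χ as a component of both source and target replaces the parameter-dependent implicit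
function theorem by the analytic inverse function theorem. -/
lemma exists_local_inverse : ∃ e : OpenPartialHomeomorph (E × (Fin 2 → ℝ) × ℝ)
    (Z × (Fin 2 → ℝ) × ℝ), (∀ a, e a = R.T a) ∧ (0, 0, R.χ₀) ∈ e.source ∧
      AnalyticAt ℝ e.symm (0, 0, R.χ₀) := by
  let e' := ContinuousLinearEquiv.ofBijective (R.dT R.χ₀) (LinearMap.ker_eq_bot.2 R.dT_bijective.1)
    (LinearMap.range_eq_top.2 R.dT_bijective.2)
  have he' : (e' : E × (Fin 2 → ℝ) × ℝ →L[ℝ] Z × (Fin 2 → ℝ) × ℝ) = R.dT R.χ₀ :=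
    ContinuousLinearEquiv.coe_ofBijective _ _ _
  have h : HasStrictFDerivAt R.T
      (e' : E × (Fin 2 → ℝ) × ℝ →L[ℝ] Z × (Fin 2 → ℝ) × ℝ) (0, 0, R.χ₀) := by
    rw [he']; exact R.hasStrictFDerivAt_T R.χ₀
  refine ⟨h.toOpenPartialHomeomorph R.T, fun a => rfl,
    h.mem_toOpenPartialHomeomorph_source, ?_⟩
  have := OpenPartialHomeomorph.analyticAt_symm' (h.toOpenPartialHomeomorph R.T) (i := e')
    h.mem_toOpenPartialHomeomorph_source (R.analyticAt_T _) h.hasFDerivAt.fderiv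
  rw [← R.T_zero R.χ₀]
  exact this

/-- An invariant subspace in which the second kernel direction is absent. -/
structure Invariant (R : Reduction E Z) where
  Y : Submodule ℝ E
  W : Submodule ℝ Z
  complete_Y : CompleteSpace Y
  complete_W : CompleteSpace W
  proj : Z →L[ℝ] W
  proj_coe : ∀ z : W, proj z = z
  F_mem : ∀ f ∈ Y, ∀ χ, R.F f χ ∈ W
  A_comb_mem : ∀ μ : Fin 2 → ℝ, μ 1 = 0 → R.A (R.comb μ) ∈ W
  psi_eq : ∀ f ∈ Y, R.psi f 1 = 0
  solve : ∀ f μ, R.A f - R.χ₀ • R.b f - R.A (R.comb μ) ∈ W → R.psi f 1 = 0 → f ∈ Y ∧ μ 1 = 0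

/-- The symmetry which exchanges the kernel directions. -/
structure Swap (R : Reduction E Z) where
  S : E →L[ℝ] E
  S' : Z →L[ℝ] Z
  F_S : ∀ f χ, R.F (S f) χ = S' (R.F f χ)
  A_S : ∀ f, R.A (S f) = S' (R.A f)
  comb_S : ∀ μ : Fin 2 → ℝ, S (R.comb μ) = R.comb ![μ 1, μ 0]
  psi_S : ∀ f, R.psi (S f) = ![R.psi f 1, R.psi f 0]

variable {R}

/-- Inclusion of the invariant subspace. -/
def Invariant.incl (I : R.Invariant) : I.Y × ℝ × ℝ →L[ℝ] E × (Fin 2 → ℝ) × ℝ :=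
  (I.Y.subtypeL.comp (ContinuousLinearMap.fst ℝ I.Y (ℝ × ℝ))).prod
    (((ContinuousLinearMap.pi ![ContinuousLinearMap.id ℝ ℝ, 0]).comp
      ((ContinuousLinearMap.fst ℝ ℝ ℝ).comp (ContinuousLinearMap.snd ℝ I.Y (ℝ × ℝ)))).prod
      ((ContinuousLinearMap.snd ℝ ℝ ℝ).comp (ContinuousLinearMap.snd ℝ I.Y (ℝ × ℝ))))

lemma Invariant.incl_apply (I : R.Invariant) (a : I.Y × ℝ × ℝ) :
    I.incl a = ((a.1 : E), ![a.2.1, 0], a.2.2) := by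
  refine Prod.ext rfl (Prod.ext ?_ rfl)
  funext i; fin_cases i <;> rfl

/-- Projection to the invariant subspace. -/
def Invariant.out (I : R.Invariant) : Z × (Fin 2 → ℝ) × ℝ →L[ℝ] I.W × ℝ × ℝ :=
  (I.proj.comp (ContinuousLinearMap.fst ℝ Z ((Fin 2 → ℝ) × ℝ))).prod
    (((ContinuousLinearMap.proj (R := ℝ) (φ := fun _ : Fin 2 => ℝ) 0).comp
      ((ContinuousLinearMap.fst ℝ (Fin 2 → ℝ) ℝ).comp
        (ContinuousLinearMap.snd ℝ Z ((Fin 2 → ℝ) × ℝ)))).prod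
      ((ContinuousLinearMap.snd ℝ (Fin 2 → ℝ) ℝ).comp
        (ContinuousLinearMap.snd ℝ Z ((Fin 2 → ℝ) × ℝ))))

lemma Invariant.out_apply (I : R.Invariant) (a : Z × (Fin 2 → ℝ) × ℝ) :
    I.out a = (I.proj a.1, a.2.1 0, a.2.2) := rfl

/-- Restricted to Y with μ₂ = 0, T takes values in the invariant data (the projection only retypes
them), and its derivative is onto by `solve`. It is therefore open, and (0, (r, 0), χ) has a
preimage of this form near the base point. Injectivity is not needed here: local injectivity of the
full T identifies this preimage later. -/
lemma Invariant.eventually (I : R.Invariant) (N : Set (E × (Fin 2 → ℝ) × ℝ))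
    (hN : N ∈ 𝓝 ((0, 0, R.χ₀) : E × (Fin 2 → ℝ) × ℝ)) :
    ∀ᶠ y : ℝ × ℝ in 𝓝 (0, R.χ₀), ∃ a ∈ N, R.T a = (0, ![y.1, 0], y.2) ∧ a.2.1 1 = 0 := by
  have := I.complete_Y
  have := I.complete_W
  have h0 : I.incl (0, 0, R.χ₀) = (0, 0, R.χ₀) := by
    rw [I.incl_apply]
    refine Prod.ext rfl (Prod.ext ?_ rfl)
    funext i; fin_cases i <;> rfl
  have hd : HasStrictFDerivAt (fun a => I.out (R.T (I.incl a)))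
      ((I.out.comp (R.dT R.χ₀)).comp I.incl) (0, 0, R.χ₀) := by
    have h1 := R.hasStrictFDerivAt_T R.χ₀
    rw [← h0] at h1
    exact ((I.out.hasStrictFDerivAt).comp _ h1).comp _ I.incl.hasStrictFDerivAt
  have hsurj : ((I.out.comp (R.dT R.χ₀)).comp I.incl).range = ⊤ := by
    rw [LinearMap.range_eq_top]
    rintro ⟨z, s, c⟩
    obtain ⟨⟨f, μ, c'⟩, ha⟩ := R.dT_bijective.2 ((z : Z), ![s, 0], c)
    have ha' := ha
    simp only [dT_apply, Prod.mk.injEq] at ha'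
    obtain ⟨e1, e2, e3⟩ := ha'
    obtain ⟨hf, hμ⟩ := I.solve f μ (by rw [e1]; exact z.2) (by rw [e2]; rfl)
    refine ⟨(⟨f, hf⟩, μ 0, c'), ?_⟩
    change I.out (R.dT R.χ₀ (I.incl _)) = _
    have e4 : ![μ 0, 0] = μ := by
      funext i; fin_cases i
      · rfl
      · exact hμ.symm
    rw [I.incl_apply]
    simp only [e4]
    rw [ha, I.out_apply, I.proj_coe]
    rfl
  have hmap := hd.map_nhds_eq_of_surj hsurj
  have hN' : I.incl ⁻¹' N ∈ 𝓝 ((0, 0, R.χ₀) : I.Y × ℝ × ℝ) :=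
    I.incl.continuous.continuousAt.preimage_mem_nhds (by rw [h0]; exact hN)
  have h2 := image_mem_map (m := fun a => I.out (R.T (I.incl a))) hN'
  have h3 : I.out (R.T (I.incl (0, 0, R.χ₀))) = (0, 0, R.χ₀) := by
    rw [h0, R.T_zero, I.out_apply, map_zero]; rfl
  rw [hmap, h3] at h2
  have hc : Continuous fun y : ℝ × ℝ => ((0, y.1, y.2) : I.W × ℝ × ℝ) := by fun_prop
  filter_upwards [hc.continuousAt.preimage_mem_nhds (x := ((0, R.χ₀) : ℝ × ℝ)) h2] with y hy
  obtain ⟨⟨f, m, c⟩, haN, ha⟩ := hy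
  refine ⟨I.incl (f, m, c), haN, ?_, by rw [I.incl_apply]; rfl⟩
  simp only [I.incl_apply] at ha ⊢
  rw [I.out_apply] at ha
  simp only [T, Prod.mk.injEq] at ha ⊢
  refine ⟨?_, ?_, ha.2.2⟩
  · have hmem : R.F f c - R.A (R.comb ![m, 0]) ∈ I.W :=
      I.W.sub_mem (I.F_mem f f.2 c) (I.A_comb_mem _ rfl)
    have := I.proj_coe ⟨_, hmem⟩
    rw [ha.1] at this
    exact (congrArg Subtype.val this).symm
  · funext i; fin_cases i
    · exact ha.2.1
    · exact I.psi_eq f f.2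

variable (R)

/-- The parameters of the reduced problem as data of the bordered one. -/
def inj (_ : Reduction E Z) : ℝ × ℝ × ℝ →L[ℝ] Z × (Fin 2 → ℝ) × ℝ :=
  (0 : ℝ × ℝ × ℝ →L[ℝ] Z).prod (pairVec.prod
    ((ContinuousLinearMap.snd ℝ ℝ ℝ).comp (ContinuousLinearMap.snd ℝ ℝ (ℝ × ℝ))))

lemma inj_apply (q : ℝ × ℝ × ℝ) : R.inj q = (0, ![q.1, q.2.1], q.2.2) := by
  rw [← pairVec_apply]; rfl

lemma pairVec_zero (χ : ℝ) : ![((0 : ℝ), (0 : ℝ), χ).1, ((0 : ℝ), (0 : ℝ), χ).2.1] = 0 := by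
  funext i; fin_cases i <;> rfl

/-- K(r₁, r₂, χ) is the local preimage of (0, (r₁, r₂), χ) under T, so its first component f
satisfies F(f, χ) = A(comb Φ) and ψ(f) = (r₁, r₂). If F(f, χ) = 0, then (f, 0, χ) is the preimage of
(0, ψ(f), χ), so f is a value of K with Φ = 0. The symmetry claims hold because the transformed
point is again a preimage in the domain where T is injective. -/
theorem exists_reduction (I : R.Invariant) (S : R.Swap) :
    ∃ (U V : Set ℝ) (O : Set E) (Φ : ℝ × ℝ × ℝ → (Fin 2 → ℝ)) (G : ℝ × ℝ × ℝ → E),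
      (IsOpen U ∧ 0 ∈ U) ∧ (IsOpen V ∧ R.χ₀ ∈ V) ∧ (IsOpen O ∧ 0 ∈ O) ∧
      AnalyticOnNhd ℝ Φ (U ×ˢ U ×ˢ V) ∧ AnalyticOnNhd ℝ G (U ×ˢ U ×ˢ V) ∧
      (∀ q ∈ U ×ˢ U ×ˢ V, R.psi (G q) = 0) ∧
      (∀ χ ∈ V, ∀ f ∈ O, (R.F f χ = 0 ↔ ∃ r₁ ∈ U, ∃ r₂ ∈ U,
        f = R.comb ![r₁, r₂] + G (r₁, r₂, χ) ∧ Φ (r₁, r₂, χ) = 0)) ∧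
      (∀ r ∈ U, ∀ χ ∈ V, Φ (r, 0, χ) 1 = 0) ∧
      (∀ r₁ ∈ U, ∀ r₂ ∈ U, ∀ χ ∈ V,
        Φ (r₁, r₂, χ) = ![Φ (r₂, r₁, χ) 1, Φ (r₂, r₁, χ) 0]) ∧
      ∀ χ ∈ V, HasFDerivAt (fun r : ℝ × ℝ => G (r.1, r.2, χ)) (0 : ℝ × ℝ →L[ℝ] E) (0, 0) ∧
        G (0, 0, χ) = 0 ∧ Φ (0, 0, χ) = 0 := by
  obtain ⟨e, he, hsrc, han⟩ := R.exists_local_inverse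
  have hT0 : e (0, 0, R.χ₀) = (0, 0, R.χ₀) := by rw [he, R.T_zero]
  have htgt : (0, 0, R.χ₀) ∈ e.target := hT0 ▸ e.map_source hsrc
  have hsymm0 : e.symm (0, 0, R.χ₀) = (0, 0, R.χ₀) := by
    conv_lhs => rw [← hT0]
    exact e.left_inv hsrc
  let q₀ : ℝ × ℝ × ℝ := (0, 0, R.χ₀)
  have hinj0 : R.inj q₀ = (0, 0, R.χ₀) := by rw [inj_apply, pairVec_zero]
  let K : ℝ × ℝ × ℝ → E × (Fin 2 → ℝ) × ℝ := fun q => e.symm (R.inj q)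
  have hK0 : K q₀ = (0, 0, R.χ₀) := by simp only [K]; rw [hinj0, hsymm0]
  have hinjc : ContinuousAt R.inj q₀ := R.inj.continuous.continuousAt
  have hKan : ∀ᶠ q in 𝓝 q₀, AnalyticAt ℝ e.symm (R.inj q) := by
    have h := han.eventually_analyticAt
    rw [← hinj0] at h
    exact hinjc.eventually h
  have hKcont : ContinuousAt K q₀ :=
    ContinuousAt.comp (g := e.symm) (by rw [hinj0]; exact han.continuousAt) hinjc
  have hKtgt : ∀ᶠ q in 𝓝 q₀, R.inj q ∈ e.target :=
    hinjc.eventually (by rw [hinj0]; exact e.open_target.mem_nhds htgt)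
  -- The domain of the local inverse need not be invariant under the swap. By continuity the swapped
  -- point still lies in it for parameters near the base point, which is all that local uniqueness
  -- requires.
  have hKswap : ∀ᶠ q in 𝓝 q₀,
      (S.S (K q).1, (![(K q).2.1 1, (K q).2.1 0] : Fin 2 → ℝ), q.2.2) ∈ e.source := by
    have hc : ContinuousAt (fun q : ℝ × ℝ × ℝ =>
        (S.S (K q).1, (![(K q).2.1 1, (K q).2.1 0] : Fin 2 → ℝ), q.2.2)) q₀ := by
      refine (S.S.continuous.continuousAt.comp (continuousAt_fst.comp hKcont)).prodMk
        (ContinuousAt.prodMk ?_ (continuousAt_snd.comp continuousAt_snd))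
      have h1 : ContinuousAt (fun q => (K q).2.1) q₀ :=
        continuousAt_fst.comp (continuousAt_snd.comp hKcont)
      refine continuousAt_pi.2 fun i => ?_
      fin_cases i
      · exact (continuous_apply (1 : Fin 2)).continuousAt.comp h1
      · exact (continuous_apply (0 : Fin 2)).continuousAt.comp h1
    refine hc.eventually (e.open_source.mem_nhds ?_)
    change (S.S (K q₀).1, (![(K q₀).2.1 1, (K q₀).2.1 0] : Fin 2 → ℝ), q₀.2.2) ∈ e.source
    rw [hK0]
    have h0 : (![(0 : Fin 2 → ℝ) 1, (0 : Fin 2 → ℝ) 0] : Fin 2 → ℝ) = 0 := by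
      funext i; fin_cases i <;> rfl
    simp only [map_zero, h0]
    exact hsrc
  have hline : ∀ᶠ q in 𝓝 q₀, (K (q.1, 0, q.2.2)).2.1 1 = 0 := by
    have hc : ContinuousAt (fun q : ℝ × ℝ × ℝ => (q.1, q.2.2)) q₀ := by fun_prop
    filter_upwards [hc.eventually (I.eventually e.source (e.open_source.mem_nhds hsrc))]
      with q ⟨a, ha, hTa, ha1⟩
    have : K (q.1, 0, q.2.2) = a := by
      simp only [K, inj_apply]
      rw [← hTa, ← he, e.left_inv ha]
    rw [this, ha1]
  obtain ⟨ε, hε, hball⟩ := Metric.eventually_nhds_iff_ball.1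
    ((hKan.and hKtgt).and (hKswap.and hline))
  have hsmall : ∀ᶠ x : E × ℝ in 𝓝 (0, R.χ₀), (x.1, (0 : Fin 2 → ℝ), x.2) ∈ e.source := by
    have hc : Continuous fun x : E × ℝ => (x.1, (0 : Fin 2 → ℝ), x.2) := by fun_prop
    exact hc.continuousAt.eventually (e.open_source.mem_nhds hsrc)
  obtain ⟨δ, hδ, hball'⟩ := Metric.eventually_nhds_iff_ball.1 hsmall
  let U : Set ℝ := Metric.ball 0 ε
  -- Radius ε controls the parameters (r₁, r₂, χ), and δ guarantees that (f, 0, χ) lies in the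
  -- domain where T is injective. O also restricts ψ(f), so that the coordinates of every solution
  -- in O belong to U.
  let V : Set ℝ := Metric.ball R.χ₀ (min ε δ)
  let O : Set E := Metric.ball 0 δ ∩ R.psi ⁻¹' (Metric.ball 0 ε)
  have hVε : V ⊆ Metric.ball R.χ₀ ε := Metric.ball_subset_ball (min_le_left _ _)
  have hVδ : V ⊆ Metric.ball R.χ₀ δ := Metric.ball_subset_ball (min_le_right _ _)
  have h0U : (0 : ℝ) ∈ U := Metric.mem_ball_self hε
  have hmem : ∀ q ∈ U ×ˢ U ×ˢ V, q ∈ Metric.ball q₀ ε := fun q hq => by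
    rw [← ball_prod_same, ← ball_prod_same]
    exact ⟨hq.1, hq.2.1, hVε hq.2.2⟩
  have hT : ∀ q ∈ U ×ˢ U ×ˢ V, R.T (K q) = (0, ![q.1, q.2.1], q.2.2) := fun q hq => by
    rw [← he, ← R.inj_apply]
    exact e.right_inv (hball q (hmem q hq)).1.2
  let Φ : ℝ × ℝ × ℝ → (Fin 2 → ℝ) := fun q => (K q).2.1
  let G : ℝ × ℝ × ℝ → E := fun q => (K q).1 - R.comb (pairVec q)
  have hF : ∀ q ∈ U ×ˢ U ×ˢ V, R.F (K q).1 q.2.2 = R.A (R.comb (Φ q)) ∧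
      R.psi (K q).1 = ![q.1, q.2.1] ∧ (K q).2.2 = q.2.2 := fun q hq => by
    have h := hT q hq
    simp only [T, Prod.mk.injEq] at h
    refine ⟨?_, h.2⟩
    rw [← h.2.2]
    exact sub_eq_zero.1 h.1
  have hKan' : ∀ q ∈ U ×ˢ U ×ˢ V, AnalyticAt ℝ K q := fun q hq =>
    AnalyticAt.fun_comp (hball q (hmem q hq)).1.1 (R.inj.analyticAt q)
  have htriv : ∀ χ ∈ V, (0, 0, χ) ∈ e.source ∧ K (0, 0, χ) = (0, 0, χ) := fun χ hχ => by
    have h1 : ((0 : E), (0 : Fin 2 → ℝ), χ) ∈ e.source := hball' (0, χ) (by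
      rw [← ball_prod_same]; exact ⟨Metric.mem_ball_self hδ, hVδ hχ⟩)
    refine ⟨h1, ?_⟩
    simp only [K]
    rw [inj_apply, pairVec_zero, ← R.T_zero χ, ← he, e.left_inv h1]
  have hG0 : ∀ χ ∈ V, G (0, 0, χ) = 0 := fun χ hχ => by
    simp only [G]
    rw [(htriv χ hχ).2, pairVec_apply, pairVec_zero, map_zero, sub_zero]
  refine ⟨U, V, O, Φ, G, ⟨Metric.isOpen_ball, h0U⟩,
    ⟨Metric.isOpen_ball, Metric.mem_ball_self (lt_min hε hδ)⟩,
    ⟨Metric.isOpen_ball.inter (Metric.isOpen_ball.preimage R.psi.continuous),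
      Metric.mem_ball_self hδ, by simpa using hε⟩,
    fun q hq => analyticAt_fst.fun_comp (analyticAt_snd.fun_comp (hKan' q hq)),
    fun q hq => (analyticAt_fst.fun_comp (hKan' q hq)).sub
      (AnalyticAt.fun_comp (R.comb.analyticAt _) (pairVec.analyticAt q)), ?_, ?_, ?_, ?_, ?_⟩
  · intro q hq
    simp only [G, map_sub, R.psi_comb, pairVec_apply]
    rw [(hF q hq).2.1, sub_self]
  · intro χ hχ f hf
    constructor
    · intro h0
      have hψ : ∀ i, R.psi f i ∈ U := fun i => by
        have h1 : ‖R.psi f‖ < ε := by simpa using hf.2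
        simpa [U] using (norm_le_pi_norm (R.psi f) i).trans_lt h1
      have hs : (f, (0 : Fin 2 → ℝ), χ) ∈ e.source := hball' (f, χ) (by
        rw [← ball_prod_same]; exact ⟨hf.1, hVδ hχ⟩)
      have hv : ![R.psi f 0, R.psi f 1] = R.psi f := by
        funext i; fin_cases i <;> rfl
      have hK : K (R.psi f 0, R.psi f 1, χ) = (f, 0, χ) := by
        simp only [K]
        rw [inj_apply, ← e.left_inv hs, he]
        simp only [T, h0, map_zero, sub_zero, hv]
      refine ⟨R.psi f 0, hψ 0, R.psi f 1, hψ 1, ?_, ?_⟩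
      · simp only [G]
        rw [hK, pairVec_apply]; abel
      · simp only [Φ]
        rw [hK]
    · rintro ⟨r₁, h1, r₂, h2, hfeq, hΦ⟩
      have hq : (r₁, r₂, χ) ∈ U ×ˢ U ×ˢ V := ⟨h1, h2, hχ⟩
      have hfK : f = (K (r₁, r₂, χ)).1 := by
        rw [hfeq]
        simp only [G]
        rw [pairVec_apply]; abel
      have := (hF _ hq).1
      rw [← hfK, hΦ, map_zero, map_zero] at this
      exact this
  · intro r hr χ hχ
    exact (hball (r, 0, χ) (hmem _ ⟨hr, h0U, hχ⟩)).2.2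
  · intro r₁ h1 r₂ h2 χ hχ
    have hq : (r₂, r₁, χ) ∈ U ×ˢ U ×ˢ V := ⟨h2, h1, hχ⟩
    have hs := (hball _ (hmem _ hq)).2.1
    obtain ⟨hF1, hF2, -⟩ := hF _ hq
    have hK : K (r₁, r₂, χ) = (S.S (K (r₂, r₁, χ)).1,
        ![(K (r₂, r₁, χ)).2.1 1, (K (r₂, r₁, χ)).2.1 0], χ) := by
      have hTe : e (S.S (K (r₂, r₁, χ)).1,
          (![(K (r₂, r₁, χ)).2.1 1, (K (r₂, r₁, χ)).2.1 0] : Fin 2 → ℝ), χ)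
          = R.inj (r₁, r₂, χ) := by
        rw [he, inj_apply]
        simp only [T, S.F_S, ← S.comb_S, S.A_S, S.psi_S, hF2]
        simp only at hF1
        rw [hF1, sub_self]
        rfl
      change e.symm (R.inj (r₁, r₂, χ)) = _
      rw [← hTe]
      exact e.left_inv hs
    simp only [Φ]
    rw [hK]
  · intro χ hχ
    refine ⟨?_, hG0 χ hχ, by simp only [Φ]; rw [(htriv χ hχ).2]⟩
    have hq : (0, 0, χ) ∈ U ×ˢ U ×ˢ V := ⟨h0U, h0U, hχ⟩
    have hs := (hball _ (hmem _ hq)).1.1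
    have hsd := hs.differentiableAt.hasFDerivAt
    set H' := fderiv ℝ e.symm (R.inj (0, 0, χ)) with hH'
    have hinj : R.inj (0, 0, χ) = (0, 0, χ) := by rw [inj_apply, pairVec_zero]
    -- Invertibility of dT is known at χ₀ only. Differentiating T⁻¹ ∘ T = id along the trivial
    -- branch gives a left inverse at every χ in V, and a left inverse suffices.
    have hcomp : H'.comp (R.dT χ) = ContinuousLinearMap.id ℝ _ := by
      have h1 : HasFDerivAt (fun a => e.symm (R.T a)) (H'.comp (R.dT χ)) (0, 0, χ) := by
        refine HasFDerivAt.comp (g := e.symm) (0, 0, χ) ?_ (R.hasFDerivAt_T χ)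
        rw [R.T_zero, ← hinj]
        exact hsd
      have h2 : (fun a => e.symm (R.T a)) =ᶠ[𝓝 (0, 0, χ)] id := by
        filter_upwards [e.open_source.mem_nhds (htriv χ hχ).1] with a ha
        rw [← he, e.left_inv ha]; rfl
      exact (h1.congr_of_eventuallyEq h2.symm).unique (hasFDerivAt_id _)
    have hdir : ∀ μ : Fin 2 → ℝ, (H' (0, μ, 0)).1 = R.comb μ := fun μ => by
      -- The middle entry compensates (A − χ b) comb μ = (1 − χ/χ₀) A comb μ. Thus the first
      -- component of the derivative of K in direction μ is exactly comb μ, which is what G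
      -- subtracts.
      have h1 : R.dT χ (R.comb μ, (1 - χ / R.χ₀) • μ, 0) = (0, μ, 0) := by
        rw [dT_apply]
        simp only [map_smul, R.psi_comb, ← R.b_comb, smul_smul, ← sub_smul]
        have : R.χ₀ - χ - (1 - χ / R.χ₀) * R.χ₀ = 0 := by
          have := R.χ₀_ne
          field_simp
          ring
        rw [this, zero_smul]
      have h2 := DFunLike.congr_fun hcomp (R.comb μ, (1 - χ / R.χ₀) • μ, 0)
      change H' (R.dT χ _) = _ at h2
      rw [h1] at h2
      rw [h2]; rfl
    let L : ℝ × ℝ →L[ℝ] ℝ × ℝ × ℝ := (ContinuousLinearMap.fst ℝ ℝ ℝ).prod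
      ((ContinuousLinearMap.snd ℝ ℝ ℝ).prod 0)
    have hL : HasFDerivAt (fun r : ℝ × ℝ => ((r.1, r.2, χ) : ℝ × ℝ × ℝ)) L (0, 0) :=
      hasFDerivAt_fst.prodMk (hasFDerivAt_snd.prodMk (hasFDerivAt_const χ _))
    have hK1 : HasFDerivAt K (H'.comp R.inj) (0, 0, χ) :=
      HasFDerivAt.comp (g := e.symm) ((0, 0, χ) : ℝ × ℝ × ℝ) hsd R.inj.hasFDerivAt
    have hKd : HasFDerivAt (fun r : ℝ × ℝ => K (r.1, r.2, χ)) ((H'.comp R.inj).comp L) (0, 0) :=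
      HasFDerivAt.comp (g := K) (f := fun r : ℝ × ℝ => ((r.1, r.2, χ) : ℝ × ℝ × ℝ))
        ((0, 0) : ℝ × ℝ) hK1 hL
    have hpd : HasFDerivAt (fun r : ℝ × ℝ => R.comb (pairVec (r.1, r.2, χ)))
        ((R.comb.comp pairVec).comp L) (0, 0) :=
      HasFDerivAt.comp (g := R.comb.comp pairVec)
        (f := fun r : ℝ × ℝ => ((r.1, r.2, χ) : ℝ × ℝ × ℝ))
        ((0, 0) : ℝ × ℝ) (R.comb.comp pairVec).hasFDerivAt hL
    have hGd := hKd.fst.fun_sub hpd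
    refine hGd.congr_fderiv ?_
    refine ContinuousLinearMap.ext fun r => ?_
    have e1 : R.inj (L r) = (0, ![r.1, r.2], 0) := by rw [inj_apply]; rfl
    change (H' (R.inj (L r))).1 - R.comb (pairVec (L r)) = 0
    rw [e1, hdir, pairVec_apply, sub_eq_zero]
    rfl

end Reduction

end Abstract

end

end AntModel

namespace AntModel

noncomputable section

open scoped ComplexConjugate

/-! ## Symmetries on the reduced problem -/

namespace PhaseSymm

variable (T : PhaseSymm)

lemma coef_zero_pull (u : L2 Phase) : phaseFS.coef (T.pull u) 0 = phaseFS.coef u 0 := by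
  rw [coef_zero_eq, coef_zero_eq, integral_congr_ae (T.torus.coeFn_pull u),
    T.torus.integral_comp (Lp.aestronglyMeasurable u)]

/-- Commutation with the antipodal map is what preserves evenness. The coordinate swap has this
property; translations in x₂ in general do not. -/
lemma pull_mem (h : ∀ z, T.torus.toFun (antipode z) = antipode (T.torus.toFun z)) {u : L2 Phase}
    (hu : u ∈ Zsp) : T.pull u ∈ Zsp := by
  obtain ⟨h0, h1⟩ := mem_Zsp.1 hu
  refine mem_Zsp.2 ⟨by rw [T.coef_zero_pull, h0], antiPull_eq_iff.2 ?_⟩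
  have e1 := T.torus.coeFn_pull u
  have e2 := measurePreserving_antipode.quasiMeasurePreserving.ae_eq_comp e1
  have e3 := T.torus.mp.quasiMeasurePreserving.ae_eq_comp (antiPull_eq_iff.1 h1)
  filter_upwards [e1, e2, e3] with z h1 h2 h3
  simp only [Function.comp_apply] at h2 h3
  rw [h2, h1, h, h3]

lemma act_mem (h : ∀ z, T.torus.toFun (antipode z) = antipode (T.torus.toFun z))
    {f : H2 phaseCover} (hf : f ∈ X) : T.act f ∈ X := by
  rw [mem_X_iff, TorusSymm.jet0_pullH2]
  exact T.pull_mem h (mem_X_iff.1 hf)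

lemma Lop_act {p : Params} (hg : 0 < p.gam) (hc : 0 < p.sigC) (χ : ℝ) (f : H2 phaseCover) :
    Lop p χ (T.act f) = T.pull (Lop p χ f) := by
  rw [Lop_apply, Lop_apply, T.Aop_act, T.toL2_dBop_act hg hc, map_sub, map_smul]

end PhaseSymm

lemma two_pi_ang : ((Real.pi : ℝ) : Ang) + ((Real.pi : ℝ) : Ang) = 0 := by
  rw [← AddCircle.coe_add, ← two_mul]
  exact AddCircle.coe_period _

lemma swap_antipode (z : Phase) :
    symmSwap.torus.toFun (antipode z) = antipode (symmSwap.torus.toFun z) := by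
  refine Prod.ext ?_ ?_
  · funext i; rfl
  · change ((Real.pi / 2 : ℝ) : Ang) - (z.2 + ((Real.pi : ℝ) : Ang))
      = ((Real.pi / 2 : ℝ) : Ang) - z.2 + ((Real.pi : ℝ) : Ang)
    rw [← sub_eq_zero]
    have : ((Real.pi / 2 : ℝ) : Ang) - (z.2 + ((Real.pi : ℝ) : Ang))
      - (((Real.pi / 2 : ℝ) : Ang) - z.2 + ((Real.pi : ℝ) : Ang))
      = -(((Real.pi : ℝ) : Ang) + ((Real.pi : ℝ) : Ang)) := by abel
    rw [this, two_pi_ang, neg_zero]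

lemma swap_swap (z : Phase) : symmSwap.torus.toFun (symmSwap.torus.toFun z) = z :=
  symmSwap.torus.left_inv z

/-- The phase by which a shift in `x₂` acts on a positional mode. -/
def shiftPhase (t : ℝ) (ℓ : Fin 2 → ℤ) : ℂ :=
  Complex.exp (Complex.I * ((2 * Real.pi * ℓ 1 * t : ℝ) : ℂ))

lemma pair_shift (t : ℝ) (ℓ : Fin 2 → ℤ) {Θ : Ang → ℂ} (hΘ : Continuous Θ) (u : L2 Phase) :
    pair ℓ Θ ((symmShift t).pull u) = shiftPhase t ℓ * pair ℓ Θ u := by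
  have hw : ∀ z, wave ℓ Θ z = shiftPhase t ℓ * wave ℓ Θ ((symmShift t).torus.toFun z) := fun z => by
    change _ = _ * (UnitAddTorus.mFourier (-ℓ) (z.1 + posCover ![0, t]) * Θ z.2)
    rw [mFourier_shift, wave, shiftPhase]
    simp only [Fin.sum_univ_two, Matrix.cons_val_zero, Matrix.cons_val_one, mul_zero, zero_add,
      Pi.neg_apply]
    have : Complex.exp (Complex.I * ((2 * Real.pi * ℓ 1 * t : ℝ) : ℂ)) *
        Complex.exp (Complex.I * ((2 * Real.pi * ((-ℓ 1 : ℤ) : ℝ) * t : ℝ) : ℂ)) = 1 := by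
      rw [← Complex.exp_add, ← mul_add, ← Complex.ofReal_add]
      simp
    linear_combination -(UnitAddTorus.mFourier (-ℓ) z.1 * Θ z.2) * this
  have hm : AEStronglyMeasurable (fun z => (u z : ℂ) * wave ℓ Θ z)
      (volume.map (symmShift t).torus.toFun) := by
    rw [(symmShift t).torus.mp.map_eq]
    exact (integrable_pair u ℓ hΘ).aestronglyMeasurable
  have h := integral_map (symmShift t).torus.mp.measurable.aemeasurable hm
  rw [(symmShift t).torus.mp.map_eq] at h
  rw [pair_congr ((symmShift t).torus.coeFn_pull u)]
  conv_rhs => rw [pair, h, ← integral_const_mul]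
  rw [pair]
  congr 1; funext z
  rw [hw z]; ring

lemma coef_eq_pair (u : Phase → ℝ) (n : (Fin 2 → ℤ) × ℤ) :
    phaseFS.coef u n = pair n.1 (fun θ => fourier (-n.2) θ) u := by
  rw [FourierSystem.coef, pair]
  congr 1; funext z
  rw [← phaseFS.E_neg]; rfl

lemma coef_shift (t : ℝ) (n : (Fin 2 → ℤ) × ℤ) (u : L2 Phase) :
    phaseFS.coef ((symmShift t).pull u) n = shiftPhase t n.1 * phaseFS.coef u n := by
  rw [coef_eq_pair, coef_eq_pair, pair_shift t n.1 (ContinuousMap.continuous _)]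

lemma shiftPhase_neg (t : ℝ) (ℓ : Fin 2 → ℤ) : shiftPhase t (-ℓ) = (shiftPhase t ℓ)⁻¹ := by
  rw [shiftPhase, shiftPhase, ← Complex.exp_neg]
  congr 1
  simp

lemma shiftPhase_pow (N : ℕ) (hN : N ≠ 0) (ℓ : Fin 2 → ℤ) : shiftPhase (1 / N) ℓ ^ N = 1 := by
  rw [shiftPhase, ← Complex.exp_nat_mul, Complex.exp_eq_one_iff]
  refine ⟨ℓ 1, ?_⟩
  have : (N : ℂ) ≠ 0 := Nat.cast_ne_zero.2 hN
  push_cast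
  field_simp

lemma shiftPhase_k1 (t : ℝ) (k : ℕ) : shiftPhase t (kvec k 0) = 1 := by
  simp [shiftPhase, kvec, k1]

/-- k/(k+1) is not an integer. The shift by 1/(k+1) is used because it has finite order, so averages
over it are finite sums, and yet it moves e^{2πikx₂}. -/
lemma shiftPhase_k2_ne {k : ℕ} (hk : 0 < k) :
    shiftPhase (1 / (k + 1 : ℕ)) (kvec k 1) ≠ 1 := by
  rw [shiftPhase, Ne, Complex.exp_eq_one_iff]
  rintro ⟨n, hn⟩
  have h1 : ((k : ℂ)) = n * (k + 1 : ℕ) := by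
    have hI := Complex.I_ne_zero
    have hpi : (Real.pi : ℂ) ≠ 0 := Complex.ofReal_ne_zero.2 Real.pi_pos.ne'
    have hN : ((k + 1 : ℕ) : ℂ) ≠ 0 := Nat.cast_ne_zero.2 (Nat.succ_ne_zero k)
    simp only [kvec, k2, Matrix.cons_val_one, Matrix.cons_val_zero] at hn
    push_cast at hn hN ⊢
    field_simp at hn
    linear_combination hn
  have h2 : (k : ℤ) = n * (k + 1 : ℕ) := by exact_mod_cast h1
  have h3 : ((k + 1 : ℕ) : ℤ) ∣ k := ⟨n, by rw [h2]; ring⟩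
  have := Nat.le_of_dvd hk (Int.natCast_dvd_natCast.1 h3)
  omega

lemma act_shift_eq_iff (t : ℝ) {f : H2 phaseCover} : (symmShift t).act f = f ↔
    ∀ n : (Fin 2 → ℤ) × ℤ, (shiftPhase t n.1 - 1) * phaseFS.coef (jet0 phaseCover f) n = 0 := by
  constructor
  · intro h n
    have h1 := coef_shift t n (jet0 phaseCover f)
    rw [← TorusSymm.jet0_pullH2 (symmShift t).torus phaseFS, h] at h1
    rw [sub_mul, one_mul, ← h1, sub_self]
  · intro h
    refine H2_ext phaseFS (phaseFS.coef_ext fun n => ?_)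
    rw [TorusSymm.jet0_pullH2, coef_shift, ← sub_eq_zero, ← h n]
    ring

section Abstract

variable {E C W Z : Type*} [NormedAddCommGroup E] [NormedSpace ℝ E] [NormedAddCommGroup C]
  [NormedSpace ℝ C] [NormedAddCommGroup W] [NormedSpace ℝ W] [NormedAddCommGroup Z]
  [NormedSpace ℝ Z]

lemma analyticAt_add_bilinear (M N : C →L[ℝ] W →L[ℝ] Z) (a b : E →L[ℝ] C) (u w : E →L[ℝ] W)
    (f : E) : AnalyticAt ℝ (fun f => M (a f) (u f) + N (b f) (w f)) f := by
  have h1 : AnalyticAt ℝ (fun f => M (a f) (u f)) f :=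
    AnalyticAt.fun_comp (f := fun f => (a f, u f)) (M.analyticAt_bilinear (a f, u f)) ((a.analyticAt f).prod (u.analyticAt f))
  have h2 : AnalyticAt ℝ (fun f => N (b f) (w f)) f :=
    AnalyticAt.fun_comp (f := fun f => (b f, w f)) (N.analyticAt_bilinear (b f, w f)) ((b.analyticAt f).prod (w.analyticAt f))
  exact h1.fun_add h2

lemma hasFDerivAt_add_bilinear_zero (M N : C →L[ℝ] W →L[ℝ] Z) (a b : E →L[ℝ] C)
    (u w : E →L[ℝ] W) :
    HasFDerivAt (fun f => M (a f) (u f) + N (b f) (w f)) (0 : E →L[ℝ] Z) 0 := by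
  have h1 := M.hasFDerivAt_of_bilinear (a.hasFDerivAt (x := 0)) (u.hasFDerivAt (x := 0))
  have h2 := N.hasFDerivAt_of_bilinear (b.hasFDerivAt (x := 0)) (w.hasFDerivAt (x := 0))
  refine (h1.fun_add h2).congr_fderiv ?_
  ext f
  simp

end Abstract

namespace BifData

variable {p : Params} {k : ℕ} (D : BifData p k)

/-- The linear part of the chemotactic term on `X`. -/
def bX : X →L[ℝ] Zsp :=
  (((1 / (2 * Real.pi)) • toL2.comp (dBop p)).comp X.subtypeL).codRestrict Zsp fun f =>
    Zsp.smul_mem _ (dBop_mem D.gam D.sigC (mem_X_iff_act.1 f.2).2)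

lemma bX_coe (f : X) : (D.bX f : L2 Phase) = (1 / (2 * Real.pi)) • toL2 (dBop p f.1) := rfl

/-- The quadratic term with values in `L²`. -/
def quad (_ : BifData p k) (f : X) : L2 Phase :=
  mulCL ((dBop p).comp X.subtypeL f) ((jet0 phaseCover).comp X.subtypeL f)
    + mulCL ((Bop p).comp X.subtypeL f) ((jet1 phaseCover 2).comp X.subtypeL f)

/-- The quadratic term on `X`. -/
def qX (f : X) : Zsp := Zsp.orthogonalProjectionOnto (D.quad f)

/-- The projection in `qX` acts trivially. It is there so that analyticity and the derivative at 0
carry over from L² to Z by composition with a continuous linear map. -/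
lemma qX_coe (f : X) : (D.qX f : L2 Phase) = Qop p f.1 f.1 := by
  have h := Submodule.orthogonalProjectionOnto_mem_subspace_eq_self
    (⟨Qop p f.1 f.1, Qop_mem D.gam D.sigC f f⟩ : Zsp)
  exact congrArg Subtype.val h

lemma analyticAt_quad (f : X) : AnalyticAt ℝ D.quad f :=
  @analyticAt_add_bilinear X (C(Phase, ℝ)) (L2 Phase) (L2 Phase)
    (Submodule.normedAddCommGroup X) (Submodule.normedSpace X) _ _ _ _ _ _ mulCL mulCL
    ((dBop p).comp X.subtypeL) ((Bop p).comp X.subtypeL)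
    ((jet0 phaseCover).comp X.subtypeL) ((jet1 phaseCover 2).comp X.subtypeL) f

lemma hasFDerivAt_quad : HasFDerivAt D.quad (0 : X →L[ℝ] L2 Phase) 0 :=
  @hasFDerivAt_add_bilinear_zero X (C(Phase, ℝ)) (L2 Phase) (L2 Phase)
    (Submodule.normedAddCommGroup X) (Submodule.normedSpace X) _ _ _ _ _ _ mulCL mulCL
    ((dBop p).comp X.subtypeL) ((Bop p).comp X.subtypeL)
    ((jet0 phaseCover).comp X.subtypeL) ((jet1 phaseCover 2).comp X.subtypeL)

lemma LX_eq (f : X) : AX p f - chiK p k • D.bX f = D.LX (chiK p k) f := by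
  refine Subtype.ext ?_
  rw [LX_coe, Lop_apply, Submodule.coe_sub, Submodule.coe_smul, AX_coe, bX_coe, smul_smul,
    mul_one_div]

/-- The bifurcation problem on `X`. -/
def reduction : Reduction X Zsp where
  A := AX p
  b := D.bX
  q := D.qX
  analytic_q f := (Zsp.orthogonalProjectionOnto.analyticAt _).fun_comp (D.analyticAt_quad f)
  q_zero := by
    refine Subtype.ext ?_
    rw [D.qX_coe]
    simp [Qop]
  deriv_q := by
    have h := HasFDerivAt.comp (g := Zsp.orthogonalProjectionOnto) (0 : X)
      Zsp.orthogonalProjectionOnto.hasFDerivAt D.hasFDerivAt_quad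
    rw [ContinuousLinearMap.comp_zero] at h
    exact h
  comb := D.comb
  psi := D.psi
  χ₀ := chiK p k
  χ₀_ne := D.chiK_pos.ne'
  b_comb μ := by
    have h := D.LX_comb_crit μ
    rw [← D.LX_eq, sub_eq_zero] at h
    exact h.symm
  psi_comb := D.psi_comb
  bij := by
    have h := D.bord_bijective
    convert h using 1
    funext a
    rw [D.LX_eq]; rfl

lemma F_coe (f : X) (χ : ℝ) : (D.reduction.F f χ : L2 Phase) = Fop p f.1 χ := by
  change ((AX p f - χ • (D.bX f + D.qX f) : Zsp) : L2 Phase) = _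
  rw [Submodule.coe_sub, Submodule.coe_smul, Submodule.coe_add, AX_coe, bX_coe, qX_coe]
  rfl

include D in
lemma phi_swap (z : Phase) :
    AntModel.phi p (kvec k 0) (symmSwap.torus.toFun z) = AntModel.phi p (kvec k 1) z := by
  have hx := D.sigX
  have hs := D.sigTh
  have hl := D.lam
  have h1 := Uhat_swap hx hs hl D.pos z.2
  have h2 : Uhat p (-k1 k) (((Real.pi / 2 : ℝ) : Ang) - z.2) = Uhat p (-k2 k) z.2 := by
    rw [Uhat_neg hx hs hl (ℓ := k1 k) (kvec_ne_zero D.pos 0),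
      Uhat_neg hx hs hl (ℓ := k2 k) (kvec_ne_zero D.pos 1), h1]
  have hm : ∀ n : ℤ, UnitAddTorus.mFourier ![n, 0] (posSwap.toFun z.1)
      = UnitAddTorus.mFourier ![0, n] z.1 := fun n => by
    simp [UnitAddTorus.mFourier, Fin.prod_univ_two, posSwap]
  have e1 : -k1 k = ![-(k : ℤ), 0] := by funext i; fin_cases i <;> simp [k1]
  have e2 : -k2 k = ![0, -(k : ℤ)] := by funext i; fin_cases i <;> simp [k2]
  change (Uhat p (k1 k) (((Real.pi / 2 : ℝ) : Ang) - z.2) * UnitAddTorus.mFourier (k1 k)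
      (posSwap.toFun z.1) + Uhat p (-k1 k) (((Real.pi / 2 : ℝ) : Ang) - z.2) *
      UnitAddTorus.mFourier (-k1 k) (posSwap.toFun z.1)).re
    = (Uhat p (k2 k) z.2 * UnitAddTorus.mFourier (k2 k) z.1
      + Uhat p (-k2 k) z.2 * UnitAddTorus.mFourier (-k2 k) z.1).re
  rw [h1, h2, e1, e2, hm, k1, hm]
  rfl

/-- The swap on `X`. -/
def swapX (_ : BifData p k) : X →L[ℝ] X := (symmSwap.act.comp X.subtypeL).codRestrict X
  fun f => symmSwap.act_mem swap_antipode f.2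

/-- The swap on `Z`. -/
def swapZ (_ : BifData p k) : Zsp →L[ℝ] Zsp := (symmSwap.pull.comp Zsp.subtypeL).codRestrict Zsp
  fun u => symmSwap.pull_mem swap_antipode u.2

lemma swapX_coe (f : X) : (D.swapX f : H2 phaseCover) = symmSwap.act f.1 := rfl

lemma swapZ_coe (u : Zsp) : (D.swapZ u : L2 Phase) = symmSwap.pull u.1 := rfl

lemma act_phi (i j : Fin 2) (T : PhaseSymm) (h : ∀ z, AntModel.phi p (kvec k i) (T.torus.toFun z)
    = AntModel.phi p (kvec k j) z) : T.act (D.phi i).1 = (D.phi j).1 :=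
  act_phiH D.sigX D.sigTh D.lam (kvec_ne_zero D.pos i) (kvec_ne_zero D.pos j) T h

lemma swapX_comb (μ : Fin 2 → ℝ) : D.swapX (D.comb μ) = D.comb ![μ 1, μ 0] := by
  have h0 : D.swapX (D.phi 0) = D.phi 1 := Subtype.ext (D.act_phi 0 1 symmSwap D.phi_swap)
  have h1 : D.swapX (D.phi 1) = D.phi 0 := Subtype.ext (D.act_phi 1 0 symmSwap fun z => by
    rw [← D.phi_swap, swap_swap])
  rw [comb_apply, comb_apply, map_add, map_smul, map_smul, h0, h1, add_comm]
  rfl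

/-- f minus its kernel part is annihilated by ψ, hence lies in the range of L. The range is
preserved by the swap, so ψ still vanishes there, and only the kernel part counts. No explicit
symmetry of P is needed. -/
lemma psi_swapX (f : X) : D.psi (D.swapX f) = ![D.psi f 1, D.psi f 0] := by
  have h0 : D.psi (f - D.comb (D.psi f)) = 0 := by rw [map_sub, psi_comb, sub_self]
  obtain ⟨w, hw⟩ := D.exists_LX_eq
    (z := ⟨jet0 phaseCover (f - D.comb (D.psi f)).1, mem_X_iff.1 (f - D.comb (D.psi f)).2⟩)
    fun j => congrFun h0 j
  have hw' : Lop p (chiK p k) w.1 = jet0 phaseCover (f - D.comb (D.psi f)).1 :=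
    congrArg Subtype.val hw
  have h1 : D.psi (D.swapX (f - D.comb (D.psi f))) = 0 := by
    funext j
    rw [psi_apply, swapX_coe, TorusSymm.jet0_pullH2, ← hw']
    have h2 := D.dual_Lop j (symmSwap.act w.1)
    rw [symmSwap.Lop_act D.gam D.sigC] at h2
    exact h2
  rw [map_sub, map_sub, sub_eq_zero, swapX_comb, psi_comb] at h1
  exact h1

/-- The exchange of coordinates as a symmetry of the bifurcation problem. -/
def swap : D.reduction.Swap where
  S := D.swapX
  S' := D.swapZ
  F_S f χ := Subtype.ext (by
    rw [D.F_coe, D.swapX_coe, D.swapZ_coe, D.F_coe, symmSwap.Fop_act D.gam D.sigC])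
  A_S f := Subtype.ext (symmSwap.Aop_act p f.1)
  comb_S := D.swapX_comb
  psi_S := D.psi_swapX

/-- The shift in `x₂` by which the second kernel direction is excluded. -/
def shift (k : ℕ) : PhaseSymm := symmShift (1 / (k + 1 : ℕ))

/-- The functions of `X` invariant under the shift. -/
def invX (_ : BifData p k) : Submodule ℝ X :=
  LinearMap.ker (((shift k).act - ContinuousLinearMap.id ℝ _).comp X.subtypeL).toLinearMap

/-- The functions of `Z` invariant under the shift. -/
def invZ (_ : BifData p k) : Submodule ℝ Zsp :=
  LinearMap.ker (((shift k).pull - ContinuousLinearMap.id ℝ _).comp Zsp.subtypeL).toLinearMap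

lemma mem_invX {f : X} : f ∈ D.invX ↔ (shift k).act f.1 = f.1 := by
  rw [invX, LinearMap.mem_ker]
  exact sub_eq_zero

lemma mem_invZ {u : Zsp} : u ∈ D.invZ ↔ (shift k).pull u.1 = u.1 := by
  rw [invZ, LinearMap.mem_ker]
  exact sub_eq_zero

lemma isClosed_invX : IsClosed (D.invX : Set X) := by
  have h : (D.invX : Set X) = {f : X | (shift k).act f.1 = f.1} := Set.ext fun f => D.mem_invX
  rw [h]
  exact isClosed_eq ((shift k).act.continuous.comp continuous_subtype_val) continuous_subtype_val

lemma isClosed_invZ : IsClosed (D.invZ : Set Zsp) := by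
  have h : (D.invZ : Set Zsp) = {f : Zsp | (shift k).pull f.1 = f.1} := Set.ext fun f => D.mem_invZ
  rw [h]
  exact isClosed_eq ((shift k).pull.continuous.comp continuous_subtype_val) continuous_subtype_val

instance completeSpace_invX : CompleteSpace D.invX := D.isClosed_invX.completeSpace_coe

instance completeSpace_invZ : CompleteSpace D.invZ := D.isClosed_invZ.completeSpace_coe

lemma phi_zero_mem_invX : D.phi 0 ∈ D.invX := by
  refine D.mem_invX.2 (D.act_phi 0 0 _ fun z => ?_)
  have hm : ∀ n : ℤ, UnitAddTorus.mFourier ![n, 0] (z.1 + posCover ![0, 1 / (k + 1 : ℕ)])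
      = UnitAddTorus.mFourier ![n, 0] z.1 := fun n => by
    rw [mFourier_shift]
    simp [Fin.sum_univ_two]
  have e1 : -k1 k = ![-(k : ℤ), 0] := by funext i; fin_cases i <;> simp [k1]
  change (Uhat p (k1 k) z.2 * UnitAddTorus.mFourier (k1 k)
      (z.1 + posCover ![0, 1 / (k + 1 : ℕ)]) + Uhat p (-k1 k) z.2 *
      UnitAddTorus.mFourier (-k1 k) (z.1 + posCover ![0, 1 / (k + 1 : ℕ)])).re
    = (Uhat p (k1 k) z.2 * UnitAddTorus.mFourier (k1 k) z.1
      + Uhat p (-k1 k) z.2 * UnitAddTorus.mFourier (-k1 k) z.1).re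
  rw [e1, hm, k1, hm]

lemma dual_one_of_pull_eq {u : L2 Phase} (h : (shift k).pull u = u) : D.dual 1 u = 0 := by
  have h1 := pair_shift (1 / (k + 1 : ℕ)) (kvec k 1) (D.continuous_Phat 1) u
  change pair _ _ ((shift k).pull u) = _ at h1
  rw [h] at h1
  have h2 : (shiftPhase (1 / (k + 1 : ℕ)) (kvec k 1) - 1) *
      pair (kvec k 1) (Phat p (kvec k 1)) u = 0 := by rw [sub_mul, one_mul, ← h1, sub_self]
  have h3 := (mul_eq_zero.1 h2).resolve_left (sub_ne_zero.2 (shiftPhase_k2_ne D.pos))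
  rw [dual_apply, h3]; simp

lemma psi_one_of_mem {f : X} (hf : f ∈ D.invX) : D.psi f 1 = 0 := by
  refine D.dual_one_of_pull_eq ?_
  change (shift k).pull (jet0 phaseCover f.1) = jet0 phaseCover f.1
  conv_rhs => rw [← D.mem_invX.1 hf]
  exact (TorusSymm.jet0_pullH2 ..).symm

lemma AX_mem_invZ {f : X} (hf : f ∈ D.invX) : AX p f ∈ D.invZ := by
  rw [mem_invZ, AX_coe, ← (shift k).Aop_act, D.mem_invX.1 hf]

/-- The average of a function over the shifts. -/
lemma exists_average (f : X) (hf : (shift k).pull (Lop p (chiK p k) f.1) = Lop p (chiK p k) f.1) :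
    ∃ g ∈ D.invX, Lop p (chiK p k) g.1 = Lop p (chiK p k) f.1 ∧
      phaseFS.coef (jet0 phaseCover g.1) (kvec k 0, 0)
        = phaseFS.coef (jet0 phaseCover f.1) (kvec k 0, 0) := by
  classical
  set t : ℝ := 1 / (k + 1 : ℕ) with ht
  -- A translation in x₂ need not preserve X, so individual shifts of f may leave it. The multiplier
  -- that keeps exactly the shift-invariant modes is even in ℓ and stays in X. By summing roots of
  -- unity, (k+1) g equals the sum of the k+1 shifts of f in H², which transfers the value of L.
  let ν : (Fin 2 → ℤ) → ℂ := fun ℓ => if shiftPhase t ℓ = 1 then 1 else 0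
  obtain ⟨g, hg, hgc⟩ := exists_positional_multiplier ν (K := 1)
    (fun ℓ => by simp only [ν]; split_ifs <;> simp)
    (fun ℓ => by simp only [ν, shiftPhase_neg, inv_eq_one])
    (fun ℓ => by simp only [ν]; split_ifs <;> simp) (mem_X_iff_act.1 f.2).2
  have hgX : g ∈ X := mem_X_iff_act.2 ⟨by rw [hgc, (mem_X_iff_act.1 f.2).1, mul_zero], hg⟩
  let a : ℕ → H2 phaseCover := fun j => (shift k).act^[j] f.1
  have ha : ∀ j, a (j + 1) = (shift k).act (a j) := fun j => Function.iterate_succ_apply' _ _ _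
  have hac : ∀ j n, phaseFS.coef (jet0 phaseCover (a j)) n
      = shiftPhase t n.1 ^ j * phaseFS.coef (jet0 phaseCover f.1) n := fun j n => by
    induction j with
    | zero => simp [a]
    | succ j ih => rw [ha, TorusSymm.jet0_pullH2, shift, coef_shift, ih]; ring
  have haL : ∀ j, Lop p (chiK p k) (a j) = Lop p (chiK p k) f.1 := fun j => by
    induction j with
    | zero => rfl
    | succ j ih => rw [ha, (shift k).Lop_act D.gam D.sigC, ih, hf]
  have hN : ((k + 1 : ℕ) : ℝ) ≠ 0 := Nat.cast_ne_zero.2 (Nat.succ_ne_zero k)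
  have hsum : ((k + 1 : ℕ) : ℝ) • g = ∑ j ∈ Finset.range (k + 1), a j := by
    refine H2_ext phaseFS (phaseFS.coef_ext fun n => ?_)
    have e : phaseFS.coef (jet0 phaseCover (∑ j ∈ Finset.range (k + 1), a j)) n
        = ∑ j ∈ Finset.range (k + 1), phaseFS.coef (jet0 phaseCover (a j)) n := by
      rw [map_sum]
      exact map_sum (phaseFS.coefL (M := Phase) n) _ _
    rw [e, map_smul, phaseFS.coef_smul, hgc]
    simp only [hac, ← Finset.sum_mul]
    rw [← mul_assoc]
    congr 1
    by_cases h : shiftPhase t n.1 = 1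
    · simp [ν, h]
    · have hz : ∑ j ∈ Finset.range (k + 1), shiftPhase t n.1 ^ j = 0 := by
        rw [geom_sum_eq h, ht, shiftPhase_pow _ (Nat.succ_ne_zero k), sub_self, zero_div]
      simp [ν, h, hz]
  refine ⟨⟨g, hgX⟩, D.mem_invX.2 ((act_shift_eq_iff t).2 fun n => ?_), ?_, ?_⟩
  · rw [hgc]
    by_cases h : shiftPhase t n.1 = 1
    · rw [h]; simp
    · simp [ν, h]
  · have h1 : ((k + 1 : ℕ) : ℝ) • Lop p (chiK p k) g = ((k + 1 : ℕ) : ℝ) • Lop p (chiK p k) f.1 := by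
      rw [← map_smul, hsum, map_sum]
      simp only [haL, Finset.sum_const, Finset.card_range]
      rw [Nat.cast_smul_eq_nsmul]
    exact smul_right_injective _ hN h1
  · rw [hgc]
    simp [ν, shiftPhase_k1]

/-- The shift average g of f has the same image under L, so g − f is in the kernel. Its
φ₂-coordinate vanishes because ψ₂ does on both functions, and its φ₁-coordinate because averaging
leaves the k₁-coefficient unchanged. Hence f = g. -/
lemma mem_invX_of_LX {f : X} (hf : D.LX (chiK p k) f ∈ D.invZ) (h1 : D.psi f 1 = 0) :
    f ∈ D.invX := by
  obtain ⟨g, hg, hL, hc⟩ := D.exists_average f (D.mem_invZ.1 hf)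
  have hL' : D.LX (chiK p k) (g - f) = 0 := by
    rw [map_sub, sub_eq_zero]; exact Subtype.ext hL
  set μ := D.psi (g - f) with hμ
  have h2 : g - f - D.comb μ = 0 := by
    refine D.eq_zero_of_LX_eq_zero ?_ ?_
    · rw [map_sub, hL', LX_comb_crit, sub_zero]
    · rw [map_sub, psi_comb, ← hμ, sub_self]
  have h3 : g - f = D.comb μ := sub_eq_zero.1 h2
  have hμ1 : μ 1 = 0 := by
    rw [hμ, map_sub, Pi.sub_apply, D.psi_one_of_mem hg, h1, sub_self]
  have hμ0 : μ 0 = 0 := by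
    have h4 : phaseFS.coef (jet0 phaseCover (g - f).1) (kvec k 0, 0) = 0 := by
      rw [Submodule.coe_sub, map_sub, phaseFS.coef_sub, hc, sub_self]
    rw [h3, comb_apply, hμ1, zero_smul, add_zero, Submodule.coe_smul, map_smul, phaseFS.coef_smul,
      coef_phi_kvec, if_pos rfl, ← Complex.ofReal_mul] at h4
    exact (mul_eq_zero.1 (Complex.ofReal_eq_zero.1 h4)).resolve_right D.intU_pos.ne'
  have hμz : μ = 0 := by
    funext i; fin_cases i
    · exact hμ0
    · exact hμ1
  rw [hμz, map_zero, sub_eq_zero] at h3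
  rwa [← h3]

/-- The shift-invariant functions as an invariant subspace of the bifurcation problem. -/
def invariant : D.reduction.Invariant where
  Y := D.invX
  W := D.invZ
  complete_Y := D.completeSpace_invX
  complete_W := D.completeSpace_invZ
  proj := D.invZ.orthogonalProjectionOnto
  proj_coe := Submodule.orthogonalProjectionOnto_mem_subspace_eq_self
  F_mem f hf χ := D.mem_invZ.2 (by
    rw [D.F_coe, ← (shift k).Fop_act D.gam D.sigC, D.mem_invX.1 hf])
  A_comb_mem μ hμ := by
    change AX p (D.comb μ) ∈ D.invZ
    rw [comb_apply, hμ, zero_smul, add_zero, map_smul]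
    exact D.invZ.smul_mem _ (D.AX_mem_invZ D.phi_zero_mem_invX)
  psi_eq f hf := D.psi_one_of_mem hf
  solve f μ hz h1 := by
    change AX p f - chiK p k • D.bX f - AX p (D.comb μ) ∈ D.invZ at hz
    rw [D.LX_eq] at hz
    have hμ : μ 1 = 0 := by
      have h2 := D.dual_one_of_pull_eq (D.mem_invZ.1 hz)
      rw [Submodule.coe_sub, map_sub, D.dual_LX, D.dual_AX_comb, zero_sub, neg_eq_zero] at h2
      exact (mul_eq_zero.1 h2).resolve_left D.weight_ne
    refine ⟨D.mem_invX_of_LX ?_ h1, hμ⟩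
    have h3 : AX p (D.comb μ) ∈ D.invZ := by
      rw [comb_apply, hμ, zero_smul, add_zero, map_smul]
      exact D.invZ.smul_mem _ (D.AX_mem_invZ D.phi_zero_mem_invX)
    have := D.invZ.add_mem hz h3
    rwa [sub_add_cancel] at this

end BifData

end

end AntModel

/-! ### Translation to almost-everywhere statements and conclusion. -/

namespace AntModel

noncomputable section

lemma iteratedDeriv_eq_zero_of_eqOn_zero {E : Type*} [NormedAddCommGroup E] [NormedSpace ℝ E]
    {g : ℝ → E} {V : Set ℝ} (hV : IsOpen V) (h : ∀ x ∈ V, g x = 0) {x : ℝ} (hx : x ∈ V) (n : ℕ) :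
    iteratedDeriv n g x = 0 := by
  have h1 : g =ᶠ[nhds x] fun _ => (0 : E) := Filter.mem_of_superset (hV.mem_nhds hx) h
  rw [h1.iteratedDeriv_eq]
  simp

namespace BifData

variable {p : Params} {k : ℕ} (D : BifData p k)

lemma F_ae_zero_iff (f : X) (χ : ℝ) : F p f.1 χ =ᵐ[volume] 0 ↔ D.reduction.F f χ = 0 := by
  have h := F_ae D.gam D.sigC f.1 χ
  have h0 := Lp.coeFn_zero ℝ 2 (volume : Measure Phase)
  rw [← D.F_coe f χ] at h
  constructor
  · intro h1
    exact Subtype.ext (Lp.ext ((h.trans h1).trans h0.symm))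
  · intro h1
    rw [h1] at h
    exact h.symm.trans h0

lemma fn_ae_eq_iff (f g : X) (r₁ r₂ : ℝ) :
    (fn f.1 =ᵐ[volume] fun z => r₁ * AntModel.phi p (k1 k) z + r₂ * AntModel.phi p (k2 k) z
      + fn g.1 z) ↔ f = D.comb ![r₁, r₂] + g := by
  have e : (fn (D.comb ![r₁, r₂] + g).1) =ᵐ[volume] fun z =>
      r₁ * AntModel.phi p (k1 k) z + r₂ * AntModel.phi p (k2 k) z + fn g.1 z := by
    have h : jet0 phaseCover (D.comb ![r₁, r₂] + g).1
        = r₁ • jet0 phaseCover (D.phi 0).1 + r₂ • jet0 phaseCover (D.phi 1).1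
          + jet0 phaseCover g.1 := by
      rw [D.comb_apply]; rfl
    change (jet0 phaseCover (D.comb ![r₁, r₂] + g).1 : Phase → ℝ) =ᵐ[volume] _
    rw [h]
    have hk1 : jet0 phaseCover (D.phi 0).1 =ᵐ[volume] AntModel.phi p (k1 k) :=
      coeFn_phiH D.sigX D.sigTh D.lam (kvec_ne_zero D.pos 0)
    have hk2 : jet0 phaseCover (D.phi 1).1 =ᵐ[volume] AntModel.phi p (k2 k) :=
      coeFn_phiH D.sigX D.sigTh D.lam (kvec_ne_zero D.pos 1)
    filter_upwards [Lp.coeFn_add (r₁ • jet0 phaseCover (D.phi 0).1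
        + r₂ • jet0 phaseCover (D.phi 1).1) (jet0 phaseCover g.1),
      Lp.coeFn_add (r₁ • jet0 phaseCover (D.phi 0).1) (r₂ • jet0 phaseCover (D.phi 1).1),
      Lp.coeFn_smul r₁ (jet0 phaseCover (D.phi 0).1), Lp.coeFn_smul r₂ (jet0 phaseCover (D.phi 1).1),
      hk1, hk2] with z a1 a2 a3 a4 a5 a6
    rw [a1, Pi.add_apply, a2, Pi.add_apply, a3, a4, Pi.smul_apply, Pi.smul_apply, a5, a6]
    rfl
  constructor
  · intro h
    exact Subtype.ext (H2_ext phaseFS (Lp.ext (h.trans e.symm)))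
  · rintro rfl
    exact e

end BifData

end

end AntModel

theorem theorem5p3 (gam sigC sigX lam tau : ℝ) (hgam : 0 < gam) (hsigC : 0 < sigC)
    (hsigX : 0 < sigX) (hlam : 0 < lam) (htau : 0 ≤ tau)
    (k : ℕ) (hk : 0 < k) (hnp : AntModel.NonPythagorean k) :
    ∃ sig0 : ℝ, 0 < sig0 ∧ ∀ sigTh : ℝ, 0 < sigTh → sigTh < sig0 →
      let p : AntModel.Params := ⟨gam, sigC, sigX, sigTh, lam, tau⟩
      let χk : ℝ := AntModel.chiK p k
      0 < χk ∧
      ∃ (U V : Set ℝ) (O : Set AntModel.X) (Φ : ℝ × ℝ × ℝ → (Fin 2 → ℝ))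
        (G : ℝ × ℝ × ℝ → AntModel.X),
        (IsOpen U ∧ 0 ∈ U) ∧ (IsOpen V ∧ χk ∈ V) ∧ (IsOpen O ∧ 0 ∈ O) ∧
        AnalyticOnNhd ℝ Φ (U ×ˢ U ×ˢ V) ∧
        AnalyticOnNhd ℝ G (U ×ˢ U ×ˢ V) ∧
        (∀ q ∈ U ×ˢ U ×ˢ V, G q ∈ AntModel.rangeInX p χk) ∧
        -- equivalence with the reduced equation
        (∀ χ ∈ V, ∀ f ∈ O,
          (AntModel.F p f.1 χ =ᵐ[MeasureTheory.volume] 0 ↔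
            ∃ r₁ ∈ U, ∃ r₂ ∈ U,
              (AntModel.fn f.1 =ᵐ[MeasureTheory.volume] fun z =>
                r₁ * AntModel.phi p (AntModel.k1 k) z + r₂ * AntModel.phi p (AntModel.k2 k) z
                  + AntModel.fn (G (r₁, r₂, χ)).1 z) ∧
              Φ (r₁, r₂, χ) = 0)) ∧
        -- field lines
        (∃ Ξ Λ : ℝ → ℝ → ℝ, ∀ r ∈ U, ∀ χ ∈ V,
          Φ (r, r, χ) = Ξ r χ • ![1, 1] ∧ Φ (r, 0, χ) = Λ r χ • ![1, 0]) ∧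
        -- swap symmetry
        (∀ r₁ ∈ U, ∀ r₂ ∈ U, ∀ χ ∈ V,
          Φ (r₁, r₂, χ) = Matrix.mulVec !![0, 1; 1, 0] (Φ (r₂, r₁, χ))) ∧
        -- vanishing derivatives
        (∀ χ ∈ V,
          HasFDerivAt (fun r : ℝ × ℝ => G (r.1, r.2, χ)) (0 : ℝ × ℝ →L[ℝ] AntModel.X) (0, 0) ∧
          ∀ n : ℕ, iteratedDeriv n (fun x : ℝ => G (0, 0, x)) χ = 0 ∧
            iteratedDeriv n (fun x : ℝ => Φ (0, 0, x)) χ = 0) := by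
  obtain ⟨σ0, hσ0, hspec⟩ := AntModel.exists_spectral (p := ⟨gam, sigC, sigX, 1, lam, tau⟩)
    hgam hsigC hsigX hlam htau hk
  refine ⟨σ0, hσ0, fun sigTh hs hs' => ?_⟩
  intro p χk
  obtain ⟨h1, h2, h3⟩ := hspec sigTh hs hs'
  have D : AntModel.BifData p k := ⟨hgam, hsigC, hsigX, hs, hlam, htau, hk, hnp, h1, h2, h3⟩
  obtain ⟨U, V, O, Φ, G, hU, hV, hO, hΦ, hG, hpsi, hiff, hline, hswap, hzero⟩ :=
    D.reduction.exists_reduction D.invariant D.swap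
  refine ⟨D.chiK_pos, U, V, O, Φ, G, hU, hV, hO, hΦ, hG, fun q hq => D.mem_rangeInX (hpsi q hq),
    fun χ hχ f hf => ?_, ⟨fun r χ => Φ (r, r, χ) 0, fun r χ => Φ (r, 0, χ) 0,
    fun r hr χ hχ => ⟨?_, ?_⟩⟩, fun r₁ h₁ r₂ h₂ χ hχ => ?_, fun χ hχ => ⟨(hzero χ hχ).1,
    fun n => ⟨?_, ?_⟩⟩⟩
  · rw [D.F_ae_zero_iff, hiff χ hχ f hf]
    exact exists_congr fun r₁ => and_congr_right fun _ => exists_congr fun r₂ =>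
      and_congr_right fun _ => and_congr_left' (D.fn_ae_eq_iff _ _ _ _).symm
  -- At r₁ = r₂ the swap identity says that the two components of Φ coincide, which is the diagonal
  -- field line.
  · have h := congrFun (hswap r hr r hr χ hχ) 1
    funext i
    fin_cases i
    · simp
    · simpa using h
  · funext i
    fin_cases i
    · simp
    · simpa using hline r hr χ hχ
  · rw [hswap r₁ h₁ r₂ h₂ χ hχ]
    funext i
    fin_cases i <;> simp [Matrix.mulVec, dotProduct, Fin.sum_univ_two]
  · exact @AntModel.iteratedDeriv_eq_zero_of_eqOn_zero AntModel.X
      (Submodule.normedAddCommGroup AntModel.X) (Submodule.normedSpace AntModel.X) _ V hV.1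
      (fun x hx => (hzero x hx).2.1) χ hχ n
  · exact AntModel.iteratedDeriv_eq_zero_of_eqOn_zero hV.1 (fun x hx => (hzero x hx).2.2) hχ n
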